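/- Let $\omega_1,\omega_2\in\mathbb{C}$ with $\Re(\omega_1),\Re(\omega_2)>0$ and put $\omega=\frac{1}{2}(\omega_1+\omega_2)$. Let $G(z)=G(z;\omega_1,\omega_2)$ be the hyperbolic gamma function, that is, the meromorphic function of $z\in\mathbb{C}$ which for $|\Im(z)|<\Re(\omega)$ is given by \[ G(z)=\exp\left(i\int_0^\infty\left(\frac{\sin(2zt)}{2\sinh(\omega_1t)\sinh(\omega_2t)}-\frac{z}{\omega_1\omega_2t}\right)\frac{dt}{t}\right), \] and which satisfies $G(z+i\omega_1)=-2i\sinh\bigl(\pi(z+i\omega)/\omega_2\bigr)G(z)$. Let $\mathcal{G}_{2i\omega}=\{u\in\mathbb{C}^8 \mid \sum_{j=1}^8u_j=4i\omega\}$ and \[ I_h(u;z)=\frac{G(i\omega+2z)\,G(i\omega-2z)}{\prod_{j=1}^8G(u_j+z)\,G(u_j-z)}. \] Theorem 4.2. For $u\in\mathcal{G}_{2i\omega}$ with $\Im(u_j-i\omega)<0$ $(j=1,\ldots,8)$ the integral $\int_{\mathbb{R}}I_h(u;z)\,dz$ converges absolutely, and as a function of such $u$ it has a unique meromorphic extension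 $S_h(u)=S_h(u;\omega_1,\omega_2)$ to $u\in\mathcal{G}_{2i\omega}$, the hyperbolic hypergeometric function. It has the following properties, as identities between meromorphic functions in $u\in\mathcal{G}_{2i\omega}$. (1) $S_h(u)$ is invariant under permutations of $(u_1,\ldots,u_8)$. (2) Let $w=s_{\beta_{1234}}$ be the reflection $wu=u-\langle u,\beta_{1234}\rangle\beta_{1234}$ in $\beta_{1234}=\frac{1}{2}(1,1,1,1,-1,-1,-1,-1)$, so that $wu=(u_1+s,\ldots,u_4+s,u_5-s,\ldots,u_8-s)$ with $s=i\omega-\frac{1}{2}(u_1+u_2+u_3+u_4)$ for $u\in\mathcal{G}_{2i\omega}$. Then \[ S_h(u)=S_h(wu)\prod_{1\leq j<k\leq 4}G(i\omega-u_j-u_k)\prod_{5\leq j<k\leq 8}G(i\omega-u_j-u_k). \] (3) Consequently $S_h$ is invariant under a twisted action of the Weyl group $W(E_7)$. Here $W(E_7)$ is generated by the reflections $s_\gamma u=u-\langle u,\gamma\rangle\gamma$ of $\mathbb{C}^8$ in the roots $\gamma=\epsilon_j-\epsilon_k$ $(j\neq k)$ and $\gamma=\frac{1}{2}\bigl(\sum_{j\in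 T}\epsilon_j-\sum_{j\notin T}\epsilon_j\bigr)$ $(T\subset\{1,\ldots,8\}$, $|T|=4)$, where $\langle\cdot,\cdot\rangle$ is the complex bilinear extension of the standard scalar product and $\epsilon_1,\ldots,\epsilon_8$ is the standard basis. Put $\lambda_{jk}=\epsilon_j+\epsilon_k-\frac{1}{4}(\epsilon_1+\cdots+\epsilon_8)$ for $1\leq j<k\leq 8$. For every $\sigma\in W(E_7)$, \[ S_h(u)=S_h(\sigma u)\prod_{\substack{1\leq j<k\leq 8\\ \sigma\lambda_{jk}\in\{-\lambda_{lm}\,:\,1\leq l<m\leq 8\}}}G(i\omega-u_j-u_k). \] -/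

import Mathlib

open Complex Filter Topology MeasureTheory

noncomputable section

/-- The integral representation of the hyperbolic gamma function, valid for
`|Im z| < Re ω`, where `ω = (ω₁ + ω₂) / 2`. -/
def hypGammaStrip (ω₁ ω₂ z : ℂ) : ℂ :=
  Complex.exp (I * ∫ t : ℝ in Set.Ioi 0,
    (Complex.sin (2 * z * t) / (2 * Complex.sinh (ω₁ * t) * Complex.sinh (ω₂ * t))
      - z / (ω₁ * ω₂ * t)) / t)

/-- The factor of the first order difference equation
`G (z + i ω₁) = -2 i sinh (π (z + i ω) / ω₂) * G z`, with `ω = (ω₁ + ω₂) / 2`. -/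
def hypGammaShift (ω₁ ω₂ z : ℂ) : ℂ :=
  -2 * I * Complex.sinh (Real.pi * ((z + I * ((ω₁ + ω₂) / 2)) / ω₂))

/-- Ruijsenaars' hyperbolic gamma function `G(z; ω₁, ω₂)` as a meromorphic function of `z ∈ ℂ`:
the meromorphic extension of `hypGammaStrip`, obtained from the difference equation
`G (z + i ω₁) = hypGammaShift z * G z`. The integer `n` is chosen such that
`|Im (z - i n ω₁)| ≤ Re ω₁ / 2 < Re ω`; at most one of the two products is nonempty.
At its poles the function takes the value `0`. -/
def hypGamma (ω₁ ω₂ z : ℂ) : ℂ :=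
  let n : ℤ := ⌊z.im / ω₁.re + 1 / 2⌋
  hypGammaStrip ω₁ ω₂ (z - I * n * ω₁)
    * (∏ k ∈ Finset.range n.toNat, hypGammaShift ω₁ ω₂ (z - I * (k + 1) * ω₁))
    / (∏ k ∈ Finset.range (-n).toNat, hypGammaShift ω₁ ω₂ (z + I * k * ω₁))

/-- The hyperplane `𝒢_c = {u ∈ ℂ⁸ | u₁ + ⋯ + u₈ = 2c}`. -/
def paramSpace (c : ℂ) : Set (Fin 8 → ℂ) := {u | ∑ j, u j = 2 * c}

/-- The hyperplane `𝒢_{2iω}`, `ω = (ω₁ + ω₂) / 2`. -/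
def hypParamSpace (ω₁ ω₂ : ℂ) : Set (Fin 8 → ℂ) := paramSpace (2 * I * ((ω₁ + ω₂) / 2))

/-- The integrand `I_h(u; z) = G(iω + 2z) G(iω - 2z) / ∏ⱼ G(uⱼ + z) G(uⱼ - z)`. -/
def hypIntegrand (ω₁ ω₂ : ℂ) (u : Fin 8 → ℂ) (z : ℂ) : ℂ :=
  hypGamma ω₁ ω₂ (I * ((ω₁ + ω₂) / 2) + 2 * z) * hypGamma ω₁ ω₂ (I * ((ω₁ + ω₂) / 2) - 2 * z)
    / ∏ j, (hypGamma ω₁ ω₂ (u j + z) * hypGamma ω₁ ω₂ (u j - z))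

/-- `f` (of which only the values on `H` matter) is a meromorphic function on the affine subspace
`H` of `ℂ⁸`: near every point of `H` it is a quotient `g / h` of analytic functions, where `h` does
not vanish identically on `H` near that point. The values of `f` where `h` vanishes do not matter.
(An analytic function on `H` extends locally to an analytic function on `ℂ⁸`.) -/
def MeromorphicOnSubspace (f : (Fin 8 → ℂ) → ℂ) (H : Set (Fin 8 → ℂ)) : Prop :=
  ∀ a ∈ H, ∃ g h : (Fin 8 → ℂ) → ℂ, AnalyticAt ℂ g a ∧ AnalyticAt ℂ h a ∧
    (∃ᶠ u in 𝓝[H] a, h u ≠ 0) ∧ ∀ᶠ u in 𝓝[H] a, h u ≠ 0 → f u = g u / h u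

/-- `f` and `g` are equal as meromorphic functions on `H`: they coincide on a dense relatively
open subset of `H`. -/
def MeromorphicEqOn (f g : (Fin 8 → ℂ) → ℂ) (H : Set (Fin 8 → ℂ)) : Prop :=
  H ⊆ closure {a | a ∈ H ∧ f =ᶠ[𝓝[H] a] g}

/-- `S` is the hyperbolic hypergeometric function `S_h`: the meromorphic extension to
`𝒢_{2iω}` of the absolutely convergent integral `∫_ℝ I_h(u; z) dz`, where the real line separates
the upward from the downward pole sequences, that is, where `Im (uⱼ - iω) < 0` for all `j`. -/
structure IsHyperbolicHypergeometric (ω₁ ω₂ : ℂ) (S : (Fin 8 → ℂ) → ℂ) : Prop where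
  meromorphic : MeromorphicOnSubspace S (hypParamSpace ω₁ ω₂)
  integral : ∀ u ∈ hypParamSpace ω₁ ω₂, (∀ j, (u j - I * ((ω₁ + ω₂) / 2)).im < 0) →
    Integrable (fun x : ℝ => hypIntegrand ω₁ ω₂ u x) ∧ S u = ∫ x : ℝ, hypIntegrand ω₁ ω₂ u x

/-- The reflection `s_γ u = u - ⟨u, γ⟩ γ` of `ℂ⁸` (for `⟨γ, γ⟩ = 2`), where `⟨·, ·⟩` is the
complex bilinear extension of the standard scalar product. -/
def rootReflection (γ : Fin 8 → ℂ) : Module.End ℂ (Fin 8 → ℂ) where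
  toFun u := u - (∑ j, u j * γ j) • γ
  map_add' u v := by
    ext i
    simp only [Pi.add_apply, Pi.sub_apply, Pi.smul_apply, smul_eq_mul, add_mul,
      Finset.sum_add_distrib]
    ring
  map_smul' c u := by
    ext i
    simp only [Pi.sub_apply, Pi.smul_apply, smul_eq_mul, RingHom.id_apply, mul_assoc,
      ← Finset.mul_sum]
    ring

/-- The vector `β_T = ½ (∑_{j ∈ T} ε_j - ∑_{j ∉ T} ε_j)`. -/
def betaRoot (T : Finset (Fin 8)) : Fin 8 → ℂ := fun j => if j ∈ T then 1 / 2 else -1 / 2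

/-- The root system `R(E₇)`: the roots `α⁻_{jk} = ε_j - ε_k` (`j ≠ k`) and
`β_{jklm} = β_{{j,k,l,m}}` (`j < k < l < m`). -/
def rootsE7 : Set (Fin 8 → ℂ) :=
  {γ | (∃ j k : Fin 8, j ≠ k ∧ γ = Pi.single j 1 - Pi.single k 1) ∨
    ∃ T : Finset (Fin 8), T.card = 4 ∧ γ = betaRoot T}

/-- The Weyl group `W(E₇)` acting on `ℂ⁸`, generated by the reflections in the roots of `R(E₇)`.
As reflections are involutions, the monoid that they generate is a group. -/
def weylE7 : Submonoid (Module.End ℂ (Fin 8 → ℂ)) :=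
  Submonoid.closure (rootReflection '' rootsE7)

/-- The element `w = s_{β_{1234}}` of `W(E₇)`. -/
def wE7 : Module.End ℂ (Fin 8 → ℂ) := rootReflection (betaRoot {0, 1, 2, 3})

/-- The vectors `λ_{jk} = ε_j + ε_k - δ / 2` with `δ = ½ (ε_1 + ⋯ + ε_8)`. For `u ∈ 𝒢_{2iω}` one
has `⟨u, λ_{jk}⟩ = u_j + u_k - iω`, and `W(E₇)` permutes the 56 vectors `± λ_{jk}`, `j < k`. -/
def lambdaE7 (j k : Fin 8) : Fin 8 → ℂ :=
  Pi.single j 1 + Pi.single k 1 - fun _ => 1 / 4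

open scoped Classical in
/-- The multiplier of the twisted `W(E₇)`-action: the product of `G(iω - u_j - u_k)` over those
`j < k` for which `σ λ_{jk} = -λ_{lm}` for some `l < m`. -/
def twistE7 (ω₁ ω₂ : ℂ) (σ : Module.End ℂ (Fin 8 → ℂ)) (u : Fin 8 → ℂ) : ℂ :=
  ∏ p : Fin 8 × Fin 8,
    if p.1 < p.2 ∧ ∃ l m : Fin 8, l < m ∧ σ (lambdaE7 p.1 p.2) = -lambdaE7 l m then
      hypGamma ω₁ ω₂ (I * ((ω₁ + ω₂) / 2) - u p.1 - u p.2)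
    else 1

end

/-!
Everything happens in the variables `v = -u`: as `G(-z) G(z) = 1`, the integrand is the weight
`G(η + 2z) G(η - 2z)`, `η = iω`, times the product of the `G(vⱼ + z) G(vⱼ - z)`.

*The function `G`.* The difference equation on the strip comes from an integral representation of
`log (2 cosh)`. Integrating the logarithmic derivative of `G` along horizontal segments compares
`|G(x + a)|` with `|G(x)|` up to the factor `exp (π |x| Im (a / ω₁ω₂))`
(`norm_hypGamma_add_le`, `norm_hypGamma_add_le_of_large`). These rates give absolute convergence,
uniformly in the parameters, so that the integral is analytic in `v` as long as the real line
separates the two families of poles.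

*Continuation.* In a half-plane, `G` has finitely many poles. The product `hypClear` of all
`vⱼ + vₖ - ζ - ζ'` with `ζ, ζ'` among them lies in the ideal generated by the polynomial that clears
the poles `ζ - vⱼ` of the integrand and the one that clears the poles `vⱼ - ζ`. Hence the integral
multiplied by `hypClear` is a sum of two integrals, in each of which one family of poles is gone and
the contour may be moved past it (`exists_hypClear_mul_hypInt_eq`). This is the meromorphic
continuation, and it is unique by the identity theorem
(`IsLocalQuotient.denseEq_of_eventuallyEq`).

*The symmetry under `w`.* It rests on the evaluation of the beta integral, the analogous integral
with six parameters, `hypInt_six_eq`. A trigonometric identity and a shift of the contour yield a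
contiguous relation (`sinh_mul_hypInt_shift`). It says that the quotient of the beta integral by its
claimed value is `iω₁`-periodic when two parameters move with constant sum. The rates of growth
cancel, so the quotient is bounded, hence constant (`hypInt_mul_hypCross_comm`). Its value is found
by letting two parameters tend to a pole of `G`, where the contour is pinched
(`tendsto_mul_hypInt_pinch`). A double integral whose two inner integrals are both beta integrals
then gives the transformation on an open set of parameters, by Fubini's theorem
(`hypInt_eight_mul_eq`), and the identity theorem extends it (`denseEq_wE7`).

*The Weyl group.* The group is generated by the permutations and `w` (`weylE7_le`), and it permutes
the weights `±λⱼₖ`. The twist is a cocycle, as a weight whose sign changes twice contributes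
`G(z) G(-z) = 1` (`twistE7_mul`). So the general functional equation follows from those for the
generators (`denseEq_weylE7`).
-/

/-! ### Holomorphic functions given by integrals -/

open Metric in
/-- Holomorphic dependence of an integral on a parameter: a dominating function suffices, since the
derivative of the integrand is controlled by Cauchy's estimate. -/
theorem hasDerivAt_integral_of_norm_le {α : Type*} [MeasurableSpace α] {μ : Measure α}
    {F : ℂ → α → ℂ} {z₀ : ℂ} {r : ℝ} (hr : 0 < r) {g : α → ℝ} (hg : Integrable g μ)
    (hm : ∀ z ∈ ball z₀ r, AEStronglyMeasurable (F z) μ)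
    (hd : ∀ᵐ t ∂μ, DifferentiableOn ℂ (fun z => F z t) (ball z₀ r))
    (hb : ∀ᵐ t ∂μ, ∀ z ∈ ball z₀ r, ‖F z t‖ ≤ g t) :
    HasDerivAt (fun z => ∫ t, F z t ∂μ) (∫ t, deriv (fun z => F z t) z₀ ∂μ) z₀ := by
  have hz₀ : z₀ ∈ ball z₀ r := mem_ball_self hr
  have hF' : AEStronglyMeasurable (fun t => deriv (fun z => F z t) z₀) μ := by
    obtain ⟨s, hs⟩ : ∃ s : ℕ → ℂ, (∀ n, s n ∈ ball 0 r ∧ s n ≠ 0) ∧ Tendsto s atTop (𝓝 0) := by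
      refine ⟨fun n => ((r / (n + 2) : ℝ) : ℂ), fun n => ⟨?_, ?_⟩, ?_⟩
      · rw [mem_ball_zero_iff, Complex.norm_real, Real.norm_of_nonneg (by positivity)]
        rw [div_lt_iff₀ (by positivity)]
        have : (0 : ℝ) ≤ n := by positivity
        nlinarith
      · exact Complex.ofReal_ne_zero.2 (by positivity)
      · have : Tendsto (fun n : ℕ => r / ((n : ℝ) + 2)) atTop (𝓝 0) := by
          apply Tendsto.div_atTop tendsto_const_nhds
          exact tendsto_atTop_add_const_right _ _ tendsto_natCast_atTop_atTop
        exact_mod_cast (Complex.continuous_ofReal.tendsto 0).comp this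
    have hs0 : Tendsto s atTop (𝓝[≠] 0) :=
      tendsto_nhdsWithin_iff.2 ⟨hs.2, Eventually.of_forall fun n => (hs.1 n).2⟩
    refine aestronglyMeasurable_of_tendsto_ae atTop
      (f := fun n t => (s n)⁻¹ • (F (z₀ + s n) t - F z₀ t)) (fun n => ?_) ?_
    · have hmem : z₀ + s n ∈ ball z₀ r := by simpa using (hs.1 n).1
      exact ((hm _ hmem).sub (hm _ hz₀)).const_smul (s n)⁻¹
    · filter_upwards [hd] with t ht
      have h := ((ht z₀ hz₀).differentiableAt (isOpen_ball.mem_nhds hz₀)).hasDerivAt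
      exact h.tendsto_slope_zero.comp hs0
  refine (hasDerivAt_integral_of_dominated_loc_of_deriv_le (𝕜 := ℂ) (s := ball z₀ (r / 2))
    (bound := fun t => g t / (r / 4)) (F' := fun z t => deriv (fun z => F z t) z)
    (ball_mem_nhds z₀ (by positivity)) ?_ ?_ hF' ?_ (hg.div_const _) ?_).2
  · filter_upwards [ball_mem_nhds z₀ hr] with z hz using hm z hz
  · refine hg.mono' (hm _ hz₀) ?_
    filter_upwards [hb] with t ht using ht _ hz₀
  · filter_upwards [hd, hb] with t ht hbt z hz
    have hsub : closedBall z (r / 4) ⊆ ball z₀ r := by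
      intro w hw
      rw [mem_closedBall] at hw
      rw [mem_ball] at hz ⊢
      linarith [dist_triangle w z z₀]
    have h := Complex.norm_deriv_le_of_forall_mem_sphere_norm_le (c := z) (R := r / 4)
      (C := g t) (f := fun z => F z t) (by positivity)
      ((ht.mono hsub).diffContOnCl_ball (le_refl _)) ?_
    · exact h
    · exact fun w hw => hbt w (hsub (sphere_subset_closedBall hw))
  · filter_upwards [hd] with t ht z hz
    exact ((ht z (ball_subset_ball (by linarith) hz)).differentiableAt
      (isOpen_ball.mem_nhds (ball_subset_ball (by linarith) hz))).hasDerivAt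

open Metric in
/-- A map into a space of continuous functions that is continuous, and holomorphic at each point
of the space, is holomorphic: it is the Cauchy integral of its own values. -/
theorem analyticAt_continuousMap {K F : Type*} [TopologicalSpace K] [CompactSpace K]
    [NormedAddCommGroup F] [NormedSpace ℂ F] [CompleteSpace F] {φ : ℂ → C(K, F)} {t₀ : ℂ} {r : ℝ}
    (hr : 0 < r) (hc : ContinuousOn φ (closedBall t₀ r))
    (hd : ∀ k, DifferentiableOn ℂ (fun t => φ t k) (closedBall t₀ r)) :
    AnalyticAt ℂ φ t₀ := by
  lift r to NNReal using hr.le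
  have hr' : 0 < r := by exact_mod_cast hr
  have hci : CircleIntegrable φ t₀ r :=
    (hc.mono sphere_subset_closedBall).circleIntegrable r.2
  have h := (hasFPowerSeriesOn_cauchy_integral hci hr').analyticAt
  refine h.congr ?_
  filter_upwards [ball_mem_nhds t₀ hr] with w hw
  ext k
  have h1 : DiffContOnCl ℂ (fun t => φ t k) (ball t₀ r) := (hd k).diffContOnCl_ball (le_refl _)
  rw [← h1.two_pi_i_inv_smul_circleIntegral_sub_inv_smul hw, ContinuousMap.smul_apply]
  congr 1
  have hci' : CircleIntegrable (fun z => (z - w)⁻¹ • φ z) t₀ r := by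
    have h3 : ContinuousOn (fun z => (z - w)⁻¹) (sphere t₀ r) := ?_
    · exact (h3.smul (hc.mono sphere_subset_closedBall)).circleIntegrable r.2
    refine ContinuousOn.inv₀ (by fun_prop) fun z hz h0 => ?_
    rw [sub_eq_zero] at h0
    subst h0
    rw [mem_sphere] at hz
    rw [mem_ball] at hw
    linarith
  have h2 := ContinuousLinearMap.intervalIntegral_comp_comm (a := 0) (b := 2 * Real.pi)
    (μ := volume) (ContinuousMap.evalCLM ℂ k : C(K, F) →L[ℂ] F) hci'.out
  simp only [circleIntegral]
  exact h2.symm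

open Metric in
/-- **Osgood's lemma**: a continuous function of several complex variables that is holomorphic in
each variable separately is analytic. -/
theorem analyticOnNhd_of_separately {n : ℕ} : ∀ {F : Type} [NormedAddCommGroup F]
    [NormedSpace ℂ F] [CompleteSpace F] {f : (Fin n → ℂ) → F} {U : Set (Fin n → ℂ)},
    IsOpen U → ContinuousOn f U →
    (∀ u ∈ U, ∀ i, DifferentiableAt ℂ (fun t => f (Function.update u i t)) (u i)) →
    AnalyticOnNhd ℂ f U := by
  induction n with
  | zero =>
    intro F _ _ _ f U _ _ _ u _
    have : f = fun _ => f 0 := by ext v; congr 1; exact Subsingleton.elim _ _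
    rw [this]; exact analyticAt_const
  | succ n ih =>
    intro F _ _ _ f U hU hc hs a ha
    obtain ⟨r₀, hr₀, hball⟩ := Metric.isOpen_iff.1 hU a ha
    obtain ⟨r, hr, hrr⟩ : ∃ r, 0 < r ∧ r < r₀ := exists_between hr₀
    have hmem : ∀ w ∈ closedBall (a 0) r, ∀ y ∈ ball (Fin.tail a) r,
        (Fin.cons w y : Fin (n + 1) → ℂ) ∈ U := by
      intro w hw y hy
      apply hball
      rw [mem_ball, dist_pi_lt_iff hr₀]
      intro i
      refine Fin.cases ?_ (fun j => ?_) i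
      · simpa using lt_of_le_of_lt hw hrr
      · simpa [Fin.tail] using (((dist_pi_lt_iff hr).1 (mem_ball.1 hy)) j).trans hrr
    let K := Set.Icc (0 : ℝ) (2 * Real.pi)
    let c : K → ℂ := fun θ => circleMap (a 0) r θ
    have hcK : ∀ θ, c θ ∈ sphere (a 0) r := fun θ => circleMap_mem_sphere _ hr.le _
    have hccont : Continuous c := (continuous_circleMap _ _).comp continuous_subtype_val
    let V := ball (Fin.tail a) r
    have hVc : Continuous (fun p : V × K => f (Fin.cons (c p.2) p.1.1)) := by
      refine hc.comp_continuous ?_ fun p => hmem _ (sphere_subset_closedBall (hcK _)) _ p.1.2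
      refine continuous_pi fun i => ?_
      refine Fin.cases ?_ (fun j => ?_) i
      · simp only [Fin.cons_zero]; fun_prop
      · simp only [Fin.cons_succ]
        exact (continuous_apply j).comp (continuous_subtype_val.comp continuous_fst)
    let Φ' : C(V, C(K, F)) := ContinuousMap.curry ⟨_, hVc⟩
    classical
    let Φ : (Fin n → ℂ) → C(K, F) := fun y => if h : y ∈ V then Φ' ⟨y, h⟩ else 0
    have hΦ : ∀ y ∈ V, ∀ θ, Φ y θ = f (Fin.cons (c θ) y) := by
      intro y hy θ
      simp only [Φ, dif_pos hy]; rfl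
    have hΦc : ContinuousOn Φ V := by
      rw [continuousOn_iff_continuous_domRestrict]
      convert Φ'.continuous using 1
      ext1 y
      simp [Φ, y.2]
    have hΦa : AnalyticOnNhd ℂ Φ V := by
      refine ih isOpen_ball hΦc fun y hy i => ?_
      obtain ⟨s, hs0, hsV⟩ := Metric.isOpen_iff.1 (isOpen_ball : IsOpen V) y hy
      have hup : ∀ t ∈ closedBall (y i) (s / 2), Function.update y i t ∈ V := by
        intro t ht
        apply hsV
        rw [mem_ball, dist_pi_lt_iff hs0]
        intro j
        by_cases hj : j = i
        · subst hj; rw [mem_closedBall] at ht; simp; linarith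
        · simp [hj, hs0]
      refine (analyticAt_continuousMap (r := s / 2) (by positivity) ?_ ?_).differentiableAt
      · exact hΦc.comp (by fun_prop) hup
      · intro θ t ht
        have h1 := hs (Fin.cons (c θ) (Function.update y i t))
          (hmem _ (sphere_subset_closedBall (hcK _)) _ (hup t ht)) i.succ
        simp only [Fin.cons_succ, Function.update_self] at h1
        refine DifferentiableWithinAt.congr
          (h1.differentiableWithinAt (s := closedBall (y i) (s / 2))) ?_ ?_
        on_goal 2 => rw [hΦ _ (hup t ht), ← Fin.cons_update]; simp
        intro t' ht'
        rw [hΦ _ (hup t' ht'), ← Fin.cons_update]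
        simp
    let k₀ : ℂ → K → ℂ := fun w θ => (2 * Real.pi * I)⁻¹ * deriv (circleMap (a 0) r) θ * (c θ - w)⁻¹
    have hne : ∀ w ∈ ball (a 0) r, ∀ θ, c θ - w ≠ 0 := by
      intro w hw θ h0
      have h1 := hcK θ
      rw [sub_eq_zero.1 h0, mem_sphere] at h1
      rw [mem_ball] at hw
      linarith
    let W := ball (a 0) r
    have hkc : Continuous (fun p : W × K => k₀ p.1.1 p.2) := by
      simp only [k₀, deriv_circleMap]
      refine Continuous.mul (by fun_prop) (Continuous.inv₀ (by fun_prop) fun p => hne _ p.1.2 _)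
    let k' : C(W, C(K, ℂ)) := ContinuousMap.curry ⟨_, hkc⟩
    let k : ℂ → C(K, ℂ) := fun w => if h : w ∈ W then k' ⟨w, h⟩ else 0
    have hk : ∀ w ∈ W, ∀ θ, k w θ = k₀ w θ := by
      intro w hw θ
      simp only [k, dif_pos hw]; rfl
    have hkcont : ContinuousOn k W := by
      rw [continuousOn_iff_continuous_domRestrict]
      convert k'.continuous using 1
      ext1 y
      simp [k, y.2]
    have hka : AnalyticAt ℂ k (a 0) := by
      have hsub : closedBall (a 0) (r / 2) ⊆ W := closedBall_subset_ball (by linarith)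
      refine analyticAt_continuousMap (r := r / 2) (by positivity) (hkcont.mono hsub) ?_
      intro θ t ht
      have h1 : DifferentiableAt ℂ (fun w => k₀ w θ) t := by
        simp only [k₀]
        exact ((differentiableAt_const _).sub differentiableAt_id).inv (hne t (hsub ht) θ)
          |>.const_mul _
      exact DifferentiableWithinAt.congr h1.differentiableWithinAt
          (fun t' ht' => hk t' (hsub ht') θ) (hk t (hsub ht) θ)
    let μK : Measure K := Measure.comap Subtype.val volume
    have : IsFiniteMeasure μK := by
      refine ⟨?_⟩
      rw [Measure.comap_apply _ Subtype.val_injective (fun s hs => measurableSet_Icc.subtype_image hs)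
        _ MeasurableSet.univ]
      refine lt_of_le_of_lt (measure_mono (t := Set.Icc (0 : ℝ) (2 * Real.pi)) ?_) measure_Icc_lt_top
      rintro _ ⟨x, -, rfl⟩
      exact x.2
    have hint : ∀ (x : C(K, ℂ)) (y : C(K, F)), Integrable (fun θ => x θ • y θ) μK :=
      fun x y => (x.continuous.smul y.continuous).integrable_of_hasCompactSupport
        (HasCompactSupport.of_compactSpace _)
    let B₀ : C(K, ℂ) →ₗ[ℂ] C(K, F) →ₗ[ℂ] F := LinearMap.mk₂ ℂ (fun x y => ∫ θ, x θ • y θ ∂μK)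
      (fun x x' y => by
        simp only [ContinuousMap.add_apply, add_smul]; exact integral_add (hint _ _) (hint _ _))
      (fun s x y => by
        simp only [ContinuousMap.smul_apply, smul_assoc]; exact integral_smul _ _)
      (fun x y y' => by
        simp only [ContinuousMap.add_apply, smul_add]; exact integral_add (hint _ _) (hint _ _))
      (fun s x y => by
        simp only [ContinuousMap.smul_apply, smul_comm _ s]; exact integral_smul _ _)
    let B : C(K, ℂ) →L[ℂ] C(K, F) →L[ℂ] F := LinearMap.mkContinuous₂ B₀
      (μK.real Set.univ) (fun x y => by
        have := norm_integral_le_of_norm_le_const (μ := μK)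
          (f := fun θ => x θ • y θ) (C := ‖x‖ * ‖y‖) (Eventually.of_forall fun θ => by
            rw [norm_smul]
            exact mul_le_mul (x.norm_coe_le_norm θ) (y.norm_coe_le_norm θ) (norm_nonneg _)
              (norm_nonneg _))
        refine this.trans (le_of_eq ?_)
        ring)
    have hB : ∀ x y, B x y = ∫ θ, x θ • y θ ∂μK := fun x y => rfl
    have hev : f =ᶠ[𝓝 a] fun u => B (k (u 0)) (Φ (Fin.tail u)) := by
      filter_upwards [ball_mem_nhds a hr] with u hu
      have hu0 : u 0 ∈ W := (dist_pi_lt_iff hr).1 (mem_ball.1 hu) 0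
      have hu1 : Fin.tail u ∈ V := (dist_pi_lt_iff hr).2 fun j =>
        (dist_pi_lt_iff hr).1 (mem_ball.1 hu) j.succ
      rw [hB]
      have h1 : DiffContOnCl ℂ (fun w => f (Fin.cons w (Fin.tail u))) (ball (a 0) r) := by
        refine DifferentiableOn.diffContOnCl_ball (U := closedBall (a 0) r) ?_ (le_refl _)
        intro w hw
        have h1 := hs (Fin.cons w (Fin.tail u)) (hmem _ hw _ hu1) 0
        simp only [Fin.cons_zero, Fin.update_cons_zero] at h1
        exact h1.differentiableWithinAt
      have h2 := h1.two_pi_i_inv_smul_circleIntegral_sub_inv_smul hu0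
      rw [Fin.cons_self_tail] at h2
      rw [← h2, circleIntegral, intervalIntegral.integral_of_le (by positivity),
        ← integral_Icc_eq_integral_Ioc, ← integral_smul,
        ← integral_subtype_comap (μ := volume) measurableSet_Icc]
      refine integral_congr_ae (Eventually.of_forall fun θ => ?_)
      simp only [hk _ hu0, hΦ _ hu1, k₀, c, smul_smul, mul_assoc]
    refine AnalyticAt.congr ?_ hev.symm
    have h1 : AnalyticAt ℂ (fun u : Fin (n + 1) → ℂ => (k (u 0), Φ (Fin.tail u))) a := by
      refine AnalyticAt.prod ?_ ?_
      · exact hka.comp_of_eq ((ContinuousLinearMap.proj (R := ℂ) (φ := fun _ : Fin (n + 1) => ℂ)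
          0).analyticAt a) rfl
      · have ht : AnalyticAt ℂ (fun u : Fin (n + 1) → ℂ => Fin.tail u) a :=
          (ContinuousLinearMap.pi fun j : Fin n => ContinuousLinearMap.proj (R := ℂ)
            (φ := fun _ : Fin (n + 1) => ℂ) j.succ).analyticAt a
        exact (hΦa (Fin.tail a) (mem_ball_self hr)).comp_of_eq ht rfl
    exact (ContinuousLinearMap.analyticAt_bilinear B _).comp h1

open Metric in
/-- Analytic dependence of an integral on several complex parameters, for a locally dominated
integrand. -/
theorem analyticOnNhd_integral {n : ℕ} {α : Type*} [MeasurableSpace α] {μ : Measure α}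
    {F : (Fin n → ℂ) → α → ℂ} {U : Set (Fin n → ℂ)} (hU : IsOpen U)
    (hm : ∀ u ∈ U, AEStronglyMeasurable (F u) μ)
    (hd : ∀ᵐ t ∂μ, DifferentiableOn ℂ (fun u => F u t) U)
    (hb : ∀ u ∈ U, ∃ r > 0, ∃ g : α → ℝ, Integrable g μ ∧
      ∀ᵐ t ∂μ, ∀ v ∈ ball u r, ‖F v t‖ ≤ g t) :
    AnalyticOnNhd ℂ (fun u => ∫ t, F u t ∂μ) U := by
  refine analyticOnNhd_of_separately hU ?_ ?_
  · intro u hu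
    obtain ⟨r, hr, g, hg, hbd⟩ := hb u hu
    refine ContinuousAt.continuousWithinAt ?_
    refine continuousAt_of_dominated (bound := g) ?_ ?_ hg ?_
    · filter_upwards [hU.mem_nhds hu] with v hv using hm v hv
    · filter_upwards [ball_mem_nhds u hr] with v hv
      filter_upwards [hbd] with t ht using ht v hv
    · filter_upwards [hd] with t ht using
        (ht u hu).continuousWithinAt.continuousAt (hU.mem_nhds hu)
  · intro u hu i
    obtain ⟨r, hr, g, hg, hbd⟩ := hb u hu
    obtain ⟨r', hr', hsub⟩ := Metric.isOpen_iff.1 hU u hu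
    have hup : ∀ s, 0 < s → ∀ t ∈ ball (u i) s, Function.update u i t ∈ ball u s := by
      intro s hs t ht
      rw [mem_ball, dist_pi_lt_iff hs]
      intro j
      by_cases hj : j = i
      · subst hj; simpa using ht
      · simp [hj, hs]
    have h1 := hasDerivAt_integral_of_norm_le (μ := μ)
      (F := fun z t => F (Function.update u i z) t) (z₀ := u i)
      (lt_min hr hr') hg ?_ ?_ ?_
    · exact h1.differentiableAt
    · intro z hz
      exact hm _ (hsub (hup _ hr' _ (ball_subset_ball (min_le_right _ _) hz)))
    · filter_upwards [hd] with t ht z hz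
      have h2 : Function.update u i z ∈ U :=
        hsub (hup _ hr' _ (ball_subset_ball (min_le_right _ _) hz))
      have h3 := (ht _ h2).differentiableAt (hU.mem_nhds h2)
      have h4 : DifferentiableAt ℂ (fun z => Function.update u i z) z :=
        (hasDerivAt_update u i z).differentiableAt
      exact (h3.comp z h4).differentiableWithinAt
    · filter_upwards [hbd] with t ht z hz
      exact ht _ (hup _ hr _ (ball_subset_ball (min_le_left _ _) hz))

theorem isOpen_strip (lo hi : ℝ) : IsOpen {z : ℂ | lo < z.im ∧ z.im < hi} :=
  (isOpen_lt continuous_const Complex.continuous_im).inter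
    (isOpen_lt Complex.continuous_im continuous_const)

theorem convex_strip (lo hi : ℝ) : Convex ℝ {z : ℂ | lo < z.im ∧ z.im < hi} :=
  (convex_halfSpace_im_gt lo).inter (convex_halfSpace_im_lt hi)

open Metric in
/-- Cauchy's theorem for a strip, in the form that `∫ f (x + w) dx` does not depend on `w`. It is
holomorphic in `w`, and constant along horizontal lines by translation invariance. -/
theorem integral_strip_shift {f : ℂ → ℂ} {lo hi : ℝ}
    (hf : DifferentiableOn ℂ f {z | lo < z.im ∧ z.im < hi})
    (hb : ∀ w : ℂ, lo < w.im → w.im < hi → ∃ r > 0, ∃ g : ℝ → ℝ, Integrable g ∧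
      ∀ x : ℝ, ∀ w' ∈ ball w r, ‖f (x + w')‖ ≤ g x)
    {w w' : ℂ} (hw : lo < w.im ∧ w.im < hi) (hw' : lo < w'.im ∧ w'.im < hi) :
    ∫ x : ℝ, f (x + w) = ∫ x : ℝ, f (x + w') := by
  set U : Set ℂ := {z | lo < z.im ∧ z.im < hi} with hU
  have hUo : IsOpen U := isOpen_strip lo hi
  have hadd : ∀ (x : ℝ) (z : ℂ), z ∈ U → (x : ℂ) + z ∈ U := by
    intro x z hz; simpa [hU] using hz
  have hder : ∀ z ∈ U, ∃ f', HasDerivAt (fun w => ∫ x : ℝ, f (x + w)) f' z := by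
    intro z hz
    obtain ⟨r, hr, g, hg, hbd⟩ := hb z hz.1 hz.2
    obtain ⟨r', hr', hsub⟩ := Metric.isOpen_iff.1 hUo z hz
    refine ⟨_, hasDerivAt_integral_of_norm_le (lt_min hr hr') hg ?_ ?_ ?_⟩
    · intro v hv
      refine Continuous.aestronglyMeasurable ?_
      refine hf.continuousOn.comp_continuous (by fun_prop) fun x => hadd x v ?_
      exact hsub (ball_subset_ball (min_le_right _ _) hv)
    · refine Eventually.of_forall fun x => ?_
      refine hf.comp (by fun_prop) fun v hv => hadd x v ?_
      exact hsub (ball_subset_ball (min_le_right _ _) hv)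
    · exact Eventually.of_forall fun x v hv => hbd x v (ball_subset_ball (min_le_left _ _) hv)
  have htr : ∀ (z : ℂ) (s : ℝ), ∫ x : ℝ, f (x + (z + s)) = ∫ x : ℝ, f (x + z) := by
    intro z s
    rw [← integral_add_right_eq_self (fun x : ℝ => f (x + z)) s]
    congr 1; ext x; congr 1; push_cast; ring
  have hzero : ∀ z ∈ U, HasDerivAt (fun w => ∫ x : ℝ, f (x + w)) 0 z := by
    intro z hz
    obtain ⟨f', hf'⟩ := hder z hz
    have h1 : HasDerivAt (fun s : ℝ => ∫ x : ℝ, f (x + (z + s))) f' 0 := by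
      have h2 : HasDerivAt (fun s : ℝ => z + (s : ℂ)) 1 0 := by
        simpa using (Complex.ofRealCLM.hasDerivAt (x := (0 : ℝ))).const_add z
      have h3 : HasDerivAt (fun w => ∫ x : ℝ, f (x + w)) f' (z + ((0 : ℝ) : ℂ)) := by simpa using hf'
      have h4 := h3.comp (0 : ℝ) h2
      rw [mul_one] at h4
      exact h4
    simp only [htr] at h1
    rwa [h1.unique (hasDerivAt_const (0 : ℝ) _)] at hf'
  refine (convex_strip lo hi).is_const_of_fderivWithin_eq_zero (𝕜 := ℂ)
    (f := fun w => ∫ x : ℝ, f (x + w)) (fun z hz =>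
      (hzero z hz).differentiableAt.differentiableWithinAt) (fun z hz => ?_) hw hw'
  rw [fderivWithin_of_isOpen hUo hz]
  have := (hzero z hz).hasFDerivAt.fderiv
  rw [this]; ext; simp

/-- A function that is holomorphic in a strip, has a period `q` shorter than the width of the strip
and is bounded on narrower strips is constant, by Liouville's theorem for its periodic extension. -/
theorem eq_of_periodic_of_bounded_strip {q : ℂ} (hq : 0 < q.im) {f : ℂ → ℂ} {lo hi : ℝ}
    (hlo : lo + q.im < hi) (hf : DifferentiableOn ℂ f {z | lo < z.im ∧ z.im < hi})
    (hper : ∀ s : ℂ, lo < s.im → s.im + q.im < hi → f (s + q) = f s)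
    (hb : ∀ a b : ℝ, lo < a → b < hi → ∃ C, ∀ s : ℂ, a ≤ s.im → s.im ≤ b → ‖f s‖ ≤ C)
    {w w' : ℂ} (hw : lo < w.im ∧ w.im < hi) (hw' : lo < w'.im ∧ w'.im < hi) : f w = f w' := by
  obtain ⟨a, ha, haq⟩ : ∃ a, lo < a ∧ a + q.im < hi := by
    obtain ⟨a, h1, h2⟩ := exists_between (show lo < hi - q.im by linarith)
    exact ⟨a, h1, by linarith⟩
  let n : ℂ → ℤ := fun s => ⌊(s.im - a) / q.im⌋
  let g : ℂ → ℂ := fun s => f (s - n s * q)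
  have him : ∀ (s : ℂ) (k : ℤ), (s - k * q).im = s.im - k * q.im := by
    intro s k; simp
  have hn1 : ∀ s, a ≤ s.im - n s * q.im := by
    intro s
    have := Int.floor_le ((s.im - a) / q.im)
    rw [le_div_iff₀ hq] at this
    simp only [n]; linarith
  have hn2 : ∀ s, s.im - n s * q.im < a + q.im := by
    intro s
    have := Int.lt_floor_add_one ((s.im - a) / q.im)
    rw [div_lt_iff₀ hq] at this
    simp only [n]; linarith
  have hopen := isOpen_strip lo hi
  have hgloc : ∀ s : ℂ, g =ᶠ[𝓝 s] fun s' => f (s' - n s * q) := by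
    intro s
    have hc : Continuous fun s' : ℂ => (s' - n s * q).im := by fun_prop
    have h1 : ∀ᶠ s' : ℂ in 𝓝 s, max lo (a - q.im) < (s' - n s * q).im :=
      hc.continuousAt.eventually (lt_mem_nhds (by
        simp only [him]; exact max_lt (ha.trans_le (hn1 s)) (by linarith [hn1 s])))
    have h2 : ∀ᶠ s' : ℂ in 𝓝 s, (s' - n s * q).im < a + q.im :=
      hc.continuousAt.eventually (gt_mem_nhds (by simp only [him]; exact hn2 s))
    filter_upwards [h1, h2] with s' h1 h2
    rw [max_lt_iff, him] at h1
    rw [him] at h2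
    rcases le_or_gt a (s'.im - n s * q.im) with h | h
    · have : n s' = n s := by
        simp only [n] at h h2 ⊢
        rw [Int.floor_eq_iff, le_div_iff₀ hq, div_lt_iff₀ hq]
        constructor <;> linarith
      simp only [g, this]
    · have : n s' = n s - 1 := by
        simp only [n] at h h1 ⊢
        rw [Int.floor_eq_iff, le_div_iff₀ hq, div_lt_iff₀ hq]
        push_cast
        constructor <;> linarith
      have h3 := hper (s' - n s * q) (by rw [him]; exact h1.1) (by rw [him]; linarith)
      simp only [g, this]
      rw [← h3]
      congr 1; push_cast; ring
  have hgd : Differentiable ℂ g := by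
    intro s
    refine DifferentiableAt.congr_of_eventuallyEq ?_ (hgloc s)
    have hmem : s - n s * q ∈ {z : ℂ | lo < z.im ∧ z.im < hi} := by
      refine ⟨?_, ?_⟩
      · rw [him]; exact ha.trans_le (hn1 s)
      · rw [him]; exact (hn2 s).trans haq
    have h1 := (hf _ hmem).differentiableAt (hopen.mem_nhds hmem)
    exact h1.comp s (f := fun s' => s' - n s * q) (by fun_prop)
  have hgb : Bornology.IsBounded (Set.range g) := by
    obtain ⟨C, hC⟩ := hb a (a + q.im) ha haq
    rw [isBounded_iff_forall_norm_le]
    refine ⟨C, ?_⟩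
    rintro _ ⟨s, rfl⟩
    exact hC _ (by rw [him]; exact hn1 s) (by rw [him]; exact (hn2 s).le)
  have hconst := hgd.apply_eq_apply_of_bounded hgb
  have heq : Set.EqOn f (fun _ => g 0) {z | lo < z.im ∧ z.im < hi} := by
    have hmem : (((a + q.im / 2 : ℝ) : ℂ) * I) ∈ {z : ℂ | lo < z.im ∧ z.im < hi} := by
      simp; constructor <;> linarith
    refine AnalyticOnNhd.eqOn_of_preconnected_of_eventuallyEq (hf.analyticOnNhd hopen)
      (analyticOnNhd_const) (convex_strip lo hi).isPreconnected hmem ?_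
    have h1 : ∀ᶠ s : ℂ in 𝓝 (((a + q.im / 2 : ℝ) : ℂ) * I), a < s.im ∧ s.im < a + q.im :=
      (isOpen_strip a (a + q.im)).mem_nhds (by simp; linarith)
    filter_upwards [h1] with s hs
    rw [← hconst s 0]
    have : n s = 0 := by
      simp only [n]
      rw [Int.floor_eq_iff, le_div_iff₀ hq, div_lt_iff₀ hq]
      push_cast
      constructor <;> linarith [hs.1, hs.2]
    simp [g, this]
  rw [heq hw, heq hw']

/-! ### Elementary bounds for hyperbolic and trigonometric functions -/

theorem norm_exp_le_exp_abs_re (w : ℂ) : ‖Complex.exp w‖ ≤ Real.exp |w.re| := by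
  rw [Complex.norm_exp]; exact Real.exp_le_exp.2 (le_abs_self _)

theorem norm_sinh_le (w : ℂ) : ‖Complex.sinh w‖ ≤ Real.exp |w.re| := by
  rw [Complex.sinh, norm_div]
  have h1 := norm_sub_le (Complex.exp w) (Complex.exp (-w))
  have h2 := norm_exp_le_exp_abs_re w
  have h3 := norm_exp_le_exp_abs_re (-w)
  rw [Complex.neg_re, abs_neg] at h3
  rw [div_le_iff₀ (by norm_num)]
  simp only [Complex.norm_ofNat]
  linarith

theorem norm_cosh_le (w : ℂ) : ‖Complex.cosh w‖ ≤ Real.exp |w.re| := by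
  rw [Complex.cosh, norm_div]
  have h1 := norm_add_le (Complex.exp w) (Complex.exp (-w))
  have h2 := norm_exp_le_exp_abs_re w
  have h3 := norm_exp_le_exp_abs_re (-w)
  rw [Complex.neg_re, abs_neg] at h3
  rw [div_le_iff₀ (by norm_num)]
  simp only [Complex.norm_ofNat]
  linarith

theorem norm_sin_le (w : ℂ) : ‖Complex.sin w‖ ≤ Real.exp |w.im| := by
  have h := norm_sinh_le (w * I)
  rw [Complex.sinh_mul_I, norm_mul, Complex.norm_I, mul_one] at h
  simpa using h

theorem norm_cos_le (w : ℂ) : ‖Complex.cos w‖ ≤ Real.exp |w.im| := by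
  have h := norm_cosh_le (w * I)
  rw [Complex.cosh_mul_I] at h
  simpa using h

theorem sinh_abs_re_le_norm_sinh (w : ℂ) : Real.sinh |w.re| ≤ ‖Complex.sinh w‖ := by
  rw [Complex.sinh, norm_div, Complex.norm_ofNat, Real.sinh_eq]
  refine div_le_div_of_nonneg_right ?_ (by norm_num)
  have h1 := norm_sub_norm_le (Complex.exp w) (Complex.exp (-w))
  have h2 := norm_sub_norm_le (Complex.exp (-w)) (Complex.exp w)
  rw [norm_sub_rev] at h2
  simp only [Complex.norm_exp, Complex.neg_re] at h1 h2
  rcases abs_cases w.re with ⟨h, _⟩ | ⟨h, _⟩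
  · rw [h]; exact h1
  · rw [h, neg_neg]; exact h2

theorem mul_exp_div_le_sinh {s : ℝ} (hs : 0 ≤ s) : s * Real.exp s / (1 + 2 * s) ≤ Real.sinh s := by
  rw [div_le_iff₀ (by positivity), Real.sinh_eq]
  have h1 : 1 + 2 * s ≤ Real.exp s * Real.exp s := by
    rw [← Real.exp_add]; have := Real.add_one_le_exp (s + s); linarith
  have h2 : Real.exp (-s) * Real.exp s = 1 := by rw [← Real.exp_add]; simp
  have h3 : (1 + 2 * s) * Real.exp (-s) ≤ Real.exp s := by
    have := mul_le_mul_of_nonneg_right h1 (Real.exp_pos (-s)).le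
    calc _ ≤ _ := this
      _ = Real.exp s * (Real.exp (-s) * Real.exp s) := by ring
      _ = _ := by rw [h2, mul_one]
  linarith

theorem norm_sinh_sub_self_le (w : ℂ) : ‖Complex.sinh w - w‖ ≤ ‖w‖ ^ 3 * Real.exp ‖w‖ := by
  have h1 := Complex.norm_exp_sub_sum_le_norm_mul_exp w 3
  have h2 := Complex.norm_exp_sub_sum_le_norm_mul_exp (-w) 3
  simp only [Finset.sum_range_succ, Finset.sum_range_zero, norm_neg] at h1 h2
  have h3 : Complex.sinh w - w = ((Complex.exp w - (0 + w ^ 0 / (Nat.factorial 0 : ℂ)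
      + w ^ 1 / (Nat.factorial 1 : ℂ) + w ^ 2 / (Nat.factorial 2 : ℂ)))
      - (Complex.exp (-w) - (0 + (-w) ^ 0 / (Nat.factorial 0 : ℂ)
      + (-w) ^ 1 / (Nat.factorial 1 : ℂ) + (-w) ^ 2 / (Nat.factorial 2 : ℂ)))) / 2 := by
    rw [Complex.sinh]; simp [Nat.factorial]; ring
  rw [h3, norm_div, Complex.norm_ofNat, div_le_iff₀ (by norm_num)]
  refine (norm_sub_le _ _).trans ?_
  linarith

theorem norm_cosh_sub_one_le (w : ℂ) : ‖Complex.cosh w - 1‖ ≤ ‖w‖ ^ 2 * Real.exp ‖w‖ := by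
  have h1 := Complex.norm_exp_sub_sum_le_norm_mul_exp w 2
  have h2 := Complex.norm_exp_sub_sum_le_norm_mul_exp (-w) 2
  simp only [Finset.sum_range_succ, Finset.sum_range_zero, norm_neg] at h1 h2
  have h3 : Complex.cosh w - 1 = ((Complex.exp w - (0 + w ^ 0 / (Nat.factorial 0 : ℂ)
      + w ^ 1 / (Nat.factorial 1 : ℂ)))
      + (Complex.exp (-w) - (0 + (-w) ^ 0 / (Nat.factorial 0 : ℂ)
      + (-w) ^ 1 / (Nat.factorial 1 : ℂ)))) / 2 := by
    rw [Complex.cosh]; simp [Nat.factorial]; ring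
  rw [h3, norm_div, Complex.norm_ofNat, div_le_iff₀ (by norm_num)]
  refine (norm_add_le _ _).trans ?_
  linarith

theorem norm_sin_sub_self_le (w : ℂ) : ‖Complex.sin w - w‖ ≤ ‖w‖ ^ 3 * Real.exp ‖w‖ := by
  have h := norm_sinh_sub_self_le (w * I)
  rw [Complex.sinh_mul_I, ← sub_mul, norm_mul, norm_mul, Complex.norm_I, mul_one, mul_one] at h
  exact h

theorem norm_cos_sub_one_le (w : ℂ) : ‖Complex.cos w - 1‖ ≤ ‖w‖ ^ 2 * Real.exp ‖w‖ := by
  have h := norm_cosh_sub_one_le (w * I)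
  rw [Complex.cosh_mul_I, norm_mul, Complex.norm_I, mul_one] at h
  exact h

theorem norm_sin_le_mul (w : ℂ) : ‖Complex.sin w‖ ≤ ‖w‖ * Real.exp |w.im| := by
  have hconv : Convex ℝ {v : ℂ | -|w.im| ≤ v.im ∧ v.im ≤ |w.im|} :=
    (convex_halfSpace_im_ge _).inter (convex_halfSpace_im_le _)
  have h := hconv.norm_image_sub_le_of_norm_deriv_le (f := Complex.sin) (x := 0) (y := w)
    (C := Real.exp |w.im|) (fun v _ => Complex.differentiable_sin v) (fun v hv => ?_)
    (by simp) ⟨neg_abs_le _, le_abs_self _⟩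
  · rw [Complex.sin_zero, sub_zero, sub_zero] at h
    linarith
  · rw [Complex.deriv_sin]
    exact (norm_cos_le v).trans (Real.exp_le_exp.2 (abs_le.2 hv))

section sinh_bounds

variable {α β : ℂ}

theorem re_mul_le_norm_sinh (hα : 0 < α.re) {t : ℝ} (ht : 0 ≤ t) :
    α.re * t ≤ ‖Complex.sinh (α * t)‖ := by
  have h1 := sinh_abs_re_le_norm_sinh (α * t)
  have h2 : |(α * t).re| = α.re * t := by
    rw [Complex.re_mul_ofReal, abs_of_nonneg (by positivity)]
  rw [h2] at h1
  exact (Real.self_le_sinh_iff.2 (by positivity)).trans h1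

theorem sinh_mul_ne_zero (hα : 0 < α.re) {t : ℝ} (ht : 0 < t) : Complex.sinh (α * t) ≠ 0 := by
  have := re_mul_le_norm_sinh hα ht.le
  have h2 : 0 < α.re * t := by positivity
  exact norm_pos_iff.1 (h2.trans_le this)

theorem exp_le_norm_sinh (hα : 0 < α.re) {t : ℝ} (ht : 1 ≤ t) :
    α.re / (1 + 2 * α.re) * Real.exp (α.re * t) ≤ ‖Complex.sinh (α * t)‖ := by
  have h1 := sinh_abs_re_le_norm_sinh (α * t)
  have h2 : |(α * t).re| = α.re * t := by
    rw [Complex.re_mul_ofReal, abs_of_nonneg (by positivity)]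
  rw [h2] at h1
  refine le_trans ?_ ((mul_exp_div_le_sinh (by positivity)).trans h1)
  rw [mul_div_right_comm]
  refine mul_le_mul_of_nonneg_right ?_ (Real.exp_pos _).le
  rw [div_le_div_iff₀ (by positivity) (by positivity)]
  nlinarith

theorem norm_inv_sinh_sub_le (hα : 0 < α.re) : ∃ M : ℝ, 0 ≤ M ∧ ∀ t : ℝ, 0 < t → t ≤ 1 →
    ‖1 / Complex.sinh (α * t) - 1 / (α * t)‖ ≤ M * t := by
  have hα0 : α ≠ 0 := by rintro rfl; simp at hα
  refine ⟨‖α‖ ^ 2 * Real.exp ‖α‖ / α.re, by positivity, fun t ht ht1 => ?_⟩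
  have hs := sinh_mul_ne_zero hα ht
  have ht0 : (t : ℂ) ≠ 0 := by exact_mod_cast ht.ne'
  rw [div_sub_div _ _ hs (by positivity), norm_div, norm_mul, one_mul, mul_one, norm_sub_rev]
  have h1 := norm_sinh_sub_self_le (α * t)
  have h2 := re_mul_le_norm_sinh hα ht.le
  have h3 : ‖α * t‖ = ‖α‖ * t := by rw [norm_mul, Complex.norm_real, Real.norm_of_nonneg ht.le]
  have hα' : 0 < ‖α‖ := by positivity
  rw [h3] at h1 ⊢
  have h4 : Real.exp (‖α‖ * t) ≤ Real.exp ‖α‖ := Real.exp_le_exp.2 (by nlinarith)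
  rw [div_le_iff₀ (mul_pos (norm_pos_iff.2 hs) (by positivity))]
  calc ‖Complex.sinh (α * t) - α * t‖ ≤ (‖α‖ * t) ^ 3 * Real.exp ‖α‖ :=
        h1.trans (mul_le_mul_of_nonneg_left h4 (by positivity))
    _ = ‖α‖ ^ 2 * Real.exp ‖α‖ / α.re * t * (α.re * t * (‖α‖ * t)) := by field_simp
    _ ≤ _ := by gcongr

theorem norm_inv_mul_sub_le {p q : ℝ → ℂ} {a b c : ℝ} (hα : α ≠ 0) (ha : 0 ≤ a)
    (hb : 0 < b) (hc : 0 ≤ c)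
    (hp : ∀ t : ℝ, 0 < t → t ≤ 1 → ‖1 / p t - 1 / (α * t)‖ ≤ a * t)
    (hq : ∀ t : ℝ, 0 < t → t ≤ 1 → ‖1 / q t - 1 / (β * t)‖ ≤ c * t)
    (hq' : ∀ t : ℝ, 0 < t → t ≤ 1 → b * t ≤ ‖q t‖) :
    ∃ M : ℝ, 0 ≤ M ∧ ∀ t : ℝ, 0 < t → t ≤ 1 →
      ‖1 / (p t * q t) - 1 / (α * β * t ^ 2)‖ ≤ M := by
  refine ⟨a / b + c / ‖α‖, by positivity, fun t ht ht1 => ?_⟩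
  have ht0 : (t : ℂ) ≠ 0 := by exact_mod_cast ht.ne'
  have h1 : 1 / (p t * q t) - 1 / (α * β * t ^ 2)
      = (1 / p t - 1 / (α * t)) * (1 / q t) + 1 / (α * t) * (1 / q t - 1 / (β * t)) := by
    rw [one_div_mul_eq_div, one_div (α * β * t ^ 2)]
    simp only [div_eq_mul_inv, one_mul, mul_inv]
    ring
  rw [h1]
  refine (norm_add_le _ _).trans (add_le_add ?_ ?_)
  · rw [norm_mul, norm_div, norm_one]
    calc _ ≤ a * t * (1 / (b * t)) := by
          gcongr
          · exact hp t ht ht1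
          · exact hq' t ht ht1
      _ = a / b := by field_simp
  · rw [norm_mul, norm_div, norm_one, norm_mul, Complex.norm_real, Real.norm_of_nonneg ht.le]
    calc _ ≤ 1 / (‖α‖ * t) * (c * t) := by
          gcongr
          exact hq t ht ht1
      _ = c / ‖α‖ := by field_simp

end sinh_bounds

/-- The dominating functions used for all integrals over `(0, ∞)` below. -/
theorem integrableOn_exp_add_inv {δ : ℝ} (hδ : 0 < δ) (A B : ℝ) :
    IntegrableOn (fun t : ℝ => A * Real.exp (-δ * t) + B * (1 + t ^ 2)⁻¹) (Set.Ioi 0) :=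
  ((exp_neg_integrableOn_Ioi 0 hδ).const_mul A).add
    ((integrable_inv_one_add_sq.const_mul B).integrableOn)

theorem le_exp_add_inv {f : ℝ → ℝ} {M A B δ : ℝ} (hM : 0 ≤ M) (hA : 0 ≤ A) (hB : 0 ≤ B)
    (h1 : ∀ t, 0 < t → t ≤ 1 → f t ≤ M) (h2 : ∀ t, 1 ≤ t → f t ≤ A * Real.exp (-δ * t) + B / t ^ 2)
    {t : ℝ} (ht : 0 < t) :
    f t ≤ A * Real.exp (-δ * t) + (2 * M + 2 * B) * (1 + t ^ 2)⁻¹ := by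
  rcases le_total t 1 with h | h
  · have h3 : M ≤ 2 * M * (1 + t ^ 2)⁻¹ := by
      rw [← div_eq_mul_inv, le_div_iff₀ (by positivity)]
      nlinarith [mul_nonneg hM (by nlinarith : (0 : ℝ) ≤ 1 - t ^ 2)]
    have h4 : 0 ≤ A * Real.exp (-δ * t) := by positivity
    have h5 : 0 ≤ 2 * B * (1 + t ^ 2)⁻¹ := by positivity
    linarith [h1 t ht h]
  · have h3 : B / t ^ 2 ≤ 2 * B * (1 + t ^ 2)⁻¹ := by
      rw [← div_eq_mul_inv, div_le_div_iff₀ (by positivity) (by positivity)]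
      nlinarith [mul_nonneg hB (by nlinarith : (0 : ℝ) ≤ t ^ 2 - 1)]
    have h5 : 0 ≤ 2 * M * (1 + t ^ 2)⁻¹ := by positivity
    linarith [h2 t h]

/-! ### An integral representation of the logarithm of the hyperbolic cosine -/

/-- The integral `∫₀^∞ (cos (2zt) / sinh (ωt) - 1 / (ωt)) dt / t`, which is a logarithm of
`1 / (2 cosh (πz / ω))`. -/
noncomputable def coshLog (ω z : ℂ) : ℂ :=
  ∫ t : ℝ in Set.Ioi 0, (Complex.cos (2 * z * t) / Complex.sinh (ω * t) - 1 / (ω * t)) / t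

section coshLog

variable {ω : ℂ}

theorem norm_coshLog_integrand_le (hω : 0 < ω.re) {y Z : ℝ} (hZ : 0 ≤ Z) :
    ∃ A B : ℝ, ∀ z : ℂ, |z.im| ≤ y → ‖z‖ ≤ Z → ∀ t : ℝ, 0 < t →
      ‖(Complex.cos (2 * z * t) / Complex.sinh (ω * t) - 1 / (ω * t)) / t‖
        ≤ A * Real.exp (-(ω.re - 2 * y) * t) + B * (1 + t ^ 2)⁻¹ := by
  obtain ⟨M, hM, hMb⟩ := norm_inv_sinh_sub_le hω
  have hω0 : ω ≠ 0 := by rintro rfl; simp at hω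
  have hωn : 0 < ‖ω‖ := norm_pos_iff.2 hω0
  refine ⟨(1 + 2 * ω.re) / ω.re, _, fun z hy hz t ht => le_exp_add_inv
    (f := fun t => ‖(Complex.cos (2 * z * t) / Complex.sinh (ω * t) - 1 / (ω * t)) / t‖)
    (M := 4 * Z ^ 2 * Real.exp (2 * Z) / ω.re + M) (B := 1 / ‖ω‖)
    (by positivity) (by positivity) (by positivity) ?_ ?_ ht⟩
  · intro t ht ht1
    have hs := sinh_mul_ne_zero hω ht
    have ht0 : (t : ℂ) ≠ 0 := by exact_mod_cast ht.ne'
    have h1 : (Complex.cos (2 * z * t) / Complex.sinh (ω * t) - 1 / (ω * t)) / t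
        = (Complex.cos (2 * z * t) - 1) / (Complex.sinh (ω * t) * t)
          + (1 / Complex.sinh (ω * t) - 1 / (ω * t)) / t := by
      field_simp; ring
    simp only [h1]
    have hnt : ‖(t : ℂ)‖ = t := by rw [Complex.norm_real, Real.norm_of_nonneg ht.le]
    refine (norm_add_le _ _).trans (add_le_add ?_ ?_)
    · rw [norm_div, norm_mul, hnt]
      have h2 := norm_cos_sub_one_le (2 * z * t)
      have h3 : ‖2 * z * t‖ ≤ 2 * Z * t := by
        rw [norm_mul, norm_mul, hnt, Complex.norm_ofNat]; gcongr
      have h4 : ‖2 * z * t‖ ≤ 2 * Z := h3.trans (by nlinarith)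
      have h5 := re_mul_le_norm_sinh hω ht.le
      rw [div_le_iff₀ (mul_pos (norm_pos_iff.2 hs) ht)]
      calc _ ≤ (2 * Z * t) ^ 2 * Real.exp (2 * Z) := h2.trans (by gcongr)
        _ = 4 * Z ^ 2 * Real.exp (2 * Z) / ω.re * (ω.re * t * t) := by field_simp; ring
        _ ≤ _ := by gcongr
    · rw [norm_div, hnt, div_le_iff₀ ht]
      exact hMb t ht ht1
  · intro t ht
    have ht0 : 0 < t := by linarith
    have hnt : ‖(t : ℂ)‖ = t := by rw [Complex.norm_real, Real.norm_of_nonneg ht0.le]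
    simp only [sub_div]
    refine (norm_sub_le _ _).trans (add_le_add ?_ ?_)
    · rw [norm_div, norm_div, hnt]
      have h1 : ‖Complex.cos (2 * z * t)‖ ≤ Real.exp (2 * y * t) := by
        refine (norm_cos_le _).trans (Real.exp_le_exp.2 ?_)
        rw [Complex.im_mul_ofReal, abs_mul, abs_of_pos ht0]
        have : (2 * z).im = 2 * z.im := by simp
        rw [this, abs_mul, abs_two]
        gcongr
      have h2 := exp_le_norm_sinh hω ht
      have hs := sinh_mul_ne_zero hω ht0
      rw [div_div, div_le_iff₀ (mul_pos (norm_pos_iff.2 hs) ht0)]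
      calc _ ≤ Real.exp (2 * y * t) := h1
        _ = Real.exp (2 * y * t) * 1 := by ring
        _ ≤ Real.exp (2 * y * t) * t := by gcongr
        _ = (1 + 2 * ω.re) / ω.re * Real.exp (-(ω.re - 2 * y) * t) *
            (ω.re / (1 + 2 * ω.re) * Real.exp (ω.re * t) * t) := by
          have h3 : Real.exp (2 * y * t)
              = Real.exp (-(ω.re - 2 * y) * t) * Real.exp (ω.re * t) := by
            rw [← Real.exp_add]; congr 1; ring
          rw [h3]; field_simp
        _ ≤ _ := by gcongr
    · rw [norm_div, norm_div, norm_mul, hnt, norm_one]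
      apply le_of_eq; field_simp

theorem aestronglyMeasurable_coshLog_integrand (ω z : ℂ) :
    AEStronglyMeasurable (fun t : ℝ =>
      (Complex.cos (2 * z * t) / Complex.sinh (ω * t) - 1 / (ω * t)) / t)
      (volume.restrict (Set.Ioi 0)) := by
  refine Measurable.aestronglyMeasurable ?_
  have h1 : Measurable fun t : ℝ => Complex.cos (2 * z * t) := by fun_prop
  have h2 : Measurable fun t : ℝ => Complex.sinh (ω * t) :=
    (Complex.continuous_sinh.comp (by fun_prop)).measurable
  fun_prop

theorem integrableOn_coshLog_integrand (hω : 0 < ω.re) {z : ℂ} (hz : |z.im| < ω.re / 2) :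
    IntegrableOn (fun t : ℝ =>
      (Complex.cos (2 * z * t) / Complex.sinh (ω * t) - 1 / (ω * t)) / t) (Set.Ioi 0) := by
  obtain ⟨A, B, h⟩ := norm_coshLog_integrand_le hω (y := |z.im|) (norm_nonneg z)
  refine (integrableOn_exp_add_inv (δ := ω.re - 2 * |z.im|) (by linarith) A B).mono'
    (aestronglyMeasurable_coshLog_integrand ω z) ?_
  filter_upwards [self_mem_ae_restrict measurableSet_Ioi] with t ht
  exact h z le_rfl le_rfl t ht

open Metric in
theorem hasDerivAt_coshLog_integral (hω : 0 < ω.re) {z : ℂ} (hz : |z.im| < ω.re / 2) :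
    HasDerivAt (coshLog ω)
      (∫ t : ℝ in Set.Ioi 0, -2 * Complex.sin (2 * z * t) / Complex.sinh (ω * t)) z := by
  obtain ⟨r, hr, hrz⟩ : ∃ r, 0 < r ∧ |z.im| + r < ω.re / 2 :=
    ⟨(ω.re / 2 - |z.im|) / 2, by linarith, by linarith⟩
  obtain ⟨A, B, h⟩ := norm_coshLog_integrand_le hω (y := |z.im| + r) (Z := ‖z‖ + r) (by positivity)
  have h1 := hasDerivAt_integral_of_norm_le (μ := volume.restrict (Set.Ioi 0))
    (F := fun (z : ℂ) (t : ℝ) =>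
      (Complex.cos (2 * z * t) / Complex.sinh (ω * t) - 1 / (ω * t)) / t) (z₀ := z) hr
    (integrableOn_exp_add_inv (δ := ω.re - 2 * (|z.im| + r)) (by linarith) A B)
    (fun w _ => aestronglyMeasurable_coshLog_integrand ω w)
    (Eventually.of_forall fun t => by
      refine Differentiable.differentiableOn ?_
      fun_prop) ?_
  · refine h1.congr_deriv ?_
    refine setIntegral_congr_fun measurableSet_Ioi fun t ht => ?_
    have ht' : 0 < t := ht
    have ht0 : (t : ℂ) ≠ 0 := by exact_mod_cast ht'.ne'
    have h2 : HasDerivAt (fun z : ℂ => 2 * z * (t : ℂ)) (2 * t) z := by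
      simpa using ((hasDerivAt_id z).const_mul 2).mul_const (t : ℂ)
    have h3 := (((h2.ccos).div_const (Complex.sinh (ω * t))).sub_const (1 / (ω * t))).div_const
      (t : ℂ)
    rw [h3.deriv]
    field_simp
  · filter_upwards [self_mem_ae_restrict measurableSet_Ioi] with t ht w hw
    rw [mem_ball, dist_eq_norm] at hw
    refine h w ?_ ?_ t ht
    · have := (abs_im_le_norm (w - z)).trans hw.le
      rw [Complex.sub_im] at this
      have h5 := abs_sub_abs_le_abs_sub w.im z.im
      linarith
    · linarith [norm_sub_norm_le w z]

theorem integral_sin_mul_exp_neg {z s : ℂ} (h : 2 * |z.im| < s.re) :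
    ∫ t : ℝ in Set.Ioi 0, Complex.sin (2 * z * t) * Complex.exp (-s * t)
      = 2 * z / (s ^ 2 + 4 * z ^ 2) := by
  have habs := abs_lt.1 (show |2 * z.im| < s.re by rw [abs_mul, abs_two]; exact h)
  have ha : (-s - 2 * z * I).re < 0 := by simp; linarith
  have hb : (-s + 2 * z * I).re < 0 := by simp; linarith
  have ha0 : -s - 2 * z * I ≠ 0 := by intro h0; rw [h0] at ha; simp at ha
  have hb0 : -s + 2 * z * I ≠ 0 := by intro h0; rw [h0] at hb; simp at hb
  have h1 := integral_exp_mul_complex_Ioi ha 0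
  have h2 := integral_exp_mul_complex_Ioi hb 0
  have hi1 := integrableOn_exp_mul_complex_Ioi ha 0
  have hi2 := integrableOn_exp_mul_complex_Ioi hb 0
  have h3 : ∀ t : ℝ, Complex.sin (2 * z * t) * Complex.exp (-s * t)
      = I / 2 * Complex.exp ((-s - 2 * z * I) * t)
        - I / 2 * Complex.exp ((-s + 2 * z * I) * t) := by
    intro t
    rw [Complex.sin, sub_mul (-s), add_mul (-s), sub_eq_add_neg (-s * (t : ℂ)), Complex.exp_add,
      Complex.exp_add]
    ring_nf
  simp only [h3]
  rw [integral_sub (hi1.const_mul _) (hi2.const_mul _), integral_const_mul, integral_const_mul, h1,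
    h2]
  have h4 : s ^ 2 + 4 * z ^ 2 = (-s - 2 * z * I) * (-s + 2 * z * I) := by
    ring_nf; rw [Complex.I_sq]; ring
  rw [h4]
  simp only [Complex.ofReal_zero, mul_zero, Complex.exp_zero]
  rw [eq_div_iff (mul_ne_zero ha0 hb0)]
  have e1 : -1 / (-s - 2 * z * I) * (-s - 2 * z * I) = -1 := div_mul_cancel₀ _ ha0
  have e2 : -1 / (-s + 2 * z * I) * (-s + 2 * z * I) = -1 := div_mul_cancel₀ _ hb0
  linear_combination (I / 2 * (-s + 2 * z * I)) * e1 - (I / 2 * (-s - 2 * z * I)) * e2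
    - 2 * z * Complex.I_sq

theorem hasSum_inv_sinh (hω : 0 < ω.re) {t : ℝ} (ht : 0 < t) :
    HasSum (fun n : ℕ => 2 * Complex.exp (-((2 * n + 1) * ω) * t)) (1 / Complex.sinh (ω * t)) := by
  have hq : ‖Complex.exp (-2 * ω * t)‖ < 1 := by
    rw [Complex.norm_exp, Real.exp_lt_one_iff, Complex.re_mul_ofReal]
    have : (-2 * ω).re = -2 * ω.re := by simp
    rw [this]; nlinarith [mul_pos hω ht]
  have h1 := (hasSum_geometric_of_norm_lt_one hq).mul_left (2 * Complex.exp (-ω * t))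
  have e1 : (fun n : ℕ => 2 * Complex.exp (-((2 * n + 1) * ω) * t))
      = fun n : ℕ => 2 * Complex.exp (-ω * t) * Complex.exp (-2 * ω * t) ^ n := by
    ext n
    rw [mul_assoc, ← Complex.exp_nat_mul, ← Complex.exp_add]
    congr 2; ring
  have e2 : 1 / Complex.sinh (ω * t)
      = 2 * Complex.exp (-ω * t) * (1 - Complex.exp (-2 * ω * t))⁻¹ := by
    have hs := sinh_mul_ne_zero hω ht
    have h2 : (1 - Complex.exp (-2 * ω * t)) ≠ 0 := by
      intro h0
      rw [sub_eq_zero] at h0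
      rw [← h0] at hq; simp at hq
    rw [← div_eq_mul_inv, div_eq_div_iff hs h2, Complex.sinh]
    have h3 : Complex.exp (-2 * ω * t) = Complex.exp (-ω * t) * Complex.exp (-ω * t) := by
      rw [← Complex.exp_add]; congr 1; ring
    have h4 : Complex.exp (-ω * t) * Complex.exp (ω * t) = 1 := by
      rw [← Complex.exp_add]; simp
    rw [h3, show -(ω * (t : ℂ)) = -ω * t by ring]
    linear_combination -h4
  rw [e1, e2]; exact h1

theorem hasSum_integral_sin_div_sinh (hω : 0 < ω.re) {z : ℂ} (hz : |z.im| < ω.re / 2) :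
    HasSum (fun n : ℕ => 4 * z / (((2 * n + 1) * ω) ^ 2 + 4 * z ^ 2))
      (∫ t : ℝ in Set.Ioi 0, Complex.sin (2 * z * t) / Complex.sinh (ω * t)) := by
  have hres : ∀ n : ℕ, ((2 * n + 1) * ω).re = (2 * n + 1) * ω.re := by intro n; simp
  have hδ : ∀ n : ℕ, 0 < (2 * n + 1) * ω.re - 2 * |z.im| := by
    intro n
    have : (0 : ℝ) ≤ n := by positivity
    nlinarith
  set δ : ℕ → ℝ := fun n => (2 * n + 1) * ω.re - 2 * |z.im| with hδdef
  have hbound : ∀ (n : ℕ) (t : ℝ), 0 < t →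
      ‖Complex.sin (2 * z * t) * (2 * Complex.exp (-((2 * n + 1) * ω) * t))‖
        ≤ 8 * ‖z‖ / δ n * Real.exp (-(δ n / 2) * t) := by
    intro n t ht
    have hnt : ‖(t : ℂ)‖ = t := by rw [Complex.norm_real, Real.norm_of_nonneg ht.le]
    have h1 := norm_sin_le_mul (2 * z * t)
    have h2 : |(2 * z * t).im| = 2 * |z.im| * t := by
      rw [Complex.im_mul_ofReal, abs_mul, abs_of_pos ht]
      simp [abs_mul]
    have h3 : ‖2 * z * t‖ = 2 * ‖z‖ * t := by rw [norm_mul, norm_mul, hnt, Complex.norm_ofNat]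
    have h4 : ‖Complex.exp (-((2 * n + 1) * ω) * t)‖ = Real.exp (-((2 * n + 1) * ω.re) * t) := by
      rw [Complex.norm_exp, Complex.re_mul_ofReal, Complex.neg_re, hres]
    rw [h2, h3] at h1
    rw [norm_mul, norm_mul, h4, Complex.norm_ofNat]
    have h5 : δ n / 2 * t ≤ Real.exp (δ n / 2 * t) := by
      linarith [Real.add_one_le_exp (δ n / 2 * t)]
    have h6 : Real.exp (2 * |z.im| * t) * Real.exp (-((2 * n + 1) * ω.re) * t)
        = Real.exp (-(δ n / 2) * t) * Real.exp (-(δ n / 2) * t) := by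
      rw [← Real.exp_add, ← Real.exp_add]; congr 1; simp only [hδdef]; ring
    have h7 : Real.exp (-(δ n / 2) * t) * Real.exp (δ n / 2 * t) = 1 := by
      rw [← Real.exp_add]; simp
    calc _ ≤ (2 * ‖z‖ * t * Real.exp (2 * |z.im| * t))
          * (2 * Real.exp (-((2 * n + 1) * ω.re) * t)) := by gcongr
      _ = 4 * ‖z‖ * t * (Real.exp (2 * |z.im| * t) * Real.exp (-((2 * n + 1) * ω.re) * t)) := by ring
      _ = 8 * ‖z‖ / δ n * Real.exp (-(δ n / 2) * t)
          * (Real.exp (-(δ n / 2) * t) * (δ n / 2 * t)) := by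
        rw [h6]; have : δ n ≠ 0 := (hδ n).ne'
        field_simp; ring
      _ ≤ 8 * ‖z‖ / δ n * Real.exp (-(δ n / 2) * t)
          * (Real.exp (-(δ n / 2) * t) * Real.exp (δ n / 2 * t)) := by
        have := hδ n; gcongr
      _ = _ := by rw [h7, mul_one]
  have hexp : ∀ n, IntegrableOn (fun t : ℝ => 8 * ‖z‖ / δ n * Real.exp (-(δ n / 2) * t))
      (Set.Ioi 0) := fun n => (exp_neg_integrableOn_Ioi 0 (half_pos (hδ n))).const_mul _
  have hint : ∀ n : ℕ, IntegrableOn (fun t : ℝ =>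
      Complex.sin (2 * z * t) * (2 * Complex.exp (-((2 * n + 1) * ω) * t))) (Set.Ioi 0) := by
    intro n
    refine (hexp n).mono' (Continuous.aestronglyMeasurable (by fun_prop)) ?_
    filter_upwards [self_mem_ae_restrict measurableSet_Ioi] with t ht using hbound n t ht
  have hsum : Summable fun n : ℕ => ∫ t : ℝ in Set.Ioi 0,
      ‖Complex.sin (2 * z * t) * (2 * Complex.exp (-((2 * n + 1) * ω) * t))‖ := by
    have hs : Summable fun n : ℕ => 16 * ‖z‖ / δ 0 ^ 2 * (1 / ((n + 1 : ℕ) : ℝ) ^ 2) :=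
      ((summable_nat_add_iff 1).2 (Real.summable_one_div_nat_pow.2 one_lt_two)).mul_left _
    refine Summable.of_nonneg_of_le (fun n => integral_nonneg fun t => norm_nonneg _)
      (fun n => ?_) hs
    refine (setIntegral_mono_on (hint n).norm (hexp n) measurableSet_Ioi
      (fun t ht => hbound n t ht)).trans ?_
    rw [integral_const_mul, integral_exp_mul_Ioi (by linarith [hδ n]) 0]
    have h0 := hδ 0
    have hn := hδ n
    have h8 : δ 0 * (n + 1) ≤ δ n := by
      simp only [hδdef] at h0 ⊢
      have : (0 : ℝ) ≤ n := by positivity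
      push_cast at h0 ⊢
      nlinarith [abs_nonneg z.im, mul_nonneg this (abs_nonneg z.im), mul_nonneg this hω.le]
    rw [mul_zero, Real.exp_zero]
    calc 8 * ‖z‖ / δ n * (-1 / -(δ n / 2)) = 16 * ‖z‖ / (δ n) ^ 2 := by
          have := hn.ne'; field_simp; ring
      _ ≤ 16 * ‖z‖ / (δ 0 * (n + 1)) ^ 2 := by gcongr
      _ = _ := by have := h0.ne'; push_cast; field_simp
  have h1 := hasSum_integral_of_summable_integral_norm (μ := volume.restrict (Set.Ioi (0 : ℝ)))
    (F := fun (n : ℕ) (t : ℝ) =>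
      Complex.sin (2 * z * t) * (2 * Complex.exp (-((2 * n + 1) * ω) * t))) hint hsum
  have e1 : (fun n : ℕ => 4 * z / (((2 * n + 1) * ω) ^ 2 + 4 * z ^ 2)) = fun n : ℕ =>
      ∫ t : ℝ in Set.Ioi 0,
        Complex.sin (2 * z * t) * (2 * Complex.exp (-((2 * n + 1) * ω) * t)) := by
    ext n
    have h2 := integral_sin_mul_exp_neg (z := z) (s := (2 * n + 1) * ω) (by
      rw [hres]; linarith [hδ n])
    simp only [mul_left_comm _ (2 : ℂ)]
    rw [integral_const_mul, h2]
    ring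
  have e2 : ∫ t : ℝ in Set.Ioi 0, Complex.sin (2 * z * t) / Complex.sinh (ω * t)
      = ∫ t : ℝ in Set.Ioi 0, ∑' n : ℕ,
        Complex.sin (2 * z * t) * (2 * Complex.exp (-((2 * n + 1) * ω) * t)) := by
    refine setIntegral_congr_fun measurableSet_Ioi fun t ht => ?_
    have h3 := (hasSum_inv_sinh hω ht).mul_left (Complex.sin (2 * z * t))
    rw [h3.tsum_eq]; ring
  rw [e1, e2]; exact h1

theorem cosh_ne_zero_of_strip (hω : 0 < ω.re) {z : ℂ} (hz : |z.im| < ω.re / 2) :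
    Complex.cosh (Real.pi * (z / ω)) ≠ 0 := by
  have hω0 : ω ≠ 0 := by rintro rfl; simp at hω
  intro h0
  rw [← Complex.cos_mul_I, Complex.cos_eq_zero_iff] at h0
  obtain ⟨k, hk⟩ := h0
  have hπ : (Real.pi : ℂ) ≠ 0 := by exact_mod_cast Real.pi_ne_zero
  have h1 : z = -((2 * k + 1) / 2 : ℝ) * (ω * I) := by
    have h2 : z * I * (2 * Real.pi) = (2 * k + 1) * ω * Real.pi := by
      field_simp at hk
      linear_combination hk * Real.pi
    have h3 : z * I * 2 = (2 * k + 1) * ω := mul_right_cancel₀ hπ (by linear_combination h2)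
    push_cast
    linear_combination (-I / 2) * h3 + z * Complex.I_sq
  rw [h1] at hz
  have h4 : (-(((2 * k + 1) / 2 : ℝ) : ℂ) * (ω * I)).im = -((2 * k + 1) / 2 * ω.re) := by
    rw [neg_mul, Complex.neg_im, Complex.im_ofReal_mul]; simp
  rw [h4, abs_neg, abs_mul, abs_of_pos hω] at hz
  have h5 : |((2 * k + 1) / 2 : ℝ)| < 1 / 2 := by nlinarith
  rw [abs_div, abs_two, div_lt_div_iff_of_pos_right (by norm_num)] at h5
  have h6 : |2 * k + 1| < 1 := by exact_mod_cast h5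
  rw [Int.abs_lt_one_iff] at h6
  omega

/-- The partial fraction expansion of `tanh`, from that of the cotangent. -/
theorem tsum_eq_tanh (hω : 0 < ω.re) {z : ℂ} (hz : |z.im| < ω.re / 2) :
    ∑' n : ℕ, 4 * z / (((2 * n + 1) * ω) ^ 2 + 4 * z ^ 2)
      = Real.pi / (2 * ω) * Complex.tanh (Real.pi * (z / ω)) := by
  have hω0 : ω ≠ 0 := by rintro rfl; simp at hω
  rcases eq_or_ne z 0 with rfl | hz0
  · simp
  set x : ℂ := I * z / ω with hx
  have hzI : z = -I * (x * ω) := by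
    rw [hx, div_mul_cancel₀ _ hω0]; linear_combination z * Complex.I_sq
  -- `2 x` is not an integer, since `x = i z / ω` would put `z` outside of the strip
  have h2x : ∀ m : ℤ, (m : ℂ) ≠ 2 * x := by
    intro m hm
    have h1 : z = -((m / 2 : ℝ) : ℂ) * (I * ω) := by
      rw [hzI]; push_cast; rw [hm]; ring
    rw [h1] at hz
    have h2 : (-((m / 2 : ℝ) : ℂ) * (I * ω)).im = -(m / 2 * ω.re) := by
      rw [neg_mul, Complex.neg_im, Complex.im_ofReal_mul]; simp
    rw [h2, abs_neg, abs_mul, abs_of_pos hω] at hz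
    have h5 : |(m / 2 : ℝ)| < 1 / 2 := by nlinarith
    rw [abs_div, abs_two, div_lt_div_iff_of_pos_right (by norm_num)] at h5
    have h6 : |m| < 1 := by exact_mod_cast h5
    rw [Int.abs_lt_one_iff] at h6
    rw [h6] at h1
    apply hz0; rw [h1]; simp
  have hi2 : 2 * x ∈ Complex.integerComplement := by
    rintro ⟨m, hm⟩; exact h2x m hm
  have hi1 : x ∈ Complex.integerComplement := by
    rintro ⟨m, hm⟩; exact h2x (2 * m) (by push_cast; rw [← hm])
  have hsum := summable_cotTerm hi2
  have hodd : ∀ n : ℕ, cotTerm (2 * x) (2 * n + 1) = 1 / 2 * cotTerm x n := by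
    intro n
    simp only [cotTerm]
    rw [show (2 * x - (((2 * n + 1 : ℕ) : ℂ) + 1)) = 2 * (x - (n + 1)) by push_cast; ring,
      show (2 * x + (((2 * n + 1 : ℕ) : ℂ) + 1)) = 2 * (x + (n + 1)) by push_cast; ring]
    simp only [one_div, mul_inv]; ring
  have heven : ∀ n : ℕ, 4 * z / (((2 * n + 1) * ω) ^ 2 + 4 * z ^ 2)
      = I / ω * cotTerm (2 * x) (2 * n) := by
    intro n
    have hm := h2x (2 * n + 1)
    have hp := h2x (-(2 * n + 1))
    push_cast at hm hp
    have hm' : 2 * x - (2 * n + 1) ≠ 0 := fun h => hm (sub_eq_zero.1 h).symm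
    have hp' : 2 * x + (2 * n + 1) ≠ 0 := fun h => hp (eq_neg_of_add_eq_zero_left h).symm
    have hD : ((2 * n + 1) * ω) ^ 2 + 4 * z ^ 2
        = -(ω ^ 2 * ((2 * x - (2 * n + 1)) * (2 * x + (2 * n + 1)))) := by
      rw [hzI]; ring_nf; rw [Complex.I_sq]; ring
    simp only [cotTerm]
    push_cast
    rw [hD, one_div_add_one_div hm' hp', hzI]
    field_simp
    ring
  have hs1 : Summable fun n : ℕ => cotTerm (2 * x) (2 * n) :=
    hsum.comp_injective (mul_right_injective₀ two_ne_zero)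
  have hs2 : Summable fun n : ℕ => cotTerm (2 * x) (2 * n + 1) :=
    hsum.comp_injective (fun a b h => by simpa using h)
  have h1 := tsum_even_add_odd hs1 hs2
  have h2 := cot_series_rep' hi2
  have h3 := cot_series_rep' hi1
  simp only [hodd, tsum_mul_left] at h1
  simp only [cotTerm] at h1
  rw [← h2, ← h3] at h1
  simp only [heven, tsum_mul_left, cotTerm]
  have hxne : x ≠ 0 := fun h => h2x 0 (by rw [h]; simp)
  have hπ : (Real.pi : ℂ) ≠ 0 := by exact_mod_cast Real.pi_ne_zero
  have hsin2 : Complex.sin (Real.pi * (2 * x)) ≠ 0 := by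
    rw [Ne, Complex.sin_eq_zero_iff]
    rintro ⟨k, hk⟩
    exact h2x k (mul_left_cancel₀ hπ (by rw [hk]; ring))
  have e1 : Real.pi * (2 * x) = 2 * (Real.pi * x) := by ring
  have hsin2' := hsin2
  rw [e1, Complex.sin_two_mul] at hsin2'
  have hsx : Complex.sin (Real.pi * x) ≠ 0 := fun h => hsin2' (by rw [h]; ring)
  have hcx : Complex.cos (Real.pi * x) ≠ 0 := fun h => hsin2' (by rw [h]; ring)
  have hcot : Complex.cot (Real.pi * (2 * x)) - 1 / 2 * Complex.cot (Real.pi * x)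
      = -(1 / 2) * Complex.tan (Real.pi * x) := by
    rw [Complex.cot_eq_cos_div_sin, Complex.cot_eq_cos_div_sin, Complex.tan_eq_sin_div_cos, e1,
      Complex.sin_two_mul, Complex.cos_two_mul]
    field_simp
    linear_combination Complex.sin_sq_add_cos_sq (Real.pi * x)
  have htan : Complex.tan (Real.pi * x) = Complex.tanh (Real.pi * (z / ω)) * I := by
    rw [← Complex.tan_mul_I]; congr 1; rw [hx]; ring
  have h4 : ∑' n : ℕ, (1 / (2 * x - (((2 * n : ℕ) : ℂ) + 1)) + 1 / (2 * x + (((2 * n : ℕ) : ℂ) + 1)))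
      = Real.pi * (-(1 / 2) * (Complex.tanh (Real.pi * (z / ω)) * I)) := by
    rw [← htan, ← hcot]
    have h5 : 1 / (2 * x) = 1 / 2 * (1 / x) := by field_simp
    rw [h5] at h1
    linear_combination h1
  rw [h4]
  linear_combination (-(Real.pi / (2 * ω)) * Complex.tanh (Real.pi * (z / ω))) * Complex.I_sq

theorem integral_sin_div_sinh (hω : 0 < ω.re) {z : ℂ} (hz : |z.im| < ω.re / 2) :
    ∫ t : ℝ in Set.Ioi 0, Complex.sin (2 * z * t) / Complex.sinh (ω * t)
      = Real.pi / (2 * ω) * Complex.tanh (Real.pi * (z / ω)) := by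
  have h := hasSum_integral_sin_div_sinh hω hz
  rw [← tsum_eq_tanh hω hz, h.tsum_eq]

theorem hasDerivAt_coshLog (hω : 0 < ω.re) {z : ℂ} (hz : |z.im| < ω.re / 2) :
    HasDerivAt (coshLog ω) (-(Real.pi / ω) * Complex.tanh (Real.pi * (z / ω))) z := by
  convert hasDerivAt_coshLog_integral hω hz using 1
  simp only [mul_div_assoc]
  rw [integral_const_mul, integral_sin_div_sinh hω hz]
  have hω0 : ω ≠ 0 := by rintro rfl; simp at hω
  field_simp

/-- The logarithmic derivative of the left-hand side vanishes. -/
theorem exp_coshLog_mul_cosh_eq (hω : 0 < ω.re) {z : ℂ} (hz : |z.im| < ω.re / 2) :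
    Complex.exp (coshLog ω z) * Complex.cosh (Real.pi * (z / ω)) = Complex.exp (coshLog ω 0) := by
  have hω0 : ω ≠ 0 := by rintro rfl; simp at hω
  set U : Set ℂ := {z | -(ω.re / 2) < z.im ∧ z.im < ω.re / 2} with hU
  have hUo : IsOpen U := isOpen_strip _ _
  have hmem : ∀ z : ℂ, |z.im| < ω.re / 2 ↔ z ∈ U := fun z => abs_lt
  have hd : ∀ z ∈ U, HasDerivAt
      (fun z => Complex.exp (coshLog ω z) * Complex.cosh (Real.pi * (z / ω))) 0 z := by
    intro z hz
    have hz' := (hmem z).2 hz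
    have h1 := (hasDerivAt_coshLog hω hz').cexp
    have h2 : HasDerivAt (fun z : ℂ => Real.pi * (z / ω)) (Real.pi / ω) z := by
      simpa [div_eq_mul_inv] using ((hasDerivAt_id z).div_const ω).const_mul (Real.pi : ℂ)
    refine (h1.mul h2.ccosh).congr_deriv ?_
    have h3 : Complex.tanh (Real.pi * (z / ω)) * Complex.cosh (Real.pi * (z / ω))
        = Complex.sinh (Real.pi * (z / ω)) := by
      rw [Complex.tanh_eq_sinh_div_cosh, div_mul_cancel₀ _ (cosh_ne_zero_of_strip hω hz')]
    linear_combination (-Complex.exp (coshLog ω z) * (Real.pi / ω)) * h3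
  have h0 : (0 : ℂ) ∈ U := by simp [hU, hω]
  have h := (convex_strip (-(ω.re / 2)) (ω.re / 2)).is_const_of_fderivWithin_eq_zero (𝕜 := ℂ)
    (f := fun z => Complex.exp (coshLog ω z) * Complex.cosh (Real.pi * (z / ω)))
    (fun z hz => (hd z hz).differentiableAt.differentiableWithinAt) (fun z hz => ?_)
    ((hmem z).1 hz) h0
  · simpa using h
  · rw [fderivWithin_of_isOpen hUo hz, (hd z hz).hasFDerivAt.fderiv]
    ext; simp

/-- The normalization: the duplication formula `2 sinh x cosh x = sinh (2x)` under the integral sign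
and the substitution `t ↦ t / 2`. -/
theorem two_mul_coshLog_quarter (hω : 0 < ω.re) :
    2 * coshLog ω (I * ω / 4) = coshLog ω 0 := by
  have h := integral_comp_mul_left_Ioi (fun t : ℝ =>
    (Complex.cos (2 * 0 * t) / Complex.sinh (ω * t) - 1 / (ω * t)) / t) 0
    (show (0 : ℝ) < 1 / 2 by norm_num)
  have h2 : coshLog ω 0 = (2 : ℂ)⁻¹ * ∫ t : ℝ in Set.Ioi 0,
      (Complex.cos (2 * 0 * ((1 / 2 * t : ℝ) : ℂ)) / Complex.sinh (ω * ((1 / 2 * t : ℝ) : ℂ))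
        - 1 / (ω * ((1 / 2 * t : ℝ) : ℂ))) / ((1 / 2 * t : ℝ) : ℂ) := by
    rw [h, coshLog, mul_zero, Complex.real_smul, ← mul_assoc]
    norm_num
  rw [h2, coshLog, ← integral_const_mul, ← integral_const_mul]
  refine setIntegral_congr_fun measurableSet_Ioi fun t ht => ?_
  have ht0 : (t : ℂ) ≠ 0 := by exact_mod_cast (Set.mem_Ioi.1 ht).ne'
  have hω0 : ω ≠ 0 := by rintro rfl; simp at hω
  have hh : (0 : ℝ) < 1 / 2 * t := by have := Set.mem_Ioi.1 ht; linarith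
  have hs := sinh_mul_ne_zero hω hh
  have hs' := sinh_mul_ne_zero hω (Set.mem_Ioi.1 ht)
  have e1 : Complex.cos (2 * (I * ω / 4) * t) = Complex.cosh (ω * ((1 / 2 * t : ℝ) : ℂ)) := by
    rw [← Complex.cos_mul_I]; congr 1; push_cast; ring
  have e2 : Complex.sinh (ω * t) = 2 * Complex.sinh (ω * ((1 / 2 * t : ℝ) : ℂ))
      * Complex.cosh (ω * ((1 / 2 * t : ℝ) : ℂ)) := by
    rw [← Complex.sinh_two_mul]; congr 1; push_cast; ring
  simp only [mul_zero, zero_mul, Complex.cos_zero]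
  rw [e2] at hs'
  rw [e1, e2]
  have hc : Complex.cosh (ω * ((1 / 2 * t : ℝ) : ℂ)) ≠ 0 := right_ne_zero_of_mul hs'
  generalize Complex.cosh (ω * ((1 / 2 * t : ℝ) : ℂ)) = c at hc ⊢
  generalize Complex.sinh (ω * ((1 / 2 * t : ℝ) : ℂ)) = d at hs ⊢
  push_cast
  field_simp

/-- The constant `exp (coshLog ω 0) = 1 / 2` is determined by the point `z = iω/4`, at which
`2 cosh² = 1`. -/
theorem exp_neg_coshLog (hω : 0 < ω.re) {z : ℂ} (hz : |z.im| < ω.re / 2) :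
    Complex.exp (-coshLog ω z) = 2 * Complex.cosh (Real.pi * (z / ω)) := by
  have hω0 : ω ≠ 0 := by rintro rfl; simp at hω
  have h1 := exp_coshLog_mul_cosh_eq hω (z := I * ω / 4) (by
    have : (I * ω / 4).im = ω.re / 4 := by simp
    rw [this, abs_of_pos (by positivity)]; linarith)
  have h2 : Complex.cosh (Real.pi * (I * ω / 4 / ω)) ^ 2 = 1 / 2 := by
    have : (Real.pi : ℂ) * (I * ω / 4 / ω) = (Real.pi / 4 : ℝ) * I := by
      push_cast; field_simp
    rw [this, Complex.cosh_mul_I, ← Complex.ofReal_cos, Real.cos_pi_div_four, ← Complex.ofReal_pow,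
      div_pow, Real.sq_sqrt (by norm_num)]
    norm_num
  have h3 : Complex.exp (coshLog ω (I * ω / 4)) ^ 2 = Complex.exp (coshLog ω 0) := by
    rw [← two_mul_coshLog_quarter hω, two_mul, Complex.exp_add, sq]
  have hne := Complex.exp_ne_zero (coshLog ω 0)
  have h4 : Complex.exp (coshLog ω 0) = 1 / 2 := by
    have h5 : Complex.exp (coshLog ω 0) * (1 / 2)
        = Complex.exp (coshLog ω 0) * Complex.exp (coshLog ω 0) := by
      conv_rhs => rw [← h1]
      rw [← h3, ← h2]; ring
    exact (mul_left_cancel₀ hne h5).symm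
  have h6 := exp_coshLog_mul_cosh_eq hω hz
  rw [h4] at h6
  rw [Complex.exp_neg, inv_eq_iff_eq_inv]
  have hc := cosh_ne_zero_of_strip hω hz
  refine eq_inv_of_mul_eq_one_left ?_
  linear_combination 2 * h6

end coshLog

/-! ### The hyperbolic gamma function on the strip -/

/-- The integral in the definition of `hypGammaStrip`. -/
noncomputable def hypGammaLog (ω₁ ω₂ z : ℂ) : ℂ :=
  ∫ t : ℝ in Set.Ioi 0,
    (Complex.sin (2 * z * t) / (2 * Complex.sinh (ω₁ * t) * Complex.sinh (ω₂ * t))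
      - z / (ω₁ * ω₂ * t)) / t

section hypGamma

variable {ω₁ ω₂ : ℂ}

theorem hypGammaStrip_eq (ω₁ ω₂ z : ℂ) :
    hypGammaStrip ω₁ ω₂ z = Complex.exp (I * hypGammaLog ω₁ ω₂ z) := rfl

theorem norm_hypGammaLog_integrand_le (hω₁ : 0 < ω₁.re) (hω₂ : 0 < ω₂.re) {y Z : ℝ} (hZ : 0 ≤ Z) :
    ∃ A B : ℝ, ∀ z : ℂ, |z.im| ≤ y → ‖z‖ ≤ Z → ∀ t : ℝ, 0 < t →
      ‖(Complex.sin (2 * z * t) / (2 * Complex.sinh (ω₁ * t) * Complex.sinh (ω₂ * t))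
        - z / (ω₁ * ω₂ * t)) / t‖
        ≤ A * Real.exp (-(ω₁.re + ω₂.re - 2 * y) * t) + B * (1 + t ^ 2)⁻¹ := by
  have h01 := ne_zero_of_re_pos hω₁
  have h02 := ne_zero_of_re_pos hω₂
  have hn1 : 0 < ‖ω₁‖ := norm_pos_iff.2 h01
  have hn2 : 0 < ‖ω₂‖ := norm_pos_iff.2 h02
  obtain ⟨M₁, hM₁, hb₁⟩ := norm_inv_sinh_sub_le hω₁
  obtain ⟨M₂, hM₂, hb₂⟩ := norm_inv_sinh_sub_le hω₂
  obtain ⟨M, hM, hb⟩ := norm_inv_mul_sub_le h01 hM₁ hω₂ hM₂ hb₁ hb₂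
    (fun t ht _ => re_mul_le_norm_sinh hω₂ ht.le)
  refine ⟨(1 + 2 * ω₁.re) / ω₁.re * ((1 + 2 * ω₂.re) / ω₂.re), _, fun z hy hz t ht =>
    le_exp_add_inv (f := fun t => ‖(Complex.sin (2 * z * t)
      / (2 * Complex.sinh (ω₁ * t) * Complex.sinh (ω₂ * t)) - z / (ω₁ * ω₂ * t)) / t‖)
    (M := 4 * Z ^ 3 * Real.exp (2 * Z) / (ω₁.re * ω₂.re) + Z * M) (B := Z / (‖ω₁‖ * ‖ω₂‖))
    (by positivity) (by positivity) (by positivity) ?_ ?_ ht⟩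
  · intro t ht ht1
    have hs1 := sinh_mul_ne_zero hω₁ ht
    have hs2 := sinh_mul_ne_zero hω₂ ht
    have ht0 : (t : ℂ) ≠ 0 := by exact_mod_cast ht.ne'
    have hnt : ‖(t : ℂ)‖ = t := by rw [Complex.norm_real, Real.norm_of_nonneg ht.le]
    have h1 : (Complex.sin (2 * z * t) / (2 * Complex.sinh (ω₁ * t) * Complex.sinh (ω₂ * t))
        - z / (ω₁ * ω₂ * t)) / t
        = (Complex.sin (2 * z * t) - 2 * z * t)
            / (2 * Complex.sinh (ω₁ * t) * Complex.sinh (ω₂ * t) * t)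
          + z * (1 / (Complex.sinh (ω₁ * t) * Complex.sinh (ω₂ * t))
            - 1 / (ω₁ * ω₂ * t ^ 2)) := by
      field_simp; ring
    simp only [h1]
    refine (norm_add_le _ _).trans (add_le_add ?_ ?_)
    · rw [norm_div, norm_mul, norm_mul, norm_mul, hnt, Complex.norm_ofNat]
      have h2 := norm_sin_sub_self_le (2 * z * t)
      have h3 : ‖2 * z * t‖ ≤ 2 * Z * t := by
        rw [norm_mul, norm_mul, hnt, Complex.norm_ofNat]; gcongr
      have h4 : ‖2 * z * t‖ ≤ 2 * Z := h3.trans (by nlinarith)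
      have h5 := re_mul_le_norm_sinh hω₁ ht.le
      have h6 := re_mul_le_norm_sinh hω₂ ht.le
      have p1 := norm_pos_iff.2 hs1
      have p2 := norm_pos_iff.2 hs2
      rw [div_le_iff₀ (by positivity)]
      calc _ ≤ (2 * Z * t) ^ 3 * Real.exp (2 * Z) := h2.trans (by gcongr)
        _ = 4 * Z ^ 3 * Real.exp (2 * Z) / (ω₁.re * ω₂.re)
            * (2 * (ω₁.re * t) * (ω₂.re * t) * t) := by field_simp; ring
        _ ≤ _ := by gcongr
    · rw [norm_mul]
      gcongr
      exact hb t ht ht1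
  · intro t ht
    have ht0 : 0 < t := by linarith
    have hnt : ‖(t : ℂ)‖ = t := by rw [Complex.norm_real, Real.norm_of_nonneg ht0.le]
    simp only [sub_div]
    refine (norm_sub_le _ _).trans (add_le_add ?_ ?_)
    · rw [norm_div, norm_div, hnt, norm_mul, norm_mul, Complex.norm_ofNat]
      have h1 : ‖Complex.sin (2 * z * t)‖ ≤ Real.exp (2 * y * t) := by
        refine (norm_sin_le _).trans (Real.exp_le_exp.2 ?_)
        rw [Complex.im_mul_ofReal, abs_mul, abs_of_pos ht0]
        have : (2 * z).im = 2 * z.im := by simp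
        rw [this, abs_mul, abs_two]
        gcongr
      have h2 := exp_le_norm_sinh hω₁ ht
      have h3 := exp_le_norm_sinh hω₂ ht
      have p1 := norm_pos_iff.2 (sinh_mul_ne_zero hω₁ ht0)
      have p2 := norm_pos_iff.2 (sinh_mul_ne_zero hω₂ ht0)
      rw [div_div, div_le_iff₀ (by positivity)]
      calc _ ≤ Real.exp (2 * y * t) := h1
        _ = Real.exp (2 * y * t) * 1 := by ring
        _ ≤ Real.exp (2 * y * t) * (2 * t) := by gcongr; linarith
        _ = (1 + 2 * ω₁.re) / ω₁.re * ((1 + 2 * ω₂.re) / ω₂.re)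
            * Real.exp (-(ω₁.re + ω₂.re - 2 * y) * t) *
            (2 * (ω₁.re / (1 + 2 * ω₁.re) * Real.exp (ω₁.re * t))
              * (ω₂.re / (1 + 2 * ω₂.re) * Real.exp (ω₂.re * t)) * t) := by
          have h3 : Real.exp (2 * y * t) = Real.exp (-(ω₁.re + ω₂.re - 2 * y) * t)
              * Real.exp (ω₁.re * t) * Real.exp (ω₂.re * t) := by
            rw [← Real.exp_add, ← Real.exp_add]; congr 1; ring
          rw [h3]; field_simp
        _ ≤ _ := by gcongr
    · rw [norm_div, norm_div, norm_mul, norm_mul, hnt]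
      rw [div_div, mul_assoc, ← sq, ← div_div]
      gcongr

theorem aestronglyMeasurable_hypGammaLog_integrand (ω₁ ω₂ z : ℂ) :
    AEStronglyMeasurable (fun t : ℝ =>
      (Complex.sin (2 * z * t) / (2 * Complex.sinh (ω₁ * t) * Complex.sinh (ω₂ * t))
      - z / (ω₁ * ω₂ * t)) / t)
      (volume.restrict (Set.Ioi 0)) := by
  refine Measurable.aestronglyMeasurable ?_
  have h1 : Measurable fun t : ℝ => Complex.sin (2 * z * t) :=
    (Complex.continuous_sin.comp (by fun_prop)).measurable
  have h2 : ∀ ω : ℂ, Measurable fun t : ℝ => Complex.sinh (ω * t) := fun ω =>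
    (Complex.continuous_sinh.comp (by fun_prop)).measurable
  have h3 := h2 ω₁
  have h4 := h2 ω₂
  fun_prop

theorem integrableOn_hypGammaLog_integrand (hω₁ : 0 < ω₁.re) (hω₂ : 0 < ω₂.re) {z : ℂ}
    (hz : |z.im| < (ω₁.re + ω₂.re) / 2) :
    IntegrableOn (fun t : ℝ =>
      (Complex.sin (2 * z * t) / (2 * Complex.sinh (ω₁ * t) * Complex.sinh (ω₂ * t))
      - z / (ω₁ * ω₂ * t)) / t) (Set.Ioi 0) := by
  obtain ⟨A, B, h⟩ := norm_hypGammaLog_integrand_le hω₁ hω₂ (y := |z.im|) (norm_nonneg z)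
  refine (integrableOn_exp_add_inv (δ := ω₁.re + ω₂.re - 2 * |z.im|) (by linarith) A B).mono'
    (aestronglyMeasurable_hypGammaLog_integrand ω₁ ω₂ z) ?_
  filter_upwards [self_mem_ae_restrict measurableSet_Ioi] with t ht
  exact h z le_rfl le_rfl t ht

open Metric in
theorem hasDerivAt_hypGammaLog (hω₁ : 0 < ω₁.re) (hω₂ : 0 < ω₂.re) {z : ℂ}
    (hz : |z.im| < (ω₁.re + ω₂.re) / 2) :
    HasDerivAt (hypGammaLog ω₁ ω₂) (∫ t : ℝ in Set.Ioi 0,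
      (Complex.cos (2 * z * t) / (Complex.sinh (ω₁ * t) * Complex.sinh (ω₂ * t))
        - 1 / (ω₁ * ω₂ * t ^ 2))) z := by
  obtain ⟨r, hr, hrz⟩ : ∃ r, 0 < r ∧ |z.im| + r < (ω₁.re + ω₂.re) / 2 :=
    ⟨((ω₁.re + ω₂.re) / 2 - |z.im|) / 2, by linarith, by linarith⟩
  obtain ⟨A, B, h⟩ := norm_hypGammaLog_integrand_le hω₁ hω₂ (y := |z.im| + r) (Z := ‖z‖ + r)
    (by positivity)
  have h1 := hasDerivAt_integral_of_norm_le (μ := volume.restrict (Set.Ioi 0))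
    (F := fun (z : ℂ) (t : ℝ) =>
      (Complex.sin (2 * z * t) / (2 * Complex.sinh (ω₁ * t) * Complex.sinh (ω₂ * t))
      - z / (ω₁ * ω₂ * t)) / t) (z₀ := z) hr
    (integrableOn_exp_add_inv (δ := ω₁.re + ω₂.re - 2 * (|z.im| + r)) (by linarith) A B)
    (fun w _ => aestronglyMeasurable_hypGammaLog_integrand ω₁ ω₂ w)
    (Eventually.of_forall fun t => by
      refine Differentiable.differentiableOn ?_
      fun_prop) ?_
  · refine h1.congr_deriv ?_
    refine setIntegral_congr_fun measurableSet_Ioi fun t ht => ?_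
    have ht' : 0 < t := ht
    have ht0 : (t : ℂ) ≠ 0 := by exact_mod_cast ht'.ne'
    have h2 : HasDerivAt (fun z : ℂ => 2 * z * (t : ℂ)) (2 * t) z := by
      simpa using ((hasDerivAt_id z).const_mul 2).mul_const (t : ℂ)
    have h3 := (((h2.csin).div_const (2 * Complex.sinh (ω₁ * t) * Complex.sinh (ω₂ * t))).sub
      ((hasDerivAt_id z).div_const (ω₁ * ω₂ * t))).div_const (t : ℂ)
    have h4 := sinh_mul_ne_zero hω₁ ht'
    have h5 := sinh_mul_ne_zero hω₂ ht'
    have h6 := ne_zero_of_re_pos hω₁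
    have h7 := ne_zero_of_re_pos hω₂
    have h8 := h3.deriv
    simp only [id] at h8
    refine Eq.trans h8 ?_
    field_simp
  · filter_upwards [self_mem_ae_restrict measurableSet_Ioi] with t ht w hw
    rw [mem_ball, dist_eq_norm] at hw
    refine h w ?_ ?_ t ht
    · have := (abs_im_le_norm (w - z)).trans hw.le
      rw [Complex.sub_im] at this
      have h5 := abs_sub_abs_le_abs_sub w.im z.im
      linarith
    · have h6 : ‖w‖ - ‖z‖ ≤ ‖w - z‖ := norm_sub_norm_le w z
      linarith

theorem hypGammaStrip_ne_zero (z : ℂ) : hypGammaStrip ω₁ ω₂ z ≠ 0 := Complex.exp_ne_zero _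

theorem hypGammaStrip_comm (ω₁ ω₂ z : ℂ) : hypGammaStrip ω₂ ω₁ z = hypGammaStrip ω₁ ω₂ z := by
  rw [hypGammaStrip_eq, hypGammaStrip_eq, hypGammaLog, hypGammaLog]
  congr 2
  refine integral_congr_ae (Eventually.of_forall fun t => ?_)
  simp only
  rw [mul_comm ω₂ ω₁, mul_right_comm 2 (Complex.sinh (ω₂ * t))]

theorem hypGammaStrip_neg (z : ℂ) : hypGammaStrip ω₁ ω₂ (-z) = (hypGammaStrip ω₁ ω₂ z)⁻¹ := by
  rw [hypGammaStrip_eq, hypGammaStrip_eq, ← Complex.exp_neg, ← mul_neg, hypGammaLog, hypGammaLog,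
    ← integral_neg]
  congr 2
  refine integral_congr_ae (Eventually.of_forall fun t => ?_)
  simp only
  rw [mul_neg, neg_mul, Complex.sin_neg]
  ring

theorem hypGammaShift_eq_cosh (hω₂ : 0 < ω₂.re) (z : ℂ) :
    hypGammaShift ω₁ ω₂ z = 2 * Complex.cosh (Real.pi * ((z + I * ω₁ / 2) / ω₂)) := by
  have h02 := ne_zero_of_re_pos hω₂
  have h1 : (Real.pi : ℂ) * ((z + I * ((ω₁ + ω₂) / 2)) / ω₂)
      = Real.pi * ((z + I * ω₁ / 2) / ω₂) + Real.pi / 2 * I := by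
    field_simp; ring
  rw [hypGammaShift, h1, Complex.sinh_add, Complex.sinh_mul_I, Complex.cosh_mul_I,
    Complex.cos_pi_div_two, Complex.sin_pi_div_two]
  linear_combination (-2 * Complex.cosh (Real.pi * ((z + I * ω₁ / 2) / ω₂))) * Complex.I_sq

/-- Difference equation within the strip. The difference of the two integrals is a `coshLog` for
`ω₂`, since `sin (2(z + iω₁)t) - sin (2zt)` contains the factor `sinh (ω₁t)`. -/
theorem hypGammaStrip_add (hω₁ : 0 < ω₁.re) (hω₂ : 0 < ω₂.re) {z : ℂ}
    (hz : -((ω₁.re + ω₂.re) / 2) < z.im) (hz' : z.im + ω₁.re < (ω₁.re + ω₂.re) / 2) :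
    hypGammaStrip ω₁ ω₂ (z + I * ω₁) = hypGammaShift ω₁ ω₂ z * hypGammaStrip ω₁ ω₂ z := by
  have him : (z + I * ω₁).im = z.im + ω₁.re := by simp
  have hi1 := integrableOn_hypGammaLog_integrand hω₁ hω₂ (z := z) (by
    rw [abs_lt]; constructor <;> linarith)
  have hi2 := integrableOn_hypGammaLog_integrand hω₁ hω₂ (z := z + I * ω₁) (by
    rw [him, abs_lt]; constructor <;> linarith)
  have hL : hypGammaLog ω₁ ω₂ (z + I * ω₁) - hypGammaLog ω₁ ω₂ z
      = I * coshLog ω₂ (z + I * ω₁ / 2) := by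
    rw [hypGammaLog, hypGammaLog, ← integral_sub hi2 hi1, coshLog, ← integral_const_mul]
    refine setIntegral_congr_fun measurableSet_Ioi fun t ht => ?_
    have ht' : 0 < t := ht
    have ht0 : (t : ℂ) ≠ 0 := by exact_mod_cast ht'.ne'
    have h4 := sinh_mul_ne_zero hω₁ ht'
    have h5 := sinh_mul_ne_zero hω₂ ht'
    have h6 := ne_zero_of_re_pos hω₁
    have h7 := ne_zero_of_re_pos hω₂
    have h8 : Complex.sin (2 * (z + I * ω₁) * t) - Complex.sin (2 * z * t)
        = 2 * (Complex.sinh (ω₁ * t) * I) * Complex.cos (2 * (z + I * ω₁ / 2) * t) := by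
      rw [Complex.sin_sub_sin, ← Complex.sin_mul_I]
      congr 2
      · congr 1; ring
      · ring
    have h9 : (Complex.sin (2 * (z + I * ω₁) * t)
          / (2 * Complex.sinh (ω₁ * t) * Complex.sinh (ω₂ * t)) - (z + I * ω₁) / (ω₁ * ω₂ * t)) / t
        - (Complex.sin (2 * z * t) / (2 * Complex.sinh (ω₁ * t) * Complex.sinh (ω₂ * t))
          - z / (ω₁ * ω₂ * t)) / t
        = ((Complex.sin (2 * (z + I * ω₁) * t) - Complex.sin (2 * z * t))
            / (2 * Complex.sinh (ω₁ * t) * Complex.sinh (ω₂ * t)) - I * ω₁ / (ω₁ * ω₂ * t)) / t := by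
      ring
    refine Eq.trans h9 ?_
    rw [h8]
    field_simp
  have hc := exp_neg_coshLog hω₂ (z := z + I * ω₁ / 2) (by
    have : (z + I * ω₁ / 2).im = z.im + ω₁.re / 2 := by simp
    rw [this, abs_lt]; constructor <;> linarith)
  rw [hypGammaShift_eq_cosh hω₂, ← hc, hypGammaStrip_eq, hypGammaStrip_eq, ← Complex.exp_add]
  congr 1
  linear_combination I * hL + coshLog ω₂ (z + I * ω₁ / 2) * Complex.I_sq

/-! ### The hyperbolic gamma function as a meromorphic function -/

/-- From the strip `|Im z| ≤ Re ω₁ / 2` upwards the difference equation holds by definition: the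
upper product in `hypGamma` gains one factor. -/
theorem hypGamma_add_of_le (hω₁ : 0 < ω₁.re) {z : ℂ} (hz : -(ω₁.re / 2) ≤ z.im) :
    hypGamma ω₁ ω₂ (z + I * ω₁) = hypGammaShift ω₁ ω₂ z * hypGamma ω₁ ω₂ z := by
  have him : (z + I * ω₁).im / ω₁.re + 1 / 2 = z.im / ω₁.re + 1 / 2 + 1 := by
    have : (z + I * ω₁).im = z.im + ω₁.re := by simp
    rw [this]; field_simp; ring
  obtain ⟨N, hN⟩ : ∃ N : ℕ, ⌊z.im / ω₁.re + 1 / 2⌋ = N := by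
    refine Int.eq_ofNat_of_zero_le (Int.floor_nonneg.2 ?_)
    have : -(1 / 2) ≤ z.im / ω₁.re := by rw [le_div_iff₀ hω₁]; linarith
    linarith
  simp only [hypGamma, him, Int.floor_add_one, hN]
  have h1 : ((N : ℤ) + 1).toNat = N + 1 := by omega
  have h2 : (-((N : ℤ) + 1)).toNat = 0 := by omega
  have h3 : (-(N : ℤ)).toNat = 0 := by omega
  rw [h1, h2, h3, Int.toNat_natCast, Finset.range_zero, Finset.prod_empty, Finset.prod_empty,
    div_one, div_one, Finset.prod_range_succ']
  have h4 : z + I * ω₁ - I * ((N : ℤ) + 1 : ℤ) * ω₁ = z - I * (N : ℤ) * ω₁ := by push_cast; ring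
  have h5 : z + I * ω₁ - I * ((0 : ℕ) + 1) * ω₁ = z := by push_cast; ring
  have h6 : ∀ k : ℕ, z + I * ω₁ - I * ((k + 1 : ℕ) + 1) * ω₁ = z - I * (k + 1) * ω₁ := by
    intro k; push_cast; ring
  rw [h4, h5]
  simp only [h6]
  ring

/-- The difference equation downwards, in the form that survives at poles: if `hypGammaShift`
vanishes, both sides are `0`. -/
theorem hypGamma_sub_of_lt (hω₁ : 0 < ω₁.re) {z : ℂ} (hz : z.im < ω₁.re / 2) :
    hypGamma ω₁ ω₂ (z - I * ω₁) = hypGamma ω₁ ω₂ z / hypGammaShift ω₁ ω₂ (z - I * ω₁) := by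
  have him : (z - I * ω₁).im / ω₁.re + 1 / 2 = z.im / ω₁.re + 1 / 2 - 1 := by
    have : (z - I * ω₁).im = z.im - ω₁.re := by simp
    rw [this]; field_simp; ring
  obtain ⟨N, hN⟩ : ∃ N : ℕ, ⌊z.im / ω₁.re + 1 / 2⌋ = -(N : ℤ) := by
    have h : ⌊z.im / ω₁.re + 1 / 2⌋ < 1 := by
      rw [Int.floor_lt]
      have : z.im / ω₁.re < 1 / 2 := by rw [div_lt_iff₀ hω₁]; linarith
      push_cast; linarith
    obtain ⟨N, hN⟩ := Int.eq_ofNat_of_zero_le (a := -⌊z.im / ω₁.re + 1 / 2⌋) (by omega)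
    exact ⟨N, by omega⟩
  simp only [hypGamma, him, Int.floor_sub_one, hN]
  have h1 : (-(N : ℤ) - 1).toNat = 0 := by omega
  have h2 : (-(-(N : ℤ) - 1)).toNat = N + 1 := by omega
  have h3 : (-(N : ℤ)).toNat = 0 := by omega
  rw [h1, h2, h3, neg_neg, Int.toNat_natCast, Finset.range_zero, Finset.prod_empty,
    Finset.prod_empty, mul_one, mul_one, Finset.prod_range_succ']
  have h4 : z - I * ω₁ - I * (-(N : ℤ) - 1 : ℤ) * ω₁ = z - I * (-(N : ℤ) : ℤ) * ω₁ := by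
    push_cast; ring
  have h5 : z - I * ω₁ + I * (0 : ℕ) * ω₁ = z - I * ω₁ := by push_cast; ring
  have h6 : ∀ k : ℕ, z - I * ω₁ + I * (k + 1 : ℕ) * ω₁ = z + I * k * ω₁ := by
    intro k; push_cast; ring
  rw [h4, h5]
  simp only [h6]
  rw [div_div]

/-- The integral represents `G` in the whole strip `|Im z| < Re ω`, which is wider than the strip of
width `Re ω₁` used in the definition. -/
theorem hypGamma_eq_strip (hω₁ : 0 < ω₁.re) (hω₂ : 0 < ω₂.re) {z : ℂ}
    (hz : |z.im| < (ω₁.re + ω₂.re) / 2) : hypGamma ω₁ ω₂ z = hypGammaStrip ω₁ ω₂ z := by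
  have hadd : ∀ z : ℂ, (z + I * ω₁).im = z.im + ω₁.re := by intro z; simp
  have hsub : ∀ z : ℂ, (z - I * ω₁).im = z.im - ω₁.re := by intro z; simp
  have key : ∀ (N : ℕ) (z : ℂ), |z.im| < (ω₁.re + ω₂.re) / 2 → -((N + 1 / 2) * ω₁.re) ≤ z.im →
      z.im < (N + 1 / 2) * ω₁.re → hypGamma ω₁ ω₂ z = hypGammaStrip ω₁ ω₂ z := by
    intro N
    induction N with
    | zero =>
      intro z _ h1 h2
      have : ⌊z.im / ω₁.re + 1 / 2⌋ = 0 := by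
        rw [Int.floor_eq_iff]
        have e1 : -(1 / 2) ≤ z.im / ω₁.re := by
          rw [le_div_iff₀ hω₁]; push_cast at h1; linarith
        have e2 : z.im / ω₁.re < 1 / 2 := by
          rw [div_lt_iff₀ hω₁]; push_cast at h2; linarith
        push_cast
        constructor <;> linarith
      simp only [hypGamma, this]
      simp
    | succ N ih =>
      intro z hz h1 h2
      have hN : (0 : ℝ) ≤ N := by positivity
      have hNω : 0 ≤ N * ω₁.re := by positivity
      push_cast at h1 h2
      have hz2 := abs_lt.1 hz
      rcases le_or_gt (ω₁.re / 2) z.im with h | h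
      · have e : z = (z - I * ω₁) + I * ω₁ := by ring
        have h3 := hsub z
        rw [e, hypGamma_add_of_le hω₁ (by rw [h3]; linarith), hypGammaStrip_add hω₁ hω₂
          (by rw [h3]; linarith) (by rw [h3]; linarith), ih]
        · rw [h3, abs_lt]; constructor <;> linarith
        · rw [h3]; nlinarith
        · rw [h3]; nlinarith
      · rcases lt_or_ge z.im (-(ω₁.re / 2)) with h' | h'
        · have h3 := hadd z
          have e := hypGamma_sub_of_lt (ω₂ := ω₂) hω₁ (z := z + I * ω₁) (by rw [h3]; linarith)
          rw [add_sub_cancel_right] at e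
          have e2 := hypGammaStrip_add hω₁ hω₂ (z := z) (by linarith) (by linarith)
          rw [ih (z + I * ω₁) (by rw [h3, abs_lt]; constructor <;> linarith)
            (by rw [h3]; nlinarith) (by rw [h3]; nlinarith), e2] at e
          have h4 : hypGammaShift ω₁ ω₂ z ≠ 0 := by
            intro h0
            rw [h0, zero_mul] at e2
            exact hypGammaStrip_ne_zero _ e2
          rw [e, mul_div_cancel_left₀ _ h4]
        · exact ih z hz (by nlinarith) (by nlinarith)
  obtain ⟨N, hN⟩ := exists_nat_gt (|z.im| / ω₁.re)
  rw [div_lt_iff₀ hω₁] at hN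
  have h1 := abs_le.1 (le_refl |z.im|)
  exact key N z hz (by nlinarith) (by nlinarith)

theorem hypGamma_ne_zero (hω₁ : 0 < ω₁.re) (hω₂ : 0 < ω₂.re) {z : ℂ}
    (hz : |z.im| < (ω₁.re + ω₂.re) / 2) : hypGamma ω₁ ω₂ z ≠ 0 := by
  rw [hypGamma_eq_strip hω₁ hω₂ hz]; exact hypGammaStrip_ne_zero _

/-- The difference equation, above the highest pole. -/
theorem hypGamma_add (hω₁ : 0 < ω₁.re) (hω₂ : 0 < ω₂.re) {z : ℂ}
    (hz : -((ω₁.re + ω₂.re) / 2) < z.im) :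
    hypGamma ω₁ ω₂ (z + I * ω₁) = hypGammaShift ω₁ ω₂ z * hypGamma ω₁ ω₂ z := by
  rcases le_or_gt (-(ω₁.re / 2)) z.im with h | h
  · exact hypGamma_add_of_le hω₁ h
  · have him : (z + I * ω₁).im = z.im + ω₁.re := by simp
    rw [hypGamma_eq_strip hω₁ hω₂, hypGamma_eq_strip hω₁ hω₂, hypGammaStrip_add hω₁ hω₂ hz]
    · linarith
    · rw [abs_lt]; constructor <;> linarith
    · rw [him, abs_lt]; constructor <;> linarith

theorem differentiable_hypGammaShift (ω₁ ω₂ : ℂ) : Differentiable ℂ (hypGammaShift ω₁ ω₂) := by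
  unfold hypGammaShift
  fun_prop

theorem differentiableAt_hypGamma (hω₁ : 0 < ω₁.re) (hω₂ : 0 < ω₂.re) {z : ℂ}
    (hz : -((ω₁.re + ω₂.re) / 2) < z.im) : DifferentiableAt ℂ (hypGamma ω₁ ω₂) z := by
  have key : ∀ (N : ℕ) (z : ℂ), -((ω₁.re + ω₂.re) / 2) < z.im →
      z.im < (ω₁.re + ω₂.re) / 2 + N * ω₁.re → DifferentiableAt ℂ (hypGamma ω₁ ω₂) z := by
    intro N
    induction N with
    | zero =>
      intro z h1 h2
      simp only [Nat.cast_zero, zero_mul, add_zero] at h2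
      have hev : hypGamma ω₁ ω₂ =ᶠ[𝓝 z] hypGammaStrip ω₁ ω₂ := by
        filter_upwards [(isOpen_strip _ _).mem_nhds ⟨h1, h2⟩] with w hw
        exact hypGamma_eq_strip hω₁ hω₂ (abs_lt.2 hw)
      refine DifferentiableAt.congr_of_eventuallyEq ?_ hev
      exact (((hasDerivAt_hypGammaLog hω₁ hω₂ (abs_lt.2 ⟨h1, h2⟩)).differentiableAt.const_mul
        I).cexp)
    | succ N ih =>
      intro z h1 h2
      rcases lt_or_ge z.im ((ω₁.re + ω₂.re) / 2 + N * ω₁.re) with h | h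
      · exact ih z h1 h
      · have hNω : 0 ≤ N * ω₁.re := by positivity
        have hsub : ∀ z : ℂ, (z - I * ω₁).im = z.im - ω₁.re := by intro z; simp
        push_cast at h2
        have hev : hypGamma ω₁ ω₂ =ᶠ[𝓝 z]
            fun w => hypGammaShift ω₁ ω₂ (w - I * ω₁) * hypGamma ω₁ ω₂ (w - I * ω₁) := by
          filter_upwards [(isOpen_lt continuous_const Complex.continuous_im).mem_nhds
            (show ω₁.re / 2 < z.im by linarith)] with w hw
          have hw' : ω₁.re / 2 < w.im := hw
          rw [← hypGamma_add hω₁ hω₂ (by rw [hsub]; linarith), sub_add_cancel]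
        refine DifferentiableAt.congr_of_eventuallyEq ?_ hev
        have h3 : DifferentiableAt ℂ (fun w : ℂ => w - I * ω₁) z := by fun_prop
        refine DifferentiableAt.mul ?_ ?_
        · exact (differentiable_hypGammaShift ω₁ ω₂ _).comp z h3
        · exact DifferentiableAt.comp z (ih _ (by rw [hsub]; linarith) (by rw [hsub]; linarith)) h3
  obtain ⟨N, hN⟩ := exists_nat_gt (z.im / ω₁.re)
  rw [div_lt_iff₀ hω₁] at hN
  exact key N z hz (by linarith)

/-- Reflection equation. It holds at all points: `G` takes the value `0` at its poles, which are the
negatives of its zeros, and `0⁻¹ = 0`. -/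
theorem hypGamma_neg (hω₁ : 0 < ω₁.re) (hω₂ : 0 < ω₂.re) (z : ℂ) :
    hypGamma ω₁ ω₂ (-z) = (hypGamma ω₁ ω₂ z)⁻¹ := by
  have key : ∀ (N : ℕ) (z : ℂ), -((ω₁.re + ω₂.re) / 2) < z.im →
      z.im < (ω₁.re + ω₂.re) / 2 + N * ω₁.re →
      hypGamma ω₁ ω₂ (-z) = (hypGamma ω₁ ω₂ z)⁻¹ := by
    intro N
    induction N with
    | zero =>
      intro z h1 h2
      simp only [Nat.cast_zero, zero_mul, add_zero] at h2
      have h3 := abs_lt.2 ⟨h1, h2⟩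
      rw [hypGamma_eq_strip hω₁ hω₂ h3, hypGamma_eq_strip hω₁ hω₂ (by simpa using h3),
        hypGammaStrip_neg]
    | succ N ih =>
      intro z h1 h2
      rcases lt_or_ge z.im ((ω₁.re + ω₂.re) / 2 + N * ω₁.re) with h | h
      · exact ih z h1 h
      · have hNω : 0 ≤ N * ω₁.re := by positivity
        have hsub : ∀ z : ℂ, (z - I * ω₁).im = z.im - ω₁.re := by intro z; simp
        push_cast at h2
        have h02 := ne_zero_of_re_pos hω₂
        have e1 := hypGamma_add hω₁ hω₂ (z := z - I * ω₁) (by rw [hsub]; linarith)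
        rw [sub_add_cancel] at e1
        have e2 := hypGamma_sub_of_lt (ω₂ := ω₂) hω₁ (z := -(z - I * ω₁)) (by
          rw [Complex.neg_im, hsub]; linarith)
        rw [show -(z - I * ω₁) - I * ω₁ = -z by ring, ih (z - I * ω₁) (by rw [hsub]; linarith)
          (by rw [hsub]; linarith)] at e2
        have e3 : hypGammaShift ω₁ ω₂ (-z) = hypGammaShift ω₁ ω₂ (z - I * ω₁) := by
          rw [hypGammaShift_eq_cosh hω₂, hypGammaShift_eq_cosh hω₂, ← Complex.cosh_neg]
          congr 2; ring
        rw [e2, e1, e3, mul_inv, div_eq_mul_inv, mul_comm]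
  rcases le_or_gt 0 z.im with h | h
  · obtain ⟨N, hN⟩ := exists_nat_gt (z.im / ω₁.re)
    rw [div_lt_iff₀ hω₁] at hN
    exact key N z (by linarith) (by linarith)
  · obtain ⟨N, hN⟩ := exists_nat_gt (-z.im / ω₁.re)
    rw [div_lt_iff₀ hω₁] at hN
    have := key N (-z) (by rw [Complex.neg_im]; linarith) (by rw [Complex.neg_im]; linarith)
    rw [neg_neg] at this
    rw [this, inv_inv]

theorem differentiableOn_hypGamma (hω₁ : 0 < ω₁.re) (hω₂ : 0 < ω₂.re) :
    DifferentiableOn ℂ (hypGamma ω₁ ω₂) {z | -((ω₁.re + ω₂.re) / 2) < z.im} :=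
  fun _ hz => (differentiableAt_hypGamma hω₁ hω₂ hz).differentiableWithinAt

theorem isOpen_halfPlane (a : ℝ) : IsOpen {z : ℂ | a < z.im} :=
  isOpen_lt continuous_const Complex.continuous_im

/-- Symmetry in `ω₁, ω₂`, which the definition of `G` by the difference equation in `iω₁` hides. By
it the difference equation in `iω₂` holds as well. -/
theorem hypGamma_comm (hω₁ : 0 < ω₁.re) (hω₂ : 0 < ω₂.re) (z : ℂ) :
    hypGamma ω₂ ω₁ z = hypGamma ω₁ ω₂ z := by
  have h1 : Set.EqOn (hypGamma ω₂ ω₁) (hypGamma ω₁ ω₂) {z | -((ω₁.re + ω₂.re) / 2) < z.im} := by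
    refine AnalyticOnNhd.eqOn_of_preconnected_of_eventuallyEq (z₀ := 0) ?_
      ((differentiableOn_hypGamma hω₁ hω₂).analyticOnNhd (isOpen_halfPlane _))
      (convex_halfSpace_im_gt _).isPreconnected (by simp; linarith) ?_
    · have := differentiableOn_hypGamma hω₂ hω₁
      rw [add_comm ω₂.re] at this
      exact this.analyticOnNhd (isOpen_halfPlane _)
    · filter_upwards [(isOpen_strip (-((ω₁.re + ω₂.re) / 2)) ((ω₁.re + ω₂.re) / 2)).mem_nhds
        (show (0 : ℂ) ∈ _ by simp; linarith)] with w hw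
      rw [hypGamma_eq_strip hω₁ hω₂ (abs_lt.2 hw), hypGamma_eq_strip hω₂ hω₁
        (by rw [add_comm]; exact abs_lt.2 hw), hypGammaStrip_comm]
  rcases lt_or_ge (-((ω₁.re + ω₂.re) / 2)) z.im with h | h
  · exact h1 h
  · rw [← inv_inj, ← hypGamma_neg hω₂ hω₁, ← hypGamma_neg hω₁ hω₂]
    refine h1 ?_
    rw [Set.mem_ofPred_eq, Complex.neg_im]; linarith

/-- The numerator of the integrand is elementary. -/
theorem hypGamma_mul_hypGamma_two (hω₁ : 0 < ω₁.re) (hω₂ : 0 < ω₂.re) {z : ℂ}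
    (hz : |z.im| < (ω₁.re + ω₂.re) / 2) :
    hypGamma ω₁ ω₂ (I * ((ω₁ + ω₂) / 2) + 2 * z) * hypGamma ω₁ ω₂ (I * ((ω₁ + ω₂) / 2) - 2 * z)
      = 4 * Complex.sinh (2 * Real.pi * z / ω₁) * Complex.sinh (2 * Real.pi * z / ω₂) := by
  have h01 := ne_zero_of_re_pos hω₁
  have h02 := ne_zero_of_re_pos hω₂
  set η : ℂ := I * ((ω₁ + ω₂) / 2) with hη
  have hηim : η.im = (ω₁.re + ω₂.re) / 2 := by simp [hη]
  have hU := isOpen_strip (-((ω₁.re + ω₂.re) / 2)) ((ω₁.re + ω₂.re) / 2)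
  have h2im : ∀ w : ℂ, (2 * w).im = 2 * w.im := by intro w; simp
  -- by analytic continuation it suffices to consider small positive imaginary parts
  refine AnalyticOnNhd.eqOn_of_preconnected_of_eventuallyEq
    (𝕜 := ℂ) (E := ℂ) (F := ℂ)
    (f := fun z => hypGamma ω₁ ω₂ (η + 2 * z) * hypGamma ω₁ ω₂ (η - 2 * z))
    (g := fun z => 4 * Complex.sinh (2 * Real.pi * z / ω₁) * Complex.sinh (2 * Real.pi * z / ω₂))
    (U := {z | -((ω₁.re + ω₂.re) / 2) < z.im ∧ z.im < (ω₁.re + ω₂.re) / 2})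
    (z₀ := ((ω₁.re + ω₂.re) / 4 : ℝ) * I) ?_ ?_ (convex_strip _ _).isPreconnected ?_ ?_
    (abs_lt.1 hz)
  · refine DifferentiableOn.analyticOnNhd (fun w hw => ?_) hU
    refine (DifferentiableAt.mul ?_ ?_).differentiableWithinAt
    · exact DifferentiableAt.comp w (differentiableAt_hypGamma hω₁ hω₂ (by
        rw [Complex.add_im, hηim, h2im]; linarith [hw.1])) (by fun_prop)
    · exact DifferentiableAt.comp w (differentiableAt_hypGamma hω₁ hω₂ (by
        rw [Complex.sub_im, hηim, h2im]; linarith [hw.2])) (by fun_prop)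
  · exact (Differentiable.differentiableOn (by fun_prop)).analyticOnNhd hU
  · simp; constructor <;> linarith
  · filter_upwards [(isOpen_strip 0 ((ω₁.re + ω₂.re) / 2)).mem_nhds
      (show (((ω₁.re + ω₂.re) / 4 : ℝ) * I : ℂ) ∈ _ by simp; constructor <;> linarith)] with w hw
    have hw1 : 0 < w.im := hw.1
    have hw2 : w.im < (ω₁.re + ω₂.re) / 2 := hw.2
    have e1 : η + 2 * w = (2 * w - η + I * ω₂) + I * ω₁ := by rw [hη]; ring
    have him1 : (2 * w - η).im = 2 * w.im - (ω₁.re + ω₂.re) / 2 := by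
      rw [Complex.sub_im, hηim, h2im]
    have him2 : (2 * w - η + I * ω₂).im = 2 * w.im - (ω₁.re + ω₂.re) / 2 + ω₂.re := by
      rw [Complex.add_im, him1]; simp
    have e2 := hypGamma_add hω₂ hω₁ (z := 2 * w - η) (by rw [him1]; linarith)
    rw [hypGamma_comm hω₁ hω₂, hypGamma_comm hω₁ hω₂] at e2
    have e3 : hypGamma ω₁ ω₂ (η - 2 * w) = (hypGamma ω₁ ω₂ (2 * w - η))⁻¹ := by
      rw [← hypGamma_neg hω₁ hω₂]; congr 1; ring
    have hne := hypGamma_ne_zero hω₁ hω₂ (z := 2 * w - η) (by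
      rw [him1, abs_lt]; constructor <;> linarith)
    rw [e1, hypGamma_add hω₁ hω₂ (by rw [him2]; linarith), e2, e3]
    have s1 : hypGammaShift ω₂ ω₁ (2 * w - η) = -2 * I * Complex.sinh (2 * Real.pi * w / ω₁) := by
      rw [hypGammaShift, hη]; congr 2; ring
    have s2 : hypGammaShift ω₁ ω₂ (2 * w - η + I * ω₂)
        = 2 * I * Complex.sinh (2 * Real.pi * w / ω₂) := by
      have : (Real.pi : ℂ) * ((2 * w - η + I * ω₂ + I * ((ω₁ + ω₂) / 2)) / ω₂)
          = 2 * Real.pi * w / ω₂ + Real.pi * I := by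
        rw [hη]; field_simp; ring
      rw [hypGammaShift, this, Complex.sinh_add, Complex.sinh_mul_I, Complex.cosh_mul_I,
        Complex.cos_pi, Complex.sin_pi]
      ring
    rw [s1, s2]
    field_simp
    rw [Complex.I_sq]; ring

end hypGamma

/-! ### Growth of the hyperbolic gamma function along horizontal lines -/

/-- The exponential rate of `|G (x + a) / G x|` for `x → ±∞`: this quotient is comparable to
`exp (π |x| Im (a / (ω₁ ω₂)))`. -/
noncomputable def hypRate (ω₁ ω₂ a : ℂ) : ℝ := (a / (ω₁ * ω₂)).im

section growth

variable {ω₁ ω₂ : ℂ}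

theorem hypRate_add (a b : ℂ) : hypRate ω₁ ω₂ (a + b) = hypRate ω₁ ω₂ a + hypRate ω₁ ω₂ b := by
  simp [hypRate, add_div]

theorem hypRate_sub (a b : ℂ) : hypRate ω₁ ω₂ (a - b) = hypRate ω₁ ω₂ a - hypRate ω₁ ω₂ b := by
  simp [hypRate, sub_div]

theorem hypRate_neg (a : ℂ) : hypRate ω₁ ω₂ (-a) = -hypRate ω₁ ω₂ a := by
  simp [hypRate, neg_div]

theorem hypRate_real_mul (c : ℝ) (a : ℂ) : hypRate ω₁ ω₂ (c * a) = c * hypRate ω₁ ω₂ a := by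
  rw [hypRate, hypRate, mul_div_assoc, Complex.im_ofReal_mul]

theorem hypRate_I_mul_left (hω₁ : 0 < ω₁.re) : hypRate ω₁ ω₂ (I * ω₁) = (1 / ω₂).re := by
  have h01 := ne_zero_of_re_pos hω₁
  rw [hypRate, show I * ω₁ / (ω₁ * ω₂) = (1 / ω₂) * I by field_simp]
  simp

theorem hypRate_I_mul_right (hω₂ : 0 < ω₂.re) : hypRate ω₁ ω₂ (I * ω₂) = (1 / ω₁).re := by
  have h02 := ne_zero_of_re_pos hω₂
  rw [hypRate, show I * ω₂ / (ω₁ * ω₂) = (1 / ω₁) * I by field_simp]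
  simp

theorem re_one_div_pos {ω : ℂ} (hω : 0 < ω.re) : 0 < (1 / ω).re := by
  rw [one_div, Complex.inv_re]
  exact div_pos hω (Complex.normSq_pos.2 (ne_zero_of_re_pos hω))

theorem continuous_hypRate (ω₁ ω₂ : ℂ) : Continuous (hypRate ω₁ ω₂) := by
  unfold hypRate; fun_prop

theorem normSq_cosh (a b : ℝ) :
    ‖Complex.cosh (a + b * I)‖ ^ 2 = Real.sinh a ^ 2 + Real.cos b ^ 2 := by
  rw [Complex.cosh_add, Complex.cosh_mul_I, Complex.sinh_mul_I, ← Complex.ofReal_cosh,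
    ← Complex.ofReal_sinh, ← Complex.ofReal_cos, ← Complex.ofReal_sin, ← mul_assoc,
    ← Complex.ofReal_mul, ← Complex.ofReal_mul, ← Complex.normSq_eq_norm_sq,
    Complex.normSq_add_mul_I]
  have h1 := Real.cosh_sq a
  have h2 := Real.sin_sq_add_cos_sq b
  rw [mul_pow, mul_pow, h1]
  linear_combination Real.sinh a ^ 2 * h2

theorem normSq_sinh (a b : ℝ) :
    ‖Complex.sinh (a + b * I)‖ ^ 2 = Real.sinh a ^ 2 + Real.sin b ^ 2 := by
  rw [Complex.sinh_add, Complex.cosh_mul_I, Complex.sinh_mul_I, ← Complex.ofReal_cosh,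
    ← Complex.ofReal_sinh, ← Complex.ofReal_cos, ← Complex.ofReal_sin, ← mul_assoc,
    ← Complex.ofReal_mul, ← Complex.ofReal_mul, ← Complex.normSq_eq_norm_sq,
    Complex.normSq_add_mul_I]
  have h1 := Real.cosh_sq a
  have h2 := Real.sin_sq_add_cos_sq b
  rw [mul_pow, mul_pow, h1]
  linear_combination Real.sinh a ^ 2 * h2

theorem norm_tanh_le {y : ℝ} (hy : y < Real.pi / 2) {v : ℂ} (hv : |v.im| ≤ y) :
    ‖Complex.tanh v‖ ≤ 1 / Real.cos y := by
  have hy0 : 0 ≤ y := (abs_nonneg _).trans hv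
  have hc : 0 < Real.cos y := Real.cos_pos_of_mem_Ioo ⟨by linarith [Real.pi_pos], hy⟩
  have h1 : Real.cos y ≤ Real.cos v.im := by
    rw [← Real.cos_abs v.im]
    exact Real.cos_le_cos_of_nonneg_of_le_pi (abs_nonneg _) (by linarith [Real.pi_pos]) hv
  have h2 : Real.cos y ≤ 1 := Real.cos_le_one y
  have e1 := normSq_cosh v.re v.im
  have e2 := normSq_sinh v.re v.im
  rw [Complex.re_add_im] at e1 e2
  have h3 := Real.sin_sq_add_cos_sq v.im
  have h4 : 0 < ‖Complex.cosh v‖ := by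
    have h0 : ‖Complex.cosh v‖ ^ 2 ≠ 0 := by
      rw [e1]; nlinarith [sq_nonneg (Real.sinh v.re)]
    exact (norm_nonneg _).lt_of_ne' (fun h => h0 (by rw [h]; simp))
  rw [Complex.tanh_eq_sinh_div_cosh, norm_div, div_le_div_iff₀ h4 hc, one_mul]
  refine (le_abs_self _).trans (abs_le_of_sq_le_sq ?_ h4.le)
  rw [mul_pow, e1, e2]
  have h5 : Real.cos y ^ 2 ≤ Real.cos v.im ^ 2 := by gcongr
  have h6 : Real.cos y ^ 2 ≤ 1 := by nlinarith
  nlinarith [sq_nonneg (Real.sinh v.re), sq_nonneg (Real.sin v.im)]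

theorem abs_log_two_cosh_sub_abs_le (u : ℝ) :
    |Real.log (2 * Real.cosh u) - (|u|)| ≤ Real.log 2 := by
  have h1 : Real.exp |u| ≤ 2 * Real.cosh u := by
    rw [← Real.cosh_abs, Real.cosh_eq]; linarith [Real.exp_pos (-|u|)]
  have h2 : 2 * Real.cosh u ≤ 2 * Real.exp |u| := by
    rw [← Real.cosh_abs, Real.cosh_eq]
    have : Real.exp (-|u|) ≤ Real.exp |u| := Real.exp_le_exp.2 (by linarith [abs_nonneg u])
    linarith
  have h3 := Real.log_le_log (Real.exp_pos _) h1
  have h4 := Real.log_le_log (by positivity) h2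
  rw [Real.log_exp] at h3
  rw [Real.log_mul (by norm_num) (Real.exp_pos _).ne', Real.log_exp] at h4
  have := Real.log_nonneg (one_le_two : (1 : ℝ) ≤ 2)
  rw [abs_le]; constructor <;> linarith

theorem coshLog_ofReal {Ω : ℝ} (hΩ : 0 < Ω) (x : ℝ) :
    coshLog Ω x = -(Real.log (2 * Real.cosh (Real.pi * (x / Ω))) : ℝ) := by
  have h1 := exp_neg_coshLog (ω := Ω) (z := x) (by simpa using hΩ) (by simpa using hΩ)
  obtain ⟨l, hl⟩ : ∃ l : ℝ, coshLog Ω x = l := by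
    refine ⟨∫ t : ℝ in Set.Ioi 0, (Real.cos (2 * x * t) / Real.sinh (Ω * t) - 1 / (Ω * t)) / t, ?_⟩
    rw [coshLog, ← integral_complex_ofReal]
    congr 1; ext t; push_cast; rfl
  rw [hl] at h1 ⊢
  have h2 : Real.exp (-l) = 2 * Real.cosh (Real.pi * (x / Ω)) := by exact_mod_cast h1
  rw [← h2, Real.log_exp]; push_cast; ring

theorem norm_coshLog_add_le {Ω y : ℝ} (hΩ : 0 < Ω) (hy : y < Ω / 2) :
    ∃ M : ℝ, ∀ w : ℂ, |w.im| ≤ y → ‖coshLog Ω w + (Real.pi * |w.re| / Ω : ℝ)‖ ≤ M := by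
  refine ⟨Real.pi / Ω * (1 / Real.cos (Real.pi * y / Ω)) * y + Real.log 2, fun w hw => ?_⟩
  have hΩ' : 0 < (Ω : ℂ).re := by simpa using hΩ
  have hconv := convex_strip (-(Ω / 2)) (Ω / 2)
  have hconv2 : Convex ℝ {v : ℂ | -y ≤ v.im ∧ v.im ≤ y} :=
    (convex_halfSpace_im_ge _).inter (convex_halfSpace_im_le _)
  have hd : ∀ v ∈ {v : ℂ | -y ≤ v.im ∧ v.im ≤ y}, HasDerivAt (coshLog Ω)
      (-(Real.pi / Ω) * Complex.tanh (Real.pi * (v / Ω))) v := fun v hv =>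
    hasDerivAt_coshLog hΩ' (by rw [Complex.ofReal_re]; exact (abs_le.2 hv).trans_lt hy)
  have h1 := hconv2.norm_image_sub_le_of_norm_hasDerivWithin_le (f := coshLog Ω)
    (C := Real.pi / Ω * (1 / Real.cos (Real.pi * y / Ω))) (x := (w.re : ℂ)) (y := w)
    (fun v hv => (hd v hv).hasDerivWithinAt) (fun v hv => ?_)
    (by simp; exact (abs_nonneg _).trans hw) (abs_le.1 hw)
  · have h2 : ‖w - w.re‖ ≤ y := by
      have : w - w.re = w.im * I := by
        apply Complex.ext <;> simp
      rw [this, norm_mul, Complex.norm_I, mul_one, Complex.norm_real]; exact hw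
    have hy0 : 0 ≤ y := (abs_nonneg _).trans hw
    have hcos : 0 < Real.cos (Real.pi * y / Ω) := by
      refine Real.cos_pos_of_mem_Ioo ⟨?_, ?_⟩
      · have : 0 ≤ Real.pi * y / Ω := by positivity
        linarith [Real.pi_pos]
      · rw [div_lt_iff₀ hΩ]; nlinarith [Real.pi_pos]
    have h3 : ‖coshLog Ω w.re + (Real.pi * |w.re| / Ω : ℝ)‖ ≤ Real.log 2 := by
      rw [coshLog_ofReal hΩ, ← Complex.ofReal_neg, ← Complex.ofReal_add, Complex.norm_real,
        Real.norm_eq_abs]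
      have h4 := abs_log_two_cosh_sub_abs_le (Real.pi * (w.re / Ω))
      have h5 : |Real.pi * (w.re / Ω)| = Real.pi * |w.re| / Ω := by
        rw [abs_mul, abs_div, abs_of_pos hΩ, abs_of_pos Real.pi_pos]; ring
      rw [h5] at h4
      rw [← abs_neg]
      convert h4 using 2
      ring
    calc _ = ‖(coshLog Ω w - coshLog Ω w.re)
          + (coshLog Ω w.re + (Real.pi * |w.re| / Ω : ℝ))‖ := by congr 1; ring
      _ ≤ _ := (norm_add_le _ _).trans (add_le_add (h1.trans (by gcongr)) h3)
  · rw [norm_mul, norm_neg]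
    have e1 : ‖(Real.pi / Ω : ℂ)‖ = Real.pi / Ω := by
      rw [norm_div, Complex.norm_real, Complex.norm_real, Real.norm_of_nonneg Real.pi_pos.le,
        Real.norm_of_nonneg hΩ.le]
    rw [e1]
    have hvim : (Real.pi * (v / Ω) : ℂ).im = Real.pi * v.im / Ω := by
      rw [Complex.im_ofReal_mul, Complex.div_ofReal_im]; ring
    refine mul_le_mul_of_nonneg_left (norm_tanh_le ?_ ?_) (by positivity)
    · rw [div_lt_iff₀ hΩ]; nlinarith [Real.pi_pos]
    · rw [hvim, abs_div, abs_mul, abs_of_pos hΩ, abs_of_pos Real.pi_pos]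
      have : |v.im| ≤ y := abs_le.2 hv
      gcongr

/-- The logarithmic derivative of `G` is `-iπ |Re w| / (ω₁ ω₂)` up to a bounded error. The
singularity at `t = 0` of the integrand is removed by comparison with `coshLog`. -/
theorem norm_deriv_hypGammaLog_add_le (hω₁ : 0 < ω₁.re) (hω₂ : 0 < ω₂.re) {y : ℝ}
    (hy : y < (ω₁.re + ω₂.re) / 2) :
    ∃ M : ℝ, ∀ w : ℂ, |w.im| ≤ y →
      ‖deriv (hypGammaLog ω₁ ω₂) w + Real.pi * |w.re| / (ω₁ * ω₂)‖ ≤ M := by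
  have h01 := ne_zero_of_re_pos hω₁
  have h02 := ne_zero_of_re_pos hω₂
  set Ω : ℝ := ω₁.re + ω₂.re with hΩdef
  have hΩ : 0 < Ω := by positivity
  have hΩ' : 0 < (Ω : ℂ).re := by simpa using hΩ
  have hΩ0 : (Ω : ℂ) ≠ 0 := ne_zero_of_re_pos hΩ'
  obtain ⟨M₁, hM₁, hb₁⟩ := norm_inv_sinh_sub_le hω₁
  obtain ⟨M₂, hM₂, hb₂⟩ := norm_inv_sinh_sub_le hω₂
  obtain ⟨M₃, hM₃, hb₃⟩ := norm_inv_sinh_sub_le hΩ'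
  obtain ⟨M, hM, hb⟩ := norm_inv_mul_sub_le h01 hM₁ hω₂ hM₂ hb₁ hb₂
    (fun t ht _ => re_mul_le_norm_sinh hω₂ ht.le)
  obtain ⟨M', hM', hb'⟩ := norm_inv_mul_sub_le (α := 1) (β := Ω) (p := fun t => (t : ℂ)) one_ne_zero
    le_rfl hΩ' hM₃ (fun t ht _ => by simp) hb₃ (fun t ht _ => re_mul_le_norm_sinh hΩ' ht.le)
  obtain ⟨M'', hM''⟩ := norm_coshLog_add_le (y := y) hΩ (by linarith)
  let k : ℝ → ℂ := fun t => 1 / (Complex.sinh (ω₁ * t) * Complex.sinh (ω₂ * t))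
    - Ω / (ω₁ * ω₂) * (1 / (t * Complex.sinh (Ω * t)))
  set c : ℝ := ‖(Ω / (ω₁ * ω₂) : ℂ)‖ with hc
  have hk0 : ∀ t : ℝ, 0 < t → t ≤ 1 → ‖k t‖ ≤ M + c * M' := by
    intro t ht ht1
    have ht0 : (t : ℂ) ≠ 0 := by exact_mod_cast ht.ne'
    have e : k t = (1 / (Complex.sinh (ω₁ * t) * Complex.sinh (ω₂ * t)) - 1 / (ω₁ * ω₂ * t ^ 2))
        - Ω / (ω₁ * ω₂) * (1 / (t * Complex.sinh (Ω * t)) - 1 / (1 * Ω * t ^ 2)) := by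
      simp only [k]; field_simp; ring
    rw [e]
    refine (norm_sub_le _ _).trans (add_le_add (hb t ht ht1) ?_)
    rw [norm_mul]
    exact mul_le_mul_of_nonneg_left (hb' t ht ht1) (norm_nonneg _)
  set C : ℝ := (1 + 2 * ω₁.re) / ω₁.re * ((1 + 2 * ω₂.re) / ω₂.re) + c * ((1 + 2 * Ω) / Ω) with hC
  have hk1 : ∀ t : ℝ, 1 ≤ t → ‖k t‖ ≤ C * Real.exp (-Ω * t) := by
    intro t ht
    have ht0 : 0 < t := by linarith
    have hnt : ‖(t : ℂ)‖ = t := by rw [Complex.norm_real, Real.norm_of_nonneg ht0.le]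
    have h1 := exp_le_norm_sinh hω₁ ht
    have h2 := exp_le_norm_sinh hω₂ ht
    have h3 := exp_le_norm_sinh hΩ' ht
    rw [Complex.ofReal_re] at h3
    have p1 := norm_pos_iff.2 (sinh_mul_ne_zero hω₁ ht0)
    have p2 := norm_pos_iff.2 (sinh_mul_ne_zero hω₂ ht0)
    have p3 := norm_pos_iff.2 (sinh_mul_ne_zero hΩ' ht0)
    have hexp : Real.exp (-Ω * t) * (Real.exp (ω₁.re * t) * Real.exp (ω₂.re * t)) = 1 := by
      rw [← Real.exp_add, ← Real.exp_add, Real.exp_eq_one_iff, hΩdef]; ring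
    have hexp' : Real.exp (-Ω * t) * Real.exp (Ω * t) = 1 := by
      rw [← Real.exp_add, Real.exp_eq_one_iff]; ring
    refine (norm_sub_le _ _).trans ?_
    rw [hC, add_mul]
    refine add_le_add ?_ ?_
    · rw [norm_div, norm_one, norm_mul, div_le_iff₀ (by positivity)]
      calc (1 : ℝ) = (1 + 2 * ω₁.re) / ω₁.re * ((1 + 2 * ω₂.re) / ω₂.re) * Real.exp (-Ω * t)
            * ((ω₁.re / (1 + 2 * ω₁.re) * Real.exp (ω₁.re * t))
            * (ω₂.re / (1 + 2 * ω₂.re) * Real.exp (ω₂.re * t))) := by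
            rw [← hexp]; field_simp
        _ ≤ _ := by gcongr
    · rw [norm_mul, norm_div (1 : ℂ), norm_one, norm_mul, hnt, mul_assoc]
      refine mul_le_mul_of_nonneg_left ?_ (norm_nonneg _)
      rw [div_le_iff₀ (by positivity)]
      calc (1 : ℝ) = Real.exp (-Ω * t) * Real.exp (Ω * t) := hexp'.symm
        _ = (1 + 2 * Ω) / Ω * Real.exp (-Ω * t)
            * (1 * (Ω / (1 + 2 * Ω) * Real.exp (Ω * t))) := by
            generalize Real.exp (-Ω * t) = A
            generalize Real.exp (Ω * t) = B
            field_simp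
        _ ≤ _ := by gcongr
  have hkm : Measurable k := by
    have h2 : ∀ ω : ℂ, Measurable fun t : ℝ => Complex.sinh (ω * t) := fun ω =>
      (Complex.continuous_sinh.comp (by fun_prop)).measurable
    have h3 := h2 ω₁
    have h4 := h2 ω₂
    have h5 := h2 Ω
    simp only [k]
    fun_prop
  rcases lt_or_ge y 0 with hyneg | hy0
  · exact ⟨0, fun w hw => absurd ((abs_nonneg _).trans hw) (not_le.2 hyneg)⟩
  have hbd : ∀ w : ℂ, |w.im| ≤ y → ∀ t : ℝ, 0 < t → ‖Complex.cos (2 * w * t) * k t‖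
      ≤ C * Real.exp (-(Ω - 2 * y) * t)
        + (2 * (Real.exp (2 * y) * (M + c * M')) + 2 * 0) * (1 + t ^ 2)⁻¹ := by
    intro w hw t ht
    have hcos : ∀ t : ℝ, 0 < t → ‖Complex.cos (2 * w * t)‖ ≤ Real.exp (2 * y * t) := by
      intro t ht
      refine (norm_cos_le _).trans (Real.exp_le_exp.2 ?_)
      rw [Complex.im_mul_ofReal, abs_mul, abs_of_pos ht]
      have : (2 * w).im = 2 * w.im := by simp
      rw [this, abs_mul, abs_two]
      gcongr
    refine le_exp_add_inv (f := fun t => ‖Complex.cos (2 * w * t) * k t‖)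
      (M := Real.exp (2 * y) * (M + c * M')) (B := 0) (by positivity) (by positivity) le_rfl ?_ ?_ ht
    · intro t ht ht1
      rw [norm_mul]
      refine mul_le_mul ((hcos t ht).trans (Real.exp_le_exp.2 (by nlinarith))) (hk0 t ht ht1)
        (norm_nonneg _) (Real.exp_pos _).le
    · intro t ht
      rw [norm_mul, zero_div, add_zero]
      calc _ ≤ Real.exp (2 * y * t) * (C * Real.exp (-Ω * t)) :=
            mul_le_mul (hcos t (by linarith)) (hk1 t ht) (norm_nonneg _) (Real.exp_pos _).le
        _ = C * (Real.exp (2 * y * t) * Real.exp (-Ω * t)) := by ring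
        _ = _ := by rw [← Real.exp_add]; congr 2; ring
  have hgi := integrableOn_exp_add_inv (δ := Ω - 2 * y) (by linarith) C
    (2 * (Real.exp (2 * y) * (M + c * M')) + 2 * 0)
  refine ⟨(∫ t : ℝ in Set.Ioi 0, (C * Real.exp (-(Ω - 2 * y) * t)
        + (2 * (Real.exp (2 * y) * (M + c * M')) + 2 * 0) * (1 + t ^ 2)⁻¹)) + c * M'',
    fun w hw => ?_⟩
  have hw' : |w.im| < (Ω : ℂ).re / 2 := by rw [Complex.ofReal_re]; linarith
  have hki : IntegrableOn (fun t : ℝ => Complex.cos (2 * w * t) * k t) (Set.Ioi 0) := by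
    refine hgi.mono' ?_ ?_
    · exact ((Complex.continuous_cos.comp (by fun_prop)).measurable.mul hkm).aestronglyMeasurable
    · filter_upwards [self_mem_ae_restrict measurableSet_Ioi] with t ht using hbd w hw t ht
  have hsplit : deriv (hypGammaLog ω₁ ω₂) w
      = (∫ t : ℝ in Set.Ioi 0, Complex.cos (2 * w * t) * k t)
        + Ω / (ω₁ * ω₂) * coshLog Ω w := by
    rw [(hasDerivAt_hypGammaLog hω₁ hω₂ (hw.trans_lt hy)).deriv, coshLog, ← integral_const_mul,
      ← integral_add hki ((integrableOn_coshLog_integrand hΩ' hw').const_mul _)]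
    refine setIntegral_congr_fun measurableSet_Ioi fun t ht => ?_
    have ht' : 0 < t := ht
    have ht0 : (t : ℂ) ≠ 0 := by exact_mod_cast ht'.ne'
    have h3 := sinh_mul_ne_zero hΩ' ht'
    have h4 := sinh_mul_ne_zero hω₁ ht'
    have h5 := sinh_mul_ne_zero hω₂ ht'
    simp only [k]
    field_simp
    ring
  have e : deriv (hypGammaLog ω₁ ω₂) w + Real.pi * |w.re| / (ω₁ * ω₂)
      = (∫ t : ℝ in Set.Ioi 0, Complex.cos (2 * w * t) * k t)
        + Ω / (ω₁ * ω₂) * (coshLog Ω w + (Real.pi * |w.re| / Ω : ℝ)) := by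
    rw [hsplit]; push_cast; field_simp; ring
  rw [e]
  refine (norm_add_le _ _).trans (add_le_add ?_ ?_)
  · refine norm_integral_le_of_norm_le hgi ?_
    filter_upwards [self_mem_ae_restrict measurableSet_Ioi] with t ht using hbd w hw t ht
  · rw [norm_mul]
    exact mul_le_mul_of_nonneg_left (hM'' w hw) (norm_nonneg _)

/-- Growth within the strip, by integrating the logarithmic derivative from `x` to `x + a`. -/
theorem norm_hypGamma_add_le_of_strip (hω₁ : 0 < ω₁.re) (hω₂ : 0 < ω₂.re) {y r : ℝ}
    (hy : y < (ω₁.re + ω₂.re) / 2) :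
    ∃ M : ℝ, 0 ≤ M ∧ ∀ (x : ℝ) (a : ℂ), ‖a‖ ≤ r → |a.im| ≤ y →
      ‖hypGamma ω₁ ω₂ (x + a)‖
        ≤ M * Real.exp (Real.pi * |x| * hypRate ω₁ ω₂ a) * ‖hypGamma ω₁ ω₂ x‖ := by
  obtain ⟨M, hM⟩ := norm_deriv_hypGammaLog_add_le hω₁ hω₂ hy
  refine ⟨Real.exp ((M + Real.pi * r / ‖ω₁ * ω₂‖) * r), (Real.exp_pos _).le, fun x a har hay => ?_⟩
  have hr : 0 ≤ r := (norm_nonneg _).trans har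
  have hy0 : 0 ≤ y := (abs_nonneg _).trans hay
  set S : Set ℂ := Metric.closedBall 0 r ∩ {v | -y ≤ v.im ∧ v.im ≤ y} with hS
  have hconv : Convex ℝ S := (convex_closedBall 0 r).inter
    ((convex_halfSpace_im_ge _).inter (convex_halfSpace_im_le _))
  have him : ∀ s : ℂ, ((x : ℂ) + s).im = s.im := by intro s; simp
  have hd : ∀ s ∈ S, HasDerivAt (fun s : ℂ => hypGammaLog ω₁ ω₂ (x + s)
      + Real.pi * |x| / (ω₁ * ω₂) * s)
      (deriv (hypGammaLog ω₁ ω₂) (x + s) + Real.pi * |x| / (ω₁ * ω₂)) s := by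
    intro s hs
    have h1 := (hasDerivAt_hypGammaLog hω₁ hω₂ (z := x + s) (by
      rw [him]; exact (abs_le.2 hs.2).trans_lt hy)).differentiableAt.hasDerivAt
    have h2 := h1.comp_const_add (x : ℂ) s
    have h3 := (hasDerivAt_id s).const_mul (Real.pi * |x| / (ω₁ * ω₂) : ℂ)
    rw [mul_one] at h3
    exact h2.add h3
  have h0S : (0 : ℂ) ∈ S := ⟨by simpa using hr, by simpa using hy0⟩
  have haS : a ∈ S := ⟨by simpa using har, abs_le.1 hay⟩
  have h1 := hconv.norm_image_sub_le_of_norm_hasDerivWithin_le (x := 0) (y := a)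
    (C := M + Real.pi * r / ‖ω₁ * ω₂‖) (fun s hs => (hd s hs).hasDerivWithinAt) (fun s hs => ?_)
    h0S haS
  · have hq : hypGamma ω₁ ω₂ (x + a) = hypGamma ω₁ ω₂ x
        * Complex.exp (I * ((hypGammaLog ω₁ ω₂ (x + a) + Real.pi * |x| / (ω₁ * ω₂) * a)
          - (hypGammaLog ω₁ ω₂ (x + 0) + Real.pi * |x| / (ω₁ * ω₂) * 0)))
        * Complex.exp (-I * ((Real.pi * |x| : ℝ) * (a / (ω₁ * ω₂)))) := by
      rw [hypGamma_eq_strip hω₁ hω₂ (by rw [him]; exact hay.trans_lt hy),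
        hypGamma_eq_strip hω₁ hω₂ (by simp; linarith), hypGammaStrip_eq, hypGammaStrip_eq,
        ← Complex.exp_add, ← Complex.exp_add]
      congr 1
      rw [add_zero]; push_cast; ring
    rw [hq, norm_mul, norm_mul]
    have e1 : ‖Complex.exp (-I * ((Real.pi * |x| : ℝ) * (a / (ω₁ * ω₂))))‖
        = Real.exp (Real.pi * |x| * hypRate ω₁ ω₂ a) := by
      rw [Complex.norm_exp]; congr 1
      rw [hypRate, ← Complex.im_ofReal_mul]
      simp
    rw [e1]
    have e2 : ‖Complex.exp (I * ((hypGammaLog ω₁ ω₂ (x + a) + Real.pi * |x| / (ω₁ * ω₂) * a)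
          - (hypGammaLog ω₁ ω₂ (x + 0) + Real.pi * |x| / (ω₁ * ω₂) * 0)))‖
        ≤ Real.exp ((M + Real.pi * r / ‖ω₁ * ω₂‖) * r) := by
      refine (Complex.norm_exp_le_exp_norm _).trans (Real.exp_le_exp.2 ?_)
      rw [norm_mul, Complex.norm_I, one_mul]
      refine h1.trans ?_
      rw [sub_zero]
      have : 0 ≤ M + Real.pi * r / ‖ω₁ * ω₂‖ := by
        have h0 := (norm_nonneg _).trans (hM 0 (by simpa using hy0))
        positivity
      gcongr
    calc _ ≤ ‖hypGamma ω₁ ω₂ x‖ * Real.exp ((M + Real.pi * r / ‖ω₁ * ω₂‖) * r)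
          * Real.exp (Real.pi * |x| * hypRate ω₁ ω₂ a) := by gcongr
      _ = _ := by ring
  · have h2 := hM (x + s) (by rw [him]; exact abs_le.2 hs.2)
    have h3 : ((x : ℂ) + s).re = x + s.re := by simp
    rw [h3] at h2
    have e : deriv (hypGammaLog ω₁ ω₂) (x + s) + Real.pi * |x| / (ω₁ * ω₂)
        = (deriv (hypGammaLog ω₁ ω₂) (x + s) + Real.pi * |x + s.re| / (ω₁ * ω₂))
          + Real.pi * ((|x| - |x + s.re| : ℝ) : ℂ) / (ω₁ * ω₂) := by push_cast; ring
    rw [e]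
    refine (norm_add_le _ _).trans (add_le_add (by exact_mod_cast h2) ?_)
    rw [norm_div, norm_mul, Complex.norm_real, Complex.norm_real,
      Real.norm_of_nonneg Real.pi_pos.le, Real.norm_eq_abs]
    have h4 : |(|x| - |x + s.re|)| ≤ r := by
      refine (abs_abs_sub_abs_le _ _).trans ?_
      have h5 : x - (x + s.re) = -s.re := by ring
      rw [h5, abs_neg]
      exact (Complex.abs_re_le_norm s).trans (by simpa using hs.1)
    gcongr

theorem abs_re_mul_div_le (ω : ℂ) (x : ℝ) {b : ℂ} {r : ℝ} (hb : ‖b‖ ≤ r) :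
    |((Real.pi : ℂ) * ((x + b) / ω)).re - Real.pi * x * (1 / ω).re| ≤ Real.pi * r / ‖ω‖ := by
  have h1 : ((Real.pi : ℂ) * ((x + b) / ω)).re - Real.pi * x * (1 / ω).re
      = Real.pi * (b / ω).re := by
    rw [Complex.re_ofReal_mul, add_div, Complex.add_re]
    have : ((x : ℂ) / ω).re = x * (1 / ω).re := by
      rw [← Complex.re_ofReal_mul]; congr 1; ring
    rw [this]; ring
  rw [h1, abs_mul, abs_of_pos Real.pi_pos, mul_div_assoc]
  refine mul_le_mul_of_nonneg_left ?_ Real.pi_pos.le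
  refine (Complex.abs_re_le_norm _).trans ?_
  rw [norm_div]
  gcongr

theorem norm_sinh_div_le {ω : ℂ} (hω : 0 < ω.re) (r : ℝ) :
    ∃ M : ℝ, 0 ≤ M ∧ ∀ (x : ℝ) (b : ℂ), ‖b‖ ≤ r →
      ‖Complex.sinh (Real.pi * ((x + b) / ω))‖ ≤ M * Real.exp (Real.pi * |x| * (1 / ω).re) := by
  refine ⟨Real.exp (Real.pi * r / ‖ω‖), (Real.exp_pos _).le, fun x b hb => ?_⟩
  have h1 := abs_re_mul_div_le ω x hb
  have h2 := re_one_div_pos hω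
  rw [← Real.exp_add]
  refine (norm_sinh_le _).trans (Real.exp_le_exp.2 ?_)
  have h3 : |Real.pi * x * (1 / ω).re| = Real.pi * |x| * (1 / ω).re := by
    rw [abs_mul, abs_mul, abs_of_pos Real.pi_pos, abs_of_pos h2]
  rw [← h3]
  have h4 := abs_sub_abs_le_abs_sub ((Real.pi : ℂ) * ((x + b) / ω)).re (Real.pi * x * (1 / ω).re)
  linarith

theorem le_norm_sinh_div {ω : ℂ} (hω : 0 < ω.re) (r : ℝ) :
    ∃ X c : ℝ, 0 < X ∧ 0 < c ∧ ∀ (x : ℝ) (b : ℂ), X ≤ |x| → ‖b‖ ≤ r →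
      c * Real.exp (Real.pi * |x| * (1 / ω).re) ≤ ‖Complex.sinh (Real.pi * ((x + b) / ω))‖ := by
  have h2 := re_one_div_pos hω
  have hpi := Real.pi_pos
  refine ⟨(1 + |Real.pi * r / ‖ω‖|) / (Real.pi * (1 / ω).re), Real.exp (-(Real.pi * r / ‖ω‖)) / 3,
    by positivity, by positivity, fun x b hx hb => ?_⟩
  have h1 := abs_re_mul_div_le ω x hb
  have h3 : |Real.pi * x * (1 / ω).re| = Real.pi * |x| * (1 / ω).re := by
    rw [abs_mul, abs_mul, abs_of_pos Real.pi_pos, abs_of_pos h2]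
  have h4 := abs_sub_abs_le_abs_sub (Real.pi * x * (1 / ω).re) ((Real.pi : ℂ) * ((x + b) / ω)).re
  rw [abs_sub_comm, h3] at h4
  set s : ℝ := Real.pi * |x| * (1 / ω).re - Real.pi * r / ‖ω‖ with hs
  have hs1 : 1 ≤ s := by
    rw [div_le_iff₀ (by positivity)] at hx
    have := le_abs_self (Real.pi * r / ‖ω‖)
    linarith
  have hs2 : s ≤ |((Real.pi : ℂ) * ((x + b) / ω)).re| := by linarith
  refine le_trans ?_ (sinh_abs_re_le_norm_sinh _)
  refine le_trans ?_ (Real.sinh_le_sinh.2 hs2)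
  refine le_trans ?_ (mul_exp_div_le_sinh (by linarith))
  have e : Real.exp (-(Real.pi * r / ‖ω‖)) / 3 * Real.exp (Real.pi * |x| * (1 / ω).re)
      = Real.exp s / 3 := by
    rw [div_mul_eq_mul_div, ← Real.exp_add]; congr 2; rw [hs]; ring
  rw [e, div_le_div_iff₀ (by norm_num) (by linarith)]
  nlinarith [Real.exp_pos s]

theorem hypGammaShift_eq_sinh (x : ℝ) (a : ℂ) : hypGammaShift ω₁ ω₂ (x + a)
    = -2 * I * Complex.sinh (Real.pi * ((x + (a + I * ((ω₁ + ω₂) / 2))) / ω₂)) := by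
  rw [hypGammaShift, add_assoc]

theorem norm_neg_two_mul_I_mul (w : ℂ) : ‖-2 * I * w‖ = 2 * ‖w‖ := by
  rw [norm_mul, norm_mul, norm_neg, Complex.norm_I, Complex.norm_ofNat, mul_one]

/-- Upper bound for `G` on lines above its highest pole. -/
theorem norm_hypGamma_add_le (hω₁ : 0 < ω₁.re) (hω₂ : 0 < ω₂.re) {y : ℝ}
    (hy : y < (ω₁.re + ω₂.re) / 2) (r : ℝ) :
    ∃ M : ℝ, 0 ≤ M ∧ ∀ (x : ℝ) (a : ℂ), ‖a‖ ≤ r → -y ≤ a.im →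
      ‖hypGamma ω₁ ω₂ (x + a)‖
        ≤ M * Real.exp (Real.pi * |x| * hypRate ω₁ ω₂ a) * ‖hypGamma ω₁ ω₂ x‖ := by
  set y' : ℝ := max y (ω₁.re / 2) with hy'
  have hy'ρ : y' < (ω₁.re + ω₂.re) / 2 := max_lt hy (by linarith)
  have hy'1 : y ≤ y' := le_max_left _ _
  have hy'2 : ω₁.re / 2 ≤ y' := le_max_right _ _
  have key : ∀ (N : ℕ) (r : ℝ), ∃ M : ℝ, 0 ≤ M ∧ ∀ (x : ℝ) (a : ℂ), ‖a‖ ≤ r → -y' ≤ a.im →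
      a.im ≤ y' + N * ω₁.re → ‖hypGamma ω₁ ω₂ (x + a)‖
        ≤ M * Real.exp (Real.pi * |x| * hypRate ω₁ ω₂ a) * ‖hypGamma ω₁ ω₂ x‖ := by
    intro N
    induction N with
    | zero =>
      intro r
      obtain ⟨M, hM, h⟩ := norm_hypGamma_add_le_of_strip hω₁ hω₂ (r := r) hy'ρ
      refine ⟨M, hM, fun x a h1 h2 h3 => h x a h1 (abs_le.2 ⟨h2, by simpa using h3⟩)⟩
    | succ N ih =>
      intro r
      obtain ⟨M₁, hM₁, h1⟩ := ih r
      obtain ⟨M₂, hM₂, h2⟩ := ih (r + ‖I * ω₁‖)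
      obtain ⟨M₃, hM₃, h3⟩ := norm_sinh_div_le hω₂ (r + ‖I * ω₁‖ + ‖I * ((ω₁ + ω₂) / 2)‖)
      refine ⟨M₁ + 2 * M₃ * M₂, by positivity, fun x a har hal hau => ?_⟩
      have hNω : 0 ≤ N * ω₁.re := by positivity
      push_cast at hau
      rcases le_or_gt a.im (y' + N * ω₁.re) with h | h
      · refine (h1 x a har hal h).trans ?_
        gcongr
        have : 0 ≤ 2 * M₃ * M₂ := by positivity
        linarith
      · have him : (a - I * ω₁).im = a.im - ω₁.re := by simp
        have hn : ‖a - I * ω₁‖ ≤ r + ‖I * ω₁‖ := (norm_sub_le _ _).trans (by gcongr)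
        have e1 := hypGamma_add hω₁ hω₂ (z := x + (a - I * ω₁)) (by
          rw [Complex.add_im, him, Complex.ofReal_im]; linarith)
        rw [show (x : ℂ) + (a - I * ω₁) + I * ω₁ = x + a by ring] at e1
        have e2 := h2 x (a - I * ω₁) hn (by rw [him]; linarith) (by rw [him]; linarith)
        have e3 := h3 x (a - I * ω₁ + I * ((ω₁ + ω₂) / 2)) ((norm_add_le _ _).trans (by gcongr))
        rw [e1, norm_mul, hypGammaShift_eq_sinh, norm_neg_two_mul_I_mul]
        have e4 : Real.exp (Real.pi * |x| * (1 / ω₂).re)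
            * Real.exp (Real.pi * |x| * hypRate ω₁ ω₂ (a - I * ω₁))
            = Real.exp (Real.pi * |x| * hypRate ω₁ ω₂ a) := by
          rw [← Real.exp_add, hypRate_sub, hypRate_I_mul_left hω₁]; congr 1; ring
        calc _ ≤ 2 * (M₃ * Real.exp (Real.pi * |x| * (1 / ω₂).re))
              * (M₂ * Real.exp (Real.pi * |x| * hypRate ω₁ ω₂ (a - I * ω₁))
                * ‖hypGamma ω₁ ω₂ x‖) := by gcongr
          _ = 2 * M₃ * M₂ * Real.exp (Real.pi * |x| * hypRate ω₁ ω₂ a)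
                * ‖hypGamma ω₁ ω₂ x‖ := by rw [← e4]; ring
          _ ≤ _ := by gcongr; linarith
  obtain ⟨N, hN⟩ := exists_nat_gt (r / ω₁.re)
  rw [div_lt_iff₀ hω₁] at hN
  obtain ⟨M, hM, h⟩ := key N r
  refine ⟨M, hM, fun x a har hal => h x a har (by linarith) ?_⟩
  have := (le_abs_self _).trans ((Complex.abs_im_le_norm a).trans har)
  have h0 : 0 ≤ y' := by linarith
  linarith

/-- Upper bound for `G` on arbitrary horizontal lines, away from the poles. -/
theorem norm_hypGamma_add_le_of_large (hω₁ : 0 < ω₁.re) (hω₂ : 0 < ω₂.re) (r : ℝ) :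
    ∃ M X : ℝ, 0 ≤ M ∧ 0 ≤ X ∧ ∀ (x : ℝ) (a : ℂ), X ≤ |x| → ‖a‖ ≤ r →
      ‖hypGamma ω₁ ω₂ (x + a)‖
        ≤ M * Real.exp (Real.pi * |x| * hypRate ω₁ ω₂ a) * ‖hypGamma ω₁ ω₂ x‖ := by
  have key : ∀ (N : ℕ) (r : ℝ), ∃ M X : ℝ, 0 ≤ M ∧ 0 ≤ X ∧ ∀ (x : ℝ) (a : ℂ), X ≤ |x| → ‖a‖ ≤ r →
      -(ω₁.re / 2) - N * ω₁.re ≤ a.im → ‖hypGamma ω₁ ω₂ (x + a)‖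
        ≤ M * Real.exp (Real.pi * |x| * hypRate ω₁ ω₂ a) * ‖hypGamma ω₁ ω₂ x‖ := by
    intro N
    induction N with
    | zero =>
      intro r
      obtain ⟨M, hM, h⟩ := norm_hypGamma_add_le hω₁ hω₂ (y := ω₁.re / 2) (by linarith) r
      exact ⟨M, 0, hM, le_rfl, fun x a _ h1 h2 => h x a h1 (by simpa using h2)⟩
    | succ N ih =>
      intro r
      obtain ⟨M₁, X₁, hM₁, hX₁, h1⟩ := ih r
      obtain ⟨M₂, X₂, hM₂, hX₂, h2⟩ := ih (r + ‖I * ω₁‖)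
      obtain ⟨X₃, c, hX₃, hc, h3⟩ := le_norm_sinh_div hω₂ (r + ‖I * ((ω₁ + ω₂) / 2)‖)
      refine ⟨M₁ + M₂ / (2 * c), max X₁ (max X₂ X₃), by positivity, by positivity,
        fun x a hx har hal => ?_⟩
      have hx1 : X₁ ≤ |x| := (le_max_left _ _).trans hx
      have hx2 : X₂ ≤ |x| := ((le_max_left _ _).trans (le_max_right _ _)).trans hx
      have hx3 : X₃ ≤ |x| := ((le_max_right _ _).trans (le_max_right _ _)).trans hx
      have hNω : 0 ≤ N * ω₁.re := by positivity
      push_cast at hal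
      rcases le_or_gt (-(ω₁.re / 2) - N * ω₁.re) a.im with h | h
      · refine (h1 x a hx1 har h).trans ?_
        gcongr
        have : 0 ≤ M₂ / (2 * c) := by positivity
        linarith
      · have him : (a + I * ω₁).im = a.im + ω₁.re := by simp
        have hn : ‖a + I * ω₁‖ ≤ r + ‖I * ω₁‖ := (norm_add_le _ _).trans (by gcongr)
        have e1 := hypGamma_sub_of_lt (ω₂ := ω₂) hω₁ (z := x + (a + I * ω₁)) (by
          rw [Complex.add_im, him, Complex.ofReal_im]; linarith)
        rw [show (x : ℂ) + (a + I * ω₁) - I * ω₁ = x + a by ring] at e1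
        have e2 := h2 x (a + I * ω₁) hx2 hn (by rw [him]; linarith)
        have e3 := h3 x (a + I * ((ω₁ + ω₂) / 2)) hx3 ((norm_add_le _ _).trans (by gcongr))
        rw [e1, norm_div, hypGammaShift_eq_sinh, norm_neg_two_mul_I_mul]
        have e4 : Real.exp (Real.pi * |x| * hypRate ω₁ ω₂ (a + I * ω₁))
            = Real.exp (Real.pi * |x| * hypRate ω₁ ω₂ a)
              * Real.exp (Real.pi * |x| * (1 / ω₂).re) := by
          rw [← Real.exp_add, hypRate_add, hypRate_I_mul_left hω₁]; congr 1; ring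
        have hpos : 0 < c * Real.exp (Real.pi * |x| * (1 / ω₂).re) := by positivity
        calc _ ≤ (M₂ * Real.exp (Real.pi * |x| * hypRate ω₁ ω₂ (a + I * ω₁))
                * ‖hypGamma ω₁ ω₂ x‖) / (2 * (c * Real.exp (Real.pi * |x| * (1 / ω₂).re))) := by
              gcongr
          _ = M₂ / (2 * c) * Real.exp (Real.pi * |x| * hypRate ω₁ ω₂ a)
                * ‖hypGamma ω₁ ω₂ x‖ := by rw [e4]; field_simp
          _ ≤ _ := by gcongr; linarith
  obtain ⟨N, hN⟩ := exists_nat_gt (r / ω₁.re)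
  rw [div_lt_iff₀ hω₁] at hN
  obtain ⟨M, X, hM, hX, h⟩ := key N r
  refine ⟨M, X, hM, hX, fun x a hx har => h x a hx har ?_⟩
  have := (neg_abs_le a.im)
  have h1 := (Complex.abs_im_le_norm a).trans har
  linarith

end growth

noncomputable section

variable {ω₁ ω₂ : ℂ}

/-! ### Integrals of hyperbolic gamma functions -/

/-- The point `η = i ω`, minus which is the highest pole of `G`. -/
def hypEta (ω₁ ω₂ : ℂ) : ℂ := I * ((ω₁ + ω₂) / 2)

/-- The product `G(v + z) G(v - z)`. -/
def hypPair (ω₁ ω₂ v z : ℂ) : ℂ := hypGamma ω₁ ω₂ (v + z) * hypGamma ω₁ ω₂ (v - z)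

/-- The weight `G(iω + 2z) G(iω - 2z)`, as an entire function of `z`. -/
def hypWeight (ω₁ ω₂ z : ℂ) : ℂ :=
  4 * Complex.sinh (2 * Real.pi * z / ω₁) * Complex.sinh (2 * Real.pi * z / ω₂)

/-- The integrand `G(iω ± 2z) ∏ⱼ G(vⱼ ± z)`. As `G(-z) = 1 / G(z)`, this is `hypIntegrand` for
`u = -v` when `n = 8`. -/
def hypKernel (ω₁ ω₂ : ℂ) {n : ℕ} (v : Fin n → ℂ) (z : ℂ) : ℂ :=
  hypWeight ω₁ ω₂ z * ∏ j, hypPair ω₁ ω₂ (v j) z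

/-- The integral of `hypKernel` over the real line. -/
def hypInt (ω₁ ω₂ : ℂ) {n : ℕ} (v : Fin n → ℂ) : ℂ := ∫ x : ℝ, hypKernel ω₁ ω₂ v x

/-- The parameters for which the integral `hypInt` converges exponentially and the real line lies
above the poles of `G(vⱼ + z)` and below those of `G(vⱼ - z)`. -/
def hypDomain (ω₁ ω₂ : ℂ) (n : ℕ) : Set (Fin n → ℂ) :=
  {v | (∀ j, -((ω₁.re + ω₂.re) / 2) < (v j).im) ∧
    hypRate ω₁ ω₂ (∑ j, v j) + ((1 / ω₁).re + (1 / ω₂).re) < 0}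

theorem hypEta_im (ω₁ ω₂ : ℂ) : (hypEta ω₁ ω₂).im = (ω₁.re + ω₂.re) / 2 := by
  simp [hypEta]

theorem hypRate_hypEta (hω₁ : 0 < ω₁.re) (hω₂ : 0 < ω₂.re) :
    hypRate ω₁ ω₂ (hypEta ω₁ ω₂) = ((1 / ω₁).re + (1 / ω₂).re) / 2 := by
  have h : hypEta ω₁ ω₂ = ((1 / 2 : ℝ) : ℂ) * (I * ω₁ + I * ω₂) := by
    rw [hypEta]; push_cast; ring
  rw [h, hypRate_real_mul, hypRate_add, hypRate_I_mul_left hω₁, hypRate_I_mul_right hω₂]; ring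

theorem hypRate_sum {ι : Type*} (s : Finset ι) (v : ι → ℂ) :
    hypRate ω₁ ω₂ (∑ j ∈ s, v j) = ∑ j ∈ s, hypRate ω₁ ω₂ (v j) := by
  simp [hypRate, Finset.sum_div]

theorem integrable_exp_neg_mul_abs {c : ℝ} (hc : 0 < c) :
    Integrable (fun x : ℝ => Real.exp (-c * |x|)) := by
  rw [← integrableOn_univ, ← Set.Iic_union_Ioi (a := (0 : ℝ))]
  refine IntegrableOn.union ?_ ?_
  · refine (integrableOn_exp_mul_Iic hc 0).congr_fun (fun x hx => ?_) measurableSet_Iic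
    have hx' : x ≤ 0 := hx
    simp only [abs_of_nonpos hx']; ring_nf
  · refine (exp_neg_integrableOn_Ioi 0 hc).congr_fun (fun x hx => ?_) measurableSet_Ioi
    have hx' : 0 < x := hx
    simp only [abs_of_pos hx']

theorem norm_hypGamma_mul_le (hω₁ : 0 < ω₁.re) (hω₂ : 0 < ω₂.re) {y : ℝ}
    (hy : y < (ω₁.re + ω₂.re) / 2) (r : ℝ) :
    ∃ M : ℝ, 0 ≤ M ∧ ∀ (x : ℝ) (a b : ℂ), ‖a‖ ≤ r → ‖b‖ ≤ r → -y ≤ a.im → -y ≤ b.im →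
      ‖hypGamma ω₁ ω₂ (a + x) * hypGamma ω₁ ω₂ (b - x)‖
        ≤ M * Real.exp (Real.pi * |x| * (hypRate ω₁ ω₂ a + hypRate ω₁ ω₂ b)) := by
  obtain ⟨M, hM, h⟩ := norm_hypGamma_add_le hω₁ hω₂ hy r
  refine ⟨M * M, by positivity, fun x a b ha hb hay hby => ?_⟩
  have h1 := h x a ha hay
  have h2 := h (-x) b hb hby
  have h0 : hypGamma ω₁ ω₂ (x : ℂ) ≠ 0 := hypGamma_ne_zero hω₁ hω₂ (by simp; linarith)
  have h3 : ‖hypGamma ω₁ ω₂ (x : ℂ)‖ * ‖hypGamma ω₁ ω₂ ((-x : ℝ) : ℂ)‖ = 1 := by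
    rw [← norm_mul, Complex.ofReal_neg, hypGamma_neg hω₁ hω₂, mul_inv_cancel₀ h0, norm_one]
  rw [norm_mul, show a + x = x + a by ring, show b - x = ((-x : ℝ) : ℂ) + b by push_cast; ring]
  rw [abs_neg] at h2
  calc _ ≤ _ := mul_le_mul h1 h2 (norm_nonneg _) (by positivity)
    _ = M * M * (Real.exp (Real.pi * |x| * hypRate ω₁ ω₂ a)
        * Real.exp (Real.pi * |x| * hypRate ω₁ ω₂ b))
        * (‖hypGamma ω₁ ω₂ (x : ℂ)‖ * ‖hypGamma ω₁ ω₂ ((-x : ℝ) : ℂ)‖) := by ring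
    _ = _ := by rw [h3, mul_one, ← Real.exp_add, ← mul_add]

theorem norm_prod_hypPair_le (hω₁ : 0 < ω₁.re) (hω₂ : 0 < ω₂.re) (n : ℕ) {y : ℝ}
    (hy : y < (ω₁.re + ω₂.re) / 2) (r : ℝ) :
    ∃ M : ℝ, 0 ≤ M ∧ ∀ (x : ℝ) (w : ℂ) (v : Fin n → ℂ), (∀ j, ‖v j‖ ≤ r) → ‖w‖ ≤ r →
      (∀ j, -y ≤ (v j).im - |w.im|) →
      ‖∏ j, hypPair ω₁ ω₂ (v j) (x + w)‖
        ≤ M * Real.exp (2 * Real.pi * |x| * hypRate ω₁ ω₂ (∑ j, v j)) := by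
  obtain ⟨M, hM, h⟩ := norm_hypGamma_mul_le hω₁ hω₂ hy (r + r)
  refine ⟨M ^ n, by positivity, fun x w v hv hw hvw => ?_⟩
  have h1 : ∀ j, ‖hypPair ω₁ ω₂ (v j) (x + w)‖
      ≤ M * Real.exp (2 * Real.pi * |x| * hypRate ω₁ ω₂ (v j)) := by
    intro j
    have := abs_le.1 (le_refl |w.im|)
    have h2 := h x (v j + w) (v j - w) ((norm_add_le _ _).trans (add_le_add (hv j) hw))
      ((norm_sub_le _ _).trans (add_le_add (hv j) hw))
      (by have := hvw j; rw [Complex.add_im]; linarith)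
      (by have := hvw j; rw [Complex.sub_im]; linarith)
    rw [hypPair, show v j + (x + w) = v j + w + x by ring,
      show v j - (x + w) = v j - w - x by ring]
    refine h2.trans (le_of_eq ?_)
    rw [hypRate_add, hypRate_sub]; ring_nf
  rw [norm_prod]
  calc _ ≤ ∏ j, M * Real.exp (2 * Real.pi * |x| * hypRate ω₁ ω₂ (v j)) :=
        Finset.prod_le_prod (fun _ _ => norm_nonneg _) fun j _ => h1 j
    _ = _ := by
      rw [Finset.prod_mul_distrib, ← Real.exp_sum, hypRate_sum, Finset.mul_sum]; simp

theorem norm_sinh_two_mul_div_le {ω : ℂ} (hω : 0 < ω.re) (r : ℝ) :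
    ∃ M : ℝ, 0 ≤ M ∧ ∀ (x : ℝ) (b : ℂ), ‖b‖ ≤ r →
      ‖Complex.sinh (2 * Real.pi * (x + b) / ω)‖
        ≤ M * Real.exp (2 * Real.pi * |x| * (1 / ω).re) := by
  obtain ⟨M, hM, h⟩ := norm_sinh_div_le hω (2 * r)
  refine ⟨M, hM, fun x b hb => ?_⟩
  have h1 := h (2 * x) (2 * b) (by rw [norm_mul, Complex.norm_ofNat]; linarith)
  rw [show (2 * Real.pi * (x + b) / ω : ℂ) = Real.pi * (((2 * x : ℝ) + 2 * b) / ω) by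
    push_cast; ring]
  refine h1.trans (le_of_eq ?_)
  rw [abs_mul, abs_two]; ring_nf

theorem norm_hypWeight_le (hω₁ : 0 < ω₁.re) (hω₂ : 0 < ω₂.re) (r : ℝ) :
    ∃ M : ℝ, 0 ≤ M ∧ ∀ (x : ℝ) (b : ℂ), ‖b‖ ≤ r → ‖hypWeight ω₁ ω₂ (x + b)‖
      ≤ M * Real.exp (2 * Real.pi * |x| * ((1 / ω₁).re + (1 / ω₂).re)) := by
  obtain ⟨M₁, hM₁, h₁⟩ := norm_sinh_two_mul_div_le hω₁ r
  obtain ⟨M₂, hM₂, h₂⟩ := norm_sinh_two_mul_div_le hω₂ r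
  refine ⟨4 * M₁ * M₂, by positivity, fun x b hb => ?_⟩
  rw [hypWeight, norm_mul, norm_mul, Complex.norm_ofNat]
  calc _ ≤ _ := mul_le_mul (mul_le_mul_of_nonneg_left (h₁ x b hb) (by norm_num)) (h₂ x b hb)
        (norm_nonneg _) (by positivity)
    _ = _ := by rw [mul_add, Real.exp_add]; ring

theorem hypWeight_neg (z : ℂ) : hypWeight ω₁ ω₂ (-z) = hypWeight ω₁ ω₂ z := by
  simp only [hypWeight, mul_neg, neg_div, Complex.sinh_neg]; ring

theorem hypPair_neg (v z : ℂ) : hypPair ω₁ ω₂ v (-z) = hypPair ω₁ ω₂ v z := by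
  simp only [hypPair, sub_neg_eq_add, ← sub_eq_add_neg]; ring

theorem differentiable_hypWeight (ω₁ ω₂ : ℂ) : Differentiable ℂ (hypWeight ω₁ ω₂) := by
  unfold hypWeight; fun_prop

theorem analyticAt_hypGamma (hω₁ : 0 < ω₁.re) (hω₂ : 0 < ω₂.re) {z : ℂ}
    (hz : -((ω₁.re + ω₂.re) / 2) < z.im) : AnalyticAt ℂ (hypGamma ω₁ ω₂) z :=
  (differentiableOn_hypGamma hω₁ hω₂).analyticAt ((isOpen_halfPlane _).mem_nhds hz)

theorem differentiableAt_hypPair_right (hω₁ : 0 < ω₁.re) (hω₂ : 0 < ω₂.re) {v z : ℂ}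
    (h1 : -((ω₁.re + ω₂.re) / 2) < (v + z).im) (h2 : -((ω₁.re + ω₂.re) / 2) < (v - z).im) :
    DifferentiableAt ℂ (hypPair ω₁ ω₂ v) z :=
  ((differentiableAt_hypGamma hω₁ hω₂ h1).comp z (by fun_prop)).mul
    ((differentiableAt_hypGamma hω₁ hω₂ h2).comp z (by fun_prop))

theorem analyticAt_hypPair_left (hω₁ : 0 < ω₁.re) (hω₂ : 0 < ω₂.re) {v z : ℂ}
    (h1 : -((ω₁.re + ω₂.re) / 2) < (v + z).im) (h2 : -((ω₁.re + ω₂.re) / 2) < (v - z).im) :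
    AnalyticAt ℂ (fun v => hypPair ω₁ ω₂ v z) v :=
  ((analyticAt_hypGamma hω₁ hω₂ h1).comp_of_eq (f := fun v => v + z) (by fun_prop) rfl).mul
    ((analyticAt_hypGamma hω₁ hω₂ h2).comp_of_eq (f := fun v => v - z) (by fun_prop) rfl)

theorem continuous_hypKernel (hω₁ : 0 < ω₁.re) (hω₂ : 0 < ω₂.re) {n : ℕ} {v : Fin n → ℂ}
    (hv : ∀ j, -((ω₁.re + ω₂.re) / 2) < (v j).im) :
    Continuous fun x : ℝ => hypKernel ω₁ ω₂ v x := by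
  unfold hypKernel
  refine ((differentiable_hypWeight ω₁ ω₂).continuous.comp continuous_ofReal).mul
    (continuous_finsetProd _ fun j _ => continuous_iff_continuousAt.2 fun x => ?_)
  exact (differentiableAt_hypPair_right hω₁ hω₂ (by simpa using hv j)
    (by simpa using hv j)).continuousAt.comp (f := fun x : ℝ => (x : ℂ))
    continuous_ofReal.continuousAt

theorem isOpen_hypDomain (ω₁ ω₂ : ℂ) (n : ℕ) : IsOpen (hypDomain ω₁ ω₂ n) := by
  have h1 := continuous_hypRate ω₁ ω₂
  have e : hypDomain ω₁ ω₂ n = (⋂ j, {v | -((ω₁.re + ω₂.re) / 2) < (v j).im}) ∩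
      {v | hypRate ω₁ ω₂ (∑ j, v j) + ((1 / ω₁).re + (1 / ω₂).re) < 0} := by
    ext; simp [hypDomain]
  rw [e]
  refine IsOpen.inter ?_ ?_
  · exact isOpen_iInter_of_finite fun j => isOpen_lt continuous_const
      (Complex.continuous_im.comp (continuous_apply j))
  · exact isOpen_lt (f := fun v : Fin n → ℂ =>
      hypRate ω₁ ω₂ (∑ j, v j) + ((1 / ω₁).re + (1 / ω₂).re)) (by fun_prop) continuous_const

theorem norm_hypKernel_le (hω₁ : 0 < ω₁.re) (hω₂ : 0 < ω₂.re) (n : ℕ) {y : ℝ}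
    (hy : y < (ω₁.re + ω₂.re) / 2) (r : ℝ) :
    ∃ M : ℝ, 0 ≤ M ∧ ∀ (x : ℝ) (v : Fin n → ℂ), (∀ j, ‖v j‖ ≤ r) → (∀ j, -y ≤ (v j).im) →
      ‖hypKernel ω₁ ω₂ v x‖ ≤ M * Real.exp (2 * Real.pi * |x|
        * (hypRate ω₁ ω₂ (∑ j, v j) + ((1 / ω₁).re + (1 / ω₂).re))) := by
  obtain ⟨M₁, hM₁, h₁⟩ := norm_prod_hypPair_le hω₁ hω₂ n hy (max r 0)
  obtain ⟨M₂, hM₂, h₂⟩ := norm_hypWeight_le hω₁ hω₂ 0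
  refine ⟨M₂ * M₁, by positivity, fun x v hv hvy => ?_⟩
  have e1 := h₁ x 0 v (fun j => (hv j).trans (le_max_left _ _)) (by simp) (by simpa using hvy)
  have e2 := h₂ x 0 (by simp)
  rw [add_zero] at e1 e2
  rw [hypKernel, norm_mul]
  calc _ ≤ _ := mul_le_mul e2 e1 (norm_nonneg _) (by positivity)
    _ = _ := by
      generalize (1 / ω₁).re + (1 / ω₂).re = K
      rw [mul_add, Real.exp_add]
      ring

/-- Locally uniform integrable bound for the integrand. -/
theorem exists_bound_hypKernel (hω₁ : 0 < ω₁.re) (hω₂ : 0 < ω₂.re) {n : ℕ} {v : Fin n → ℂ}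
    (hv : v ∈ hypDomain ω₁ ω₂ n) : ∃ r > 0, ∃ g : ℝ → ℝ, Integrable g ∧
      ∀ x : ℝ, ∀ v' ∈ Metric.ball v r, ‖hypKernel ω₁ ω₂ v' x‖ ≤ g x := by
  set ρ := (ω₁.re + ω₂.re) / 2 with hρ
  set k := hypRate ω₁ ω₂ (∑ j, v j) + ((1 / ω₁).re + (1 / ω₂).re) with hk
  have hk0 : k < 0 := hv.2
  obtain ⟨y, hyρ, hy⟩ : ∃ y, y < ρ ∧ ∀ j, -y < (v j).im := by
    have h1 : ∀ᶠ y in 𝓝[<] ρ, ∀ j, -y < (v j).im := by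
      rw [eventually_all]
      intro j
      refine eventually_nhdsWithin_of_eventually_nhds ?_
      have hc : ContinuousAt (fun y : ℝ => -y) ρ := by fun_prop
      exact hc.eventually_lt_const (hv.1 j)
    obtain ⟨y, h2, h3⟩ := (h1.and self_mem_nhdsWithin).exists
    exact ⟨y, h3, h2⟩
  obtain ⟨M, hM, h⟩ := norm_hypKernel_le hω₁ hω₂ n hyρ (‖v‖ + 1)
  have hc := continuous_hypRate ω₁ ω₂
  have hev : ∀ᶠ v' in 𝓝 v, (∀ j, -y < (v' j).im) ∧
      hypRate ω₁ ω₂ (∑ j, v' j) + ((1 / ω₁).re + (1 / ω₂).re) < k / 2 := by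
    refine Filter.Eventually.and ?_ ?_
    · rw [eventually_all]
      intro j
      have hc : ContinuousAt (fun v' : Fin n → ℂ => (v' j).im) v :=
        (Complex.continuous_im.comp (continuous_apply j)).continuousAt
      exact hc.eventually_const_lt (hy j)
    · have hc : ContinuousAt (fun v' : Fin n → ℂ =>
        hypRate ω₁ ω₂ (∑ j, v' j) + ((1 / ω₁).re + (1 / ω₂).re)) v := by fun_prop
      exact hc.eventually_lt_const (by simp only [← hk]; linarith)
  obtain ⟨r, hr, hr'⟩ := Metric.eventually_nhds_iff.1 hev
  refine ⟨min r 1, by positivity, fun x => M * Real.exp (-(Real.pi * -k) * |x|),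
    (integrable_exp_neg_mul_abs (by have := Real.pi_pos; nlinarith)).const_mul _,
    fun x v' hv' => ?_⟩
  have hd : dist v' v < min r 1 := hv'
  have hd1 := hr' (hd.trans_le (min_le_left _ _))
  refine (h x v' (fun j => ?_) (fun j => (hd1.1 j).le)).trans ?_
  · refine (norm_le_pi_norm v' j).trans ?_
    have h2 := norm_add_le v (v' - v)
    rw [add_sub_cancel, ← dist_eq_norm] at h2
    have := hd.le.trans (min_le_right _ _)
    linarith
  · have h2 := abs_nonneg x
    refine mul_le_mul_of_nonneg_left (Real.exp_le_exp.2 ?_) hM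
    have := mul_le_mul_of_nonneg_left hd1.2.le (show 0 ≤ 2 * Real.pi * |x| by positivity)
    linarith

theorem integrable_hypKernel (hω₁ : 0 < ω₁.re) (hω₂ : 0 < ω₂.re) {n : ℕ} {v : Fin n → ℂ}
    (hv : v ∈ hypDomain ω₁ ω₂ n) : Integrable fun x : ℝ => hypKernel ω₁ ω₂ v x := by
  obtain ⟨r, hr, g, hg, h⟩ := exists_bound_hypKernel hω₁ hω₂ hv
  exact hg.mono' (continuous_hypKernel hω₁ hω₂ hv.1).aestronglyMeasurable
    (ae_of_all _ fun x => h x v (Metric.mem_ball_self hr))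

theorem analyticOnNhd_hypInt (hω₁ : 0 < ω₁.re) (hω₂ : 0 < ω₂.re) (n : ℕ) :
    AnalyticOnNhd ℂ (fun v => hypInt ω₁ ω₂ v) (hypDomain ω₁ ω₂ n) := by
  refine analyticOnNhd_integral (F := fun v (x : ℝ) => hypKernel ω₁ ω₂ v x)
    (isOpen_hypDomain ω₁ ω₂ n)
    (fun v hv => (continuous_hypKernel hω₁ hω₂ hv.1).aestronglyMeasurable)
    (ae_of_all _ fun x v hv => ?_) (fun v hv => ?_)
  · refine DifferentiableAt.differentiableWithinAt (AnalyticAt.differentiableAt ?_)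
    unfold hypKernel
    refine analyticAt_const.mul (Finset.analyticAt_fun_prod _ fun j _ => ?_)
    exact (analyticAt_hypPair_left hω₁ hω₂ (by simpa using hv.1 j)
      (by simpa using hv.1 j)).comp_of_eq (f := fun v : Fin n → ℂ => v j)
      ((ContinuousLinearMap.proj (R := ℂ) (φ := fun _ : Fin n => ℂ) j).analyticAt v) rfl
  · obtain ⟨r, hr, g, hg, h⟩ := exists_bound_hypKernel hω₁ hω₂ hv
    exact ⟨r, hr, g, hg, ae_of_all _ h⟩

theorem hypInt_comp_perm {n : ℕ} (v : Fin n → ℂ) (σ : Equiv.Perm (Fin n)) :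
    hypInt ω₁ ω₂ (v ∘ σ) = hypInt ω₁ ω₂ v := by
  unfold hypInt hypKernel
  refine integral_congr_ae (ae_of_all _ fun x => ?_)
  have h : ∏ j, hypPair ω₁ ω₂ ((v ∘ σ) j) x = ∏ j, hypPair ω₁ ω₂ (v j) x :=
    Equiv.prod_comp σ fun j => hypPair ω₁ ω₂ (v j) x
  simp only [h]

theorem mem_hypDomain (hω₁ : 0 < ω₁.re) (hω₂ : 0 < ω₂.re) {n : ℕ} {v : Fin n → ℂ}
    (hv : ∀ j, -((ω₁.re + ω₂.re) / 2) < (v j).im) (hs : ∑ j, v j = -4 * hypEta ω₁ ω₂) :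
    v ∈ hypDomain ω₁ ω₂ n := by
  refine ⟨hv, ?_⟩
  have h1 := re_one_div_pos hω₁
  have h2 := re_one_div_pos hω₂
  rw [hs, show (-4 : ℂ) * hypEta ω₁ ω₂ = ((-4 : ℝ) : ℂ) * hypEta ω₁ ω₂ by push_cast; ring,
    hypRate_real_mul, hypRate_hypEta hω₁ hω₂]
  linarith


/-! ### The hyperbolic beta integral -/

/-- Partial fraction identity behind the contiguous relation, in the variables `exp (2·)`. -/
theorem balanced_six_term_identity {p q a b c d T : ℂ} (h : p * q * (a * b * c * d) = 1) :
    p * q * (q - p) * ((p * T - 1) * (a * T - 1) * (b * T - 1) * (c * T - 1) * (d * T - 1)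
        * (q * T - 1) - (p - T) * (a - T) * (b - T) * (c - T) * (d - T) * (q - T))
      = T * (T ^ 2 - 1) *
        (q * ((p * a - 1) * (p * b - 1) * (p * c - 1) * (p * d - 1)) * ((q * T - 1) * (q - T))
        - p * ((q * a - 1) * (q * b - 1) * (q * c - 1) * (q * d - 1)) * ((p * T - 1) * (p - T))) := by
  linear_combination (-(p * q * (q - p) * ((p * T - 1) * (q * T - 1)
    - T ^ 4 * ((p - T) * (q - T))) - T * (T ^ 2 - 1) * (q * ((q * T - 1) * (q - T))
    - p * ((p * T - 1) * (p - T))))) * h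

theorem sinh_add_eq_div {y x : ℂ} : Complex.sinh (y + x) =
    (Complex.exp y ^ 2 * Complex.exp x ^ 2 - 1) / (2 * (Complex.exp y * Complex.exp x)) := by
  have h1 := Complex.exp_ne_zero y
  have h2 := Complex.exp_ne_zero x
  rw [Complex.sinh, Complex.exp_neg, Complex.exp_add]
  field_simp

theorem sinh_sub_eq_div {y x : ℂ} : Complex.sinh (y - x) =
    (Complex.exp y ^ 2 - Complex.exp x ^ 2) / (2 * (Complex.exp y * Complex.exp x)) := by
  have h1 := Complex.exp_ne_zero y
  have h2 := Complex.exp_ne_zero x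
  rw [Complex.sinh, Complex.exp_neg, Complex.exp_sub]
  field_simp

/-- The trigonometric identity behind the invariance of the beta integral under contiguous
shifts of two of its parameters. -/
theorem sinh_balanced_identity {y a b c d z X : ℂ} (h : y + a + b + c + d + z = Real.pi * I) :
    Complex.sinh (z - y) * (Complex.sinh (y + X) * Complex.sinh (a + X) * Complex.sinh (b + X)
        * Complex.sinh (c + X) * Complex.sinh (d + X) * Complex.sinh (z + X)
      - Complex.sinh (y - X) * Complex.sinh (a - X) * Complex.sinh (b - X)
        * Complex.sinh (c - X) * Complex.sinh (d - X) * Complex.sinh (z - X))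
      = Complex.sinh (2 * X) *
        (Complex.sinh (y + a) * Complex.sinh (y + b) * Complex.sinh (y + c) * Complex.sinh (y + d)
          * (Complex.sinh (z + X) * Complex.sinh (z - X))
        - Complex.sinh (z + a) * Complex.sinh (z + b) * Complex.sinh (z + c) * Complex.sinh (z + d)
          * (Complex.sinh (y + X) * Complex.sinh (y - X))) := by
  have he : Complex.exp y * Complex.exp a * Complex.exp b * Complex.exp c * Complex.exp d
      * Complex.exp z = -1 := by
    rw [← Complex.exp_add, ← Complex.exp_add, ← Complex.exp_add, ← Complex.exp_add,
      ← Complex.exp_add, h, Complex.exp_pi_mul_I]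
  rw [two_mul]
  simp only [sinh_add_eq_div, sinh_sub_eq_div]
  have n1 := Complex.exp_ne_zero y
  have n2 := Complex.exp_ne_zero a
  have n3 := Complex.exp_ne_zero b
  have n4 := Complex.exp_ne_zero c
  have n5 := Complex.exp_ne_zero d
  have n6 := Complex.exp_ne_zero z
  have n7 := Complex.exp_ne_zero X
  generalize Complex.exp y = y at *
  generalize Complex.exp a = a at *
  generalize Complex.exp b = b at *
  generalize Complex.exp c = c at *
  generalize Complex.exp d = d at *
  generalize Complex.exp z = z at *
  generalize Complex.exp X = E at *
  have key := balanced_six_term_identity (p := y ^ 2) (q := z ^ 2) (a := a ^ 2) (b := b ^ 2)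
    (c := c ^ 2) (d := d ^ 2) (T := E ^ 2) (by linear_combination (y * a * b * c * d * z - 1) * he)
  have hA : ∀ q₁ q₂ q₃ q₄ q₅ q₆ : ℂ, q₁ / (2 * (y * E)) * (q₂ / (2 * (a * E)))
      * (q₃ / (2 * (b * E))) * (q₄ / (2 * (c * E))) * (q₅ / (2 * (d * E))) * (q₆ / (2 * (z * E)))
      = -(q₁ * q₂ * q₃ * q₄ * q₅ * q₆) / (64 * E ^ 6) := by
    intro q₁ q₂ q₃ q₄ q₅ q₆
    field_simp
    linear_combination 64 * (q₁ * q₂ * q₃ * q₄ * q₅ * q₆) * he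
  have hB : ∀ q₂ q₃ q₄ q₅ : ℂ, q₂ / (2 * (y * a)) * (q₃ / (2 * (y * b)))
      * (q₄ / (2 * (y * c))) * (q₅ / (2 * (y * d))) = -(q₂ * q₃ * q₄ * q₅) * z / (16 * y ^ 3) := by
    intro q₂ q₃ q₄ q₅
    field_simp
    linear_combination 16 * (q₂ * q₃ * q₄ * q₅) * he
  have hC : ∀ q₂ q₃ q₄ q₅ : ℂ, q₂ / (2 * (z * a)) * (q₃ / (2 * (z * b)))
      * (q₄ / (2 * (z * c))) * (q₅ / (2 * (z * d))) = -(q₂ * q₃ * q₄ * q₅) * y / (16 * z ^ 3) := by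
    intro q₂ q₃ q₄ q₅
    field_simp
    linear_combination 16 * (q₂ * q₃ * q₄ * q₅) * he
  rw [hA, hA, hB, hC]
  generalize (y ^ 2 * E ^ 2 - 1) * (a ^ 2 * E ^ 2 - 1) * (b ^ 2 * E ^ 2 - 1) * (c ^ 2 * E ^ 2 - 1)
    * (d ^ 2 * E ^ 2 - 1) * (z ^ 2 * E ^ 2 - 1) = A at *
  generalize (y ^ 2 - E ^ 2) * (a ^ 2 - E ^ 2) * (b ^ 2 - E ^ 2) * (c ^ 2 - E ^ 2)
    * (d ^ 2 - E ^ 2) * (z ^ 2 - E ^ 2) = B at *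
  generalize (y ^ 2 * a ^ 2 - 1) * (y ^ 2 * b ^ 2 - 1) * (y ^ 2 * c ^ 2 - 1) * (y ^ 2 * d ^ 2 - 1)
    = C at *
  generalize (z ^ 2 * a ^ 2 - 1) * (z ^ 2 * b ^ 2 - 1) * (z ^ 2 * c ^ 2 - 1) * (z ^ 2 * d ^ 2 - 1)
    = D at *
  field_simp
  linear_combination -64 * key

theorem integrable_of_strip {f : ℂ → ℂ} {lo hi : ℝ}
    (hf : DifferentiableOn ℂ f {z | lo < z.im ∧ z.im < hi})
    (hb : ∀ w : ℂ, lo < w.im → w.im < hi → ∃ r > 0, ∃ g : ℝ → ℝ, Integrable g ∧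
      ∀ x : ℝ, ∀ w' ∈ Metric.ball w r, ‖f (x + w')‖ ≤ g x)
    {w : ℂ} (hw : lo < w.im ∧ w.im < hi) : Integrable fun x : ℝ => f (x + w) := by
  obtain ⟨r, hr, g, hg, h⟩ := hb w hw.1 hw.2
  refine hg.mono' (Continuous.aestronglyMeasurable (continuous_iff_continuousAt.2 fun x => ?_))
    (ae_of_all _ fun x => h x w (Metric.mem_ball_self hr))
  have h1 : DifferentiableAt ℂ f (x + w) :=
    hf.differentiableAt ((isOpen_strip lo hi).mem_nhds (by simpa using hw))
  exact h1.continuousAt.comp (f := fun x : ℝ => (x : ℂ) + w) (by fun_prop)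

theorem hypGamma_add_mul (hω₁ : 0 < ω₁.re) (hω₂ : 0 < ω₂.re) {z : ℂ}
    (hz : -((ω₁.re + ω₂.re) / 2) < z.im) : hypGamma ω₁ ω₂ (z + I * ω₁)
      = -2 * I * Complex.sinh (Real.pi * (z + hypEta ω₁ ω₂) / ω₂) * hypGamma ω₁ ω₂ z := by
  rw [hypGamma_add hω₁ hω₂ hz, hypGammaShift, hypEta, mul_div_assoc]

theorem hypPair_add_I_mul (hω₁ : 0 < ω₁.re) (hω₂ : 0 < ω₂.re) {v : ℂ} (x : ℝ)
    (hv : -((ω₁.re + ω₂.re) / 2) < v.im) : hypPair ω₁ ω₂ (v + I * ω₁) x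
      = -4 * (Complex.sinh (Real.pi * (v + hypEta ω₁ ω₂) / ω₂ + Real.pi * x / ω₂)
        * Complex.sinh (Real.pi * (v + hypEta ω₁ ω₂) / ω₂ - Real.pi * x / ω₂))
        * hypPair ω₁ ω₂ v x := by
  rw [hypPair, hypPair, show v + I * ω₁ + x = v + x + I * ω₁ by ring,
    show v + I * ω₁ - x = v - x + I * ω₁ by ring, hypGamma_add_mul hω₁ hω₂ (by simpa using hv),
    hypGamma_add_mul hω₁ hω₂ (by simpa using hv), ← add_div, ← sub_div, ← mul_add, ← mul_sub,
    add_right_comm, sub_add_eq_add_sub]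
  linear_combination 4 * (Complex.sinh (Real.pi * (v + hypEta ω₁ ω₂ + x) / ω₂)
        * Complex.sinh (Real.pi * (v + hypEta ω₁ ω₂ - x) / ω₂))
        * (hypGamma ω₁ ω₂ (v + x) * hypGamma ω₁ ω₂ (v - x)) * I_sq

/-- Contiguous relation for the beta integral: the integrals with the first, respectively the last
parameter shifted by `i ω₁` are proportional. Let `g(z)` be `sinh (2πz/ω₁)` times the product of the
`G(v + iω₁/2 + z) G(v + iω₁/2 - z)` over the six `v`. The integrals of `g` over `ℝ + iω₁/2` and
`ℝ - iω₁/2` agree. By the difference equation and `sinh_balanced_identity` the difference of the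
integrands is, up to a constant factor, the difference of the integrands in the claim. -/
theorem sinh_mul_hypInt_shift (hω₁ : 0 < ω₁.re) (hω₂ : 0 < ω₂.re) {w a b c d q : ℂ}
    (hv : ∀ j, -((ω₁.re + ω₂.re) / 2) < ((![w, a, b, c, d, q] : Fin 6 → ℂ) j).im)
    (hs : w + a + b + c + d + q = -4 * hypEta ω₁ ω₂ - I * ω₁) :
    (Complex.sinh (Real.pi * (w + hypEta ω₁ ω₂) / ω₂ + Real.pi * (a + hypEta ω₁ ω₂) / ω₂)
      * Complex.sinh (Real.pi * (w + hypEta ω₁ ω₂) / ω₂ + Real.pi * (b + hypEta ω₁ ω₂) / ω₂)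
      * Complex.sinh (Real.pi * (w + hypEta ω₁ ω₂) / ω₂ + Real.pi * (c + hypEta ω₁ ω₂) / ω₂)
      * Complex.sinh (Real.pi * (w + hypEta ω₁ ω₂) / ω₂ + Real.pi * (d + hypEta ω₁ ω₂) / ω₂))
      * hypInt ω₁ ω₂ ![w, a, b, c, d, q + I * ω₁]
    = (Complex.sinh (Real.pi * (q + hypEta ω₁ ω₂) / ω₂ + Real.pi * (a + hypEta ω₁ ω₂) / ω₂)
      * Complex.sinh (Real.pi * (q + hypEta ω₁ ω₂) / ω₂ + Real.pi * (b + hypEta ω₁ ω₂) / ω₂)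
      * Complex.sinh (Real.pi * (q + hypEta ω₁ ω₂) / ω₂ + Real.pi * (c + hypEta ω₁ ω₂) / ω₂)
      * Complex.sinh (Real.pi * (q + hypEta ω₁ ω₂) / ω₂ + Real.pi * (d + hypEta ω₁ ω₂) / ω₂))
      * hypInt ω₁ ω₂ ![w + I * ω₁, a, b, c, d, q] := by
  have h01 := ne_zero_of_re_pos hω₁
  have h02 := ne_zero_of_re_pos hω₂
  set η := hypEta ω₁ ω₂ with hη
  set ρ := (ω₁.re + ω₂.re) / 2 with hρ
  set e : Fin 6 → ℂ := ![w, a, b, c, d, q] with he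
  have hes : ∑ j, e j = -4 * η - I * ω₁ := by rw [he, Fin.sum_univ_six]; exact hs
  obtain ⟨δ, hδ, hδe⟩ : ∃ δ > 0, ∀ j, -ρ + 2 * δ < (e j).im := by
    have h1 : ∀ᶠ δ in 𝓝[>] (0 : ℝ), ∀ j, -ρ + 2 * δ < (e j).im := by
      rw [eventually_all]
      intro j
      refine eventually_nhdsWithin_of_eventually_nhds ?_
      have hc : ContinuousAt (fun δ : ℝ => -ρ + 2 * δ) 0 := by fun_prop
      exact hc.eventually_lt_const (by simpa using hv j)
    obtain ⟨δ, h2, h3⟩ := (h1.and self_mem_nhdsWithin).exists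
    exact ⟨δ, h3, h2⟩
  set e' : Fin 6 → ℂ := fun j => e j + I * ω₁ / 2 with he'
  have he'im : ∀ j, (e' j).im = (e j).im + ω₁.re / 2 := fun j => by
    simp [he', show I * ω₁ / 2 = (1 / 2 : ℝ) * (I * ω₁) by push_cast; ring,
      -Complex.ofReal_div]; ring
  set g : ℂ → ℂ := fun z => Complex.sinh (2 * Real.pi * z / ω₁) * ∏ j, hypPair ω₁ ω₂ (e' j) z
    with hg
  set lo : ℝ := -(ω₁.re / 2 + δ) with hlo
  set hi : ℝ := ω₁.re / 2 + δ with hhi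
  have hd : DifferentiableOn ℂ g {z | lo < z.im ∧ z.im < hi} := by
    intro z hz
    refine DifferentiableAt.differentiableWithinAt (DifferentiableAt.mul (by fun_prop)
      (DifferentiableAt.fun_finsetProd fun j _ => differentiableAt_hypPair_right hω₁ hω₂ ?_ ?_))
    · have := hδe j; rw [Complex.add_im, he'im]; linarith [hz.1]
    · have := hδe j; rw [Complex.sub_im, he'im]; linarith [hz.2]
  have hb : ∀ w : ℂ, lo < w.im → w.im < hi → ∃ r > 0, ∃ G : ℝ → ℝ, Integrable G ∧
      ∀ x : ℝ, ∀ w' ∈ Metric.ball w r, ‖g (x + w')‖ ≤ G x := by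
    intro w h1 h2
    obtain ⟨r, hr, hrs⟩ := Metric.isOpen_iff.1 (isOpen_strip lo hi) w ⟨h1, h2⟩
    set R : ℝ := ‖w‖ + r + ∑ j, ‖e' j‖ with hR
    obtain ⟨M₁, hM₁, H₁⟩ := norm_sinh_two_mul_div_le hω₁ R
    obtain ⟨M₂, hM₂, H₂⟩ := norm_prod_hypPair_le hω₁ hω₂ 6 (show ρ - δ < ρ by linarith) R
    have hk := re_one_div_pos hω₁
    refine ⟨r, hr, fun x => M₁ * M₂ * Real.exp (-(2 * Real.pi * (1 / ω₁).re) * |x|),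
      (integrable_exp_neg_mul_abs (by positivity)).const_mul _, fun x w' hw' => ?_⟩
    have hsum : ∑ j, e' j = -4 * η + 2 * (I * ω₁) := by
      rw [he', Finset.sum_add_distrib, hes]; simp; ring
    have hks : hypRate ω₁ ω₂ (∑ j, e' j) = -2 * (1 / ω₁).re := by
      rw [hsum, hypRate_add, show (-4 : ℂ) * η = ((-4 : ℝ) : ℂ) * η by push_cast; ring,
        show (2 : ℂ) * (I * ω₁) = ((2 : ℝ) : ℂ) * (I * ω₁) by push_cast; ring, hypRate_real_mul,
        hypRate_real_mul, hypRate_hypEta hω₁ hω₂, hypRate_I_mul_left hω₁]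
      ring
    have hs0 : 0 ≤ ∑ j, ‖e' j‖ := Finset.sum_nonneg fun _ _ => norm_nonneg _
    have hw'R : ‖w'‖ ≤ R := by
      have h3 := norm_add_le w (w' - w)
      rw [add_sub_cancel, ← dist_eq_norm] at h3
      have h4 : dist w' w < r := hw'
      linarith
    have h5 := H₁ x w' hw'R
    have h6 := H₂ x w' e' (fun j => by
      have := Finset.single_le_sum (f := fun j => ‖e' j‖) (fun _ _ => norm_nonneg _)
        (Finset.mem_univ j)
      have := norm_nonneg w
      linarith) hw'R (fun j => by
      have h7 := hrs hw'
      have h8 : |w'.im| < hi := abs_lt.2 h7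
      have := hδe j
      rw [he'im]; linarith)
    rw [hks] at h6
    rw [hg, norm_mul]
    calc _ ≤ _ := mul_le_mul h5 h6 (norm_nonneg _) (by positivity)
      _ = M₁ * M₂ * (Real.exp (2 * Real.pi * |x| * (1 / ω₁).re)
          * Real.exp (2 * Real.pi * |x| * (-2 * (1 / ω₁).re))) := by ring
      _ = _ := by rw [← Real.exp_add]; ring_nf
  have him : (I * ω₁ / 2).im = ω₁.re / 2 := by
    rw [show I * ω₁ / 2 = (1 / 2 : ℝ) * (I * ω₁) by push_cast; ring, Complex.im_ofReal_mul]
    simp; ring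
  have hm1 : lo < (I * ω₁ / 2).im ∧ (I * ω₁ / 2).im < hi := by rw [him]; constructor <;> linarith
  have hm2 : lo < (-(I * ω₁ / 2)).im ∧ (-(I * ω₁ / 2)).im < hi := by
    rw [Complex.neg_im, him]; constructor <;> linarith
  have hshift := integral_strip_shift hd hb hm1 hm2
  have hi1 := integrable_of_strip hd hb hm1
  have hi2 := integrable_of_strip hd hb hm2
  have hzero : ∫ x : ℝ, (g (x + I * ω₁ / 2) - g (x + -(I * ω₁ / 2))) = 0 := by
    rw [integral_sub hi1 hi2, hshift, sub_self]
  have hg1 : ∀ x : ℝ, g (x + I * ω₁ / 2) = 64 * Complex.sinh (2 * Real.pi * x / ω₁)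
      * ((∏ j, Complex.sinh (Real.pi * (e j + η) / ω₂ + Real.pi * x / ω₂))
        * ∏ j, hypPair ω₁ ω₂ (e j) x) := by
    intro x
    have h1 : Complex.sinh (2 * Real.pi * (x + I * ω₁ / 2) / ω₁)
        = -Complex.sinh (2 * Real.pi * x / ω₁) := by
      rw [← sinh_add_pi_mul_I]; congr 1; field_simp
    have h2 : ∀ j, hypPair ω₁ ω₂ (e' j) (x + I * ω₁ / 2) = -2 * I *
        (Complex.sinh (Real.pi * (e j + η) / ω₂ + Real.pi * x / ω₂) * hypPair ω₁ ω₂ (e j) x) := by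
      intro j
      rw [hypPair, hypPair, he', show e j + I * ω₁ / 2 + (x + I * ω₁ / 2) = e j + x + I * ω₁ by ring,
        show e j + I * ω₁ / 2 - (x + I * ω₁ / 2) = e j - x by ring,
        hypGamma_add_mul hω₁ hω₂ (by simpa using hv j), ← hη, ← add_div, ← mul_add, add_right_comm]
      ring
    simp only [hg, h1, h2, Finset.prod_mul_distrib]
    rw [Finset.prod_const, Finset.prod_const]
    simp only [Finset.card_univ, Fintype.card_fin]
    rw [show (I : ℂ) ^ 6 = -1 by rw [show 6 = 2 * 3 by rfl, pow_mul, I_sq]; norm_num]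
    ring
  have hg2 : ∀ x : ℝ, g (x + -(I * ω₁ / 2)) = 64 * Complex.sinh (2 * Real.pi * x / ω₁)
      * ((∏ j, Complex.sinh (Real.pi * (e j + η) / ω₂ - Real.pi * x / ω₂))
        * ∏ j, hypPair ω₁ ω₂ (e j) x) := by
    intro x
    have h1 : Complex.sinh (2 * Real.pi * (x + -(I * ω₁ / 2)) / ω₁)
        = -Complex.sinh (2 * Real.pi * x / ω₁) := by
      rw [← sinh_sub_pi_mul_I]; congr 1; field_simp; ring
    have h2 : ∀ j, hypPair ω₁ ω₂ (e' j) (x + -(I * ω₁ / 2)) = -2 * I *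
        (Complex.sinh (Real.pi * (e j + η) / ω₂ - Real.pi * x / ω₂) * hypPair ω₁ ω₂ (e j) x) := by
      intro j
      rw [hypPair, hypPair, he', show e j + I * ω₁ / 2 + (x + -(I * ω₁ / 2)) = e j + x by ring,
        show e j + I * ω₁ / 2 - (x + -(I * ω₁ / 2)) = e j - x + I * ω₁ by ring,
        hypGamma_add_mul hω₁ hω₂ (by simpa using hv j), ← hη, ← sub_div, ← mul_sub,
        sub_add_eq_add_sub]
      ring
    simp only [hg, h1, h2, Finset.prod_mul_distrib]
    rw [Finset.prod_const, Finset.prod_const]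
    simp only [Finset.card_univ, Fintype.card_fin]
    rw [show (I : ℂ) ^ 6 = -1 by rw [show 6 = 2 * 3 by rfl, pow_mul, I_sq]; norm_num]
    ring
  have hw0 : -ρ < w.im := hv 0
  have hq0 : -ρ < q.im := hv 5
  have hint1 : Integrable fun x : ℝ => hypKernel ω₁ ω₂ ![w, a, b, c, d, q + I * ω₁] x := by
    refine integrable_hypKernel hω₁ hω₂ (mem_hypDomain hω₁ hω₂ (fun j => ?_) ?_)
    · fin_cases j
      · exact hv 0
      · exact hv 1
      · exact hv 2
      · exact hv 3
      · exact hv 4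
      · simp; linarith
    · rw [Fin.sum_univ_six]; simp; linear_combination hs
  have hint2 : Integrable fun x : ℝ => hypKernel ω₁ ω₂ ![w + I * ω₁, a, b, c, d, q] x := by
    refine integrable_hypKernel hω₁ hω₂ (mem_hypDomain hω₁ hω₂ (fun j => ?_) ?_)
    · fin_cases j
      · simp; linarith
      · exact hv 1
      · exact hv 2
      · exact hv 3
      · exact hv 4
      · exact hv 5
    · rw [Fin.sum_univ_six]; simp; linear_combination hs
  have hsum : Real.pi * (w + η) / ω₂ + Real.pi * (a + η) / ω₂ + Real.pi * (b + η) / ω₂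
      + Real.pi * (c + η) / ω₂ + Real.pi * (d + η) / ω₂ + Real.pi * (q + η) / ω₂
      = Real.pi * I := by
    have h1 : w + η + (a + η) + (b + η) + (c + η) + (d + η) + (q + η) = I * ω₂ := by
      have : η = I * ((ω₁ + ω₂) / 2) := rfl
      linear_combination hs + 2 * this
    field_simp
    linear_combination h1
  rw [hypInt, hypInt, ← sub_eq_zero, ← integral_const_mul, ← integral_const_mul,
    ← integral_sub (hint1.const_mul _) (hint2.const_mul _)]
  refine (integral_congr_ae (g := fun x : ℝ => -(1 / 4) * Complex.sinh (Real.pi * (q + η) / ω₂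
      - Real.pi * (w + η) / ω₂) * (g (x + I * ω₁ / 2) - g (x + -(I * ω₁ / 2))))
    (ae_of_all _ fun x => ?_)).trans (by rw [integral_const_mul, hzero, mul_zero])
  have key := sinh_balanced_identity (X := Real.pi * x / ω₂) hsum
  have k1 : hypKernel ω₁ ω₂ ![w, a, b, c, d, q + I * ω₁] x = hypWeight ω₁ ω₂ x *
      (hypPair ω₁ ω₂ w x * hypPair ω₁ ω₂ a x * hypPair ω₁ ω₂ b x * hypPair ω₁ ω₂ c x
      * hypPair ω₁ ω₂ d x * hypPair ω₁ ω₂ (q + I * ω₁) x) := by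
    rw [hypKernel, Fin.prod_univ_six]; rfl
  have k2 : hypKernel ω₁ ω₂ ![w + I * ω₁, a, b, c, d, q] x = hypWeight ω₁ ω₂ x *
      (hypPair ω₁ ω₂ (w + I * ω₁) x * hypPair ω₁ ω₂ a x * hypPair ω₁ ω₂ b x * hypPair ω₁ ω₂ c x
      * hypPair ω₁ ω₂ d x * hypPair ω₁ ω₂ q x) := by
    rw [hypKernel, Fin.prod_univ_six]; rfl
  have k3 : ∀ f : ℂ → ℂ, ∏ j, f (e j) = f w * f a * f b * f c * f d * f q := fun f => by
    rw [Fin.prod_univ_six]; rfl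
  simp only [hg1, hg2]
  rw [k1, k2, k3 fun v => Complex.sinh (Real.pi * (v + η) / ω₂ + Real.pi * x / ω₂),
    k3 fun v => Complex.sinh (Real.pi * (v + η) / ω₂ - Real.pi * x / ω₂),
    k3 fun v => hypPair ω₁ ω₂ v x, hypPair_add_I_mul hω₁ hω₂ x hw0,
    hypPair_add_I_mul hω₁ hω₂ x hq0, hypWeight,
    show 2 * Real.pi * x / ω₂ = 2 * (Real.pi * x / ω₂) by ring, ← hη]
  linear_combination (16 * Complex.sinh (2 * Real.pi * x / ω₁) * (hypPair ω₁ ω₂ w x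
    * hypPair ω₁ ω₂ a x * hypPair ω₁ ω₂ b x * hypPair ω₁ ω₂ c x * hypPair ω₁ ω₂ d x
    * hypPair ω₁ ω₂ q x)) * key


/-! ### Invariance of the beta integral under moving two parameters -/

/-- The factors of `∏_{j<k} G(η + v_j + v_k)` that pair one of `v`, `q` with one of
`a, b, c, d`. -/
def hypCross (ω₁ ω₂ v a b c d q : ℂ) : ℂ :=
  hypGamma ω₁ ω₂ (hypEta ω₁ ω₂ + v + a) * hypGamma ω₁ ω₂ (hypEta ω₁ ω₂ + v + b)
    * hypGamma ω₁ ω₂ (hypEta ω₁ ω₂ + v + c) * hypGamma ω₁ ω₂ (hypEta ω₁ ω₂ + v + d)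
    * (hypGamma ω₁ ω₂ (hypEta ω₁ ω₂ + q + a) * hypGamma ω₁ ω₂ (hypEta ω₁ ω₂ + q + b)
    * hypGamma ω₁ ω₂ (hypEta ω₁ ω₂ + q + c) * hypGamma ω₁ ω₂ (hypEta ω₁ ω₂ + q + d))

/-- The contiguous relation, with the `sinh` factors absorbed into the products of `G` by the
difference equation. -/
theorem hypInt_mul_hypCross_shift (hω₁ : 0 < ω₁.re) (hω₂ : 0 < ω₂.re) {w a b c d q : ℂ}
    (hw : -((ω₁.re + ω₂.re) / 2) < w.im) (ha : -((ω₁.re + ω₂.re) / 2) < a.im)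
    (hb : -((ω₁.re + ω₂.re) / 2) < b.im) (hc : -((ω₁.re + ω₂.re) / 2) < c.im)
    (hd : -((ω₁.re + ω₂.re) / 2) < d.im) (hq : -((ω₁.re + ω₂.re) / 2) < q.im)
    (hs : w + a + b + c + d + q = -4 * hypEta ω₁ ω₂ - I * ω₁) :
    hypInt ω₁ ω₂ ![w + I * ω₁, a, b, c, d, q] * hypCross ω₁ ω₂ w a b c d (q + I * ω₁)
    = hypInt ω₁ ω₂ ![w, a, b, c, d, q + I * ω₁] * hypCross ω₁ ω₂ (w + I * ω₁) a b c d q := by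
  have key := sinh_mul_hypInt_shift hω₁ hω₂ (w := w) (a := a) (b := b) (c := c) (d := d) (q := q)
    (fun j => by fin_cases j <;> assumption) hs
  have hG : ∀ {u k : ℂ}, -((ω₁.re + ω₂.re) / 2) < u.im → -((ω₁.re + ω₂.re) / 2) < k.im →
      hypGamma ω₁ ω₂ (hypEta ω₁ ω₂ + (u + I * ω₁) + k) = -2 * I *
        Complex.sinh (Real.pi * (u + hypEta ω₁ ω₂) / ω₂ + Real.pi * (k + hypEta ω₁ ω₂) / ω₂)
        * hypGamma ω₁ ω₂ (hypEta ω₁ ω₂ + u + k) := by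
    intro u k hu hk
    rw [show hypEta ω₁ ω₂ + (u + I * ω₁) + k = hypEta ω₁ ω₂ + u + k + I * ω₁ by ring,
      hypGamma_add_mul hω₁ hω₂ (by simp only [Complex.add_im, hypEta_im]; linarith)]
    congr 3; ring
  rw [hypCross, hypCross, hG hw ha, hG hw hb, hG hw hc, hG hw hd, hG hq ha, hG hq hb, hG hq hc,
    hG hq hd]
  linear_combination (-16 * I ^ 4 * (hypGamma ω₁ ω₂ (hypEta ω₁ ω₂ + w + a)
    * hypGamma ω₁ ω₂ (hypEta ω₁ ω₂ + w + b) * hypGamma ω₁ ω₂ (hypEta ω₁ ω₂ + w + c)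
    * hypGamma ω₁ ω₂ (hypEta ω₁ ω₂ + w + d) * (hypGamma ω₁ ω₂ (hypEta ω₁ ω₂ + q + a)
    * hypGamma ω₁ ω₂ (hypEta ω₁ ω₂ + q + b) * hypGamma ω₁ ω₂ (hypEta ω₁ ω₂ + q + c)
    * hypGamma ω₁ ω₂ (hypEta ω₁ ω₂ + q + d)))) * key

/-- Uniform bound for the beta integral along the two-parameter translations
`(s, D - s)` of its first and last parameter. -/
theorem norm_hypInt_translate_le (hω₁ : 0 < ω₁.re) (hω₂ : 0 < ω₂.re) {a b c d D : ℂ}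
    (ha : -((ω₁.re + ω₂.re) / 2) < a.im) (hb : -((ω₁.re + ω₂.re) / 2) < b.im)
    (hc : -((ω₁.re + ω₂.re) / 2) < c.im) (hd : -((ω₁.re + ω₂.re) / 2) < d.im)
    (hs : a + b + c + d + D = -4 * hypEta ω₁ ω₂) (hD : 0 ≤ hypRate ω₁ ω₂ (-D))
    (hD' : hypRate ω₁ ω₂ (-D) < (1 / ω₁).re + (1 / ω₂).re) {l u : ℝ}
    (hl : -((ω₁.re + ω₂.re) / 2) < l) (hu : u < D.im + (ω₁.re + ω₂.re) / 2) :
    ∃ C : ℝ, 0 ≤ C ∧ ∀ s : ℂ, l ≤ s.im → s.im ≤ u →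
      ‖hypInt ω₁ ω₂ ![s, a, b, c, d, D - s]‖
        ≤ C * Real.exp (-2 * Real.pi * |s.re| * hypRate ω₁ ω₂ (-D)) := by
  set ρ := (ω₁.re + ω₂.re) / 2 with hρ
  set K := (1 / ω₁).re + (1 / ω₂).re with hK
  set k := hypRate ω₁ ω₂ (-D) with hk
  have hkD : hypRate ω₁ ω₂ D = -k := by rw [hk, hypRate_neg, neg_neg]
  set e : Fin 4 → ℂ := ![a, b, c, d] with he
  have hei : ∀ j, -ρ < (e j).im := fun j => by fin_cases j <;> assumption
  obtain ⟨y, hyρ, hy1, hy2, hy3⟩ : ∃ y, y < ρ ∧ -y < l ∧ -y < D.im - u ∧ ∀ j, -y < (e j).im := by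
    have h1 : ∀ᶠ y in 𝓝[<] ρ, -y < l ∧ -y < D.im - u ∧ ∀ j, -y < (e j).im := by
      refine eventually_nhdsWithin_of_eventually_nhds ?_
      have hc : ContinuousAt (fun y : ℝ => -y) ρ := by fun_prop
      refine (hc.eventually_lt_const hl).and ((hc.eventually_lt_const (by linarith)).and ?_)
      rw [eventually_all]
      exact fun j => hc.eventually_lt_const (hei j)
    obtain ⟨y, h2, h3⟩ := (h1.and self_mem_nhdsWithin).exists
    exact ⟨y, h3, h2⟩
  set R := |l| + |u| + ‖D‖ with hR
  obtain ⟨M₁, hM₁, H₁⟩ := norm_hypGamma_mul_le hω₁ hω₂ hyρ R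
  obtain ⟨M₂, hM₂, H₂⟩ := norm_prod_hypPair_le hω₁ hω₂ 4 hyρ (‖a‖ + ‖b‖ + ‖c‖ + ‖d‖)
  obtain ⟨M₃, hM₃, H₃⟩ := norm_hypWeight_le hω₁ hω₂ 0
  set g : ℝ → ℝ := fun x => M₃ * M₂ * M₁ ^ 2 * Real.exp (-(2 * Real.pi * (K - k)) * |x|) with hg
  have hgi : Integrable g := (integrable_exp_neg_mul_abs
    (mul_pos (by have := Real.pi_pos; positivity) (by linarith))).const_mul _
  refine ⟨∫ x, g x, integral_nonneg fun x => by positivity, fun s hs1 hs2 => ?_⟩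
  have hsum : hypRate ω₁ ω₂ (∑ j, e j) = -2 * K + k := by
    have h1 : ∑ j, e j = ((-4 : ℝ) : ℂ) * hypEta ω₁ ω₂ + -D := by
      rw [Fin.sum_univ_four]; simp [he]; linear_combination hs
    rw [h1, hypRate_add, hypRate_real_mul, hypRate_hypEta hω₁ hω₂]; ring
  have hsR : ‖(s.im : ℂ) * I‖ ≤ |l| + |u| := by
    rw [norm_mul, Complex.norm_I, mul_one, Complex.norm_real, Real.norm_eq_abs, abs_le]
    constructor
    · linarith [neg_abs_le l, abs_nonneg u]
    · linarith [le_abs_self u, abs_nonneg l]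
  have hpt : ∀ x : ℝ, ‖hypKernel ω₁ ω₂ ![s, a, b, c, d, D - s] x‖
      ≤ Real.exp (-2 * Real.pi * |s.re| * k) * g x := by
    intro x
    have hpair : ∀ x : ℝ, ‖hypGamma ω₁ ω₂ (s + x) * hypGamma ω₁ ω₂ (D - s - x)‖
        ≤ M₁ * Real.exp (-(Real.pi * |s.re + x| * k)) := by
      intro x
      have h1 := H₁ (s.re + x) (s.im * I) (D - s.im * I)
        (hsR.trans (by linarith [norm_nonneg D]))
        ((norm_sub_le _ _).trans (by linarith)) (by simp; linarith) (by simp; linarith)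
      rw [← hypRate_add, add_sub_cancel, hkD] at h1
      have h2 : s + x = s.im * I + ((s.re + x : ℝ) : ℂ) := by
        apply Complex.ext <;> simp
      have h3 : D - s - x = D - s.im * I - ((s.re + x : ℝ) : ℂ) := by
        apply Complex.ext <;> simp <;> ring
      rw [h2, h3]
      refine h1.trans (le_of_eq ?_)
      ring_nf
    have h1 := hpair x
    have h2 := hpair (-x)
    have h3 := H₂ x 0 e (fun j => by
      have := norm_nonneg a; have := norm_nonneg b; have := norm_nonneg c
      have := norm_nonneg d
      fin_cases j <;> (simp [he]; linarith)) (by simp; positivity)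
      (fun j => by simpa using (hy3 j).le)
    have h4 := H₃ x 0 (by simp)
    rw [add_zero] at h3 h4
    rw [hsum] at h3
    have hk1 : hypKernel ω₁ ω₂ ![s, a, b, c, d, D - s] x = hypWeight ω₁ ω₂ x
        * (∏ j, hypPair ω₁ ω₂ (e j) x)
        * ((hypGamma ω₁ ω₂ (s + x) * hypGamma ω₁ ω₂ (D - s - x))
        * (hypGamma ω₁ ω₂ (s + (-x : ℝ)) * hypGamma ω₁ ω₂ (D - s - (-x : ℝ)))) := by
      have e1 : ∏ j, hypPair ω₁ ω₂ ((![s, a, b, c, d, D - s] : Fin 6 → ℂ) j) x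
          = hypPair ω₁ ω₂ s x * hypPair ω₁ ω₂ a x * hypPair ω₁ ω₂ b x * hypPair ω₁ ω₂ c x
            * hypPair ω₁ ω₂ d x * hypPair ω₁ ω₂ (D - s) x := by rw [Fin.prod_univ_six]; rfl
      have e2 : ∏ j, hypPair ω₁ ω₂ (e j) x = hypPair ω₁ ω₂ a x * hypPair ω₁ ω₂ b x
            * hypPair ω₁ ω₂ c x * hypPair ω₁ ω₂ d x := by rw [Fin.prod_univ_four]; rfl
      have e3 : hypPair ω₁ ω₂ s x = hypGamma ω₁ ω₂ (s + x) * hypGamma ω₁ ω₂ (s - x) := rfl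
      have e4 : hypPair ω₁ ω₂ (D - s) x
        = hypGamma ω₁ ω₂ (D - s + x) * hypGamma ω₁ ω₂ (D - s - x) := rfl
      rw [hypKernel, e1, e2, e3, e4, Complex.ofReal_neg, sub_neg_eq_add, ← sub_eq_add_neg]
      ring
    rw [hk1, norm_mul, norm_mul, norm_mul (_ * _ : ℂ)]
    have h5 : 2 * |s.re| ≤ |s.re + x| + |s.re + -x| := by
      have := abs_add_le (s.re + x) (s.re + -x)
      rw [show s.re + x + (s.re + -x) = 2 * s.re by ring, abs_mul, abs_two] at this
      exact this
    calc _ ≤ (M₃ * Real.exp (2 * Real.pi * |x| * K)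
            * (M₂ * Real.exp (2 * Real.pi * |x| * (-2 * K + k))))
          * ((M₁ * Real.exp (-(Real.pi * |s.re + x| * k)))
            * (M₁ * Real.exp (-(Real.pi * |s.re + -x| * k)))) := by gcongr
      _ = M₃ * M₂ * M₁ ^ 2 * ((Real.exp (2 * Real.pi * |x| * K)
          * Real.exp (2 * Real.pi * |x| * (-2 * K + k))) * (Real.exp (-(Real.pi * |s.re + x| * k))
          * Real.exp (-(Real.pi * |s.re + -x| * k)))) := by ring
      _ ≤ M₃ * M₂ * M₁ ^ 2 * (Real.exp (-(2 * Real.pi * (K - k)) * |x|) *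
          Real.exp (-2 * Real.pi * |s.re| * k)) := by
        refine mul_le_mul_of_nonneg_left ?_ (by positivity)
        rw [← Real.exp_add, ← Real.exp_add, ← Real.exp_add, ← Real.exp_add]
        refine Real.exp_le_exp.2 ?_
        have := mul_le_mul_of_nonneg_left h5 (mul_nonneg Real.pi_pos.le hD)
        linarith
      _ = _ := by rw [hg]; ring
  rw [hypInt]
  refine (norm_integral_le_of_norm_le (hgi.const_mul _) (ae_of_all _ hpt)).trans (le_of_eq ?_)
  rw [integral_const_mul, mul_comm]

/-- By the reflection equation `1 / hypCross` is a product of values of `G`. In this form it is seen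
to be analytic in the strip of interest. -/
theorem inv_hypCross (hω₁ : 0 < ω₁.re) (hω₂ : 0 < ω₂.re) (v a b c d q : ℂ) :
    (hypCross ω₁ ω₂ v a b c d q)⁻¹ = ∏ j : Fin 4,
      (hypGamma ω₁ ω₂ (-(hypEta ω₁ ω₂ + v + (![a, b, c, d] : Fin 4 → ℂ) j))
      * hypGamma ω₁ ω₂ (-(hypEta ω₁ ω₂ + q + (![a, b, c, d] : Fin 4 → ℂ) j))) := by
  simp only [hypGamma_neg hω₁ hω₂, ← mul_inv, Finset.prod_inv_distrib]
  congr 1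
  rw [Fin.prod_univ_four, hypCross]
  simp only [Matrix.cons_val]
  ring

theorem hypCross_ne_zero (hω₁ : 0 < ω₁.re) (hω₂ : 0 < ω₂.re) {v a b c d q : ℂ}
    (h : ∀ j : Fin 4, -((ω₁.re + ω₂.re)) < v.im + ((![a, b, c, d] : Fin 4 → ℂ) j).im ∧
      v.im + ((![a, b, c, d] : Fin 4 → ℂ) j).im < 0 ∧
      -((ω₁.re + ω₂.re)) < q.im + ((![a, b, c, d] : Fin 4 → ℂ) j).im ∧
      q.im + ((![a, b, c, d] : Fin 4 → ℂ) j).im < 0) : hypCross ω₁ ω₂ v a b c d q ≠ 0 := by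
  rw [ne_eq, ← inv_eq_zero, ← ne_eq, inv_hypCross hω₁ hω₂, Finset.prod_ne_zero_iff]
  intro j _
  obtain ⟨h1, h2, h3, h4⟩ := h j
  refine mul_ne_zero (hypGamma_ne_zero hω₁ hω₂ ?_) (hypGamma_ne_zero hω₁ hω₂ ?_)
  · rw [Complex.neg_im, abs_neg, Complex.add_im, Complex.add_im, hypEta_im, abs_lt]
    constructor <;> linarith
  · rw [Complex.neg_im, abs_neg, Complex.add_im, Complex.add_im, hypEta_im, abs_lt]
    constructor <;> linarith

/-- The exponential rate here is opposite to the one for the integral. -/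
theorem norm_inv_hypCross_translate_le (hω₁ : 0 < ω₁.re) (hω₂ : 0 < ω₂.re) {a b c d D : ℂ}
    (hs : a + b + c + d + D = -4 * hypEta ω₁ ω₂)
    (h : ∀ j, ((![a, b, c, d] : Fin 4 → ℂ) j).im + (ω₁.re + ω₂.re) / 2 + D.im ≤ 0) {l u : ℝ}
    (hl : -((ω₁.re + ω₂.re) / 2) < l) (hu : u < D.im + (ω₁.re + ω₂.re) / 2) :
    ∃ C : ℝ, 0 ≤ C ∧ ∀ s : ℂ, l ≤ s.im → s.im ≤ u →
      ‖(hypCross ω₁ ω₂ s a b c d (D - s))⁻¹‖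
        ≤ C * Real.exp (2 * Real.pi * |s.re| * hypRate ω₁ ω₂ (-D)) := by
  set ρ := (ω₁.re + ω₂.re) / 2 with hρ
  set k := hypRate ω₁ ω₂ (-D) with hk
  set η := hypEta ω₁ ω₂ with hη
  set e : Fin 4 → ℂ := ![a, b, c, d] with he
  obtain ⟨y, hyρ, hy⟩ : ∃ y, y < ρ ∧ ∀ j, -y < -ρ - u - (e j).im ∧
      -y < -ρ - D.im + l - (e j).im := by
    have h1 : ∀ᶠ y in 𝓝[<] ρ, ∀ j, -y < -ρ - u - (e j).im ∧ -y < -ρ - D.im + l - (e j).im := by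
      refine eventually_nhdsWithin_of_eventually_nhds ?_
      have hc : ContinuousAt (fun y : ℝ => -y) ρ := by fun_prop
      rw [eventually_all]
      exact fun j => (hc.eventually_lt_const (by linarith [h j])).and
        (hc.eventually_lt_const (by linarith [h j]))
    obtain ⟨y, h2, h3⟩ := (h1.and self_mem_nhdsWithin).exists
    exact ⟨y, h3, h2⟩
  set R := |l| + |u| + ‖D‖ + ‖η‖ + ∑ j, ‖e j‖ with hR
  obtain ⟨M, hM, H⟩ := norm_hypGamma_mul_le hω₁ hω₂ hyρ R
  refine ⟨M ^ 4, by positivity, fun s hs1 hs2 => ?_⟩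
  have hsR : ‖(s.im : ℂ) * I‖ ≤ |l| + |u| := by
    rw [norm_mul, Complex.norm_I, mul_one, Complex.norm_real, Real.norm_eq_abs, abs_le]
    constructor
    · linarith [neg_abs_le l, abs_nonneg u]
    · linarith [le_abs_self u, abs_nonneg l]
  have hη' : η.im = ρ := hypEta_im _ _
  have hpair : ∀ j, ‖hypGamma ω₁ ω₂ (-(η + s + e j)) * hypGamma ω₁ ω₂ (-(η + (D - s) + e j))‖
      ≤ M * Real.exp (Real.pi * |s.re| * hypRate ω₁ ω₂ (-2 * η - D - 2 * e j)) := by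
    intro j
    have hj := Finset.single_le_sum (f := fun j => ‖e j‖) (fun _ _ => norm_nonneg _)
      (Finset.mem_univ j)
    have e1 : (-η - D + s.im * I - e j).im = -ρ - D.im + s.im - (e j).im := by
      simp [hη']
    have e2 : (-η - s.im * I - e j).im = -ρ - s.im - (e j).im := by
      simp [hη']
    have h1 := H s.re (-η - D + s.im * I - e j) (-η - s.im * I - e j) ?_ ?_
      (by rw [e1]; linarith [hy j]) (by rw [e2]; linarith [hy j])
    · rw [← hypRate_add] at h1
      rw [show -η - D + s.im * I - e j + (-η - s.im * I - e j) = -2 * η - D - 2 * e j by ring,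
        mul_comm (hypGamma _ _ _)] at h1
      rw [show -(η + s + e j) = -η - s.im * I - e j - s.re by
          apply Complex.ext <;> simp <;> ring,
        show -(η + (D - s) + e j) = -η - D + s.im * I - e j + s.re by
          apply Complex.ext <;> simp <;> ring]
      exact h1
    · calc ‖-η - D + s.im * I - e j‖ ≤ ‖-η‖ + ‖D‖ + ‖(s.im : ℂ) * I‖ + ‖e j‖ := by
            refine (norm_sub_le _ _).trans (add_le_add_left ((norm_add_le _ _).trans
              (add_le_add_left (norm_sub_le _ _) _)) _)
        _ ≤ R := by rw [norm_neg]; linarith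
    · calc ‖-η - s.im * I - e j‖ ≤ ‖-η‖ + ‖(s.im : ℂ) * I‖ + ‖e j‖ :=
            (norm_sub_le _ _).trans (add_le_add_left (norm_sub_le _ _) _)
        _ ≤ R := by rw [norm_neg]; linarith [norm_nonneg D]
  rw [inv_hypCross hω₁ hω₂, norm_prod]
  calc _ ≤ ∏ j, M * Real.exp (Real.pi * |s.re| * hypRate ω₁ ω₂ (-2 * η - D - 2 * e j)) :=
        Finset.prod_le_prod (fun _ _ => norm_nonneg _) fun j _ => hpair j
    _ = M ^ 4 * Real.exp (Real.pi * |s.re| * hypRate ω₁ ω₂ (∑ j, (-2 * η - D - 2 * e j))) := by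
      rw [Finset.prod_mul_distrib, ← Real.exp_sum, hypRate_sum, Finset.mul_sum]; simp
    _ = _ := by
      have h1 : ∑ j, (-2 * η - D - 2 * e j) = ((2 : ℝ) : ℂ) * -D := by
        rw [Fin.sum_univ_four]; simp [he]; linear_combination -2 * hs
      rw [h1, hypRate_real_mul, ← hk]; ring_nf

/-- The quotient of the beta integral by `∏_{j<k} G(η + v_j + v_k)` does not change when two of
the parameters move with constant sum: it is `iω₁`-periodic by the contiguous relation, and bounded
since the exponential rates cancel. -/
theorem hypInt_mul_hypCross_comm (hω₁ : 0 < ω₁.re) (hω₂ : 0 < ω₂.re) {a b c d D s s' : ℂ}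
    (he : ∀ j, -((ω₁.re + ω₂.re) / 2) < ((![a, b, c, d] : Fin 4 → ℂ) j).im)
    (hs : a + b + c + d + D = -4 * hypEta ω₁ ω₂)
    (h : ∀ j, ((![a, b, c, d] : Fin 4 → ℂ) j).im + (ω₁.re + ω₂.re) / 2 + D.im ≤ 0)
    (hD₂ : -D.im < ω₂.re) (hD : 0 ≤ hypRate ω₁ ω₂ (-D))
    (hD' : hypRate ω₁ ω₂ (-D) < (1 / ω₁).re + (1 / ω₂).re)
    (h1 : -((ω₁.re + ω₂.re) / 2) < s.im) (h2 : -((ω₁.re + ω₂.re) / 2) < (D - s).im)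
    (h3 : -((ω₁.re + ω₂.re) / 2) < s'.im) (h4 : -((ω₁.re + ω₂.re) / 2) < (D - s').im) :
    hypInt ω₁ ω₂ ![s, a, b, c, d, D - s] * hypCross ω₁ ω₂ s' a b c d (D - s')
      = hypInt ω₁ ω₂ ![s', a, b, c, d, D - s'] * hypCross ω₁ ω₂ s a b c d (D - s) := by
  set ρ := (ω₁.re + ω₂.re) / 2 with hρ
  set f : ℂ → ℂ := fun s => hypInt ω₁ ω₂ ![s, a, b, c, d, D - s]
    * (hypCross ω₁ ω₂ s a b c d (D - s))⁻¹ with hf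
  have hne : ∀ s : ℂ, -ρ < s.im → s.im < D.im + ρ → hypCross ω₁ ω₂ s a b c d (D - s) ≠ 0 := by
    intro s hs1 hs2
    refine hypCross_ne_zero hω₁ hω₂ fun j => ?_
    have := he j
    have := h j
    rw [Complex.sub_im]
    refine ⟨?_, ?_, ?_, ?_⟩ <;> linarith
  have hfd : DifferentiableOn ℂ f {z | -ρ < z.im ∧ z.im < D.im + ρ} := by
    intro s hs12
    have hs1 : -ρ < s.im := hs12.1
    have hs2 : s.im < D.im + ρ := hs12.2
    refine DifferentiableAt.differentiableWithinAt (DifferentiableAt.mul ?_ ?_)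
    · have hmem : (![s, a, b, c, d, D - s] : Fin 6 → ℂ) ∈ hypDomain ω₁ ω₂ 6 := by
        refine mem_hypDomain hω₁ hω₂ (fun j => ?_) ?_
        · fin_cases j
          · exact hs1
          · exact he 0
          · exact he 1
          · exact he 2
          · exact he 3
          · simp; linarith
        · rw [Fin.sum_univ_six]; simp; linear_combination hs
      refine DifferentiableAt.comp (g := fun v : Fin 6 → ℂ => hypInt ω₁ ω₂ v)
        (f := fun s : ℂ => (![s, a, b, c, d, D - s] : Fin 6 → ℂ)) s
        (analyticOnNhd_hypInt hω₁ hω₂ 6 _ hmem).differentiableAt ?_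
      rw [differentiableAt_pi]
      intro j
      fin_cases j <;> simp; fun_prop
    · simp only [inv_hypCross hω₁ hω₂]
      refine DifferentiableAt.fun_finsetProd fun j _ => DifferentiableAt.mul ?_ ?_
      · refine (differentiableAt_hypGamma hω₁ hω₂ ?_).comp s (by fun_prop)
        have := h j
        simp only [Complex.neg_im, Complex.add_im, hypEta_im]; linarith
      · refine (differentiableAt_hypGamma hω₁ hω₂ ?_).comp s (by fun_prop)
        have := h j
        simp only [Complex.neg_im, Complex.add_im, Complex.sub_im, hypEta_im]; linarith
  have hmove := eq_of_periodic_of_bounded_strip (q := I * ω₁) (f := f) (lo := -ρ)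
    (hi := D.im + ρ) (by simpa using hω₁) (by simp; linarith) hfd ?_ ?_
    (w := s) (w' := s') ⟨h1, by rw [Complex.sub_im] at h2; linarith⟩
    ⟨h3, by rw [Complex.sub_im] at h4; linarith⟩
  · have n1 := hne s h1 (by rw [Complex.sub_im] at h2; linarith)
    have n2 := hne s' h3 (by rw [Complex.sub_im] at h4; linarith)
    simp only [hf] at hmove
    rw [← div_eq_mul_inv, ← div_eq_mul_inv, div_eq_div_iff n1 n2] at hmove
    exact hmove
  · intro s hs1 hs2
    have him : (I * ω₁).im = ω₁.re := by simp
    rw [him] at hs2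
    have n1 := hne s hs1 (by linarith)
    have n2 := hne (s + I * ω₁) (by rw [Complex.add_im, him]; linarith)
      (by rw [Complex.add_im, him]; linarith)
    have key := hypInt_mul_hypCross_shift hω₁ hω₂ hs1 (he 0) (he 1) (he 2) (he 3)
      (q := D - (s + I * ω₁)) (by rw [Complex.sub_im, Complex.add_im, him]; linarith)
      (by simp; linear_combination hs)
    simp only [hf]
    rw [← div_eq_mul_inv, ← div_eq_mul_inv, div_eq_div_iff n2 n1]
    rw [show D - (s + I * ω₁) + I * ω₁ = D - s by ring] at key
    exact key
  · intro l u hl hu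
    obtain ⟨C₁, hC₁, H₁⟩ := norm_hypInt_translate_le hω₁ hω₂ (he 0) (he 1) (he 2) (he 3) hs hD hD'
      hl hu
    obtain ⟨C₂, hC₂, H₂⟩ := norm_inv_hypCross_translate_le hω₁ hω₂ hs h hl hu
    refine ⟨C₁ * C₂, fun s hs1 hs2 => ?_⟩
    rw [hf, norm_mul]
    calc _ ≤ _ := mul_le_mul (H₁ s hs1 hs2) (H₂ s hs1 hs2) (norm_nonneg _) (by positivity)
      _ = C₁ * C₂ * (Real.exp (-2 * Real.pi * |s.re| * hypRate ω₁ ω₂ (-D))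
          * Real.exp (2 * Real.pi * |s.re| * hypRate ω₁ ω₂ (-D))) := by ring
      _ = _ := by rw [← Real.exp_add]; simp


/-! ### The pinched beta integral -/

/-- The entire function `sinh(πw/ω) / w`. -/
def sinhQuot (ω : ℂ) : ℂ → ℂ := dslope (fun w => Complex.sinh (Real.pi * w / ω)) 0

theorem mul_sinhQuot (ω w : ℂ) : w * sinhQuot ω w = Complex.sinh (Real.pi * w / ω) := by
  have h := sub_smul_dslope (fun w => Complex.sinh (Real.pi * w / ω)) 0 w
  simpa [sinhQuot] using h

theorem sinhQuot_zero (ω : ℂ) : sinhQuot ω 0 = Real.pi / ω := by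
  rw [sinhQuot, dslope_same]
  have h1 : HasDerivAt (fun w : ℂ => Real.pi * w / ω) (Real.pi / ω) 0 := by
    have := ((hasDerivAt_id (0 : ℂ)).const_mul (Real.pi : ℂ)).div_const ω
    rwa [mul_one] at this
  have h2 := h1.csinh.deriv
  simpa using h2

theorem continuous_sinhQuot (ω : ℂ) : Continuous (sinhQuot ω) := by
  have h : Differentiable ℂ fun w : ℂ => Complex.sinh (Real.pi * w / ω) := by fun_prop
  rw [← continuousOn_univ, sinhQuot, continuousOn_dslope Filter.univ_mem]
  exact ⟨h.continuous.continuousOn, h 0⟩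

theorem sinhQuot_ne_zero {ω : ℂ} (hω : 0 < ω.re) {w : ℂ} (h0 : 0 ≤ w.im) (h1 : w.im < ω.re) :
    sinhQuot ω w ≠ 0 := by
  have hω0 := ne_zero_of_re_pos hω
  have hpi : (Real.pi : ℂ) ≠ 0 := by exact_mod_cast Real.pi_ne_zero
  rcases eq_or_ne w 0 with rfl | hw
  · rw [sinhQuot_zero]; positivity
  · intro h
    have h2 := mul_sinhQuot ω w
    rw [h, mul_zero] at h2
    have h3 : Complex.sin (Real.pi * w / ω * I) = 0 := by rw [Complex.sin_mul_I, ← h2, zero_mul]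
    obtain ⟨k, hk⟩ := Complex.sin_eq_zero_iff.1 h3
    have h4 : w = ((-k : ℝ) : ℂ) * (I * ω) := by
      field_simp at hk
      push_cast
      linear_combination (-I) * hk + w * I_sq
    have h5 : w.im = -k * ω.re := by
      rw [h4, Complex.im_ofReal_mul]; simp
    rw [h5] at h0 h1
    have h6 : (-k : ℤ) < 1 := by
      have : (-k : ℝ) < 1 := by
        by_contra hcon
        have := mul_le_mul_of_nonneg_right (not_lt.1 hcon) hω.le
        linarith
      exact_mod_cast this
    have h7 : (0 : ℤ) ≤ -k := by
      have : (0 : ℝ) ≤ -k := by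
        by_contra hcon
        have := mul_neg_of_neg_of_pos (not_le.1 hcon) hω
        linarith
      exact_mod_cast this
    have h8 : k = 0 := by omega
    rw [h8] at h4
    exact hw (by simpa using h4)

/-- The function `w G(w - η)`, which is regular at the highest pole `-η` of `G`. The difference
equation expresses it through `G` at a regular point, so that it has the right value at `w = 0`. -/
def hypGammaReg (ω₁ ω₂ w : ℂ) : ℂ :=
  hypGamma ω₁ ω₂ (w + (-hypEta ω₁ ω₂ + I * ω₁)) / (-2 * I * sinhQuot ω₂ w)

theorem hypGammaReg_eq (hω₁ : 0 < ω₁.re) (hω₂ : 0 < ω₂.re) {w : ℂ} (h0 : 0 < w.im)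
    (h1 : w.im < ω₂.re) : hypGamma ω₁ ω₂ (-hypEta ω₁ ω₂ + w) = hypGammaReg ω₁ ω₂ w / w := by
  have hw : w ≠ 0 := fun h => by simp [h] at h0
  have h2 := sinhQuot_ne_zero hω₂ h0.le h1
  have h3 := hypGamma_add_mul hω₁ hω₂ (z := -hypEta ω₁ ω₂ + w)
    (by rw [Complex.add_im, Complex.neg_im, hypEta_im]; linarith)
  rw [show -hypEta ω₁ ω₂ + w + hypEta ω₁ ω₂ = w by ring, ← mul_sinhQuot] at h3
  have hI := I_ne_zero
  rw [hypGammaReg, show w + (-hypEta ω₁ ω₂ + I * ω₁) = -hypEta ω₁ ω₂ + w + I * ω₁ by ring, h3]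
  field_simp

theorem neg_hypEta_add_im (ω₁ ω₂ : ℂ) : (-hypEta ω₁ ω₂ + I * ω₁).im = (ω₁.re - ω₂.re) / 2 := by
  rw [Complex.add_im, Complex.neg_im, hypEta_im]; simp; ring

theorem hypGammaReg_zero_ne_zero (hω₁ : 0 < ω₁.re) (hω₂ : 0 < ω₂.re) :
    hypGammaReg ω₁ ω₂ 0 ≠ 0 := by
  refine div_ne_zero (hypGamma_ne_zero hω₁ hω₂ ?_)
    (mul_ne_zero (by simp) (sinhQuot_ne_zero hω₂ (by simp) (by simpa using hω₂)))
  rw [zero_add, neg_hypEta_add_im, abs_lt]; constructor <;> linarith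

theorem continuousAt_hypGammaReg (hω₁ : 0 < ω₁.re) (hω₂ : 0 < ω₂.re) {w : ℂ} (h0 : 0 ≤ w.im)
    (h1 : w.im < ω₂.re) : ContinuousAt (hypGammaReg ω₁ ω₂) w := by
  have h3 : DifferentiableAt ℂ (hypGamma ω₁ ω₂) (w + (-hypEta ω₁ ω₂ + I * ω₁)) := by
    refine differentiableAt_hypGamma hω₁ hω₂ ?_
    rw [Complex.add_im, neg_hypEta_add_im]; linarith
  refine ContinuousAt.div (h3.continuousAt.comp (f := fun w => w + (-hypEta ω₁ ω₂ + I * ω₁))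
    (by fun_prop)) (((continuous_sinhQuot ω₂).continuousAt).const_mul _) ?_
  exact mul_ne_zero (by simp) (sinhQuot_ne_zero hω₂ h0 h1)

/-- The growth of a product of factors `G(vⱼ + z) G(vⱼ - z)` depends on `∑ vⱼ` only. For large `|x|`
there are no poles, so that the parameters may be arbitrary. -/
theorem norm_prod_hypPair_le_of_large (hω₁ : 0 < ω₁.re) (hω₂ : 0 < ω₂.re) (n : ℕ) (r : ℝ) :
    ∃ M X : ℝ, 0 ≤ M ∧ 0 ≤ X ∧ ∀ (x : ℝ) (w : ℂ) (v : Fin n → ℂ), X ≤ |x| → ‖w‖ ≤ r →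
      (∀ j, ‖v j‖ ≤ r) → ‖∏ j, hypPair ω₁ ω₂ (v j) (x + w)‖
        ≤ M * Real.exp (2 * Real.pi * |x| * hypRate ω₁ ω₂ (∑ j, v j)) := by
  obtain ⟨M, X, hM, hX, h⟩ := norm_hypGamma_add_le_of_large hω₁ hω₂ (r + r)
  refine ⟨(M * M) ^ n, X, by positivity, hX, fun x w v hx hw hv => ?_⟩
  have h0 : hypGamma ω₁ ω₂ (x : ℂ) ≠ 0 := hypGamma_ne_zero hω₁ hω₂ (by simp; linarith)
  have h3 : ‖hypGamma ω₁ ω₂ (x : ℂ)‖ * ‖hypGamma ω₁ ω₂ ((-x : ℝ) : ℂ)‖ = 1 := by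
    rw [← norm_mul, Complex.ofReal_neg, hypGamma_neg hω₁ hω₂, mul_inv_cancel₀ h0, norm_one]
  have h1 : ∀ j, ‖hypPair ω₁ ω₂ (v j) (x + w)‖
      ≤ M * M * Real.exp (2 * Real.pi * |x| * hypRate ω₁ ω₂ (v j)) := by
    intro j
    have h1 := h x (v j + w) hx ((norm_add_le _ _).trans (add_le_add (hv j) hw))
    have h2 := h (-x) (v j - w) (by rwa [abs_neg])
      ((norm_sub_le _ _).trans (add_le_add (hv j) hw))
    rw [abs_neg] at h2
    rw [hypPair, norm_mul, show v j + (x + w) = x + (v j + w) by ring,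
      show v j - (x + w) = ((-x : ℝ) : ℂ) + (v j - w) by push_cast; ring]
    calc _ ≤ _ := mul_le_mul h1 h2 (norm_nonneg _) (by positivity)
      _ = M * M * (Real.exp (Real.pi * |x| * hypRate ω₁ ω₂ (v j + w))
          * Real.exp (Real.pi * |x| * hypRate ω₁ ω₂ (v j - w)))
          * (‖hypGamma ω₁ ω₂ (x : ℂ)‖ * ‖hypGamma ω₁ ω₂ ((-x : ℝ) : ℂ)‖) := by ring
      _ = _ := by rw [h3, mul_one, ← Real.exp_add, hypRate_add, hypRate_sub]; ring_nf
  rw [norm_prod]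
  calc _ ≤ ∏ j, M * M * Real.exp (2 * Real.pi * |x| * hypRate ω₁ ω₂ (v j)) :=
        Finset.prod_le_prod (fun _ _ => norm_nonneg _) fun j _ => h1 j
    _ = _ := by
      rw [Finset.prod_mul_distrib, ← Real.exp_sum, hypRate_sum, Finset.mul_sum]; simp

theorem integrable_sq_div_sq : Integrable fun y : ℝ => y ^ 2 / (1 + y ^ 2) ^ 2 := by
  refine integrable_inv_one_add_sq.mono' (Continuous.aestronglyMeasurable ?_)
    (ae_of_all _ fun y => ?_)
  · refine Continuous.div (by fun_prop) (by fun_prop) fun y => by positivity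
  · rw [Real.norm_of_nonneg (by positivity), div_le_iff₀ (by positivity)]
    field_simp
    nlinarith [sq_nonneg y]

theorem integral_sq_div_sq_pos : 0 < ∫ y : ℝ, y ^ 2 / (1 + y ^ 2) ^ 2 := by
  rw [integral_pos_iff_support_of_nonneg (fun y => by positivity) integrable_sq_div_sq]
  have h : Set.Ioo (0 : ℝ) 1 ⊆ Function.support fun y : ℝ => y ^ 2 / (1 + y ^ 2) ^ 2 := by
    intro y hy
    have : 0 < y := hy.1
    rw [Function.mem_support]; positivity
  refine lt_of_lt_of_le ?_ (measure_mono h)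
  simp

/-- Pinching of the contour: the beta integral diverges when two of its parameters approach the
highest pole `-η` of `G`. The leading term comes from a neighbourhood of the origin of size `ε`, on
which `N(x) ≈ 16π²x²/(ω₁ω₂)` and `G(w - η) ≈ r/w`. -/
theorem tendsto_mul_hypInt_pinch (hω₁ : 0 < ω₁.re) (hω₂ : 0 < ω₂.re) {c d e q : ℂ}
    (hc : -((ω₁.re + ω₂.re) / 2) < c.im) (hd : -((ω₁.re + ω₂.re) / 2) < d.im)
    (he : -((ω₁.re + ω₂.re) / 2) < e.im) (hq : -((ω₁.re + ω₂.re) / 2) < q.im)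
    (hs : c + d + e + q = -2 * hypEta ω₁ ω₂) :
    Tendsto (fun ε : ℝ => (ε : ℂ) * hypInt ω₁ ω₂ ![-hypEta ω₁ ω₂ + ε * I, -hypEta ω₁ ω₂ + ε * I,
        c, d, e, q - 2 * (ε * I)]) (𝓝[>] 0)
      (𝓝 (((∫ y : ℝ, y ^ 2 / (1 + y ^ 2) ^ 2 : ℝ) : ℂ) * (16 * Real.pi ^ 2 / (ω₁ * ω₂)
        * hypGammaReg ω₁ ω₂ 0 ^ 4 * (hypGamma ω₁ ω₂ c * hypGamma ω₁ ω₂ d * hypGamma ω₁ ω₂ e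
        * hypGamma ω₁ ω₂ q) ^ 2))) := by
  set ρ := (ω₁.re + ω₂.re) / 2 with hρ
  set η := hypEta ω₁ ω₂ with hη
  set K := (1 / ω₁).re + (1 / ω₂).re with hK
  have hK0 : 0 < K := add_pos (re_one_div_pos hω₁) (re_one_div_pos hω₂)
  -- `Φ (ε, x)` is the integrand without the factor `x² / (x² + ε²)²`
  set Φ : ℝ × ℝ → ℂ := fun p => 16 * sinhQuot ω₁ (2 * p.2) * sinhQuot ω₂ (2 * p.2)
    * (hypGammaReg ω₁ ω₂ (p.1 * I + p.2) * hypGammaReg ω₁ ω₂ (p.1 * I - p.2)) ^ 2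
    * (hypPair ω₁ ω₂ c p.2 * hypPair ω₁ ω₂ d p.2 * hypPair ω₁ ω₂ e p.2
      * hypPair ω₁ ω₂ (q - 2 * (p.1 * I)) p.2) with hΦ
  obtain ⟨ε₀, hε₀, hε1, hε2, hε3⟩ : ∃ ε₀ > 0, ε₀ ≤ 1 ∧ ε₀ < ω₂.re ∧ 2 * ε₀ < q.im + ρ :=
    ⟨min 1 (min (ω₂.re / 2) ((q.im + ρ) / 3)),
      lt_min one_pos (lt_min (by linarith) (by linarith)), min_le_left _ _,
      (min_le_right _ _).trans_lt ((min_le_left _ _).trans_lt (by linarith)), by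
        have := (min_le_right 1 (min (ω₂.re / 2) ((q.im + ρ) / 3))).trans (min_le_right _ _)
        linarith⟩
  have hΦc : ∀ p : ℝ × ℝ, 0 ≤ p.1 → p.1 ≤ ε₀ → ContinuousAt Φ p := by
    intro p hp1 hp2
    have hG : ∀ (s : ℝ × ℝ → ℂ), ContinuousAt s p → -ρ < (s p).im →
        ContinuousAt (fun p => hypGamma ω₁ ω₂ (s p)) p := fun s hs h =>
      (differentiableAt_hypGamma hω₁ hω₂ h).continuousAt.comp hs
    have hR : ∀ (s : ℝ × ℝ → ℂ), ContinuousAt s p → (s p).im = p.1 →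
        ContinuousAt (fun p => hypGammaReg ω₁ ω₂ (s p)) p := fun s hs h =>
      (continuousAt_hypGammaReg hω₁ hω₂ (by rw [h]; exact hp1)
        (by rw [h]; linarith)).comp hs
    have h1 := (continuous_sinhQuot ω₁).comp (f := fun p : ℝ × ℝ => (2 * p.2 : ℂ)) (by fun_prop)
    have h2 := (continuous_sinhQuot ω₂).comp (f := fun p : ℝ × ℝ => (2 * p.2 : ℂ)) (by fun_prop)
    refine ((((continuousAt_const.mul h1.continuousAt).mul h2.continuousAt).mul
      (((hR _ (by fun_prop) (by simp)).mul (hR _ (by fun_prop) (by simp))).pow 2)).mul ?_)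
    unfold hypPair
    refine ((((hG _ (by fun_prop) (by simpa using hc)).mul
      (hG _ (by fun_prop) (by simpa using hc))).mul ((hG _ (by fun_prop) (by simpa using hd)).mul
      (hG _ (by fun_prop) (by simpa using hd)))).mul ((hG _ (by fun_prop) (by simpa using he)).mul
      (hG _ (by fun_prop) (by simpa using he)))).mul ((hG _ (by fun_prop) (by simp; linarith)).mul
      (hG _ (by fun_prop) (by simp; linarith)))
  have hker : ∀ ε x : ℝ, 0 < ε → ε ≤ ε₀ →
      hypKernel ω₁ ω₂ ![-η + ε * I, -η + ε * I, c, d, e, q - 2 * (ε * I)] x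
        = x ^ 2 / (x ^ 2 + ε ^ 2 : ℂ) ^ 2 * Φ (ε, x) := by
    intro ε x h1 h2
    have e1 : hypPair ω₁ ω₂ (-η + ε * I) x = -(hypGammaReg ω₁ ω₂ (ε * I + x)
        * hypGammaReg ω₁ ω₂ (ε * I - x)) / (x ^ 2 + ε ^ 2 : ℂ) := by
      rw [hypPair, show -η + ε * I + x = -η + (ε * I + x) by ring,
        show -η + ε * I - x = -η + (ε * I - x) by ring,
        hypGammaReg_eq hω₁ hω₂ (by simpa using h1) (by simp; linarith),
        hypGammaReg_eq hω₁ hω₂ (by simpa using h1) (by simp; linarith), div_mul_div_comm,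
        show (ε * I + x) * (ε * I - x) = -(x ^ 2 + ε ^ 2 : ℂ) by
          linear_combination (ε : ℂ) ^ 2 * I_sq, div_neg, neg_div]
    have e2 : hypWeight ω₁ ω₂ x = x ^ 2 * (16 * sinhQuot ω₁ (2 * x) * sinhQuot ω₂ (2 * x)) := by
      rw [hypWeight, show (2 * Real.pi * x / ω₁ : ℂ) = Real.pi * (2 * x) / ω₁ by ring,
        show (2 * Real.pi * x / ω₂ : ℂ) = Real.pi * (2 * x) / ω₂ by ring, ← mul_sinhQuot,
        ← mul_sinhQuot]
      ring
    have e3 : ∏ j, hypPair ω₁ ω₂ ((![-η + ε * I, -η + ε * I, c, d, e, q - 2 * (ε * I)]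
        : Fin 6 → ℂ) j) x = hypPair ω₁ ω₂ (-η + ε * I) x * hypPair ω₁ ω₂ (-η + ε * I) x
        * hypPair ω₁ ω₂ c x * hypPair ω₁ ω₂ d x * hypPair ω₁ ω₂ e x
        * hypPair ω₁ ω₂ (q - 2 * (ε * I)) x := by rw [Fin.prod_univ_six]; rfl
    rw [hypKernel, e3, e1, e2, hΦ]
    generalize (x ^ 2 + ε ^ 2 : ℂ) = D
    ring
  -- bound away from the origin
  obtain ⟨M, X, hM, hX, H⟩ := norm_prod_hypPair_le_of_large hω₁ hω₂ 6
    (‖η‖ + ‖c‖ + ‖d‖ + ‖e‖ + ‖q‖ + 2)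
  obtain ⟨M', hM', H'⟩ := norm_hypWeight_le hω₁ hω₂ 0
  have hlarge : ∀ ε x : ℝ, 0 < ε → ε ≤ ε₀ → X ≤ |x| →
      ‖hypKernel ω₁ ω₂ ![-η + ε * I, -η + ε * I, c, d, e, q - 2 * (ε * I)] x‖
        ≤ M' * M * Real.exp (-(2 * Real.pi * K * |x|)) := by
    intro ε x h1 h2 h3
    have e1 := H x 0 ![-η + ε * I, -η + ε * I, c, d, e, q - 2 * (ε * I)] h3 (by
      rw [norm_zero]; positivity) (fun j => by
      have n1 := norm_nonneg η; have n2 := norm_nonneg c; have n3 := norm_nonneg d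
      have n4 := norm_nonneg e; have n5 := norm_nonneg q
      have n6 : ‖(ε : ℂ) * I‖ ≤ 1 := by
        rw [norm_mul, Complex.norm_I, mul_one, Complex.norm_real, Real.norm_of_nonneg h1.le]
        linarith
      have n7 := norm_add_le (-η) (ε * I)
      have n8 := norm_sub_le q (2 * (ε * I))
      rw [norm_neg] at n7
      rw [norm_mul, Complex.norm_ofNat] at n8
      fin_cases j <;> simp only [Fin.zero_eta, Fin.mk_one, Fin.reduceFinMk, Matrix.cons_val] <;>
        linarith)
    have e2 := H' x 0 (by simp)
    rw [add_zero] at e1 e2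
    have e3 : ∑ j, (![-η + ε * I, -η + ε * I, c, d, e, q - 2 * (ε * I)] : Fin 6 → ℂ) j
        = ((-4 : ℝ) : ℂ) * η := by
      rw [Fin.sum_univ_six]; simp only [Matrix.cons_val]; push_cast; linear_combination hs
    rw [e3, hypRate_real_mul, hypRate_hypEta hω₁ hω₂] at e1
    rw [hypKernel, norm_mul]
    calc _ ≤ _ := mul_le_mul e2 e1 (norm_nonneg _) (by positivity)
      _ = M' * M * (Real.exp (2 * Real.pi * |x| * K)
          * Real.exp (2 * Real.pi * |x| * (-4 * (K / 2)))) := by ring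
      _ = _ := by rw [← Real.exp_add]; ring_nf
  set X' := max X 1 with hX'
  obtain ⟨C, hC⟩ : ∃ C, ∀ p ∈ Set.Icc (0 : ℝ) ε₀ ×ˢ Set.Icc (-X') X', ‖Φ p‖ ≤ C :=
    (isCompact_Icc.prod isCompact_Icc).exists_bound_of_continuousOn
      fun p hp => (hΦc p hp.1.1 hp.1.2).continuousWithinAt
  have hC0 : 0 ≤ C := (norm_nonneg _).trans (hC (0, 0) ⟨⟨le_rfl, hε₀.le⟩, by
    constructor <;> simp [hX']⟩)
  have hscale : ∀ ε : ℝ, 0 < ε → ε ≤ ε₀ → (ε : ℂ) * hypInt ω₁ ω₂ ![-η + ε * I, -η + ε * I,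
        c, d, e, q - 2 * (ε * I)] = ∫ y : ℝ, (ε : ℂ) ^ 2 * hypKernel ω₁ ω₂
          ![-η + ε * I, -η + ε * I, c, d, e, q - 2 * (ε * I)] ((ε * y : ℝ) : ℂ) := by
    intro ε h1 h2
    have h0 : (ε : ℂ) ≠ 0 := by exact_mod_cast h1.ne'
    rw [integral_const_mul, Measure.integral_comp_mul_left (fun x : ℝ => hypKernel ω₁ ω₂
          ![-η + ε * I, -η + ε * I, c, d, e, q - 2 * (ε * I)] x) ε, abs_of_pos (by positivity),
      Complex.real_smul, hypInt]
    push_cast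
    field_simp
  have hev : ∀ᶠ ε : ℝ in 𝓝[>] 0, 0 < ε ∧ ε ≤ ε₀ := by
    filter_upwards [self_mem_nhdsWithin, Ioc_mem_nhdsGT hε₀] with ε h1 h2
    exact ⟨h1, h2.2⟩
  have hpt : ∀ ε y : ℝ, 0 < ε → ε ≤ ε₀ → (ε : ℂ) ^ 2 * hypKernel ω₁ ω₂
      ![-η + ε * I, -η + ε * I, c, d, e, q - 2 * (ε * I)] ((ε * y : ℝ) : ℂ)
      = ((y ^ 2 / (1 + y ^ 2) ^ 2 : ℝ) : ℂ) * Φ (ε, ε * y) := by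
    intro ε y h1 h2
    have h0 : (ε : ℂ) ≠ 0 := by exact_mod_cast h1.ne'
    have h3 : (1 + y ^ 2 : ℂ) ≠ 0 := by
      have : (1 + y ^ 2 : ℝ) ≠ 0 := by positivity
      exact_mod_cast this
    rw [hker ε _ h1 h2]
    push_cast
    rw [show ((ε : ℂ) * y) ^ 2 + ε ^ 2 = ε ^ 2 * (1 + y ^ 2) by ring]
    field_simp
  have hlim : Tendsto (fun ε : ℝ => ∫ y : ℝ, (ε : ℂ) ^ 2 * hypKernel ω₁ ω₂
      ![-η + ε * I, -η + ε * I, c, d, e, q - 2 * (ε * I)] ((ε * y : ℝ) : ℂ)) (𝓝[>] 0)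
      (𝓝 (∫ y : ℝ, ((y ^ 2 / (1 + y ^ 2) ^ 2 : ℝ) : ℂ) * Φ (0, 0))) := by
    refine tendsto_integral_filter_of_dominated_convergence
      (fun y => (C + M' * M * (2 / (2 * Real.pi * K) ^ 2) * 2) * (1 + y ^ 2)⁻¹) ?_ ?_
      (integrable_inv_one_add_sq.const_mul _) ?_
    · filter_upwards [hev] with ε hε
      refine Continuous.aestronglyMeasurable (continuous_const.mul ?_)
      refine (continuous_hypKernel hω₁ hω₂ fun j => ?_).comp (f := fun y : ℝ => ε * y)
        (by fun_prop)
      have hη' : η.im = ρ := hypEta_im _ _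
      fin_cases j
      · have := hε.1; simp [hη']; linarith
      · have := hε.1; simp [hη']; linarith
      · exact hc
      · exact hd
      · exact he
      · simp; linarith
    · filter_upwards [hev] with ε hε
      refine ae_of_all _ fun y => ?_
      rcases le_total |ε * y| X' with h | h
      · rw [hpt ε y hε.1 hε.2, norm_mul, Complex.norm_real, Real.norm_of_nonneg (by positivity)]
        have h1 := hC (ε, ε * y) ⟨⟨hε.1.le, hε.2⟩, abs_le.1 h⟩
        calc _ ≤ (1 + y ^ 2)⁻¹ * C := by
              refine mul_le_mul ?_ h1 (norm_nonneg _) (by positivity)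
              rw [div_le_iff₀ (by positivity)]
              field_simp
              nlinarith [sq_nonneg y]
          _ ≤ _ := by
            rw [mul_comm]
            refine mul_le_mul_of_nonneg_right ?_ (by positivity)
            have : 0 ≤ M' * M * (2 / (2 * Real.pi * K) ^ 2) * 2 := by positivity
            linarith
      · have h1 := hlarge ε (ε * y) hε.1 hε.2 ((le_max_left _ _).trans h)
        have hy : 1 ≤ |y| := by
          rw [abs_mul, abs_of_pos hε.1] at h
          have h2 : 1 ≤ ε * |y| := (le_max_right _ _).trans h
          nlinarith [abs_nonneg y, hε.1, hε.2]
        have hy0 : 0 < y ^ 2 := by rw [← sq_abs]; positivity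
        have hy1 : 1 ≤ y ^ 2 := by rw [← sq_abs]; nlinarith
        rw [norm_mul, norm_pow, Complex.norm_real, Real.norm_of_nonneg hε.1.le]
        have hexp : Real.exp (-(2 * Real.pi * K * |ε * y|))
            ≤ 2 / (2 * Real.pi * K) ^ 2 * (1 / (ε ^ 2 * y ^ 2)) := by
          have h3 : (2 * Real.pi * K * |ε * y|) ^ 2 / 2 ≤ Real.exp (2 * Real.pi * K * |ε * y|) := by
            have := Real.quadratic_le_exp_of_nonneg (x := 2 * Real.pi * K * |ε * y|)
              (by positivity)
            have h4 : 0 ≤ 2 * Real.pi * K * |ε * y| := by positivity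
            linarith
          rw [Real.exp_neg]
          have hεp := hε.1
          have h5 : 0 < (2 * Real.pi * K * |ε * y|) ^ 2 / 2 := by
            rw [mul_pow, sq_abs, mul_pow ε]; positivity
          refine (inv_anti₀ h5 h3).trans (le_of_eq ?_)
          rw [mul_pow, sq_abs, mul_pow ε]
          field_simp
        have hεp := hε.1
        calc _ ≤ ε ^ 2 * (M' * M * (2 / (2 * Real.pi * K) ^ 2 * (1 / (ε ^ 2 * y ^ 2)))) := by
              refine mul_le_mul_of_nonneg_left (h1.trans ?_) (by positivity)
              exact mul_le_mul_of_nonneg_left hexp (by positivity)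
          _ = M' * M * (2 / (2 * Real.pi * K) ^ 2) * (1 / y ^ 2) := by field_simp
          _ ≤ M' * M * (2 / (2 * Real.pi * K) ^ 2) * (2 * (1 + y ^ 2)⁻¹) := by
              refine mul_le_mul_of_nonneg_left ?_ (by positivity)
              rw [div_le_iff₀ hy0]
              field_simp
              linarith
          _ ≤ _ := by
            rw [← mul_assoc]
            refine mul_le_mul_of_nonneg_right ?_ (by positivity)
            linarith
    · refine ae_of_all _ fun y => ?_
      have h1 : Tendsto (fun ε : ℝ => ((y ^ 2 / (1 + y ^ 2) ^ 2 : ℝ) : ℂ) * Φ (ε, ε * y)) (𝓝[>] 0)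
          (𝓝 (((y ^ 2 / (1 + y ^ 2) ^ 2 : ℝ) : ℂ) * Φ (0, 0))) := by
        refine Tendsto.const_mul _ (tendsto_nhdsWithin_of_tendsto_nhds ?_)
        have h2 := hΦc (0, 0) le_rfl hε₀.le
        have h3 : Tendsto (fun ε : ℝ => (ε, ε * y)) (𝓝 0) (𝓝 (0, 0)) := by
          have : Continuous fun ε : ℝ => (ε, ε * y) := by fun_prop
          simpa using this.tendsto 0
        exact h2.tendsto.comp h3
      refine h1.congr' ?_
      filter_upwards [hev] with ε hε
      exact (hpt ε y hε.1 hε.2).symm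
  have hfin : ∫ y : ℝ, ((y ^ 2 / (1 + y ^ 2) ^ 2 : ℝ) : ℂ) * Φ (0, 0)
      = ((∫ y : ℝ, y ^ 2 / (1 + y ^ 2) ^ 2 : ℝ) : ℂ) * (16 * Real.pi ^ 2 / (ω₁ * ω₂)
        * hypGammaReg ω₁ ω₂ 0 ^ 4 * (hypGamma ω₁ ω₂ c * hypGamma ω₁ ω₂ d * hypGamma ω₁ ω₂ e
        * hypGamma ω₁ ω₂ q) ^ 2) := by
    rw [integral_mul_const, integral_complex_ofReal]
    congr 1
    simp only [hΦ, hypPair]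
    simp [sinhQuot_zero]
    ring
  rw [← hfin]
  refine hlim.congr' ?_
  filter_upwards [hev] with ε hε
  exact (hscale ε hε.1 hε.2).symm


/-! ### Evaluation of the beta integral -/

/-- The product `∏_{j<k} G(η + v_j + v_k)` for `v = (a, b, c, d, p, q)`. -/
def hypBetaProd (ω₁ ω₂ a b c d p q : ℂ) : ℂ :=
  hypCross ω₁ ω₂ p a b c d q * hypGamma ω₁ ω₂ (hypEta ω₁ ω₂ + p + q)
    * (hypGamma ω₁ ω₂ (hypEta ω₁ ω₂ + a + b) * hypGamma ω₁ ω₂ (hypEta ω₁ ω₂ + a + c)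
    * hypGamma ω₁ ω₂ (hypEta ω₁ ω₂ + a + d) * hypGamma ω₁ ω₂ (hypEta ω₁ ω₂ + b + c)
    * hypGamma ω₁ ω₂ (hypEta ω₁ ω₂ + b + d) * hypGamma ω₁ ω₂ (hypEta ω₁ ω₂ + c + d))

/-- The value of the constant in the beta integral. -/
def hypBetaConst (ω₁ ω₂ : ℂ) : ℂ :=
  ((∫ y : ℝ, y ^ 2 / (1 + y ^ 2) ^ 2 : ℝ) : ℂ) * (16 * Real.pi ^ 2 / (ω₁ * ω₂))
    * hypGammaReg ω₁ ω₂ 0 ^ 3 * (2 * I)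

theorem hypBetaConst_ne_zero (hω₁ : 0 < ω₁.re) (hω₂ : 0 < ω₂.re) : hypBetaConst ω₁ ω₂ ≠ 0 := by
  have h1 := ne_zero_of_re_pos hω₁
  have h2 := ne_zero_of_re_pos hω₂
  have h3 := hypGammaReg_zero_ne_zero hω₁ hω₂
  have h4 : ((∫ y : ℝ, y ^ 2 / (1 + y ^ 2) ^ 2 : ℝ) : ℂ) ≠ 0 := by
    exact_mod_cast integral_sq_div_sq_pos.ne'
  have h5 : (Real.pi : ℂ) ≠ 0 := by exact_mod_cast Real.pi_ne_zero
  have h6 := I_ne_zero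
  unfold hypBetaConst
  exact mul_ne_zero (mul_ne_zero (mul_ne_zero h4 (div_ne_zero (mul_ne_zero (by norm_num)
    (pow_ne_zero _ h5)) (mul_ne_zero h1 h2))) (pow_ne_zero _ h3)) (mul_ne_zero two_ne_zero h6)

/-- Solving the equation between the limits of both sides for the beta integral `I₀`. -/
theorem pinch_limit_cancel {I₀ κ w R Ga Gb Gc Gd Gq Tb Tc Td Fcd Fbd Fbc X Fab Fac Fad Fpq : ℂ}
    (na : Ga ≠ 0) (nb : Gb ≠ 0) (nc : Gc ≠ 0) (nd : Gd ≠ 0) (nq : Gq ≠ 0) (ntb : Tb ≠ 0)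
    (ntc : Tc ≠ 0) (ntd : Td ≠ 0) (ncd : Fcd ≠ 0) (nbd : Fbd ≠ 0) (nbc : Fbc ≠ 0) (nR : R ≠ 0)
    (h : I₀ * (Ga * Gb * Gc * Gd * (Gq * Tb * Tc * Td) * (R / (2 * I) * Gb * Gc * Gd
      * (Gq * Fcd⁻¹ * Fbd⁻¹ * Fbc⁻¹))) = κ * (w * R ^ 4 * (Gb * Gc * Gd * Gq) ^ 2)
      * (X * (Ga * Fab * Fac * Fad * (Fpq * Tb * Tc * Td)))) :
    I₀ = κ * w * R ^ 3 * (2 * I) * (X * Fpq * (Fab * Fac * Fad * Fbc * Fbd * Fcd)) := by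
  have hI := I_ne_zero
  calc I₀ = I₀ * (Ga * Gb * Gc * Gd * (Gq * Tb * Tc * Td) * (R / (2 * I) * Gb * Gc * Gd
      * (Gq * Fcd⁻¹ * Fbd⁻¹ * Fbc⁻¹))) * (2 * I * Fcd * Fbd * Fbc
      / (R * Ga * Gb ^ 2 * Gc ^ 2 * Gd ^ 2 * Gq ^ 2 * Tb * Tc * Td)) := by field_simp
    _ = _ := by rw [h]; field_simp

theorem hypInt_six_perm {v w : Fin 6 → ℂ} (σ : Equiv.Perm (Fin 6)) (h : v ∘ σ = w) :
    hypInt ω₁ ω₂ w = hypInt ω₁ ω₂ v := by rw [← h, hypInt_comp_perm]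

set_option maxHeartbeats 1000000 in
/-- The hyperbolic beta integral (Nassrallah–Rahman type) near the point where four parameters
approach `-η`. Moving first `(p, q)` and then `(a, q)` with constant sums reduces it to the pinched
integral. -/
theorem hypInt_six_eq (hω₁ : 0 < ω₁.re) (hω₂ : 0 < ω₂.re) {a b c d p q : ℂ}
    (he : ∀ j, 0 < ((![a, b, c, d] : Fin 4 → ℂ) j).im + (ω₁.re + ω₂.re) / 2)
    (hk : ∀ j, 0 < hypRate ω₁ ω₂ ((![a, b, c, d] : Fin 4 → ℂ) j + hypEta ω₁ ω₂))
    (hp : -((ω₁.re + ω₂.re) / 2) < p.im) (hq : -((ω₁.re + ω₂.re) / 2) < q.im)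
    (hs : a + b + c + d + p + q = -4 * hypEta ω₁ ω₂)
    (het : a.im + b.im + c.im + d.im + 2 * (ω₁.re + ω₂.re) < ω₂.re)
    (hkt : hypRate ω₁ ω₂ (a + hypEta ω₁ ω₂) + hypRate ω₁ ω₂ (b + hypEta ω₁ ω₂)
      + hypRate ω₁ ω₂ (c + hypEta ω₁ ω₂) + hypRate ω₁ ω₂ (d + hypEta ω₁ ω₂)
      < (1 / ω₁).re + (1 / ω₂).re) :
    hypInt ω₁ ω₂ ![a, b, c, d, p, q] = hypBetaConst ω₁ ω₂ * hypBetaProd ω₁ ω₂ a b c d p q := by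
  set ρ := (ω₁.re + ω₂.re) / 2 with hρ
  set η := hypEta ω₁ ω₂ with hη
  have hηi : η.im = ρ := hypEta_im _ _
  have ta : 0 < a.im + ρ := he 0
  have tb : 0 < b.im + ρ := he 1
  have tc : 0 < c.im + ρ := he 2
  have td : 0 < d.im + ρ := he 3
  have ka : 0 < hypRate ω₁ ω₂ (a + η) := hk 0
  have kb : 0 < hypRate ω₁ ω₂ (b + η) := hk 1
  have kc : 0 < hypRate ω₁ ω₂ (c + η) := hk 2
  have kd : 0 < hypRate ω₁ ω₂ (d + η) := hk 3
  have hsi : a.im + b.im + c.im + d.im + p.im + q.im = -4 * ρ := by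
    have := congrArg Complex.im hs
    simpa [hηi] using this
  set D := p + q with hD
  have hDi : D.im = -(a.im + b.im + c.im + d.im) - 4 * ρ := by
    rw [hD, Complex.add_im]; linarith
  have hkD : hypRate ω₁ ω₂ (-D) = hypRate ω₁ ω₂ (a + η) + hypRate ω₁ ω₂ (b + η)
      + hypRate ω₁ ω₂ (c + η) + hypRate ω₁ ω₂ (d + η) := by
    rw [← hypRate_add, ← hypRate_add, ← hypRate_add]; congr 1; linear_combination -hs
  set q₀ := -2 * η - b - c - d with hq₀
  set κ := hypRate ω₁ ω₂ I with hκ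
  -- first `p` is moved to `-η + iε` at the expense of `q`, and then `a` at the expense of the last
  -- parameter, which becomes `q₀ - 2iε`
  have hstep : ∀ᶠ ε : ℝ in 𝓝[>] 0,
      hypInt ω₁ ω₂ ![a, b, c, d, p, q] * (hypCross ω₁ ω₂ (-η + ε * I) a b c d (D + η - ε * I)
        * ((ε : ℂ) * hypCross ω₁ ω₂ (-η + ε * I) (-η + ε * I) b c d (q₀ - 2 * (ε * I))))
      = ((ε : ℂ) * hypInt ω₁ ω₂ ![-η + ε * I, -η + ε * I, b, c, d, q₀ - 2 * (ε * I)])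
        * (hypCross ω₁ ω₂ p a b c d q
        * hypCross ω₁ ω₂ a (-η + ε * I) b c d (D + η - ε * I)) := by
    have hev : ∀ᶠ ε : ℝ in 𝓝[>] 0, 0 < ε ∧ 2 * ε < 2 * ρ - (b.im + c.im + d.im + 3 * ρ) ∧
        ε < 2 * ρ - (a.im + b.im + c.im + d.im + 4 * ρ) ∧ ε < a.im + ρ ∧
        0 ≤ hypRate ω₁ ω₂ (b + η) + hypRate ω₁ ω₂ (c + η) + hypRate ω₁ ω₂ (d + η) + ε * κ ∧
        hypRate ω₁ ω₂ (b + η) + hypRate ω₁ ω₂ (c + η) + hypRate ω₁ ω₂ (d + η) + ε * κ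
          < (1 / ω₁).re + (1 / ω₂).re := by
      refine Filter.Eventually.and self_mem_nhdsWithin
        (eventually_nhdsWithin_of_eventually_nhds ?_)
      have c1 : ContinuousAt (fun ε : ℝ => 2 * ε) 0 := by fun_prop
      have c2 : ContinuousAt (fun ε : ℝ => ε) 0 := by fun_prop
      have c3 : ContinuousAt (fun ε : ℝ => hypRate ω₁ ω₂ (b + η) + hypRate ω₁ ω₂ (c + η)
        + hypRate ω₁ ω₂ (d + η) + ε * κ) 0 := by fun_prop
      refine (c1.eventually_lt_const (by linarith)).and
        ((c2.eventually_lt_const (by linarith)).and ((c2.eventually_lt_const ta).and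
        (((c3.eventually_const_lt (u := 0) (by simp only [zero_mul]; linarith)).mono
          fun _ h => h.le).and (c3.eventually_lt_const (by simp only [zero_mul]; linarith)))))
    filter_upwards [hev] with ε hε
    obtain ⟨e1, e2, e3, e4, e5, e6⟩ := hε
    have m1 := hypInt_mul_hypCross_comm hω₁ hω₂ (a := a) (b := b) (c := c) (d := d) (D := D)
      (s := p) (s' := -η + ε * I) (fun j => by linarith [he j]) (by rw [hD]; linear_combination hs)
      (fun j => by
        have : ((![a, b, c, d] : Fin 4 → ℂ) j).im ≤ a.im + b.im + c.im + d.im + 3 * ρ := by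
          fin_cases j <;> simp <;> linarith
        rw [hDi]; linarith) (by rw [hDi]; linarith) (by rw [hkD]; linarith) (by rw [hkD]; linarith)
      hp (by rw [hD, add_sub_cancel_left]; exact hq) (by simp [hηi]; linarith)
      (by simp [hηi, hDi]; linarith)
    have m2 := hypInt_mul_hypCross_comm hω₁ hω₂ (a := -η + ε * I) (b := b) (c := c) (d := d)
      (D := a + (D + η - ε * I)) (s := a) (s' := -η + ε * I)
      (fun j => by
        fin_cases j <;> simp [hηi] <;> linarith)
      (by rw [hD]; linear_combination hs)
      (fun j => by fin_cases j <;> simp [hηi, hDi] <;> linarith)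
      (by simp [hηi, hDi]; linarith)
      (by
        rw [show -(a + (D + η - ε * I)) = (b + η) + (c + η) + (d + η) + (ε : ℝ) * I by
          rw [hD]; linear_combination -hs, hypRate_add, hypRate_add, hypRate_add, hypRate_real_mul]
        exact e5)
      (by
        rw [show -(a + (D + η - ε * I)) = (b + η) + (c + η) + (d + η) + (ε : ℝ) * I by
          rw [hD]; linear_combination -hs, hypRate_add, hypRate_add, hypRate_add, hypRate_real_mul]
        exact e6)
      (by linarith) (by simp [hηi, hDi]; linarith) (by simp [hηi]; linarith)
      (by simp [hηi, hDi]; linarith)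
    rw [show a + (D + η - ε * I) - (-η + ε * I) = q₀ - 2 * (ε * I) by
      rw [hD, hq₀]; linear_combination hs, show a + (D + η - ε * I) - a = D + η - ε * I by ring]
      at m2
    rw [show D - p = q by rw [hD]; ring, show D - (-η + ε * I) = D + η - ε * I by ring] at m1
    have p1 : hypInt ω₁ ω₂ ![p, a, b, c, d, q] = hypInt ω₁ ω₂ ![a, b, c, d, p, q] := by
      refine hypInt_six_perm (Fin.cycleRange 4)⁻¹ ?_
      ext j; fin_cases j <;> rfl
    have p2 : hypInt ω₁ ω₂ ![a, -η + ε * I, b, c, d, D + η - ε * I]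
        = hypInt ω₁ ω₂ ![-η + ε * I, a, b, c, d, D + η - ε * I] := by
      refine hypInt_six_perm (Equiv.swap 0 1) ?_
      ext j; fin_cases j <;> rfl
    rw [p1] at m1
    rw [p2] at m2
    linear_combination ((ε : ℂ) * hypCross ω₁ ω₂ (-η + ε * I) (-η + ε * I) b c d
      (q₀ - 2 * (ε * I))) * m1 + (ε : ℂ) * hypCross ω₁ ω₂ p a b c d q * m2
  -- as `ε → 0`, the factors `G(-η + 2iε)` and the pinched integral grow like `1 / ε`
  have hG : ∀ s : ℝ → ℂ, Continuous s → -ρ < (s 0).im →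
      Tendsto (fun ε => hypGamma ω₁ ω₂ (s ε)) (𝓝[>] 0) (𝓝 (hypGamma ω₁ ω₂ (s 0))) :=
    fun s hs h => tendsto_nhdsWithin_of_tendsto_nhds
      ((differentiableAt_hypGamma hω₁ hω₂ h).continuousAt.comp hs.continuousAt)
  have hCr : ∀ s a' b' c' d' q' : ℝ → ℂ, Continuous s → Continuous a' → Continuous b' →
      Continuous c' → Continuous d' → Continuous q' → -ρ < (η + s 0 + a' 0).im →
      -ρ < (η + s 0 + b' 0).im → -ρ < (η + s 0 + c' 0).im → -ρ < (η + s 0 + d' 0).im →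
      -ρ < (η + q' 0 + a' 0).im → -ρ < (η + q' 0 + b' 0).im → -ρ < (η + q' 0 + c' 0).im →
      -ρ < (η + q' 0 + d' 0).im →
      Tendsto (fun ε => hypCross ω₁ ω₂ (s ε) (a' ε) (b' ε) (c' ε) (d' ε) (q' ε)) (𝓝[>] 0)
        (𝓝 (hypCross ω₁ ω₂ (s 0) (a' 0) (b' 0) (c' 0) (d' 0) (q' 0))) := by
    intro s a' b' c' d' q' hs ha hb hc hd hq h1 h2 h3 h4 h5 h6 h7 h8
    unfold hypCross
    rw [← hη]
    exact ((((hG (fun ε => η + s ε + a' ε) (by fun_prop) h1).mul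
      (hG (fun ε => η + s ε + b' ε) (by fun_prop) h2)).mul
      (hG (fun ε => η + s ε + c' ε) (by fun_prop) h3)).mul
      (hG (fun ε => η + s ε + d' ε) (by fun_prop) h4)).mul
      ((((hG (fun ε => η + q' ε + a' ε) (by fun_prop) h5).mul
      (hG (fun ε => η + q' ε + b' ε) (by fun_prop) h6)).mul
      (hG (fun ε => η + q' ε + c' ε) (by fun_prop) h7)).mul
      (hG (fun ε => η + q' ε + d' ε) (by fun_prop) h8))
  have hX1 := hCr (fun ε => -η + ε * I) (fun _ => a) (fun _ => b) (fun _ => c) (fun _ => d)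
    (fun ε => D + η - ε * I) (by fun_prop) (by fun_prop) (by fun_prop) (by fun_prop) (by fun_prop)
    (by fun_prop) (by simp; linarith) (by simp; linarith) (by simp; linarith)
    (by simp; linarith) (by simp [hηi, hDi]; linarith) (by simp [hηi, hDi]; linarith)
    (by simp [hηi, hDi]; linarith) (by simp [hηi, hDi]; linarith)
  have hY2 := hCr (fun _ => a) (fun ε => -η + ε * I) (fun _ => b) (fun _ => c) (fun _ => d)
    (fun ε => D + η - ε * I) (by fun_prop) (by fun_prop) (by fun_prop) (by fun_prop) (by fun_prop)
    (by fun_prop) (by simp; linarith) (by simp [hηi]; linarith) (by simp [hηi]; linarith)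
    (by simp [hηi]; linarith) (by simp [hηi, hDi]; linarith) (by simp [hηi, hDi]; linarith)
    (by simp [hηi, hDi]; linarith) (by simp [hηi, hDi]; linarith)
  have hX2 : Tendsto (fun ε : ℝ => (ε : ℂ)
      * hypCross ω₁ ω₂ (-η + ε * I) (-η + ε * I) b c d (q₀ - 2 * (ε * I))) (𝓝[>] 0)
      (𝓝 (hypGammaReg ω₁ ω₂ 0 / (2 * I) * hypGamma ω₁ ω₂ b * hypGamma ω₁ ω₂ c * hypGamma ω₁ ω₂ d
        * (hypGamma ω₁ ω₂ q₀ * hypGamma ω₁ ω₂ (-(η + c + d)) * hypGamma ω₁ ω₂ (-(η + b + d))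
        * hypGamma ω₁ ω₂ (-(η + b + c))))) := by
    have t1 : Tendsto (fun ε : ℝ => hypGammaReg ω₁ ω₂ (2 * ε * I) / (2 * I)) (𝓝[>] 0)
        (𝓝 (hypGammaReg ω₁ ω₂ 0 / (2 * I))) := by
      refine (tendsto_nhdsWithin_of_tendsto_nhds ?_).div_const _
      have := (continuousAt_hypGammaReg hω₁ hω₂ (w := 0) le_rfl (by simpa using hω₂)).tendsto
      refine this.comp ?_
      have h : Continuous fun ε : ℝ => (2 * ε * I : ℂ) := by fun_prop
      simpa using h.tendsto 0
    have t2 := (((((((t1.mul (hG (fun ε => b + ε * I) (by fun_prop) (by simp; linarith))).mul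
      (hG (fun ε => c + ε * I) (by fun_prop) (by simp; linarith))).mul
      (hG (fun ε => d + ε * I) (by fun_prop) (by simp; linarith))).mul
      ((((hG (fun ε => q₀ - ε * I) (by fun_prop) (by simp [hq₀, hηi]; linarith)).mul
      (hG (fun ε => -(η + c + d) - 2 * (ε * I)) (by fun_prop) (by simp [hηi]; linarith))).mul
      (hG (fun ε => -(η + b + d) - 2 * (ε * I)) (by fun_prop) (by simp [hηi]; linarith))).mul
      (hG (fun ε => -(η + b + c) - 2 * (ε * I)) (by fun_prop) (by simp [hηi]; linarith)))))))
    simp only [Complex.ofReal_zero, zero_mul, mul_zero, add_zero, sub_zero] at t2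
    refine t2.congr' ?_
    filter_upwards [self_mem_nhdsWithin, Ioo_mem_nhdsGT (half_pos hω₂)] with ε h1 h2
    have hε : 0 < ε := h1
    have h0 : (ε : ℂ) ≠ 0 := by exact_mod_cast hε.ne'
    rw [hypCross, ← hη]
    rw [show η + (-η + ε * I) + (-η + ε * I) = -η + 2 * ε * I by ring,
      hypGammaReg_eq hω₁ hω₂ (by simpa using hε) (by simp; linarith [h2.2]),
      show η + (-η + ε * I) + b = b + ε * I by ring, show η + (-η + ε * I) + c = c + ε * I by ring,
      show η + (-η + ε * I) + d = d + ε * I by ring,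
      show η + (q₀ - 2 * (ε * I)) + (-η + ε * I) = q₀ - ε * I by ring,
      show η + (q₀ - 2 * (ε * I)) + b = -(η + c + d) - 2 * (ε * I) by rw [hq₀]; ring,
      show η + (q₀ - 2 * (ε * I)) + c = -(η + b + d) - 2 * (ε * I) by rw [hq₀]; ring,
      show η + (q₀ - 2 * (ε * I)) + d = -(η + b + c) - 2 * (ε * I) by rw [hq₀]; ring]
    have hI := I_ne_zero
    field_simp
  have hI2 := tendsto_mul_hypInt_pinch hω₁ hω₂ (c := b) (d := c) (e := d) (q := q₀)
    (by linarith) (by linarith) (by linarith) (by simp [hq₀, hηi]; linarith)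
    (by rw [hq₀]; ring)
  have hlim := tendsto_nhds_unique_of_eventuallyEq (((hX1.mul hX2).const_mul _))
    (hI2.mul (hY2.const_mul _)) hstep
  simp only [Complex.ofReal_zero, zero_mul, add_zero, sub_zero] at hlim
  rw [hypCross, hypCross.eq_def ω₁ ω₂ a, ← hη, hypGamma_neg hω₁ hω₂ (η + c + d),
    hypGamma_neg hω₁ hω₂ (η + b + d), hypGamma_neg hω₁ hω₂ (η + b + c),
    show η + (D + η) + a = q₀ by rw [hD, hq₀]; linear_combination hs,
    show η + -η + a = a by ring, show η + -η + b = b by ring, show η + -η + c = c by ring,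
    show η + -η + d = d by ring, show η + a + -η = a by ring,
    show η + (D + η) + -η = η + p + q by rw [hD]; ring] at hlim
  have nz : ∀ z : ℂ, -ρ < z.im → z.im < ρ → hypGamma ω₁ ω₂ z ≠ 0 := fun z h1 h2 =>
    hypGamma_ne_zero hω₁ hω₂ (abs_lt.2 ⟨h1, h2⟩)
  have na := nz a (by linarith) (by linarith)
  have nb := nz b (by linarith) (by linarith)
  have nc := nz c (by linarith) (by linarith)
  have nd := nz d (by linarith) (by linarith)
  have nq := nz q₀ (by simp [hq₀, hηi]; linarith) (by simp [hq₀, hηi]; linarith)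
  have ncd := nz (η + c + d) (by simp [hηi]; linarith) (by simp [hηi]; linarith)
  have nbd := nz (η + b + d) (by simp [hηi]; linarith) (by simp [hηi]; linarith)
  have nbc := nz (η + b + c) (by simp [hηi]; linarith) (by simp [hηi]; linarith)
  have nDb := nz (η + (D + η) + b) (by simp [hηi, hDi]; linarith) (by simp [hηi, hDi]; linarith)
  have nDc := nz (η + (D + η) + c) (by simp [hηi, hDi]; linarith) (by simp [hηi, hDi]; linarith)
  have nDd := nz (η + (D + η) + d) (by simp [hηi, hDi]; linarith) (by simp [hηi, hDi]; linarith)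
  have nR := hypGammaReg_zero_ne_zero hω₁ hω₂
  rw [hypBetaProd, hypBetaConst, ← hη]
  exact pinch_limit_cancel na nb nc nd nq nDb nDc nDd ncd nbd nbc nR hlim


/-! ### The transformation by `w` on an open set -/

/-- The conditions on four parameters `b` under which the beta integral with the parameters `b` and
two more is evaluated. -/
structure BetaAdmissible (ω₁ ω₂ : ℂ) (b : Fin 4 → ℂ) : Prop where
  im_pos : ∀ j, 0 < (b j).im + (ω₁.re + ω₂.re) / 2
  rate_pos : ∀ j, 0 < hypRate ω₁ ω₂ (b j + hypEta ω₁ ω₂)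
  im_lt : (b 0).im + (b 1).im + (b 2).im + (b 3).im + 2 * (ω₁.re + ω₂.re) < ω₂.re
  rate_lt : hypRate ω₁ ω₂ (b 0 + hypEta ω₁ ω₂) + hypRate ω₁ ω₂ (b 1 + hypEta ω₁ ω₂)
    + hypRate ω₁ ω₂ (b 2 + hypEta ω₁ ω₂) + hypRate ω₁ ω₂ (b 3 + hypEta ω₁ ω₂)
    < (1 / ω₁).re + (1 / ω₂).re

/-- The product `∏_{j<k} G(η + b_j + b_k)` for four parameters. -/
def hypPairProd (ω₁ ω₂ : ℂ) (b : Fin 4 → ℂ) : ℂ :=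
  hypGamma ω₁ ω₂ (hypEta ω₁ ω₂ + b 0 + b 1) * hypGamma ω₁ ω₂ (hypEta ω₁ ω₂ + b 0 + b 2)
    * hypGamma ω₁ ω₂ (hypEta ω₁ ω₂ + b 0 + b 3) * hypGamma ω₁ ω₂ (hypEta ω₁ ω₂ + b 1 + b 2)
    * hypGamma ω₁ ω₂ (hypEta ω₁ ω₂ + b 1 + b 3) * hypGamma ω₁ ω₂ (hypEta ω₁ ω₂ + b 2 + b 3)

/-- The two-variable integrand `N(x) N(z) ∏ G(b'_k ± x) ∏ G(b_j ± z) G(a ± x ± z)`, for which both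
iterated integrals can be evaluated by the beta integral. -/
def hypDoubleKernel (ω₁ ω₂ : ℂ) (b' b : Fin 4 → ℂ) (a : ℂ) (x z : ℝ) : ℂ :=
  hypKernel ω₁ ω₂ b' x * hypKernel ω₁ ω₂ b z
    * (hypPair ω₁ ω₂ a (x + z) * hypPair ω₁ ω₂ a (x - z))

theorem hypDoubleKernel_swap (b' b : Fin 4 → ℂ) (a : ℂ) (x z : ℝ) :
    hypDoubleKernel ω₁ ω₂ b' b a x z = hypDoubleKernel ω₁ ω₂ b b' a z x := by
  rw [hypDoubleKernel, hypDoubleKernel, add_comm (x : ℂ), ← neg_sub (z : ℂ), hypPair_neg]; ring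

/-- The factor with `a` decays with rate `Im (a / ω₁ω₂) < 0` in `|x| + |z| ≤ |x + z| + |x - z|`,
which outweighs the possible growth of the other two factors. -/
theorem integrable_hypDoubleKernel (hω₁ : 0 < ω₁.re) (hω₂ : 0 < ω₂.re) {b' b : Fin 4 → ℂ} {a : ℂ}
    (hb' : BetaAdmissible ω₁ ω₂ b') (hb : BetaAdmissible ω₁ ω₂ b)
    (hs' : b' 0 + b' 1 + b' 2 + b' 3 = -4 * hypEta ω₁ ω₂ - 2 * a)
    (hs : b 0 + b 1 + b 2 + b 3 = -4 * hypEta ω₁ ω₂ - 2 * a) :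
    Integrable (Function.uncurry (hypDoubleKernel ω₁ ω₂ b' b a)) (volume.prod volume) := by
  set ρ := (ω₁.re + ω₂.re) / 2 with hρ
  set K := (1 / ω₁).re + (1 / ω₂).re with hK
  set η := hypEta ω₁ ω₂ with hη
  have hηi : η.im = ρ := hypEta_im _ _
  have hai : a.im = -((b 0).im + (b 1).im + (b 2).im + (b 3).im) / 2 - 2 * ρ := by
    have := congrArg Complex.im hs
    simp [hηi] at this; linarith
  have haρ : -ρ < a.im := by have := hb.im_lt; rw [hai]; linarith
  have hka : hypRate ω₁ ω₂ (-2 * a) = -2 * hypRate ω₁ ω₂ a := by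
    rw [show -2 * a = ((-2 : ℝ) : ℂ) * a by push_cast; ring, hypRate_real_mul]
  have hka' : hypRate ω₁ ω₂ (-2 * a) = hypRate ω₁ ω₂ (b 0 + η) + hypRate ω₁ ω₂ (b 1 + η)
      + hypRate ω₁ ω₂ (b 2 + η) + hypRate ω₁ ω₂ (b 3 + η) := by
    rw [← hypRate_add, ← hypRate_add, ← hypRate_add]; congr 1; linear_combination -hs
  have ha0 : hypRate ω₁ ω₂ a < 0 := by
    have := hb.rate_pos 0; have := hb.rate_pos 1; have := hb.rate_pos 2; have := hb.rate_pos 3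
    linarith
  have haK : 0 < K + hypRate ω₁ ω₂ a := by have := hb.rate_lt; linarith
  have hks : ∀ c : Fin 4 → ℂ, c 0 + c 1 + c 2 + c 3 = -4 * η - 2 * a →
      hypRate ω₁ ω₂ (∑ j, c j) + K = -K - 2 * hypRate ω₁ ω₂ a := by
    intro c hc
    rw [Fin.sum_univ_four, hc, show -4 * η - 2 * a = ((-4 : ℝ) : ℂ) * η + -2 * a by push_cast; ring,
      hypRate_add, hypRate_real_mul, hypRate_hypEta hω₁ hω₂, hka]
    ring
  have hker : ∀ c : Fin 4 → ℂ, BetaAdmissible ω₁ ω₂ c → c 0 + c 1 + c 2 + c 3 = -4 * η - 2 * a →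
      ∃ M : ℝ, 0 ≤ M ∧ ∀ x : ℝ, ‖hypKernel ω₁ ω₂ c x‖
        ≤ M * Real.exp (2 * Real.pi * |x| * (-K - 2 * hypRate ω₁ ω₂ a)) := by
    intro c hc hcs
    obtain ⟨y, hyρ, hy⟩ : ∃ y, y < ρ ∧ ∀ j, -y < (c j).im := by
      have h1 : ∀ᶠ y in 𝓝[<] ρ, ∀ j, -y < (c j).im := by
        rw [eventually_all]
        intro j
        refine eventually_nhdsWithin_of_eventually_nhds ?_
        have hcont : ContinuousAt (fun y : ℝ => -y) ρ := by fun_prop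
        exact hcont.eventually_lt_const (by linarith [hc.im_pos j])
      obtain ⟨y, h2, h3⟩ := (h1.and self_mem_nhdsWithin).exists
      exact ⟨y, h3, h2⟩
    obtain ⟨M, hM, H⟩ := norm_hypKernel_le hω₁ hω₂ 4 hyρ ‖c‖
    refine ⟨M, hM, fun x => ?_⟩
    have := H x c (fun j => norm_le_pi_norm c j) fun j => (hy j).le
    rwa [hks c hcs] at this
  obtain ⟨M', hM', H'⟩ := hker b' hb' hs'
  obtain ⟨M, hM, H⟩ := hker b hb hs
  obtain ⟨M₁, hM₁, H₁⟩ := norm_hypGamma_mul_le hω₁ hω₂ (y := -a.im) (by linarith) ‖a‖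
  set g : ℝ → ℝ := fun x => Real.exp (-(2 * Real.pi * (K + hypRate ω₁ ω₂ a)) * |x|) with hg
  have hgi : Integrable g := integrable_exp_neg_mul_abs (by positivity)
  refine ((hgi.mul_prod hgi).const_mul (M' * M * M₁ ^ 2)).mono' ?_ (ae_of_all _ fun p => ?_)
  · refine Continuous.aestronglyMeasurable ?_
    have c1 := (continuous_hypKernel hω₁ hω₂ (v := b') fun j => by
      linarith [hb'.im_pos j]).comp (f := fun p : ℝ × ℝ => p.1) (by fun_prop)
    have c2 := (continuous_hypKernel hω₁ hω₂ (v := b) fun j => by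
      linarith [hb.im_pos j]).comp (f := fun p : ℝ × ℝ => p.2) (by fun_prop)
    have c3 : Continuous fun x : ℝ => hypPair ω₁ ω₂ a x :=
      continuous_iff_continuousAt.2 fun x => (differentiableAt_hypPair_right hω₁ hω₂
        (by simpa using haρ) (by simpa using haρ)).continuousAt.comp (f := fun x : ℝ => (x : ℂ))
        continuous_ofReal.continuousAt
    have c4 := c3.comp (f := fun p : ℝ × ℝ => p.1 + p.2) (by fun_prop)
    have c5 := c3.comp (f := fun p : ℝ × ℝ => p.1 - p.2) (by fun_prop)
    refine ((c1.mul c2).mul (c4.mul c5)).congr fun p => ?_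
    simp only [Pi.mul_apply, Function.comp, Function.uncurry, hypDoubleKernel, Complex.ofReal_add,
      Complex.ofReal_sub]
  · obtain ⟨x, z⟩ := p
    have e1 := H₁ (x + z) a a le_rfl le_rfl (by simp) (by simp)
    have e2 := H₁ (x - z) a a le_rfl le_rfl (by simp) (by simp)
    rw [← hypPair.eq_def] at e1 e2
    push_cast at e1 e2
    rw [Function.uncurry, hypDoubleKernel, norm_mul, norm_mul, norm_mul]
    have h5 : |x| + |z| ≤ |x + z| + |x - z| := by
      rcases abs_cases x with ⟨h1, _⟩ | ⟨h1, _⟩ <;> rcases abs_cases z with ⟨h2, _⟩ | ⟨h2, _⟩ <;>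
        rcases abs_cases (x + z) with ⟨h3, _⟩ | ⟨h3, _⟩ <;>
        rcases abs_cases (x - z) with ⟨h4, _⟩ | ⟨h4, _⟩ <;> linarith
    calc _ ≤ _ := mul_le_mul (mul_le_mul (H' x) (H z) (norm_nonneg _) (by positivity))
          (mul_le_mul e1 e2 (norm_nonneg _) (by positivity)) (by positivity) (by positivity)
      _ = M' * M * M₁ ^ 2 * (Real.exp (2 * Real.pi * |x| * (-K - 2 * hypRate ω₁ ω₂ a))
          * Real.exp (2 * Real.pi * |z| * (-K - 2 * hypRate ω₁ ω₂ a))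
          * (Real.exp (Real.pi * |x + z| * (hypRate ω₁ ω₂ a + hypRate ω₁ ω₂ a))
          * Real.exp (Real.pi * |x - z| * (hypRate ω₁ ω₂ a + hypRate ω₁ ω₂ a)))) := by ring
      _ ≤ _ := by
        refine mul_le_mul_of_nonneg_left ?_ (by positivity)
        simp only [hg]
        rw [← Real.exp_add, ← Real.exp_add, ← Real.exp_add, ← Real.exp_add]
        refine Real.exp_le_exp.2 ?_
        have := mul_le_mul_of_nonneg_left h5 (mul_nonneg Real.pi_pos.le (neg_nonneg.2 ha0.le))
        linarith

/-- The integral over `z` is the beta integral with the six parameters `b`, `a + x` and `a - x`. -/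
theorem integral_hypDoubleKernel (hω₁ : 0 < ω₁.re) (hω₂ : 0 < ω₂.re) {b' b : Fin 4 → ℂ} {a : ℂ}
    (hb : BetaAdmissible ω₁ ω₂ b)
    (hs : b 0 + b 1 + b 2 + b 3 = -4 * hypEta ω₁ ω₂ - 2 * a) :
    ∫ x : ℝ, ∫ z : ℝ, hypDoubleKernel ω₁ ω₂ b' b a x z
      = hypBetaConst ω₁ ω₂ * hypGamma ω₁ ω₂ (hypEta ω₁ ω₂ + 2 * a) * hypPairProd ω₁ ω₂ b
        * hypInt ω₁ ω₂ ![b 0 + hypEta ω₁ ω₂ + a, b 1 + hypEta ω₁ ω₂ + a, b 2 + hypEta ω₁ ω₂ + a,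
          b 3 + hypEta ω₁ ω₂ + a, b' 0, b' 1, b' 2, b' 3] := by
  set ρ := (ω₁.re + ω₂.re) / 2 with hρ
  set η := hypEta ω₁ ω₂ with hη
  have hηi : η.im = ρ := hypEta_im _ _
  have hai : a.im = -((b 0).im + (b 1).im + (b 2).im + (b 3).im) / 2 - 2 * ρ := by
    have := congrArg Complex.im hs
    simp [hηi] at this; linarith
  have haρ : -ρ < a.im := by have := hb.im_lt; rw [hai]; linarith
  rw [hypInt, ← integral_const_mul]
  refine integral_congr_ae (ae_of_all _ fun x => ?_)
  have e4 : (![b 0, b 1, b 2, b 3] : Fin 4 → ℂ) = b := by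
    ext j; fin_cases j <;> rfl
  have key := hypInt_six_eq hω₁ hω₂ (a := b 0) (b := b 1) (c := b 2) (d := b 3) (p := a + x)
    (q := a - x) (fun j => by rw [e4]; exact hb.im_pos j) (fun j => by rw [e4]; exact hb.rate_pos j)
    (by simpa using haρ) (by simpa using haρ) (by linear_combination hs) hb.im_lt hb.rate_lt
  have e1 : ∀ z : ℝ, hypDoubleKernel ω₁ ω₂ b' b a x z = hypKernel ω₁ ω₂ b' x
      * hypKernel ω₁ ω₂ ![b 0, b 1, b 2, b 3, a + x, a - x] z := by
    intro z
    have p1 : ∏ j, hypPair ω₁ ω₂ ((![b 0, b 1, b 2, b 3, a + x, a - x] : Fin 6 → ℂ) j) z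
        = hypPair ω₁ ω₂ (b 0) z * hypPair ω₁ ω₂ (b 1) z * hypPair ω₁ ω₂ (b 2) z
          * hypPair ω₁ ω₂ (b 3) z * hypPair ω₁ ω₂ (a + x) z * hypPair ω₁ ω₂ (a - x) z := by
      rw [Fin.prod_univ_six]; rfl
    have p2 : hypPair ω₁ ω₂ a (x + z) * hypPair ω₁ ω₂ a (x - z)
        = hypPair ω₁ ω₂ (a + x) z * hypPair ω₁ ω₂ (a - x) z := by
      simp only [hypPair, add_assoc, add_sub_assoc, sub_sub, sub_add]; ring
    rw [hypDoubleKernel, p2]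
    simp only [hypKernel]
    rw [p1, Fin.prod_univ_four (fun j => hypPair ω₁ ω₂ (b j) z)]
    ring
  simp only [e1]
  rw [integral_const_mul, ← hypInt, key, hypBetaProd, hypCross, ← hη]
  have p1 : hypKernel ω₁ ω₂ ![b 0 + η + a, b 1 + η + a, b 2 + η + a, b 3 + η + a, b' 0, b' 1, b' 2,
      b' 3] x = hypWeight ω₁ ω₂ x * (hypPair ω₁ ω₂ (b 0 + η + a) x * hypPair ω₁ ω₂ (b 1 + η + a) x
        * hypPair ω₁ ω₂ (b 2 + η + a) x * hypPair ω₁ ω₂ (b 3 + η + a) x * hypPair ω₁ ω₂ (b' 0) x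
        * hypPair ω₁ ω₂ (b' 1) x * hypPair ω₁ ω₂ (b' 2) x * hypPair ω₁ ω₂ (b' 3) x) := by
    rw [hypKernel, Fin.prod_univ_eight]; rfl
  have p2 : ∀ t : ℂ, hypPair ω₁ ω₂ (t + η + a) x
      = hypGamma ω₁ ω₂ (η + (a + x) + t) * hypGamma ω₁ ω₂ (η + (a - x) + t) := by
    intro t; rw [hypPair]; congr 2 <;> ring
  rw [p1, p2, p2, p2, p2, hypPairProd, ← hη, hypKernel, Fin.prod_univ_four,
    show η + (a + x) + (a - x) = η + 2 * a by ring]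
  ring

/-- The transformation formula under `w`, for parameters in an open set where all integrals
converge. It compares the two evaluations of the double integral. -/
theorem hypInt_eight_mul_eq (hω₁ : 0 < ω₁.re) (hω₂ : 0 < ω₂.re) {b' b : Fin 4 → ℂ} {a : ℂ}
    (hb' : BetaAdmissible ω₁ ω₂ b') (hb : BetaAdmissible ω₁ ω₂ b)
    (hs' : b' 0 + b' 1 + b' 2 + b' 3 = -4 * hypEta ω₁ ω₂ - 2 * a)
    (hs : b 0 + b 1 + b 2 + b 3 = -4 * hypEta ω₁ ω₂ - 2 * a) :
    hypPairProd ω₁ ω₂ b' * hypInt ω₁ ω₂ ![b 0, b 1, b 2, b 3, b' 0 + hypEta ω₁ ω₂ + a,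
      b' 1 + hypEta ω₁ ω₂ + a, b' 2 + hypEta ω₁ ω₂ + a, b' 3 + hypEta ω₁ ω₂ + a]
    = hypPairProd ω₁ ω₂ b * hypInt ω₁ ω₂ ![b 0 + hypEta ω₁ ω₂ + a, b 1 + hypEta ω₁ ω₂ + a,
      b 2 + hypEta ω₁ ω₂ + a, b 3 + hypEta ω₁ ω₂ + a, b' 0, b' 1, b' 2, b' 3] := by
  have hηi := hypEta_im ω₁ ω₂
  have hai : a.im = -((b 0).im + (b 1).im + (b 2).im + (b 3).im) / 2 - (ω₁.re + ω₂.re) := by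
    have := congrArg Complex.im hs
    simp [hηi] at this; linarith
  have h1 := integral_hypDoubleKernel (b' := b') hω₁ hω₂ hb hs
  have h2 := integral_hypDoubleKernel (b' := b) hω₁ hω₂ hb' hs'
  have h3 := integral_integral_swap (integrable_hypDoubleKernel hω₁ hω₂ hb' hb hs' hs)
  rw [h1] at h3
  simp only [hypDoubleKernel_swap b' b] at h3
  rw [h2] at h3
  have h4 : hypInt ω₁ ω₂ ![b' 0 + hypEta ω₁ ω₂ + a, b' 1 + hypEta ω₁ ω₂ + a,
      b' 2 + hypEta ω₁ ω₂ + a, b' 3 + hypEta ω₁ ω₂ + a, b 0, b 1, b 2, b 3]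
      = hypInt ω₁ ω₂ ![b 0, b 1, b 2, b 3, b' 0 + hypEta ω₁ ω₂ + a, b' 1 + hypEta ω₁ ω₂ + a,
        b' 2 + hypEta ω₁ ω₂ + a, b' 3 + hypEta ω₁ ω₂ + a] := by
    rw [← hypInt_comp_perm _ (finAddFlip (m := 4) (n := 4))]
    congr 1; ext j; fin_cases j <;> rfl
  rw [h4] at h3
  have hne : hypBetaConst ω₁ ω₂ * hypGamma ω₁ ω₂ (hypEta ω₁ ω₂ + 2 * a) ≠ 0 := by
    refine mul_ne_zero (hypBetaConst_ne_zero hω₁ hω₂) (hypGamma_ne_zero hω₁ hω₂ ?_)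
    have := hb.im_pos 0; have := hb.im_pos 1; have := hb.im_pos 2; have := hb.im_pos 3
    have := hb.im_lt
    rw [abs_lt]
    simp [hηi]
    constructor <;> linarith
  exact mul_left_cancel₀ hne (by linear_combination -h3)


/-! ### Clearing the denominators of `G` -/

theorem exists_eq_prod_sub_mul {E : ℂ → ℂ} (hE : Differentiable ℂ E) (T : Finset ℂ)
    (hT : ∀ ζ ∈ T, E ζ = 0) :
    ∃ s : ℂ → ℂ, Differentiable ℂ s ∧ ∀ w, E w = (∏ ζ ∈ T, (w - ζ)) * s w := by
  classical
  induction T using Finset.induction_on with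
  | empty => exact ⟨E, hE, fun w => by simp⟩
  | insert ζ T hζ ih =>
    obtain ⟨s, hs, h⟩ := ih fun ξ hξ => hT ξ (Finset.mem_insert_of_mem hξ)
    have h0 : s ζ = 0 := by
      have h1 := h ζ
      rw [hT ζ (Finset.mem_insert_self _ _)] at h1
      refine (mul_eq_zero.1 h1.symm).resolve_left (Finset.prod_ne_zero_iff.2 fun ξ hξ => ?_)
      exact sub_ne_zero.2 fun h2 => hζ (h2 ▸ hξ)
    refine ⟨dslope s ζ, ?_, fun w => ?_⟩
    · rw [← differentiableOn_univ, Complex.differentiableOn_dslope Filter.univ_mem]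
      exact hs.differentiableOn
    · have h2 := sub_smul_dslope s ζ w
      rw [h0, sub_zero, smul_eq_mul] at h2
      rw [h w, Finset.prod_insert hζ, ← h2]; ring

/-- The zeros of `sinh(πw/ω)` with `-L < Im w < Re ω` can be split off by a polynomial. -/
theorem exists_sinh_eq_prod_sub_mul {ω : ℂ} (hω : 0 < ω.re) (L : ℝ) :
    ∃ (T : Finset ℂ) (s : ℂ → ℂ), (∀ ζ ∈ T, ζ.im ≤ 0) ∧ Differentiable ℂ s ∧
      (∀ w, Complex.sinh (Real.pi * w / ω) = (∏ ζ ∈ T, (w - ζ)) * s w) ∧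
      ∀ w : ℂ, -L < w.im → w.im < ω.re → s w ≠ 0 := by
  have hω0 := ne_zero_of_re_pos hω
  have hpi : (Real.pi : ℂ) ≠ 0 := by exact_mod_cast Real.pi_ne_zero
  obtain ⟨n, hn⟩ := exists_nat_gt (L / ω.re)
  rw [div_lt_iff₀ hω] at hn
  set T : Finset ℂ := (Finset.range (n + 1)).image fun k : ℕ => -(k : ℂ) * (I * ω) with hTdef
  have hE : Differentiable ℂ fun w : ℂ => Complex.sinh (Real.pi * w / ω) := by fun_prop
  have hTz : ∀ ζ ∈ T, Complex.sinh (Real.pi * ζ / ω) = 0 := by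
    intro ζ hζ
    obtain ⟨k, _, rfl⟩ := Finset.mem_image.1 hζ
    have : (Real.pi * (-(k : ℂ) * (I * ω)) / ω : ℂ) = -((k : ℂ) * Real.pi) * I := by field_simp
    rw [this, Complex.sinh_mul_I, Complex.sin_neg, Complex.sin_nat_mul_pi]; simp
  obtain ⟨s, hs, h⟩ := exists_eq_prod_sub_mul hE T hTz
  refine ⟨T, s, fun ζ hζ => ?_, hs, h, fun w h1 h2 h0 => ?_⟩
  · obtain ⟨k, _, rfl⟩ := Finset.mem_image.1 hζ
    have : (-(k : ℂ) * (I * ω)).im = -(k * ω.re) := by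
      rw [show (-(k : ℂ) * (I * ω)) = ((-k : ℝ) : ℂ) * (I * ω) by push_cast; ring,
        Complex.im_ofReal_mul]; simp
    rw [this]
    have : 0 ≤ (k : ℝ) * ω.re := by positivity
    linarith
  -- at a zero of `s` the function `sinh` vanishes, hence to the second order, which is impossible
  have h3 : Complex.sinh (Real.pi * w / ω) = 0 := by rw [h w, h0, mul_zero]
  have h4 : Complex.sin (Real.pi * w / ω * I) = 0 := by rw [Complex.sin_mul_I, h3, zero_mul]
  obtain ⟨k, hk⟩ := Complex.sin_eq_zero_iff.1 h4
  have h5 : w = ((-k : ℝ) : ℂ) * (I * ω) := by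
    field_simp at hk
    push_cast
    linear_combination (-I) * hk + w * I_sq
  have h6 : w.im = -k * ω.re := by
    rw [h5, Complex.im_ofReal_mul]; simp
  rw [h6] at h1 h2
  have hk0 : 0 ≤ k := by
    by_contra hcon
    have : (1 : ℝ) ≤ -k := by
      have : (k : ℝ) ≤ -1 := by exact_mod_cast (by omega : k ≤ -1)
      linarith
    nlinarith
  have hkn : k ≤ n := by
    by_contra hcon
    have : (n : ℝ) < k := by exact_mod_cast not_le.1 hcon
    nlinarith
  have hwT : w ∈ T := by
    refine Finset.mem_image.2 ⟨k.toNat, Finset.mem_range.2 (by omega), ?_⟩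
    have : ((k.toNat : ℕ) : ℂ) = (k : ℂ) := by
      rw [← Int.cast_natCast, Int.toNat_of_nonneg hk0]
    rw [this, h5]; push_cast; ring
  have h7 : HasDerivAt (fun w : ℂ => (∏ ζ ∈ T, (w - ζ)) * s w) 0 w := by
    have hP : DifferentiableAt ℂ (fun w : ℂ => ∏ ζ ∈ T, (w - ζ)) w := by fun_prop
    have := hP.hasDerivAt.mul (hs w).hasDerivAt
    refine this.congr_deriv ?_
    rw [h0, Finset.prod_eq_zero hwT (sub_self w)]; ring
  have h8 : HasDerivAt (fun w : ℂ => Complex.sinh (Real.pi * w / ω))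
      (Complex.cosh (Real.pi * w / ω) * (Real.pi / ω)) w := by
    have := ((hasDerivAt_id w).const_mul (Real.pi : ℂ)).div_const ω
    rw [mul_one] at this
    exact this.csinh
  simp only [h] at h8
  have h9 := h7.unique h8
  have h10 : Complex.cosh (Real.pi * w / ω) ≠ 0 := by
    intro hc
    have := Complex.cosh_sq_sub_sinh_sq (Real.pi * w / ω)
    rw [hc, h3] at this
    simp at this
  exact mul_ne_zero h10 (div_ne_zero hpi hω0) h9.symm

/-- The difference equation at all points where it makes sense. -/
theorem hypGamma_eq_div_of_ne_zero (hω₁ : 0 < ω₁.re) (hω₂ : 0 < ω₂.re) {z : ℂ}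
    (h : hypGammaShift ω₁ ω₂ z ≠ 0) :
    hypGamma ω₁ ω₂ z = hypGamma ω₁ ω₂ (z + I * ω₁) / hypGammaShift ω₁ ω₂ z := by
  rcases lt_or_ge (-((ω₁.re + ω₂.re) / 2)) z.im with hz | hz
  · rw [hypGamma_add hω₁ hω₂ hz, mul_div_cancel_left₀ _ h]
  · have := hypGamma_sub_of_lt (ω₂ := ω₂) hω₁ (z := z + I * ω₁) (by simp; linarith)
    rwa [add_sub_cancel_right] at this

/-- In a half-plane, the function `G` is the quotient of an analytic function and a polynomial whose
zeros, being poles of `G`, lie in `Im w ≤ -Re ω`. -/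
theorem exists_hypGamma_denominator (hω₁ : 0 < ω₁.re) (hω₂ : 0 < ω₂.re) (L : ℝ) :
    ∃ (m : ℕ) (ζ : Fin m → ℂ) (F : ℂ → ℂ), (∀ i, (ζ i).im ≤ -((ω₁.re + ω₂.re) / 2)) ∧
      (∀ w : ℂ, -L < w.im → AnalyticAt ℂ F w) ∧
      ∀ w : ℂ, -L < w.im → (∏ i, (w - ζ i)) ≠ 0 →
        F w = (∏ i, (w - ζ i)) * hypGamma ω₁ ω₂ w := by
  set ρ := (ω₁.re + ω₂.re) / 2 with hρ
  have hηi : (hypEta ω₁ ω₂).im = ρ := hypEta_im _ _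
  suffices key : ∀ N : ℕ, ∃ (ι : Type) (_ : Fintype ι) (ζ : ι → ℂ) (F : ℂ → ℂ),
      (∀ i, (ζ i).im ≤ -ρ) ∧ (∀ w : ℂ, -(ρ + N * ω₁.re) < w.im → AnalyticAt ℂ F w) ∧
      ∀ w : ℂ, -(ρ + N * ω₁.re) < w.im → (∏ i, (w - ζ i)) ≠ 0 →
        F w = (∏ i, (w - ζ i)) * hypGamma ω₁ ω₂ w by
    obtain ⟨N, hN⟩ := exists_nat_gt ((L - ρ) / ω₁.re)
    rw [div_lt_iff₀ hω₁] at hN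
    obtain ⟨ι, _, ζ, F, h1, h2, h3⟩ := key N
    have e : ∀ w, ∏ i, (w - ζ ((Fintype.equivFin ι).symm i)) = ∏ i, (w - ζ i) := fun w =>
      (Fintype.equivFin ι).symm.prod_comp fun i => w - ζ i
    refine ⟨Fintype.card ι, ζ ∘ (Fintype.equivFin ι).symm, F, fun i => h1 _,
      fun w hw => h2 w (by linarith), fun w hw hne => ?_⟩
    simp only [Function.comp, e] at hne ⊢
    exact h3 w (by linarith) hne
  intro N
  induction N with
  | zero =>
    refine ⟨Empty, inferInstance, Empty.elim, hypGamma ω₁ ω₂, fun i => i.elim, fun w hw =>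
      analyticAt_hypGamma hω₁ hω₂ (by simpa using hw), fun w _ _ => by simp⟩
  | succ N ih =>
    obtain ⟨ι, _, ζ, F, h1, h2, h3⟩ := ih
    obtain ⟨T, s, hT, hs, hsT, hs0⟩ := exists_sinh_eq_prod_sub_mul hω₂ ((N + 1) * ω₁.re)
    set ξ : ι ⊕ T → ℂ := Sum.elim (fun i => ζ i - I * ω₁) (fun t => t.1 - hypEta ω₁ ω₂) with hξ
    have hprod : ∀ w, ∏ i, (w - ξ i)
        = (∏ i, (w + I * ω₁ - ζ i)) * ∏ t ∈ T, (w + hypEta ω₁ ω₂ - t) := by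
      intro w
      rw [Fintype.prod_sum_type, ← Finset.prod_coe_sort T]
      simp only [hξ, Sum.elim_inl, Sum.elim_inr]
      congr 1
      · exact Finset.prod_congr rfl fun i _ => by ring
      · exact Finset.prod_congr rfl fun i _ => by ring
    have hξi : ∀ i, (ξ i).im ≤ -ρ := by
      rintro (i | t)
      · have := h1 i
        simp [hξ]; linarith
      · have := hT t.1 t.2
        simp [hξ, hηi]; linarith
    have hQ : ∀ w : ℂ, -ρ < w.im → ∏ i, (w - ξ i) ≠ 0 := fun w hw =>
      Finset.prod_ne_zero_iff.2 fun i _ h => by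
        have := hξi i
        rw [sub_eq_zero] at h
        rw [← h] at this; linarith
    have hshift : ∀ w, hypGammaShift ω₁ ω₂ w
        = -2 * I * ((∏ t ∈ T, (w + hypEta ω₁ ω₂ - t)) * s (w + hypEta ω₁ ω₂)) := by
      intro w; rw [← hsT, hypGammaShift, hypEta, mul_div_assoc]
    set F' : ℂ → ℂ := fun w => F (w + I * ω₁) / (-2 * I * s (w + hypEta ω₁ ω₂)) with hF'
    have hI : (-2 * I : ℂ) ≠ 0 := by simp
    -- below the line `Im w = -ρ + Re ω₂` the quotient by `sinh` continues the function
    have hF'eq : ∀ w : ℂ, -(ρ + (N + 1) * ω₁.re) < w.im → w.im < -ρ + ω₂.re →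
        (∏ i, (w - ξ i)) ≠ 0 → F' w = (∏ i, (w - ξ i)) * hypGamma ω₁ ω₂ w := by
      intro w hw1 hw2 hne
      rw [hprod] at hne ⊢
      have n1 := left_ne_zero_of_mul hne
      have n2 := right_ne_zero_of_mul hne
      have n3 := hs0 (w + hypEta ω₁ ω₂) (by rw [Complex.add_im, hηi]; linarith)
        (by rw [Complex.add_im, hηi]; linarith)
      have n4 : hypGammaShift ω₁ ω₂ w ≠ 0 := by
        rw [hshift]; exact mul_ne_zero hI (mul_ne_zero n2 n3)
      rw [hypGamma_eq_div_of_ne_zero hω₁ hω₂ n4, hshift,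
        show F' w = F (w + I * ω₁) / (-2 * I * s (w + hypEta ω₁ ω₂)) from rfl,
        h3 (w + I * ω₁) (by simp; linarith) n1]
      have := I_ne_zero
      field_simp
    have hF'an : ∀ w : ℂ, -(ρ + (N + 1) * ω₁.re) < w.im → w.im < -ρ + ω₂.re →
        AnalyticAt ℂ F' w := by
      intro w hw1 hw2
      refine AnalyticAt.div ((h2 (w + I * ω₁) (by simp; linarith)).comp_of_eq
        (f := fun w => w + I * ω₁) (by fun_prop) rfl) (analyticAt_const.mul
        ((hs.analyticAt _).comp_of_eq (f := fun w => w + hypEta ω₁ ω₂) (by fun_prop) rfl))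
        (mul_ne_zero hI (hs0 _ (by rw [Complex.add_im, hηi]; linarith)
          (by rw [Complex.add_im, hηi]; linarith)))
    classical
    refine ⟨ι ⊕ T, inferInstance, ξ, fun w => if -ρ < w.im then (∏ i, (w - ξ i)) * hypGamma ω₁ ω₂ w
      else F' w, hξi, fun w hw => ?_, fun w hw hne => ?_⟩
    · push_cast at hw
      rcases lt_or_ge (-ρ) w.im with h | h
      · have h4 : AnalyticAt ℂ (fun w => (∏ i, (w - ξ i)) * hypGamma ω₁ ω₂ w) w :=
          (Finset.analyticAt_fun_prod _ fun i _ => by fun_prop).mul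
            (analyticAt_hypGamma hω₁ hω₂ h)
        refine h4.congr ?_
        filter_upwards [(isOpen_halfPlane (-ρ)).mem_nhds h] with z hz
        have hz' : -ρ < z.im := hz
        rw [if_pos hz']
      · refine (hF'an w hw (by linarith)).congr ?_
        filter_upwards [(isOpen_strip (-(ρ + (N + 1) * ω₁.re)) (-ρ + ω₂.re)).mem_nhds
          ⟨hw, by linarith⟩] with z hz
        split_ifs with hz'
        · exact hF'eq z hz.1 hz.2 (hQ z hz')
        · rfl
    · push_cast at hw
      simp only
      split_ifs with h
      · rfl
      · exact hF'eq w hw (by linarith) hne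


/-! ### Meromorphic continuation of the integral -/

/-- The resultant-like product of the `αᵢ + γₖ` lies in the ideal generated by `∏ αᵢ` and `∏ γₖ`. -/
theorem exists_prod_prod_add_eq {R ι κ : Type*} [CommRing R] (s : Finset ι) (t : Finset κ)
    (α : ι → R) (γ : κ → R) :
    ∃ c d, ∏ i ∈ s, ∏ k ∈ t, (α i + γ k) = c * ∏ i ∈ s, α i + d * ∏ k ∈ t, γ k := by
  classical
  have h1 : ∀ a : R, ∃ c, ∏ k ∈ t, (a + γ k) = c * a + ∏ k ∈ t, γ k := by
    intro a
    induction t using Finset.induction_on with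
    | empty => exact ⟨0, by simp⟩
    | insert k t hk ih =>
      obtain ⟨c, hc⟩ := ih
      refine ⟨c * (a + γ k) + ∏ k ∈ t, γ k, ?_⟩
      rw [Finset.prod_insert hk, Finset.prod_insert hk, hc]; ring
  induction s using Finset.induction_on with
  | empty => exact ⟨1, 0, by simp⟩
  | insert i s hi ih =>
    obtain ⟨c, d, h⟩ := ih
    obtain ⟨c', h'⟩ := h1 (α i)
    refine ⟨c' * c, c' * α i * d + ∏ i ∈ s, ∏ k ∈ t, (α i + γ k), ?_⟩
    rw [Finset.prod_insert hi, Finset.prod_insert hi, h', add_mul]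
    nth_rewrite 1 [h]
    ring

/-- Evaluation of a polynomial in `v` and one more variable `z`. -/
def evalAt {n : ℕ} (p : MvPolynomial (Option (Fin n)) ℂ) (v : Fin n → ℂ) (z : ℂ) : ℂ :=
  MvPolynomial.aeval (fun o => Option.elim o z v) p

/-- Polynomials grow more slowly than exponentials, locally uniformly in the parameters. -/
theorem norm_evalAt_le {n : ℕ} (p : MvPolynomial (Option (Fin n)) ℂ) {r : ℝ} (hr : 0 ≤ r) :
    ∀ {ε : ℝ}, 0 < ε → ∃ M : ℝ, 0 ≤ M ∧ ∀ (x : ℝ) (w : ℂ) (v : Fin n → ℂ), ‖w‖ ≤ r →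
      (∀ j, ‖v j‖ ≤ r) → ‖evalAt p v (x + w)‖ ≤ M * Real.exp (ε * |x|) := by
  induction p using MvPolynomial.induction_on with
  | C a =>
    intro ε hε
    refine ⟨‖a‖, norm_nonneg _, fun x w v _ _ => ?_⟩
    rw [evalAt, MvPolynomial.aeval_C]
    exact le_mul_of_one_le_right (norm_nonneg _) (Real.one_le_exp (by positivity))
  | add p q hp hq =>
    intro ε hε
    obtain ⟨M, hM, h⟩ := hp hε
    obtain ⟨M', hM', h'⟩ := hq hε
    refine ⟨M + M', by positivity, fun x w v hw hv => ?_⟩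
    rw [evalAt, map_add, add_mul]
    exact (norm_add_le _ _).trans (add_le_add (h x w v hw hv) (h' x w v hw hv))
  | mul_X p o hp =>
    intro ε hε
    obtain ⟨M, hM, h⟩ := hp (half_pos hε)
    have key : ∀ (x : ℝ) (w : ℂ) (v : Fin n → ℂ), ‖w‖ ≤ r → (∀ j, ‖v j‖ ≤ r) →
        ‖Option.elim o ((x : ℂ) + w) v‖ ≤ (2 / ε + r) * Real.exp (ε / 2 * |x|) := by
      intro x w v hw hv
      have e1 : 1 ≤ Real.exp (ε / 2 * |x|) := Real.one_le_exp (by positivity)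
      have e2 := Real.add_one_le_exp (ε / 2 * |x|)
      have e3 : |x| ≤ 2 / ε * Real.exp (ε / 2 * |x|) := by
        rw [div_mul_eq_mul_div, le_div_iff₀ hε]; linarith
      have e4 : r ≤ r * Real.exp (ε / 2 * |x|) := le_mul_of_one_le_right hr e1
      rw [add_mul]
      cases o with
      | none =>
        refine (norm_add_le _ _).trans (add_le_add ?_ (hw.trans e4))
        rwa [Complex.norm_real]
      | some j => exact (hv j).trans (e4.trans (le_add_of_nonneg_left (by positivity)))
    refine ⟨M * (2 / ε + r), by positivity, fun x w v hw hv => ?_⟩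
    rw [evalAt, map_mul, MvPolynomial.aeval_X, norm_mul]
    calc _ ≤ _ := mul_le_mul (h x w v hw hv) (key x w v hw hv) (norm_nonneg _) (by positivity)
      _ = M * (2 / ε + r) * (Real.exp (ε / 2 * |x|) * Real.exp (ε / 2 * |x|)) := by ring
      _ = _ := by rw [← Real.exp_add]; ring_nf

theorem analyticAt_evalAt {n : ℕ} {E : Type*} [NormedAddCommGroup E] [NormedSpace ℂ E]
    (p : MvPolynomial (Option (Fin n)) ℂ) {v : E → Fin n → ℂ} {z : E → ℂ} {a : E}
    (hv : ∀ j, AnalyticAt ℂ (fun y => v y j) a) (hz : AnalyticAt ℂ z a) :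
    AnalyticAt ℂ (fun y => evalAt p (v y) (z y)) a := by
  unfold evalAt
  refine AnalyticAt.aeval_mvPolynomial (fun o => ?_) p
  cases o with
  | none => exact hz
  | some j => exact hv j

/-- The product of the `vⱼ + vₖ - ζ - ζ'` over all poles `ζ, ζ'` in a list. Its zeros are the
parameters for which a pole of `G(vⱼ + z)` meets a pole of `G(vₖ - z)`. -/
def hypClear {n m : ℕ} (ζ : Fin m → ℂ) (v : Fin n → ℂ) : ℂ :=
  ∏ p : Fin n × Fin m, ∏ q : Fin n × Fin m, (v p.1 - ζ p.2 + (v q.1 - ζ q.2))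

/-- The polynomial `hypClear` lies in the ideal generated by the denominators in the upper and in
the lower half-plane. -/
theorem exists_hypClear_eq {n m : ℕ} (ζ : Fin m → ℂ) :
    ∃ c d : MvPolynomial (Option (Fin n)) ℂ, ∀ (v : Fin n → ℂ) (z : ℂ), hypClear ζ v
      = evalAt c v z * ∏ j, ∏ i, (v j + z - ζ i)
        + evalAt d v (-z) * ∏ j, ∏ i, (v j + -z - ζ i) := by
  open MvPolynomial in
  obtain ⟨c, d, h⟩ := exists_prod_prod_add_eq (R := MvPolynomial (Option (Fin n)) ℂ)
    Finset.univ Finset.univ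
    (fun p : Fin n × Fin m => X (some p.1) + X none - C (ζ p.2))
    (fun p : Fin n × Fin m => X (some p.1) - X none - C (ζ p.2))
  refine ⟨c, MvPolynomial.bind₁ (fun o => Option.elim o (-MvPolynomial.X none)
    fun j => MvPolynomial.X (some j)) d, fun v z => ?_⟩
  have h1 := congrArg (fun p => evalAt p v z) h
  have h2 : evalAt (MvPolynomial.bind₁ (fun o => Option.elim o (-MvPolynomial.X none)
      fun j => MvPolynomial.X (some j)) d) v (-z) = evalAt d v z := by
    rw [evalAt, MvPolynomial.aeval_bind₁, evalAt]
    congr 2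
    ext o
    cases o <;> simp
  have h3 : hypClear ζ v = ∏ p : Fin n × Fin m, ∏ q : Fin n × Fin m,
      (v p.1 + z - ζ p.2 + (v q.1 - z - ζ q.2)) :=
    Finset.prod_congr rfl fun p _ => Finset.prod_congr rfl fun q _ => by ring
  rw [h2, h3]
  simp only [evalAt, map_add, map_mul, map_prod, map_sub, MvPolynomial.aeval_X,
    MvPolynomial.aeval_C, Option.elim_some, Option.elim_none, Algebra.algebraMap_self,
    RingHom.id_apply, Fintype.prod_prod_type, ← sub_eq_add_neg] at h1 ⊢
  exact h1

/-- The integrand with the poles of the factors `G(vⱼ + z)` in the half-plane `Im w > -L` removed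
by means of `F = ∏ᵢ (w - ζᵢ) G`. -/
def hypReg (ω₁ ω₂ : ℂ) {n : ℕ} (F : ℂ → ℂ) (p : MvPolynomial (Option (Fin n)) ℂ) (v : Fin n → ℂ)
    (z : ℂ) : ℂ :=
  evalAt p v z * hypWeight ω₁ ω₂ z * ∏ j, (F (v j + z) * hypGamma ω₁ ω₂ (v j - z))

/-- Off the poles `ζ`, `hypReg` is the integrand times the polynomial that clears them. -/
theorem hypReg_eq {n m : ℕ} {L : ℝ} {ζ : Fin m → ℂ} {F : ℂ → ℂ}
    (hF : ∀ w : ℂ, -L < w.im → (∏ i, (w - ζ i)) ≠ 0 → F w = (∏ i, (w - ζ i)) * hypGamma ω₁ ω₂ w)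
    (p : MvPolynomial (Option (Fin n)) ℂ) {v : Fin n → ℂ} {z : ℂ} (h1 : ∀ j, -L < (v j + z).im)
    (h2 : ∀ j i, v j + z ≠ ζ i) :
    hypReg ω₁ ω₂ F p v z
      = evalAt p v z * (∏ j, ∏ i, (v j + z - ζ i)) * hypKernel ω₁ ω₂ v z := by
  have h3 : ∀ j, F (v j + z) * hypGamma ω₁ ω₂ (v j - z)
      = (∏ i, (v j + z - ζ i)) * hypPair ω₁ ω₂ (v j) z := fun j => by
    rw [hF _ (h1 j) (Finset.prod_ne_zero_iff.2 fun i _ => sub_ne_zero.2 (h2 j i)), hypPair]; ring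
  rw [hypReg, hypKernel, Finset.prod_congr rfl fun j _ => h3 j, Finset.prod_mul_distrib]; ring

theorem analyticAt_hypReg (hω₁ : 0 < ω₁.re) (hω₂ : 0 < ω₂.re) {n : ℕ} {L : ℝ} {F : ℂ → ℂ}
    (hF : ∀ w : ℂ, -L < w.im → AnalyticAt ℂ F w) (p : MvPolynomial (Option (Fin n)) ℂ)
    {E : Type*} [NormedAddCommGroup E] [NormedSpace ℂ E] {v : E → Fin n → ℂ} {z : E → ℂ} {a : E}
    (hv : ∀ j, AnalyticAt ℂ (fun y => v y j) a) (hz : AnalyticAt ℂ z a)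
    (h1 : ∀ j, -L < (v a j + z a).im) (h2 : ∀ j, -((ω₁.re + ω₂.re) / 2) < (v a j - z a).im) :
    AnalyticAt ℂ (fun y => hypReg ω₁ ω₂ F p (v y) (z y)) a := by
  unfold hypReg
  refine ((analyticAt_evalAt p hv hz).mul
    (((differentiable_hypWeight ω₁ ω₂).analyticAt _).comp_of_eq hz rfl)).mul
    (Finset.analyticAt_fun_prod _ fun j _ => ?_)
  exact ((hF _ (h1 j)).comp_of_eq (f := fun y => v y j + z y) ((hv j).add hz) rfl).mul
    ((analyticAt_hypGamma hω₁ hω₂ (h2 j)).comp_of_eq (f := fun y => v y j - z y)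
      ((hv j).sub hz) rfl)

/-- Exponential bound for the regularized integrand, uniform on compact sets. -/
theorem exists_bound_hypReg (hω₁ : 0 < ω₁.re) (hω₂ : 0 < ω₂.re) {n m : ℕ} {L : ℝ}
    {ζ : Fin m → ℂ} {F : ℂ → ℂ} (hFa : ∀ w : ℂ, -L < w.im → AnalyticAt ℂ F w)
    (hF : ∀ w : ℂ, -L < w.im → (∏ i, (w - ζ i)) ≠ 0 → F w = (∏ i, (w - ζ i)) * hypGamma ω₁ ω₂ w)
    (p : MvPolynomial (Option (Fin n)) ℂ) {K : Set ((Fin n → ℂ) × ℂ)} (hK : IsCompact K)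
    (h1 : ∀ q ∈ K, ∀ j, -L < (q.1 j + q.2).im)
    (h2 : ∀ q ∈ K, ∀ j, -((ω₁.re + ω₂.re) / 2) < (q.1 j - q.2).im) {k : ℝ} (hk : k < 0)
    (h3 : ∀ q ∈ K, hypRate ω₁ ω₂ (∑ j, q.1 j) + ((1 / ω₁).re + (1 / ω₂).re) ≤ k) :
    ∃ g : ℝ → ℝ, Integrable g ∧
      ∀ q ∈ K, ∀ x : ℝ, ‖hypReg ω₁ ω₂ F p q.1 (x + q.2)‖ ≤ g x := by
  obtain ⟨r₀, hr₀⟩ := hK.isBounded.exists_norm_le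
  set r := max r₀ 0 with hr
  have hr0 : 0 ≤ r := le_max_right _ _
  have hq1 : ∀ q ∈ K, ∀ j, ‖q.1 j‖ ≤ r := fun q hq j =>
    (norm_le_pi_norm q.1 j).trans ((norm_fst_le q).trans ((hr₀ q hq).trans (le_max_left _ _)))
  have hq2 : ∀ q ∈ K, ‖q.2‖ ≤ r := fun q hq =>
    (norm_snd_le q).trans ((hr₀ q hq).trans (le_max_left _ _))
  have hpi := Real.pi_pos
  set P : MvPolynomial (Option (Fin n)) ℂ := p * ∏ j, ∏ i,
    (MvPolynomial.X (some j) + MvPolynomial.X none - MvPolynomial.C (ζ i)) with hP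
  obtain ⟨M₁, hM₁, b₁⟩ := norm_evalAt_le P hr0 (ε := -(Real.pi * k)) (by nlinarith)
  obtain ⟨M₂, hM₂, b₂⟩ := norm_hypWeight_le hω₁ hω₂ r
  obtain ⟨M₃, X, hM₃, hX, b₃⟩ := norm_prod_hypPair_le_of_large hω₁ hω₂ n r
  set X' := max X (2 * r + ∑ i, ‖ζ i‖ + 1) with hX'
  have hlarge : ∀ q ∈ K, ∀ x : ℝ, X' ≤ |x| → ‖hypReg ω₁ ω₂ F p q.1 (x + q.2)‖
      ≤ M₁ * M₂ * M₃ * Real.exp (Real.pi * k * |x|) := by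
    intro q hq x hx
    have hne : ∀ j i, q.1 j + (x + q.2) ≠ ζ i := by
      intro j i h
      have e1 : (x : ℂ) = ζ i - q.1 j - q.2 := by rw [← h]; ring
      have e2 : |x| ≤ ‖ζ i‖ + r + r := by
        rw [← Real.norm_eq_abs, ← Complex.norm_real, e1]
        exact (norm_sub_le _ _).trans (add_le_add ((norm_sub_le _ _).trans
          (add_le_add le_rfl (hq1 q hq j))) (hq2 q hq))
      have e3 : ‖ζ i‖ ≤ ∑ i, ‖ζ i‖ :=
        Finset.single_le_sum (fun i _ => norm_nonneg (ζ i)) (Finset.mem_univ i)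
      have := (le_max_right X _).trans hx
      linarith
    rw [hypReg_eq hF p (fun j => by
      have := h1 q hq j
      simpa using this) hne]
    have e1 : evalAt p q.1 (x + q.2) * ∏ j, ∏ i, (q.1 j + (x + q.2) - ζ i)
        = evalAt P q.1 (x + q.2) := by
      simp [evalAt, hP]
    rw [e1, hypKernel, norm_mul, norm_mul]
    have n1 := b₁ x q.2 q.1 (hq2 q hq) (hq1 q hq)
    have n2 := b₂ x q.2 (hq2 q hq)
    have n3 := b₃ x q.2 q.1 ((le_max_left _ _).trans hx) (hq2 q hq) (hq1 q hq)
    have n4 := h3 q hq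
    revert n2 n4
    generalize (1 / ω₁).re + (1 / ω₂).re = κ
    intro n2 n4
    calc _ ≤ _ := mul_le_mul n1 (mul_le_mul n2 n3 (norm_nonneg _) (by positivity))
          (by positivity) (by positivity)
      _ = M₁ * M₂ * M₃ * (Real.exp (-(Real.pi * k) * |x|) * Real.exp (2 * Real.pi * |x| * κ)
          * Real.exp (2 * Real.pi * |x| * hypRate ω₁ ω₂ (∑ j, q.1 j))) := by ring
      _ ≤ _ := by
        refine mul_le_mul_of_nonneg_left ?_ (by positivity)
        rw [← Real.exp_add, ← Real.exp_add]
        refine Real.exp_le_exp.2 ?_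
        have := mul_le_mul_of_nonneg_left n4 (show 0 ≤ 2 * Real.pi * |x| by positivity)
        linarith
  obtain ⟨B, hB⟩ : ∃ B, ∀ y ∈ K ×ˢ Set.Icc (-X') X',
      ‖hypReg ω₁ ω₂ F p y.1.1 ((y.2 : ℂ) + y.1.2)‖ ≤ B := by
    refine (hK.prod isCompact_Icc).exists_bound_of_continuousOn fun y hy => ?_
    have hA := analyticAt_hypReg hω₁ hω₂ hFa p (E := (Fin n → ℂ) × ℂ) (v := fun y => y.1)
      (z := fun y => y.2) (a := (y.1.1, (y.2 : ℂ) + y.1.2)) (fun j =>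
        ((ContinuousLinearMap.proj (R := ℂ) (φ := fun _ : Fin n => ℂ) j).analyticAt _).comp_of_eq
          analyticAt_fst rfl) analyticAt_snd
      (fun j => by have := h1 y.1 hy.1 j; simpa using this)
      (fun j => by have := h2 y.1 hy.1 j; simpa using this)
    exact (hA.continuousAt.comp_of_eq
      (f := fun y : ((Fin n → ℂ) × ℂ) × ℝ => (y.1.1, (y.2 : ℂ) + y.1.2))
      (by fun_prop) rfl).continuousWithinAt
  refine ⟨fun x => (M₁ * M₂ * M₃ + max B 0 * Real.exp (-(Real.pi * k) * X'))
    * Real.exp (-(-(Real.pi * k)) * |x|),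
    (integrable_exp_neg_mul_abs (by nlinarith)).const_mul _, fun q hq x => ?_⟩
  simp only [neg_neg, add_mul]
  have hB0 : 0 ≤ max B 0 := le_max_right _ _
  rcases le_total X' |x| with hx | hx
  · exact (hlarge q hq x hx).trans (le_add_of_nonneg_right (by positivity))
  · refine (hB (q, x) ⟨hq, abs_le.1 hx⟩).trans ?_
    refine le_trans ?_ (le_add_of_nonneg_left (by positivity))
    rw [mul_assoc, ← Real.exp_add]
    refine (le_max_left _ _).trans (le_mul_of_one_le_right hB0 (Real.one_le_exp ?_))
    have := mul_nonneg (mul_nonneg hpi.le (neg_nonneg.2 hk.le)) (sub_nonneg.2 hx)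
    linarith

/-- The parameters for which the continuation is given by the integral over `ℝ - iR`. -/
def hypDomainExt (ω₁ ω₂ : ℂ) (n : ℕ) (R : ℝ) : Set (Fin n → ℂ) :=
  {v | (∀ j, -((ω₁.re + ω₂.re) / 2 + R) < (v j).im) ∧
    hypRate ω₁ ω₂ (∑ j, v j) + ((1 / ω₁).re + (1 / ω₂).re) < 0}

theorem isOpen_hypDomainExt (ω₁ ω₂ : ℂ) (n : ℕ) (R : ℝ) : IsOpen (hypDomainExt ω₁ ω₂ n R) := by
  have h1 := continuous_hypRate ω₁ ω₂
  have e : hypDomainExt ω₁ ω₂ n R = (⋂ j, {v | -((ω₁.re + ω₂.re) / 2 + R) < (v j).im}) ∩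
      {v | hypRate ω₁ ω₂ (∑ j, v j) + ((1 / ω₁).re + (1 / ω₂).re) < 0} := by
    ext; simp [hypDomainExt]
  rw [e]
  refine IsOpen.inter ?_ ?_
  · exact isOpen_iInter_of_finite fun j => isOpen_lt continuous_const
      (Complex.continuous_im.comp (continuous_apply j))
  · exact isOpen_lt (f := fun v : Fin n → ℂ =>
      hypRate ω₁ ω₂ (∑ j, v j) + ((1 / ω₁).re + (1 / ω₂).re)) (by fun_prop) continuous_const

theorem convex_hypDomainExt (ω₁ ω₂ : ℂ) (n : ℕ) (R : ℝ) :
    Convex ℝ (hypDomainExt ω₁ ω₂ n R) := by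
  intro v hv w hw a b ha hb hab
  have key : ∀ s t c : ℝ, s < c → t < c → a * s + b * t < c := by
    intro s t c hs ht
    rcases ha.eq_or_lt with rfl | ha'
    · rw [zero_add] at hab; rw [hab]; linarith
    · have h1 := mul_lt_mul_of_pos_left hs ha'
      have h2 := mul_le_mul_of_nonneg_left ht.le hb
      have h3 : a * c + b * c = c := by rw [← add_mul, hab, one_mul]
      linarith
  refine ⟨fun j => ?_, ?_⟩
  · have := key _ _ _ (neg_lt_neg (hv.1 j)) (neg_lt_neg (hw.1 j))
    simp only [Pi.add_apply, Pi.smul_apply, Complex.add_im, Complex.real_smul,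
      Complex.im_ofReal_mul]
    linarith
  · have := key _ _ (-((1 / ω₁).re + (1 / ω₂).re)) (lt_neg_iff_add_neg.2 hv.2)
      (lt_neg_iff_add_neg.2 hw.2)
    simp only [Pi.add_apply, Pi.smul_apply, Complex.real_smul, Finset.sum_add_distrib,
      ← Finset.mul_sum, hypRate_add, hypRate_real_mul]
    linarith

/-- The integral over `ℝ - iR`, multiplied by a polynomial, is the continuation of `hypInt` to
parameters with `Im vⱼ > -Re ω - R`. -/
theorem exists_hypClear_mul_hypInt_eq (hω₁ : 0 < ω₁.re) (hω₂ : 0 < ω₂.re) (n : ℕ) {R : ℝ}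
    (hR : 0 ≤ R) :
    ∃ (m : ℕ) (ζ : Fin m → ℂ) (T : (Fin n → ℂ) → ℂ),
      AnalyticOnNhd ℂ T (hypDomainExt ω₁ ω₂ n R) ∧
      ∀ v ∈ hypDomain ω₁ ω₂ n, hypClear ζ v * hypInt ω₁ ω₂ v = T v := by
  set ρ := (ω₁.re + ω₂.re) / 2 with hρ
  obtain ⟨m, ζ, F, hζ, hFa, hF⟩ := exists_hypGamma_denominator hω₁ hω₂ (ρ + 2 * R)
  obtain ⟨c, d, hcd⟩ := exists_hypClear_eq (n := n) ζ
  have hproj : ∀ (j : Fin n) (v : Fin n → ℂ), AnalyticAt ℂ (fun v : Fin n → ℂ => v j) v :=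
    fun j v => (ContinuousLinearMap.proj (R := ℂ) (φ := fun _ : Fin n => ℂ) j).analyticAt v
  refine ⟨m, ζ, fun v => ∫ x : ℝ, hypReg ω₁ ω₂ F (c + d) v (x + (-(R * I))), ?_, fun v hv => ?_⟩
  · have him : ∀ v ∈ hypDomainExt ω₁ ω₂ n R, ∀ (x : ℝ) (j : Fin n),
        -(ρ + 2 * R) < (v j + (x + (-(R * I)))).im ∧ -ρ < (v j - (x + (-(R * I)))).im := by
      intro v hv x j
      have := hv.1 j
      constructor <;> simp <;> linarith
    refine analyticOnNhd_integral
      (F := fun v (x : ℝ) => hypReg ω₁ ω₂ F (c + d) v (x + (-(R * I))))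
      (isOpen_hypDomainExt ω₁ ω₂ n R) (fun v hv => ?_) (ae_of_all _ fun x v hv => ?_)
      (fun v hv => ?_)
    · refine Continuous.aestronglyMeasurable (continuous_iff_continuousAt.2 fun x => ?_)
      have := (analyticAt_hypReg hω₁ hω₂ hFa (c + d) (E := ℂ) (v := fun _ => v) (z := fun z => z)
        (a := x + (-(R * I))) (fun j => analyticAt_const) analyticAt_id
        (fun j => (him v hv x j).1) (fun j => (him v hv x j).2)).continuousAt
      exact this.comp (f := fun x : ℝ => (x : ℂ) + (-(R * I))) (by fun_prop)
    · exact (analyticAt_hypReg hω₁ hω₂ hFa (c + d) (v := fun v => v)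
        (z := fun _ => (x : ℂ) + (-(R * I))) (fun j => hproj j v) analyticAt_const
        (fun j => (him v hv x j).1)
        (fun j => (him v hv x j).2)).differentiableAt.differentiableWithinAt
    · set k := hypRate ω₁ ω₂ (∑ j, v j) + ((1 / ω₁).re + (1 / ω₂).re) with hk
      have hk0 : k < 0 := hv.2
      have hc := continuous_hypRate ω₁ ω₂
      have hc' : ContinuousAt (fun v' : Fin n → ℂ =>
        hypRate ω₁ ω₂ (∑ j, v' j) + ((1 / ω₁).re + (1 / ω₂).re)) v := by fun_prop
      have hev := Filter.Eventually.and ((isOpen_hypDomainExt ω₁ ω₂ n R).eventually_mem hv)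
        (hc'.eventually_lt_const (u := k / 2) (by simp only [← hk]; linarith))
      obtain ⟨r, hr, hsub⟩ := Metric.nhds_basis_closedBall.eventually_iff.1 hev
      obtain ⟨g, hg, hb⟩ := exists_bound_hypReg hω₁ hω₂ hFa hF (c + d)
        (K := Metric.closedBall v r ×ˢ {-(R * I : ℂ)})
        ((isCompact_closedBall v r).prod isCompact_singleton)
        (fun q hq j => by
          have := (him q.1 (hsub hq.1).1 0 j).1
          rw [Set.mem_singleton_iff.1 hq.2]; simpa using this)
        (fun q hq j => by
          have := (him q.1 (hsub hq.1).1 0 j).2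
          rw [Set.mem_singleton_iff.1 hq.2]; simpa using this)
        (k := k / 2) (by linarith) (fun q hq => (hsub hq.1).2.le)
      exact ⟨r, hr, g, hg, ae_of_all _ fun x v' hv' =>
        hb (v', _) ⟨Metric.ball_subset_closedBall hv', rfl⟩ x⟩
  · obtain ⟨δ, hδ, hδ'⟩ : ∃ δ, 0 < δ ∧ ∀ j, -ρ + δ < (v j).im := by
      have h1 : ∀ᶠ δ in 𝓝[>] (0 : ℝ), ∀ j, -ρ + δ < (v j).im := by
        rw [eventually_all]
        intro j
        refine eventually_nhdsWithin_of_eventually_nhds ?_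
        have hc : ContinuousAt (fun δ : ℝ => -ρ + δ) 0 := by fun_prop
        exact hc.eventually_lt_const (by have := hv.1 j; simp only [add_zero]; linarith)
      obtain ⟨δ, h2, h3⟩ := (h1.and self_mem_nhdsWithin).exists
      exact ⟨δ, h3, h2⟩
    have him : ∀ z : ℂ, -R - δ < z.im → z.im < δ → ∀ j,
        -(ρ + 2 * R) < (v j + z).im ∧ -ρ < (v j - z).im := by
      intro z h1 h2 j
      have := hδ' j
      constructor <;> simp <;> linarith
    have hd : ∀ p, DifferentiableOn ℂ (hypReg ω₁ ω₂ F p v) {z | -R - δ < z.im ∧ z.im < δ} :=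
      fun p z hz => (analyticAt_hypReg hω₁ hω₂ hFa p (v := fun _ => v) (z := fun z => z)
        (fun j => analyticAt_const) analyticAt_id (fun j => (him z hz.1 hz.2 j).1)
        (fun j => (him z hz.1 hz.2 j).2)).differentiableAt.differentiableWithinAt
    have hb : ∀ p, ∀ w : ℂ, -R - δ < w.im → w.im < δ → ∃ r > 0, ∃ g : ℝ → ℝ, Integrable g ∧
        ∀ x : ℝ, ∀ w' ∈ Metric.ball w r, ‖hypReg ω₁ ω₂ F p v (x + w')‖ ≤ g x := by
      intro p w h1 h2
      obtain ⟨r, hr, hsub⟩ := Metric.nhds_basis_closedBall.mem_iff.1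
        ((isOpen_strip (-R - δ) δ).mem_nhds ⟨h1, h2⟩)
      obtain ⟨g, hg, hb⟩ := exists_bound_hypReg hω₁ hω₂ hFa hF p
        (K := {v} ×ˢ Metric.closedBall w r)
        (isCompact_singleton.prod (isCompact_closedBall w r))
        (fun q hq j => by
          rw [Set.mem_singleton_iff.1 hq.1]; exact (him q.2 (hsub hq.2).1 (hsub hq.2).2 j).1)
        (fun q hq j => by
          rw [Set.mem_singleton_iff.1 hq.1]; exact (him q.2 (hsub hq.2).1 (hsub hq.2).2 j).2)
        hv.2 (fun q hq => by rw [Set.mem_singleton_iff.1 hq.1])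
      exact ⟨r, hr, g, hg, fun x w' hw' =>
        hb (v, w') ⟨rfl, Metric.ball_subset_closedBall hw'⟩ x⟩
    have hint : ∀ p, Integrable fun x : ℝ => hypReg ω₁ ω₂ F p v x := fun p => by
      simpa using integrable_of_strip (hd p) (hb p) (w := 0) ⟨by simp; linarith, by simpa⟩
    have hshift := integral_strip_shift (hd (c + d)) (hb (c + d)) (w := 0) (w' := -(R * I))
      ⟨by simp; linarith, by simpa⟩ ⟨by simp; linarith, by simp; linarith⟩
    simp only [add_zero] at hshift
    simp only
    rw [← hshift]
    have hreal : ∀ p, ∀ x : ℝ, hypReg ω₁ ω₂ F p v x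
        = evalAt p v x * (∏ j, ∏ i, (v j + x - ζ i)) * hypKernel ω₁ ω₂ v x := fun p x =>
      hypReg_eq hF p (fun j => (him x (by simp; linarith) (by simpa) j).1) fun j i h => by
        have h1 := hζ i
        have h2 := hv.1 j
        rw [← h] at h1; simp at h1; linarith
    have heven : ∀ z, hypKernel ω₁ ω₂ v (-z) = hypKernel ω₁ ω₂ v z := fun z => by
      simp only [hypKernel, hypWeight_neg, hypPair_neg]
    have hpt : ∀ x : ℝ, hypClear ζ v * hypKernel ω₁ ω₂ v x
        = hypReg ω₁ ω₂ F c v x + hypReg ω₁ ω₂ F d v ((-x : ℝ) : ℂ) := by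
      intro x
      rw [hreal, hreal, hcd v x, Complex.ofReal_neg, heven]; ring
    rw [hypInt, ← integral_const_mul]
    simp only [hpt]
    rw [integral_add (hint c) (hint d).comp_neg,
      integral_neg_eq_self (fun x : ℝ => hypReg ω₁ ω₂ F d v x), ← integral_add (hint c) (hint d)]
    refine integral_congr_ae (ae_of_all _ fun x => ?_)
    simp only [hypReg, evalAt, map_add]; ring


/-! ### The hyperbolic hypergeometric function -/

theorem hypDomain_subset_hypDomainExt (ω₁ ω₂ : ℂ) (n : ℕ) {R : ℝ} (hR : 0 ≤ R) :
    hypDomain ω₁ ω₂ n ⊆ hypDomainExt ω₁ ω₂ n R := fun v hv =>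
  ⟨fun j => by have := hv.1 j; linarith, hv.2⟩

theorem analyticAt_hypClear {n m : ℕ} (ζ : Fin m → ℂ) (v : Fin n → ℂ) :
    AnalyticAt ℂ (hypClear ζ) v := by
  have hproj : ∀ (j : Fin n), AnalyticAt ℂ (fun v : Fin n → ℂ => v j) v :=
    fun j => (ContinuousLinearMap.proj (R := ℂ) (φ := fun _ : Fin n => ℂ) j).analyticAt v
  unfold hypClear
  exact Finset.analyticAt_fun_prod _ fun p _ => Finset.analyticAt_fun_prod _ fun q _ =>
    ((hproj p.1).sub analyticAt_const).add ((hproj q.1).sub analyticAt_const)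

theorem const_mem_hypDomain (hω₁ : 0 < ω₁.re) (hω₂ : 0 < ω₂.re) :
    (fun _ : Fin 8 => -(hypEta ω₁ ω₂ / 2)) ∈ hypDomain ω₁ ω₂ 8 := by
  refine mem_hypDomain hω₁ hω₂ (fun j => ?_) ?_
  · have h : (-(hypEta ω₁ ω₂ / 2)).im = -((ω₁.re + ω₂.re) / 2 / 2) := by
      rw [← hypEta_im, Complex.neg_im, Complex.div_ofNat_im]
    rw [h]; linarith
  · simp; ring

/-- Continuation of `hypInt`: a single function that on each `hypDomainExt` is a quotient of
analytic functions. The quotients for different `R` agree by the identity theorem. -/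
theorem exists_hypInt_continuation (hω₁ : 0 < ω₁.re) (hω₂ : 0 < ω₂.re) :
    ∃ S : (Fin 8 → ℂ) → ℂ, (∀ v ∈ hypDomain ω₁ ω₂ 8, S v = hypInt ω₁ ω₂ v) ∧
      ∀ N : ℕ, ∃ (m : ℕ) (ζ : Fin m → ℂ) (T : (Fin 8 → ℂ) → ℂ),
        AnalyticOnNhd ℂ T (hypDomainExt ω₁ ω₂ 8 N) ∧
        ∀ v ∈ hypDomainExt ω₁ ω₂ 8 N, hypClear ζ v ≠ 0 → S v = T v / hypClear ζ v := by
  classical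
  choose m ζ T hT hTeq using fun N : ℕ =>
    exists_hypClear_mul_hypInt_eq hω₁ hω₂ 8 (R := N) (Nat.cast_nonneg N)
  have hle : ∀ {M N : ℕ}, M ≤ N → hypDomainExt ω₁ ω₂ 8 M ⊆ hypDomainExt ω₁ ω₂ 8 N :=
    fun {M N} h v hv => ⟨fun j => by
      have h1 := hv.1 j
      have h2 : (M : ℝ) ≤ N := by exact_mod_cast h
      linarith, hv.2⟩
  have hcons : ∀ M N : ℕ, ∀ v ∈ hypDomainExt ω₁ ω₂ 8 M, v ∈ hypDomainExt ω₁ ω₂ 8 N →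
      T M v * hypClear (ζ N) v = T N v * hypClear (ζ M) v := by
    have key : ∀ M N : ℕ, M ≤ N → ∀ v ∈ hypDomainExt ω₁ ω₂ 8 M,
        T M v * hypClear (ζ N) v = T N v * hypClear (ζ M) v := by
      intro M N h
      refine AnalyticOnNhd.eqOn_of_preconnected_of_eventuallyEq
        (f := fun v => T M v * hypClear (ζ N) v) (g := fun v => T N v * hypClear (ζ M) v)
        (fun v hv => (hT M v hv).mul (analyticAt_hypClear _ _))
        (fun v hv => (hT N v (hle h hv)).mul (analyticAt_hypClear _ _))
        (convex_hypDomainExt ω₁ ω₂ 8 M).isPreconnected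
        (hypDomain_subset_hypDomainExt ω₁ ω₂ 8 M.cast_nonneg (const_mem_hypDomain hω₁ hω₂)) ?_
      filter_upwards [(isOpen_hypDomain ω₁ ω₂ 8).mem_nhds (const_mem_hypDomain hω₁ hω₂)] with v hv
      rw [← hTeq M v hv, ← hTeq N v hv]; ring
    intro M N v hM hN
    rcases le_total M N with h | h
    · exact key M N h v hM
    · exact (key N M h v hN).symm
  refine ⟨fun v => if v ∈ hypDomain ω₁ ω₂ 8 then hypInt ω₁ ω₂ v else
    if h : ∃ N, v ∈ hypDomainExt ω₁ ω₂ 8 (N : ℕ) ∧ hypClear (ζ N) v ≠ 0 then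
      T h.choose v / hypClear (ζ h.choose) v else 0, fun v hv => if_pos hv,
    fun N => ⟨m N, ζ N, T N, hT N, fun v hv hne => ?_⟩⟩
  simp only
  split_ifs with h1 h2
  · rw [← hTeq N v h1, mul_div_cancel_left₀ _ hne]
  · rw [div_eq_div_iff h2.choose_spec.2 hne]
    exact hcons _ N v h2.choose_spec.1 hv
  · exact absurd ⟨N, hv, hne⟩ h2

/-- Direction in `∑ vⱼ = 0` in which no sum of two coordinates is constant. -/
def genericDir : Fin 8 → ℂ := ![1, 2, 3, 4, 5, 6, 7, -28]

theorem sum_genericDir : ∑ j, genericDir j = 0 := by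
  simp [genericDir, Fin.sum_univ_eight]; norm_num

theorem genericDir_add_ne_zero (j k : Fin 8) : genericDir j + genericDir k ≠ 0 := by
  fin_cases j <;> fin_cases k <;> simp [genericDir] <;> norm_num

theorem eventually_add_mul_ne_zero (a : ℂ) {b : ℂ} (hb : b ≠ 0) :
    ∀ᶠ t : ℂ in 𝓝[≠] 0, a + t * b ≠ 0 := by
  have h : ∀ᶠ t : ℂ in 𝓝[≠] 0, t ≠ -a / b := by
    rcases eq_or_ne (-a / b) 0 with h | h
    · rw [h]; exact self_mem_nhdsWithin
    · exact eventually_nhdsWithin_of_eventually_nhds (isOpen_ne.mem_nhds h.symm)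
  filter_upwards [h] with t ht h0
  exact ht (by rw [eq_div_iff hb]; linear_combination h0)

theorem tendsto_add_smul_genericDir {H : Set (Fin 8 → ℂ)} {c : ℂ} (hH : H = {u | ∑ j, u j = c})
    {a : Fin 8 → ℂ} (ha : a ∈ H) :
    Tendsto (fun t : ℂ => a + t • genericDir) (𝓝[≠] 0) (𝓝[H] a) := by
  refine tendsto_nhdsWithin_iff.2 ⟨?_, Eventually.of_forall fun t => ?_⟩
  · have : Continuous fun t : ℂ => a + t • genericDir := by fun_prop
    simpa using (this.tendsto 0).mono_left nhdsWithin_le_nhds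
  · rw [hH] at ha ⊢
    simp only [Set.mem_ofPred_eq, Pi.add_apply, Pi.smul_apply, smul_eq_mul, Finset.sum_add_distrib,
      ← Finset.mul_sum, sum_genericDir, mul_zero, add_zero]
    exact ha

theorem hypParamSpace_eq (ω₁ ω₂ : ℂ) :
    hypParamSpace ω₁ ω₂ = {u | ∑ j, u j = 4 * hypEta ω₁ ω₂} := by
  ext u
  simp only [hypParamSpace, paramSpace, Set.mem_ofPred_eq, hypEta]
  rw [show 2 * (2 * I * ((ω₁ + ω₂) / 2)) = 4 * (I * ((ω₁ + ω₂) / 2)) by ring]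

theorem frequently_hypClear_ne_zero {m : ℕ} (ζ : Fin m → ℂ) {a : Fin 8 → ℂ}
    (ha : a ∈ hypParamSpace ω₁ ω₂) :
    ∃ᶠ u in 𝓝[hypParamSpace ω₁ ω₂] a, hypClear ζ (-u) ≠ 0 := by
  refine (tendsto_add_smul_genericDir (hypParamSpace_eq ω₁ ω₂) ha).frequently
    (Eventually.frequently ?_)
  have h : ∀ p q : Fin 8 × Fin m, ∀ᶠ t : ℂ in 𝓝[≠] 0,
      (-a p.1 - ζ p.2 + (-a q.1 - ζ q.2)) + t * -(genericDir p.1 + genericDir q.1) ≠ 0 :=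
    fun p q => eventually_add_mul_ne_zero _ (neg_ne_zero.2 (genericDir_add_ne_zero _ _))
  filter_upwards [eventually_all.2 fun p => eventually_all.2 (h p)] with t ht
  refine Finset.prod_ne_zero_iff.2 fun p _ => Finset.prod_ne_zero_iff.2 fun q _ => ?_
  convert ht p q using 1
  simp only [Pi.neg_apply, Pi.add_apply, Pi.smul_apply, smul_eq_mul]; ring

theorem hypIntegrand_eq (hω₁ : 0 < ω₁.re) (hω₂ : 0 < ω₂.re) (u : Fin 8 → ℂ) (x : ℝ) :
    hypIntegrand ω₁ ω₂ u x = hypKernel ω₁ ω₂ (-u) x := by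
  have h : ∀ j, hypPair ω₁ ω₂ ((-u) j) x
      = (hypGamma ω₁ ω₂ (u j + x) * hypGamma ω₁ ω₂ (u j - x))⁻¹ := by
    intro j
    rw [hypPair, Pi.neg_apply, show -u j + (x : ℂ) = -(u j - x) by ring,
      show -u j - (x : ℂ) = -(u j + x) by ring, hypGamma_neg hω₁ hω₂, hypGamma_neg hω₁ hω₂, mul_inv]
    ring
  rw [hypIntegrand, hypKernel, Finset.prod_congr rfl fun j _ => h j, Finset.prod_inv_distrib,
    hypGamma_mul_hypGamma_two hω₁ hω₂ (by simp; linarith), hypWeight, div_eq_mul_inv]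

theorem neg_mem_hypDomain (hω₁ : 0 < ω₁.re) (hω₂ : 0 < ω₂.re) {u : Fin 8 → ℂ}
    (hu : u ∈ hypParamSpace ω₁ ω₂) (h : ∀ j, (u j - I * ((ω₁ + ω₂) / 2)).im < 0) :
    -u ∈ hypDomain ω₁ ω₂ 8 := by
  rw [hypParamSpace_eq] at hu
  refine mem_hypDomain hω₁ hω₂ (fun j => ?_) ?_
  · have h1 := h j
    have h2 := hypEta_im ω₁ ω₂
    rw [hypEta] at h2
    rw [Complex.sub_im, h2] at h1
    rw [Pi.neg_apply, Complex.neg_im]; linarith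
  · simp only [Pi.neg_apply, Finset.sum_neg_distrib]
    rw [show ∑ j, u j = 4 * hypEta ω₁ ω₂ from hu]; ring

/-- Existence of the hyperbolic hypergeometric function. -/
theorem exists_isHyperbolicHypergeometric (hω₁ : 0 < ω₁.re) (hω₂ : 0 < ω₂.re) :
    ∃ S, IsHyperbolicHypergeometric ω₁ ω₂ S := by
  obtain ⟨S, hS, hS'⟩ := exists_hypInt_continuation hω₁ hω₂
  refine ⟨fun u => S (-u), fun a ha => ?_, fun u hu h => ?_⟩
  · obtain ⟨N, hN⟩ := exists_nat_gt ‖a‖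
    obtain ⟨m, ζ, T, hT, hq⟩ := hS' N
    have hmem : -a ∈ hypDomainExt ω₁ ω₂ 8 N := by
      refine ⟨fun j => ?_, ?_⟩
      · have h1 := (abs_le.1 (Complex.abs_im_le_norm (a j))).2
        have h2 := norm_le_pi_norm a j
        rw [Pi.neg_apply, Complex.neg_im]
        linarith
      · have h1 := (const_mem_hypDomain hω₁ hω₂).2
        rw [hypParamSpace_eq] at ha
        have h2 : ∑ j, (-a) j = ∑ _j : Fin 8, -(hypEta ω₁ ω₂ / 2) := by
          simp only [Pi.neg_apply, Finset.sum_neg_distrib]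
          rw [show ∑ j, a j = 4 * hypEta ω₁ ω₂ from ha]
          simp; ring
        rwa [h2]
    have hneg : AnalyticAt ℂ (fun u : Fin 8 → ℂ => -u) a := analyticAt_id.neg
    refine ⟨fun u => T (-u), fun u => hypClear ζ (-u), (hT _ hmem).comp_of_eq hneg rfl,
      (analyticAt_hypClear ζ _).comp_of_eq hneg rfl, frequently_hypClear_ne_zero ζ ha, ?_⟩
    have h1 : ∀ᶠ u in 𝓝 a, -u ∈ hypDomainExt ω₁ ω₂ 8 N :=
      continuous_neg.continuousAt.eventually_mem ((isOpen_hypDomainExt ω₁ ω₂ 8 N).mem_nhds hmem)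
    filter_upwards [eventually_nhdsWithin_of_eventually_nhds h1] with u hu using hq _ hu
  · have hd := neg_mem_hypDomain hω₁ hω₂ hu h
    simp only [hypIntegrand_eq hω₁ hω₂]
    exact ⟨integrable_hypKernel hω₁ hω₂ hd, hS _ hd⟩


/-! ### Meromorphic functions up to dense open sets -/

/-- Equality on a dense open set. -/
def DenseEq {E : Type*} [TopologicalSpace E] (f g : E → ℂ) : Prop := Dense {a | f =ᶠ[𝓝 a] g}

namespace DenseEq

variable {E : Type*} [TopologicalSpace E] {f g k f' g' : E → ℂ}

theorem of_eq (h : ∀ x, f x = g x) : DenseEq f g :=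
  dense_univ.mono fun _ _ => Eventually.of_forall h

theorem symm (h : DenseEq f g) : DenseEq g f :=
  h.mono fun _ ha => EventuallyEq.symm ha

theorem trans (h : DenseEq f g) (h' : DenseEq g k) : DenseEq f k :=
  (h.inter_of_isOpen_left h' isOpen_setOfPred_eventually_nhds).mono fun _ ha =>
    EventuallyEq.trans ha.1 ha.2

theorem mul (h : DenseEq f g) (h' : DenseEq f' g') :
    DenseEq (fun u => f u * f' u) fun u => g u * g' u :=
  (h.inter_of_isOpen_left h' isOpen_setOfPred_eventually_nhds).mono fun _ ha =>
    EventuallyEq.mul ha.1 ha.2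

theorem prod {ι : Type*} (s : Finset ι) {f g : ι → E → ℂ}
    (h : ∀ i ∈ s, DenseEq (f i) (g i)) :
    DenseEq (fun u => ∏ i ∈ s, f i u) fun u => ∏ i ∈ s, g i u := by
  classical
  induction s using Finset.induction_on with
  | empty => exact of_eq fun x => by simp
  | insert i s hi ih =>
    simp only [Finset.prod_insert hi]
    exact (h i (Finset.mem_insert_self _ _)).mul (ih fun j hj => h j (Finset.mem_insert_of_mem hj))

theorem comp_homeomorph (h : DenseEq f g) (e : E ≃ₜ E) :
    DenseEq (fun u => f (e u)) fun u => g (e u) := by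
  have h1 : Dense (e ⁻¹' {a | f =ᶠ[𝓝 a] g}) := Dense.preimage h e.isOpenMap
  exact h1.mono fun a ha => e.continuous.continuousAt.tendsto.eventually (p := fun u => f u = g u) ha

end DenseEq

section LocalQuotient

variable {E : Type*} [NormedAddCommGroup E] [NormedSpace ℂ E]

theorem AnalyticAt.exists_ball_frequently_ne_zero {h : E → ℂ} {a : E} (hh : AnalyticAt ℂ h a)
    (hf : ∃ᶠ u in 𝓝 a, h u ≠ 0) : ∀ᶠ b in 𝓝 a, ∃ᶠ u in 𝓝 b, h u ≠ 0 := by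
  obtain ⟨r, hr, hsub⟩ := Metric.eventually_nhds_iff_ball.1 hh.eventually_analyticAt
  filter_upwards [Metric.ball_mem_nhds a hr] with b hb hcon
  refine hf ?_
  have h0 : h =ᶠ[𝓝 b] 0 := hcon.mono fun u hu => not_not.1 hu
  have := AnalyticOnNhd.eqOn_zero_of_preconnected_of_eventuallyEq_zero (𝕜 := ℂ) hsub
    (convex_ball a r).isPreconnected hb h0
  filter_upwards [Metric.ball_mem_nhds a hr] with u hu using not_not.2 (this hu)

theorem AnalyticAt.frequently_mul_ne_zero {g h : E → ℂ} {a : E} (hg : AnalyticAt ℂ g a)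
    (hgf : ∃ᶠ u in 𝓝 a, g u ≠ 0) (hh : AnalyticAt ℂ h a) (hhf : ∃ᶠ u in 𝓝 a, h u ≠ 0) :
    ∃ᶠ u in 𝓝 a, g u * h u ≠ 0 := by
  intro hcon
  obtain ⟨b, hb, hgb, hhb, h0⟩ := (hgf.and_eventually (hg.eventually_analyticAt.and
    ((hh.exists_ball_frequently_ne_zero hhf).and (eventually_eventually_nhds.2 hcon)))).exists
  obtain ⟨u, hu1, hu2, hu3⟩ := (hhb.and_eventually
    ((hgb.continuousAt.eventually_ne hb).and h0)).exists
  exact hu3 (mul_ne_zero hu2 hu1)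

/-- Local quotients of analytic functions, that is, meromorphic functions on `E`; values at the
zeros of the denominators are ignored. -/
def IsLocalQuotient (f : E → ℂ) : Prop :=
  ∀ a, ∃ g h : E → ℂ, AnalyticAt ℂ g a ∧ AnalyticAt ℂ h a ∧ (∃ᶠ u in 𝓝 a, h u ≠ 0) ∧
    ∀ᶠ u in 𝓝 a, h u ≠ 0 → f u = g u / h u

namespace IsLocalQuotient

variable {f g : E → ℂ}

theorem const (c : ℂ) : IsLocalQuotient fun _ : E => c := fun a =>
  ⟨fun _ => c, fun _ => 1, analyticAt_const, analyticAt_const,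
    Eventually.frequently (Eventually.of_forall fun _ => one_ne_zero),
    Eventually.of_forall fun _ _ => by simp⟩

theorem mul (hf : IsLocalQuotient f) (hg : IsLocalQuotient g) :
    IsLocalQuotient fun u => f u * g u := by
  intro a
  obtain ⟨g₁, h₁, hg₁, hh₁, hn₁, he₁⟩ := hf a
  obtain ⟨g₂, h₂, hg₂, hh₂, hn₂, he₂⟩ := hg a
  refine ⟨fun u => g₁ u * g₂ u, fun u => h₁ u * h₂ u, hg₁.mul hg₂, hh₁.mul hh₂,
    hh₁.frequently_mul_ne_zero hn₁ hh₂ hn₂, ?_⟩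
  filter_upwards [he₁, he₂] with u h1 h2 hne
  rw [h1 (left_ne_zero_of_mul hne), h2 (right_ne_zero_of_mul hne), div_mul_div_comm]

theorem prod {ι : Type*} (s : Finset ι) {f : ι → E → ℂ} (h : ∀ i ∈ s, IsLocalQuotient (f i)) :
    IsLocalQuotient fun u => ∏ i ∈ s, f i u := by
  classical
  induction s using Finset.induction_on with
  | empty => simpa using const 1
  | insert i s hi ih =>
    simp only [Finset.prod_insert hi]
    exact (h i (Finset.mem_insert_self _ _)).mul (ih fun j hj => h j (Finset.mem_insert_of_mem hj))

theorem comp_equiv (hf : IsLocalQuotient f) (e : E ≃L[ℂ] E) : IsLocalQuotient fun u => f (e u) := by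
  intro a
  obtain ⟨g₁, h₁, hg₁, hh₁, hn₁, he₁⟩ := hf (e a)
  have hea : AnalyticAt ℂ (fun u => e u) a := e.analyticAt a
  refine ⟨fun u => g₁ (e u), fun u => h₁ (e u), hg₁.comp_of_eq hea rfl, hh₁.comp_of_eq hea rfl,
    fun hcon => hn₁ ?_, e.continuous.continuousAt.tendsto.eventually he₁⟩
  have := e.toHomeomorph.map_nhds_eq a
  rw [show e a = e.toHomeomorph a from rfl, ← this]
  exact hcon

/-- Identity theorem for meromorphic functions. -/
theorem denseEq_of_eventuallyEq (hf : IsLocalQuotient f) (hg : IsLocalQuotient g) {a₀ : E}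
    (h : f =ᶠ[𝓝 a₀] g) : DenseEq f g := by
  set W : Set E := {a | f =ᶠ[𝓝 a] g} with hW
  have key : ∀ a, ∃ U ∈ 𝓝 a, ∀ b ∈ U, b ∈ W → U ⊆ closure W := by
    intro a
    obtain ⟨g₁, h₁, hg₁, hh₁, hn₁, he₁⟩ := hf a
    obtain ⟨g₂, h₂, hg₂, hh₂, hn₂, he₂⟩ := hg a
    have hk := hh₁.mul hh₂
    have hkn := hh₁.frequently_mul_ne_zero hn₁ hh₂ hn₂
    have hD := (hg₁.mul hh₂).sub (hg₂.mul hh₁)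
    obtain ⟨r, hr, hsub⟩ := Metric.eventually_nhds_iff_ball.1
      ((hk.eventually_analyticAt.and hD.eventually_analyticAt).and
        ((AnalyticAt.exists_ball_frequently_ne_zero hk hkn).and (he₁.and he₂)))
    have hball : ∀ c ∈ Metric.ball a r, ∀ᶠ u in 𝓝 c, u ∈ Metric.ball a r := fun c hc =>
      Metric.isOpen_ball.eventually_mem hc
    refine ⟨_, Metric.ball_mem_nhds a hr, fun b hb hbW c hc => ?_⟩
    -- near `b` the difference of the quotients vanishes, hence it does so on the whole ball
    have hD0 : ∀ᶠ u in 𝓝 b, g₁ u * h₂ u - g₂ u * h₁ u = 0 := by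
      by_contra hcon
      have h1 := (hsub b hb).1.1.frequently_mul_ne_zero (hsub b hb).2.1 (hsub b hb).1.2
        (fun h => hcon (h.mono fun u hu => not_not.1 hu))
      obtain ⟨u, hu, hub, hfg⟩ := (h1.and_eventually ((hball b hb).and hbW)).exists
      refine hu (mul_eq_zero.2 (or_iff_not_imp_left.2 fun hne => ?_))
      have hne' : h₁ u * h₂ u ≠ 0 := hne
      have n1 := left_ne_zero_of_mul hne'
      have n2 := right_ne_zero_of_mul hne'
      have e1 := (hsub u hub).2.2.1 n1
      have e2 := (hsub u hub).2.2.2 n2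
      rw [hfg, e2, div_eq_div_iff n2 n1] at e1
      exact sub_eq_zero.2 e1.symm
    have hDall := AnalyticOnNhd.eqOn_zero_of_preconnected_of_eventuallyEq_zero (𝕜 := ℂ)
      (fun c hc => (hsub c hc).1.2) (convex_ball a r).isPreconnected hb hD0
    refine mem_closure_iff_frequently.2 ?_
    refine ((hsub c hc).2.1.and_eventually (hball c hc)).mono fun u hu => ?_
    have h2 : ∀ᶠ u' in 𝓝 u, h₁ u' * h₂ u' ≠ 0 :=
      (hsub u hu.2).1.1.continuousAt.eventually_ne hu.1
    filter_upwards [h2, hball u hu.2] with u' hne hu'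
    have n1 := left_ne_zero_of_mul hne
    have n2 := right_ne_zero_of_mul hne
    rw [(hsub u' hu').2.2.1 n1, (hsub u' hu').2.2.2 n2, div_eq_div_iff n1 n2]
    exact sub_eq_zero.1 (hDall hu')
  have hopen : IsOpen (closure W) := by
    refine isOpen_iff_mem_nhds.2 fun a ha => ?_
    obtain ⟨U, hU, hU'⟩ := key a
    obtain ⟨b, hb, hbW⟩ := mem_closure_iff_nhds.1 ha U hU
    exact mem_of_superset hU (hU' b hb hbW)
  have : closure W = Set.univ := IsClopen.eq_univ ⟨isClosed_closure, hopen⟩ ⟨a₀, subset_closure h⟩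
  exact dense_iff_closure_eq.2 this

end IsLocalQuotient

end LocalQuotient

/-! ### The parameter space as a vector space -/

/-- The linear space parallel to `𝒢_{2iω}`. -/
def sumZero : Submodule ℂ (Fin 8 → ℂ) where
  carrier := {x | ∑ j, x j = 0}
  add_mem' {x y} hx hy := by
    have hx' : ∑ j, x j = 0 := hx
    have hy' : ∑ j, y j = 0 := hy
    show ∑ j, (x + y) j = 0
    simp only [Pi.add_apply, Finset.sum_add_distrib, hx', hy', add_zero]
  zero_mem' := by simp
  smul_mem' c x hx := by
    have hx' : ∑ j, x j = 0 := hx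
    show ∑ j, (c • x) j = 0
    simp only [Pi.smul_apply, smul_eq_mul, ← Finset.mul_sum, hx', mul_zero]

theorem mem_sumZero {x : Fin 8 → ℂ} : x ∈ sumZero ↔ ∑ j, x j = 0 := Iff.rfl

/-- The parametrization of `𝒢_{2iω}` by `sumZero`, centred at the point with equal coordinates,
which is fixed by the Weyl group. -/
def hypParam (ω₁ ω₂ : ℂ) (x : sumZero) : Fin 8 → ℂ :=
  fun j => hypEta ω₁ ω₂ / 2 + (x : Fin 8 → ℂ) j

theorem range_hypParam (ω₁ ω₂ : ℂ) : Set.range (hypParam ω₁ ω₂) = hypParamSpace ω₁ ω₂ := by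
  rw [hypParamSpace_eq]
  ext u
  constructor
  · rintro ⟨x, rfl⟩
    have := mem_sumZero.1 x.2
    show ∑ j, (hypEta ω₁ ω₂ / 2 + (x : Fin 8 → ℂ) j) = _
    rw [Finset.sum_add_distrib, this]; simp; ring
  · intro hu
    have hu' : ∑ j, u j = 4 * hypEta ω₁ ω₂ := hu
    refine ⟨⟨fun j => u j - hypEta ω₁ ω₂ / 2, ?_⟩, ?_⟩
    · rw [mem_sumZero, Finset.sum_sub_distrib, hu']; simp; ring
    · ext j; simp [hypParam]

theorem hypParam_mem (x : sumZero) : hypParam ω₁ ω₂ x ∈ hypParamSpace ω₁ ω₂ :=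
  range_hypParam ω₁ ω₂ ▸ Set.mem_range_self x

theorem analyticAt_hypParam (x : sumZero) : AnalyticAt ℂ (hypParam ω₁ ω₂) x :=
  analyticAt_const.add (sumZero.subtypeL.analyticAt x)

theorem analyticAt_hypParam_apply (x : sumZero) (j : Fin 8) :
    AnalyticAt ℂ (fun x => hypParam ω₁ ω₂ x j) x :=
  ((ContinuousLinearMap.proj (R := ℂ) (φ := fun _ : Fin 8 => ℂ) j).analyticAt _).comp_of_eq
    (analyticAt_hypParam x) rfl

theorem isInducing_hypParam (ω₁ ω₂ : ℂ) : IsInducing (hypParam ω₁ ω₂) :=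
  (Homeomorph.addLeft (fun _ : Fin 8 => hypEta ω₁ ω₂ / 2)).isInducing.comp IsInducing.subtypeVal

theorem map_hypParam_nhds (x : sumZero) :
    map (hypParam ω₁ ω₂) (𝓝 x) = 𝓝[hypParamSpace ω₁ ω₂] (hypParam ω₁ ω₂ x) := by
  rw [(isInducing_hypParam ω₁ ω₂).map_nhds_eq, range_hypParam]

theorem MeromorphicOnSubspace.isLocalQuotient {f : (Fin 8 → ℂ) → ℂ}
    (hf : MeromorphicOnSubspace f (hypParamSpace ω₁ ω₂)) :
    IsLocalQuotient fun x => f (hypParam ω₁ ω₂ x) := by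
  intro x
  obtain ⟨g, h, hg, hh, hn, he⟩ := hf _ (hypParam_mem x)
  rw [← map_hypParam_nhds] at hn he
  exact ⟨fun x => g (hypParam ω₁ ω₂ x), fun x => h (hypParam ω₁ ω₂ x),
    hg.comp_of_eq (analyticAt_hypParam x) rfl, hh.comp_of_eq (analyticAt_hypParam x) rfl,
    frequently_map.1 hn, eventually_map.1 he⟩

/-- The coordinates `hypParam` identify the two notions of equality almost everywhere. -/
theorem meromorphicEqOn_of_denseEq {f g : (Fin 8 → ℂ) → ℂ}
    (h : DenseEq (fun x => f (hypParam ω₁ ω₂ x)) fun x => g (hypParam ω₁ ω₂ x)) :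
    MeromorphicEqOn f g (hypParamSpace ω₁ ω₂) := by
  intro u hu
  rw [← range_hypParam] at hu
  obtain ⟨x, rfl⟩ := hu
  have h1 := h x
  rw [(isInducing_hypParam ω₁ ω₂).closure_eq_preimage_closure_image] at h1
  refine closure_mono ?_ h1
  rintro _ ⟨y, hy, rfl⟩
  refine ⟨hypParam_mem y, ?_⟩
  rw [← map_hypParam_nhds]
  exact hy

/-- The identity theorem on the parameter space. -/
theorem denseEq_of_eventually {f g : (Fin 8 → ℂ) → ℂ}
    (hf : IsLocalQuotient fun x => f (hypParam ω₁ ω₂ x))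
    (hg : IsLocalQuotient fun x => g (hypParam ω₁ ω₂ x)) {u : Fin 8 → ℂ}
    (hu : u ∈ hypParamSpace ω₁ ω₂) (h : ∀ᶠ v in 𝓝[hypParamSpace ω₁ ω₂] u, f v = g v) :
    DenseEq (fun x => f (hypParam ω₁ ω₂ x)) fun x => g (hypParam ω₁ ω₂ x) := by
  rw [← range_hypParam] at hu
  obtain ⟨x, rfl⟩ := hu
  rw [← map_hypParam_nhds] at h
  exact hf.denseEq_of_eventuallyEq hg (eventually_map.1 h)

/-! ### The factors `G(iω - uⱼ - uₖ)` -/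

/-- The composition of `G` with a nowhere constant analytic function is meromorphic. -/
theorem isLocalQuotient_hypGamma (hω₁ : 0 < ω₁.re) (hω₂ : 0 < ω₂.re) {E : Type*}
    [NormedAddCommGroup E] [NormedSpace ℂ E] {ℓ : E → ℂ} (hℓ : ∀ x, AnalyticAt ℂ ℓ x)
    (hn : ∀ x c, ∃ᶠ y in 𝓝 x, ℓ y ≠ c) : IsLocalQuotient fun x => hypGamma ω₁ ω₂ (ℓ x) := by
  intro x
  obtain ⟨m, ζ, F, -, hFa, hF⟩ := exists_hypGamma_denominator hω₁ hω₂ (-(ℓ x).im + 1)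
  have hx : -(-(ℓ x).im + 1) < (ℓ x).im := by linarith
  have hev : ∀ᶠ y in 𝓝 x, -(-(ℓ x).im + 1) < (ℓ y).im :=
    (hℓ x).continuousAt.eventually_mem ((isOpen_halfPlane _).mem_nhds hx)
  refine ⟨fun y => F (ℓ y), fun y => ∏ i, (ℓ y - ζ i), (hFa _ hx).comp_of_eq (hℓ x) rfl,
    Finset.analyticAt_fun_prod _ fun i _ => (hℓ x).sub analyticAt_const, ?_, ?_⟩
  · have : ∀ s : Finset (Fin m), ∃ᶠ y in 𝓝 x, ∏ i ∈ s, (ℓ y - ζ i) ≠ 0 := by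
      intro s
      induction s using Finset.induction_on with
      | empty => exact Eventually.frequently (Eventually.of_forall fun _ => by simp)
      | insert i s hi ih =>
        simp only [Finset.prod_insert hi]
        exact AnalyticAt.frequently_mul_ne_zero ((hℓ x).sub analyticAt_const)
          ((hn x (ζ i)).mono fun y hy => sub_ne_zero.2 hy)
          (Finset.analyticAt_fun_prod _ fun i _ => (hℓ x).sub analyticAt_const) ih
    exact this _
  · filter_upwards [hev] with y hy hne
    rw [hF _ hy hne, mul_div_cancel_left₀ _ hne]

theorem frequently_hypParam_ne (x : sumZero) (j k : Fin 8) (c : ℂ) :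
    ∃ᶠ y in 𝓝 x, hypParam ω₁ ω₂ y j + hypParam ω₁ ω₂ y k ≠ c := by
  have h := (tendsto_add_smul_genericDir (hypParamSpace_eq ω₁ ω₂) (hypParam_mem x)).frequently
    (p := fun u => u j + u k ≠ c) (Eventually.frequently ?_)
  · rw [← map_hypParam_nhds] at h
    exact frequently_map.1 h
  · filter_upwards [eventually_add_mul_ne_zero (hypParam ω₁ ω₂ x j + hypParam ω₁ ω₂ x k - c)
      (genericDir_add_ne_zero j k)] with t ht h
    refine ht ?_
    simp only [Pi.add_apply, Pi.smul_apply, smul_eq_mul] at h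
    linear_combination h

theorem isLocalQuotient_hypGamma_sub (hω₁ : 0 < ω₁.re) (hω₂ : 0 < ω₂.re) (j k : Fin 8) :
    IsLocalQuotient fun x => hypGamma ω₁ ω₂
      (I * ((ω₁ + ω₂) / 2) - hypParam ω₁ ω₂ x j - hypParam ω₁ ω₂ x k) := by
  refine isLocalQuotient_hypGamma hω₁ hω₂ (fun x => (analyticAt_const.sub
    (analyticAt_hypParam_apply x j)).sub (analyticAt_hypParam_apply x k)) fun x c => ?_
  refine (frequently_hypParam_ne (ω₁ := ω₁) (ω₂ := ω₂) x j k (I * ((ω₁ + ω₂) / 2) - c)).mono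
    fun y hy h => hy ?_
  rw [← h]; ring

theorem isLocalQuotient_hypGamma_add (hω₁ : 0 < ω₁.re) (hω₂ : 0 < ω₂.re) (j k : Fin 8) :
    IsLocalQuotient fun x => hypGamma ω₁ ω₂
      (hypParam ω₁ ω₂ x j + hypParam ω₁ ω₂ x k - I * ((ω₁ + ω₂) / 2)) := by
  refine isLocalQuotient_hypGamma hω₁ hω₂ (fun x => ((analyticAt_hypParam_apply x j).add
    (analyticAt_hypParam_apply x k)).sub analyticAt_const) fun x c => ?_
  refine (frequently_hypParam_ne (ω₁ := ω₁) (ω₂ := ω₂) x j k (I * ((ω₁ + ω₂) / 2) + c)).mono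
    fun y hy h => hy ?_
  rw [← h]; ring

/-- The relation `G(z) G(-z) = 1`, in which both factors may have been given the junk value `0`. -/
theorem denseEq_hypGamma_mul_neg (hω₁ : 0 < ω₁.re) (hω₂ : 0 < ω₂.re) (j k : Fin 8) :
    DenseEq (fun x => hypGamma ω₁ ω₂
        (I * ((ω₁ + ω₂) / 2) - hypParam ω₁ ω₂ x j - hypParam ω₁ ω₂ x k)
      * hypGamma ω₁ ω₂ (hypParam ω₁ ω₂ x j + hypParam ω₁ ω₂ x k - I * ((ω₁ + ω₂) / 2)))
      fun _ => 1 := by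
  refine IsLocalQuotient.denseEq_of_eventuallyEq (a₀ := 0)
    ((isLocalQuotient_hypGamma_sub hω₁ hω₂ j k).mul (isLocalQuotient_hypGamma_add hω₁ hω₂ j k))
    (IsLocalQuotient.const 1) ?_
  have h0 : hypParam ω₁ ω₂ 0 j + hypParam ω₁ ω₂ 0 k - I * ((ω₁ + ω₂) / 2) = 0 := by
    simp [hypParam, hypEta]
  have hc : ContinuousAt (fun x => hypParam ω₁ ω₂ x j + hypParam ω₁ ω₂ x k
      - I * ((ω₁ + ω₂) / 2)) 0 :=
    (((analyticAt_hypParam_apply 0 j).add (analyticAt_hypParam_apply 0 k)).sub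
      analyticAt_const).continuousAt
  have hev := hc.eventually_mem ((isOpen_strip (-((ω₁.re + ω₂.re) / 2))
    ((ω₁.re + ω₂.re) / 2)).mem_nhds (by rw [h0]; simp; linarith))
  filter_upwards [hev] with x hx
  rw [show I * ((ω₁ + ω₂) / 2) - hypParam ω₁ ω₂ x j - hypParam ω₁ ω₂ x k
    = -(hypParam ω₁ ω₂ x j + hypParam ω₁ ω₂ x k - I * ((ω₁ + ω₂) / 2)) by ring,
    hypGamma_neg hω₁ hω₂, inv_mul_cancel₀ (hypGamma_ne_zero hω₁ hω₂ (abs_lt.2 hx))]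


/-! ### The linear action on the parameters -/

/-- The standard bilinear form on `ℂ⁸`. -/
def dot (u v : Fin 8 → ℂ) : ℂ := ∑ j, u j * v j

theorem dot_comm (u v : Fin 8 → ℂ) : dot u v = dot v u :=
  Finset.sum_congr rfl fun _ _ => mul_comm _ _

theorem dot_sub_left (u v w : Fin 8 → ℂ) : dot (u - v) w = dot u w - dot v w := by
  simp [dot, sub_mul, Finset.sum_sub_distrib]

theorem dot_smul_left (c : ℂ) (u w : Fin 8 → ℂ) : dot (c • u) w = c * dot u w := by
  simp [dot, Finset.mul_sum, mul_assoc]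

theorem dot_sub_right (u v w : Fin 8 → ℂ) : dot u (v - w) = dot u v - dot u w := by
  rw [dot_comm, dot_sub_left, dot_comm v, dot_comm w]

theorem dot_smul_right (c : ℂ) (u w : Fin 8 → ℂ) : dot u (c • w) = c * dot u w := by
  rw [dot_comm, dot_smul_left, dot_comm]

theorem dot_neg_right (u v : Fin 8 → ℂ) : dot u (-v) = -dot u v := by
  simp [dot]

theorem dot_one (u : Fin 8 → ℂ) : dot u (fun _ => 1) = ∑ j, u j := by simp [dot]

theorem rootReflection_apply (γ u : Fin 8 → ℂ) : rootReflection γ u = u - dot u γ • γ := rfl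

/-- The invertible linear maps that preserve the bilinear form and fix the constant vectors. These
act on `𝒢_{2iω}`. -/
structure IsParamIsometry (σ : Module.End ℂ (Fin 8 → ℂ)) : Prop where
  isUnit : IsUnit σ
  dot_map : ∀ u v, dot (σ u) (σ v) = dot u v
  map_one : σ (fun _ => 1) = fun _ => 1

namespace IsParamIsometry

variable {σ τ : Module.End ℂ (Fin 8 → ℂ)}

theorem mul (hσ : IsParamIsometry σ) (hτ : IsParamIsometry τ) : IsParamIsometry (σ * τ) where
  isUnit := hσ.isUnit.mul hτ.isUnit
  dot_map u v := by rw [Module.End.mul_apply, Module.End.mul_apply, hσ.dot_map, hτ.dot_map]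
  map_one := by rw [Module.End.mul_apply, hτ.map_one, hσ.map_one]

theorem map_const (hσ : IsParamIsometry σ) (c : ℂ) : σ (fun _ => c) = fun _ => c := by
  have h : (fun _ : Fin 8 => c) = c • fun _ : Fin 8 => (1 : ℂ) := by ext; simp
  rw [h, map_smul, hσ.map_one]

theorem sum_map (hσ : IsParamIsometry σ) (u : Fin 8 → ℂ) : ∑ j, σ u j = ∑ j, u j := by
  rw [← dot_one, ← dot_one]
  nth_rewrite 1 [← hσ.map_one]
  exact hσ.dot_map _ _

/-- Such a map acts on the parameter space through a linear isomorphism of `∑ xⱼ = 0`. -/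
theorem exists_equiv (hσ : IsParamIsometry σ) (ω₁ ω₂ : ℂ) : ∃ e : sumZero ≃L[ℂ] sumZero,
    ∀ x, hypParam ω₁ ω₂ (e x) = σ (hypParam ω₁ ω₂ x) := by
  obtain ⟨τ, hστ, hτσ⟩ := isUnit_iff_exists.1 hσ.isUnit
  have h1 : ∀ x, σ (τ x) = x := fun x => by rw [← Module.End.mul_apply, hστ]; rfl
  have h2 : ∀ x, τ (σ x) = x := fun x => by rw [← Module.End.mul_apply, hτσ]; rfl
  let e : sumZero ≃ₗ[ℂ] sumZero := LinearEquiv.ofLinearMap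
    (σ.restrict fun x hx => by rw [mem_sumZero, hσ.sum_map]; exact hx)
    (τ.restrict fun x hx => by rw [mem_sumZero, ← hσ.sum_map, h1]; exact hx)
    (by ext x : 1; exact Subtype.ext (h1 x)) (by ext x : 1; exact Subtype.ext (h2 x))
  refine ⟨e.toContinuousLinearEquiv, fun x => ?_⟩
  have h3 : hypParam ω₁ ω₂ x = (fun _ => hypEta ω₁ ω₂ / 2) + (x : Fin 8 → ℂ) := rfl
  rw [h3, map_add, hσ.map_const]
  rfl

theorem denseEq_comp (hσ : IsParamIsometry σ) {f g : (Fin 8 → ℂ) → ℂ}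
    (h : DenseEq (fun x => f (hypParam ω₁ ω₂ x)) fun x => g (hypParam ω₁ ω₂ x)) :
    DenseEq (fun x => f (σ (hypParam ω₁ ω₂ x))) fun x => g (σ (hypParam ω₁ ω₂ x)) := by
  obtain ⟨e, he⟩ := hσ.exists_equiv ω₁ ω₂
  simp only [← he]
  exact h.comp_homeomorph e.toHomeomorph

theorem isLocalQuotient_comp (hσ : IsParamIsometry σ) {f : (Fin 8 → ℂ) → ℂ}
    (h : IsLocalQuotient fun x => f (hypParam ω₁ ω₂ x)) :
    IsLocalQuotient fun x => f (σ (hypParam ω₁ ω₂ x)) := by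
  obtain ⟨e, he⟩ := hσ.exists_equiv ω₁ ω₂
  simp only [← he]
  exact h.comp_equiv e

end IsParamIsometry

/-- Permutation of the coordinates. -/
def permEnd (π : Equiv.Perm (Fin 8)) : Module.End ℂ (Fin 8 → ℂ) := LinearMap.funLeft ℂ ℂ π

theorem permEnd_apply (π : Equiv.Perm (Fin 8)) (u : Fin 8 → ℂ) : permEnd π u = u ∘ π := rfl

theorem permEnd_mul (π π' : Equiv.Perm (Fin 8)) : permEnd π * permEnd π' = permEnd (π' * π) := rfl

theorem isParamIsometry_permEnd (π : Equiv.Perm (Fin 8)) : IsParamIsometry (permEnd π) where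
  isUnit := isUnit_iff_exists.2 ⟨permEnd π⁻¹, by rw [permEnd_mul, inv_mul_cancel]; rfl,
    by rw [permEnd_mul, mul_inv_cancel]; rfl⟩
  dot_map u v := Equiv.sum_comp π fun j => u j * v j
  map_one := rfl

theorem isParamIsometry_rootReflection {γ : Fin 8 → ℂ} (h2 : dot γ γ = 2)
    (h0 : dot (fun _ => 1) γ = 0) : IsParamIsometry (rootReflection γ) where
  isUnit := by
    have h : rootReflection γ * rootReflection γ = 1 := by
      refine LinearMap.ext fun u => ?_
      show rootReflection γ (rootReflection γ u) = u
      simp only [rootReflection_apply, dot_sub_left, dot_smul_left, h2]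
      ext i
      simp; ring
    exact isUnit_iff_exists.2 ⟨_, h, h⟩
  dot_map u v := by
    simp only [rootReflection_apply, dot_sub_left, dot_smul_left, dot_sub_right, dot_smul_right, h2]
    rw [dot_comm γ v]; ring
  map_one := by rw [rootReflection_apply, h0, zero_smul, sub_zero]

theorem betaRoot_standard : betaRoot {0, 1, 2, 3}
    = ![1 / 2, 1 / 2, 1 / 2, 1 / 2, -1 / 2, -1 / 2, -1 / 2, -1 / 2] := by
  ext j
  fin_cases j <;> simp [betaRoot]

theorem isParamIsometry_wE7 : IsParamIsometry wE7 := by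
  refine isParamIsometry_rootReflection ?_ ?_ <;> rw [betaRoot_standard] <;>
    simp [dot, Fin.sum_univ_eight]
  all_goals norm_num

theorem wE7_apply {u : Fin 8 → ℂ} (hu : u ∈ hypParamSpace ω₁ ω₂) {s : ℂ}
    (hs : s = hypEta ω₁ ω₂ - (u 0 + u 1 + u 2 + u 3) / 2) :
    wE7 u = ![u 0 + s, u 1 + s, u 2 + s, u 3 + s, u 4 - s, u 5 - s, u 6 - s, u 7 - s] := by
  rw [hypParamSpace_eq] at hu
  have hu' : ∑ j, u j = 4 * hypEta ω₁ ω₂ := hu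
  rw [Fin.sum_univ_eight] at hu'
  have h : dot u (betaRoot {0, 1, 2, 3}) = -2 * s := by
    rw [betaRoot_standard, dot, Fin.sum_univ_eight, hs]
    simp only [Matrix.cons_val]
    linear_combination (-1 / 2) * hu'
  rw [wE7, rootReflection_apply, h, betaRoot_standard]
  ext j
  fin_cases j <;> simp <;> ring

/-! ### Uniqueness and the functional equations -/

theorem IsHyperbolicHypergeometric.eq_hypInt {S : (Fin 8 → ℂ) → ℂ}
    (hS : IsHyperbolicHypergeometric ω₁ ω₂ S) (hω₁ : 0 < ω₁.re) (hω₂ : 0 < ω₂.re) {u : Fin 8 → ℂ}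
    (hu : u ∈ hypParamSpace ω₁ ω₂) (h : ∀ j, (u j).im < (hypEta ω₁ ω₂).im) :
    S u = hypInt ω₁ ω₂ (-u) := by
  rw [(hS.integral u hu fun j => by
    have := h j
    rw [hypEta] at this
    rw [Complex.sub_im]; linarith).2, hypInt]
  simp only [hypIntegrand_eq hω₁ hω₂]

theorem eventually_im_lt {u : Fin 8 → ℂ} {s : Set (Fin 8 → ℂ)} {c : ℝ} (h : ∀ j, (u j).im < c) :
    ∀ᶠ v in 𝓝[s] u, ∀ j, (v j).im < c := by
  rw [eventually_all]
  intro j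
  refine eventually_nhdsWithin_of_eventually_nhds ?_
  have hc : ContinuousAt (fun v : Fin 8 → ℂ => (v j).im) u :=
    (Complex.continuous_im.comp (continuous_apply j)).continuousAt
  exact hc.eventually_lt_const (h j)

theorem hypParam_zero_im_lt (hω₁ : 0 < ω₁.re) (hω₂ : 0 < ω₂.re) (j : Fin 8) :
    (hypParam ω₁ ω₂ 0 j).im < (hypEta ω₁ ω₂).im := by
  have : (hypParam ω₁ ω₂ 0 j).im = (hypEta ω₁ ω₂).im / 2 := by
    simp [hypParam]
  rw [this, hypEta_im]; linarith

theorem IsHyperbolicHypergeometric.denseEq {S S' : (Fin 8 → ℂ) → ℂ}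
    (hS : IsHyperbolicHypergeometric ω₁ ω₂ S) (hS' : IsHyperbolicHypergeometric ω₁ ω₂ S')
    (hω₁ : 0 < ω₁.re) (hω₂ : 0 < ω₂.re) :
    DenseEq (fun x => S (hypParam ω₁ ω₂ x)) fun x => S' (hypParam ω₁ ω₂ x) := by
  refine denseEq_of_eventually hS.meromorphic.isLocalQuotient hS'.meromorphic.isLocalQuotient
    (hypParam_mem 0) ?_
  filter_upwards [self_mem_nhdsWithin, eventually_im_lt (hypParam_zero_im_lt hω₁ hω₂)] with u hu h
  rw [hS.eq_hypInt hω₁ hω₂ hu h, hS'.eq_hypInt hω₁ hω₂ hu h]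

theorem IsHyperbolicHypergeometric.denseEq_perm {S : (Fin 8 → ℂ) → ℂ}
    (hS : IsHyperbolicHypergeometric ω₁ ω₂ S) (hω₁ : 0 < ω₁.re) (hω₂ : 0 < ω₂.re)
    (π : Equiv.Perm (Fin 8)) :
    DenseEq (fun x => S (hypParam ω₁ ω₂ x ∘ π)) fun x => S (hypParam ω₁ ω₂ x) := by
  refine denseEq_of_eventually (f := fun u => S (u ∘ π))
    ((isParamIsometry_permEnd π).isLocalQuotient_comp hS.meromorphic.isLocalQuotient)
    hS.meromorphic.isLocalQuotient (hypParam_mem 0) ?_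
  filter_upwards [self_mem_nhdsWithin, eventually_im_lt (hypParam_zero_im_lt hω₁ hω₂)] with u hu h
  have hu' : u ∘ π ∈ hypParamSpace ω₁ ω₂ := by
    rw [hypParamSpace_eq] at hu ⊢
    exact (Equiv.sum_comp π u).trans hu
  rw [hS.eq_hypInt hω₁ hω₂ hu h, hS.eq_hypInt hω₁ hω₂ hu' fun j => h _]
  exact hypInt_comp_perm (-u) π

theorem isOpen_setOf_betaAdmissible (ω₁ ω₂ : ℂ) : IsOpen {b | BetaAdmissible ω₁ ω₂ b} := by
  have hr := continuous_hypRate ω₁ ω₂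
  have hi : ∀ j : Fin 4, Continuous fun b : Fin 4 → ℂ => (b j).im := fun j =>
    Complex.continuous_im.comp (continuous_apply j)
  have e : {b | BetaAdmissible ω₁ ω₂ b}
      = (⋂ j, {b : Fin 4 → ℂ | 0 < (b j).im + (ω₁.re + ω₂.re) / 2}) ∩
        (⋂ j, {b : Fin 4 → ℂ | 0 < hypRate ω₁ ω₂ (b j + hypEta ω₁ ω₂)}) ∩
        {b : Fin 4 → ℂ |
          (b 0).im + (b 1).im + (b 2).im + (b 3).im + 2 * (ω₁.re + ω₂.re) < ω₂.re} ∩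
        {b : Fin 4 → ℂ | hypRate ω₁ ω₂ (b 0 + hypEta ω₁ ω₂) + hypRate ω₁ ω₂ (b 1 + hypEta ω₁ ω₂)
          + hypRate ω₁ ω₂ (b 2 + hypEta ω₁ ω₂) + hypRate ω₁ ω₂ (b 3 + hypEta ω₁ ω₂)
          < (1 / ω₁).re + (1 / ω₂).re} := by
    ext b
    simp only [Set.mem_inter_iff, Set.mem_iInter, Set.mem_ofPred_eq]
    exact ⟨fun h => ⟨⟨⟨h.im_pos, h.rate_pos⟩, h.im_lt⟩, h.rate_lt⟩,
      fun h => ⟨h.1.1.1, h.1.1.2, h.1.2, h.2⟩⟩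
  rw [e]
  refine ((((isOpen_iInter_of_finite fun j => ?_).inter (isOpen_iInter_of_finite fun j => ?_)).inter
    ?_).inter ?_)
  · exact isOpen_lt continuous_const ((hi j).add continuous_const)
  · exact isOpen_lt continuous_const (by fun_prop)
  · exact isOpen_lt (((((hi 0).add (hi 1)).add (hi 2)).add (hi 3)).add continuous_const)
      continuous_const
  · exact isOpen_lt (by fun_prop) continuous_const

theorem betaAdmissible_const (hω₁ : 0 < ω₁.re) (hω₂ : 0 < ω₂.re) {θ : ℝ} (h0 : 0 < θ)
    (h1 : θ < 1) (h2 : θ * ((ω₁.re + ω₂.re) / 2) < ω₂.re) :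
    BetaAdmissible ω₁ ω₂ fun _ => (((θ / 4 - 1 : ℝ) : ℂ)) * hypEta ω₁ ω₂ := by
  have h3 := re_one_div_pos hω₁
  have h4 := re_one_div_pos hω₂
  have hr : hypRate ω₁ ω₂ (((θ / 4 - 1 : ℝ) : ℂ) * hypEta ω₁ ω₂ + hypEta ω₁ ω₂)
      = θ / 4 * (((1 / ω₁).re + (1 / ω₂).re) / 2) := by
    rw [hypRate_add, hypRate_real_mul, hypRate_hypEta hω₁ hω₂]; ring
  have hi : (((θ / 4 - 1 : ℝ) : ℂ) * hypEta ω₁ ω₂).im = (θ / 4 - 1) * ((ω₁.re + ω₂.re) / 2) := by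
    rw [Complex.im_ofReal_mul, hypEta_im]
  refine ⟨fun j => ?_, fun j => ?_, ?_, ?_⟩
  · rw [hi]
    have : 0 < θ / 4 * ((ω₁.re + ω₂.re) / 2) := by positivity
    linarith
  · rw [hr]; positivity
  · rw [hi]; linarith
  · simp only [hr]
    generalize (1 / ω₁).re = p at *
    generalize (1 / ω₂).re = q at *
    nlinarith

/-- The second product of values of `G` in the transformation formula under `w`. -/
theorem hypPairProd_mul_eq_one (hω₁ : 0 < ω₁.re) (hω₂ : 0 < ω₂.re) {b c : Fin 4 → ℂ}
    (h01 : hypEta ω₁ ω₂ + c 0 + c 1 = -(hypEta ω₁ ω₂ + b 2 + b 3))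
    (h02 : hypEta ω₁ ω₂ + c 0 + c 2 = -(hypEta ω₁ ω₂ + b 1 + b 3))
    (h03 : hypEta ω₁ ω₂ + c 0 + c 3 = -(hypEta ω₁ ω₂ + b 1 + b 2))
    (h12 : hypEta ω₁ ω₂ + c 1 + c 2 = -(hypEta ω₁ ω₂ + b 0 + b 3))
    (h13 : hypEta ω₁ ω₂ + c 1 + c 3 = -(hypEta ω₁ ω₂ + b 0 + b 2))
    (h23 : hypEta ω₁ ω₂ + c 2 + c 3 = -(hypEta ω₁ ω₂ + b 0 + b 1))
    (hne : ∀ j k, |(hypEta ω₁ ω₂ + b j + b k).im| < (ω₁.re + ω₂.re) / 2) :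
    hypPairProd ω₁ ω₂ b * hypPairProd ω₁ ω₂ c = 1 := by
  have n := fun j k => hypGamma_ne_zero hω₁ hω₂ (hne j k)
  have n01 := n 0 1; have n02 := n 0 2; have n03 := n 0 3
  have n12 := n 1 2; have n13 := n 1 3; have n23 := n 2 3
  simp only [hypPairProd, h01, h02, h03, h12, h13, h23, hypGamma_neg hω₁ hω₂]
  field_simp

theorem filter_lt_four : (Finset.univ.filter fun p : Fin 8 × Fin 8 => p.1 < p.2 ∧ p.2 < 4)
    = {(0, 1), (0, 2), (0, 3), (1, 2), (1, 3), (2, 3)} := by decide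

theorem filter_four_le : (Finset.univ.filter fun p : Fin 8 × Fin 8 => 4 ≤ p.1 ∧ p.1 < p.2)
    = {(4, 5), (4, 6), (4, 7), (5, 6), (5, 7), (6, 7)} := by decide

theorem prod_hypGamma_lt_four (u : Fin 8 → ℂ) :
    (∏ p : Fin 8 × Fin 8 with p.1 < p.2 ∧ p.2 < 4,
      hypGamma ω₁ ω₂ (I * ((ω₁ + ω₂) / 2) - u p.1 - u p.2))
      = hypPairProd ω₁ ω₂ ![-u 0, -u 1, -u 2, -u 3] := by
  rw [filter_lt_four]
  repeat rw [Finset.prod_insert (by decide)]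
  rw [Finset.prod_singleton]
  simp only [hypPairProd, Matrix.cons_val, ← sub_eq_add_neg, hypEta]
  ring

theorem prod_hypGamma_four_le (u : Fin 8 → ℂ) :
    (∏ p : Fin 8 × Fin 8 with 4 ≤ p.1 ∧ p.1 < p.2,
      hypGamma ω₁ ω₂ (I * ((ω₁ + ω₂) / 2) - u p.1 - u p.2))
      = hypPairProd ω₁ ω₂ ![-u 4, -u 5, -u 6, -u 7] := by
  rw [filter_four_le]
  repeat rw [Finset.prod_insert (by decide)]
  rw [Finset.prod_singleton]
  simp only [hypPairProd, Matrix.cons_val, ← sub_eq_add_neg, hypEta]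
  ring

/-- By the identity theorem it suffices to prove this near one point `u₀`. There all `uⱼ` and all
`(wu)ⱼ` must lie below `Im = Re ω`, so that both sides are integrals, and both quadruples in the
double integral must be admissible. With four coordinates `(1 - θ/4) η` and four coordinates
`(θ/4) η` this is so for small `θ`, and `w` exchanges these quadruples of coordinates. -/
theorem IsHyperbolicHypergeometric.denseEq_wE7 {S : (Fin 8 → ℂ) → ℂ}
    (hS : IsHyperbolicHypergeometric ω₁ ω₂ S) (hω₁ : 0 < ω₁.re) (hω₂ : 0 < ω₂.re) :
    DenseEq (fun x => S (hypParam ω₁ ω₂ x)) fun x => S (wE7 (hypParam ω₁ ω₂ x))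
      * (∏ p : Fin 8 × Fin 8 with p.1 < p.2 ∧ p.2 < 4,
          hypGamma ω₁ ω₂ (I * ((ω₁ + ω₂) / 2) - hypParam ω₁ ω₂ x p.1 - hypParam ω₁ ω₂ x p.2))
      * ∏ p : Fin 8 × Fin 8 with 4 ≤ p.1 ∧ p.1 < p.2,
          hypGamma ω₁ ω₂ (I * ((ω₁ + ω₂) / 2) - hypParam ω₁ ω₂ x p.1 - hypParam ω₁ ω₂ x p.2) := by
  set η := hypEta ω₁ ω₂ with hη
  have hηi : η.im = (ω₁.re + ω₂.re) / 2 := hypEta_im _ _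
  have hρ : 0 < (ω₁.re + ω₂.re) / 2 := by linarith
  -- any `θ` with `0 < θ < 1` and `θ Re ω < Re ω₂` would do
  set θ : ℝ := ω₂.re / (ω₁.re + ω₂.re) with hθ
  have hθ0 : 0 < θ := by positivity
  have hθ1 : θ < 1 := by rw [hθ, div_lt_one (by linarith)]; linarith
  have hθ2 : θ * ((ω₁.re + ω₂.re) / 2) < ω₂.re := by
    have : θ * (ω₁.re + ω₂.re) = ω₂.re := div_mul_cancel₀ _ (by linarith)
    linarith
  -- the parameters of the double integral as functions of `u`; the remaining one is `a = -η - s`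
  set b : (Fin 8 → ℂ) → Fin 4 → ℂ := fun u => ![-u 0, -u 1, -u 2, -u 3] with hb
  set s : (Fin 8 → ℂ) → ℂ := fun u => η - (u 0 + u 1 + u 2 + u 3) / 2 with hs
  set b' : (Fin 8 → ℂ) → Fin 4 → ℂ := fun u =>
    ![-u 4 + s u, -u 5 + s u, -u 6 + s u, -u 7 + s u] with hb'
  have hbc : Continuous b := by
    refine continuous_pi fun j => ?_
    fin_cases j <;> simp [hb] <;> fun_prop
  have hsc : Continuous s := by fun_prop
  have hbc' : Continuous b' := by
    refine continuous_pi fun j => ?_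
    fin_cases j <;> simp [hb'] <;> fun_prop
  set α : ℂ := ((1 - θ / 4 : ℝ) : ℂ) * η with hα
  set β : ℂ := ((θ / 4 : ℝ) : ℂ) * η with hβ
  have hαβ : α + β = η := by rw [hα, hβ]; push_cast; ring
  set u₀ : Fin 8 → ℂ := ![α, α, α, α, β, β, β, β] with hu₀
  have hu₀H : u₀ ∈ hypParamSpace ω₁ ω₂ := by
    rw [hypParamSpace_eq]
    show ∑ j, u₀ j = _
    rw [Fin.sum_univ_eight, hu₀]
    simp only [Matrix.cons_val]
    linear_combination 4 * hαβ
  have hsu₀ : s u₀ = η - 2 * α := by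
    simp only [hs, hu₀, Matrix.cons_val]; ring
  have hbu₀ : b u₀ = fun _ => ((θ / 4 - 1 : ℝ) : ℂ) * η := by
    ext j
    fin_cases j <;> simp [hb, hu₀, hα] <;> ring
  have hbu₀' : b' u₀ = fun _ => ((θ / 4 - 1 : ℝ) : ℂ) * η := by
    have h : -β + s u₀ = ((θ / 4 - 1 : ℝ) : ℂ) * η := by
      rw [hsu₀, hα, hβ]; push_cast; ring
    rw [← h]
    ext j
    fin_cases j <;> simp [hb', hu₀]
  have hαi : α.im = (1 - θ / 4) * η.im := Complex.im_ofReal_mul _ _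
  have hβi : β.im = θ / 4 * η.im := Complex.im_ofReal_mul _ _
  have hηpos : 0 < η.im := by rw [hηi]; exact hρ
  have hwu₀ : wE7 u₀ = ![β, β, β, β, α, α, α, α] := by
    rw [wE7_apply hu₀H (s := s u₀) rfl, hsu₀]
    ext j
    fin_cases j <;> simp [hu₀] <;>
      first | linear_combination (-1 : ℂ) * hαβ | linear_combination hαβ
  have hα1 : α.im < η.im := by rw [hαi]; nlinarith
  have hβ1 : β.im < η.im := by rw [hβi]; nlinarith
  have hadm := betaAdmissible_const hω₁ hω₂ hθ0 hθ1 hθ2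
  have e1 : ∀ᶠ u in 𝓝[hypParamSpace ω₁ ω₂] u₀, ∀ j, (u j).im < η.im := by
    refine eventually_im_lt fun j => ?_
    fin_cases j <;> simpa [hu₀]
  have e2 : ∀ᶠ u in 𝓝[hypParamSpace ω₁ ω₂] u₀, ∀ j, (wE7 u j).im < η.im := by
    have hc : Continuous wE7 := wE7.continuous_of_finiteDimensional
    have h : ∀ᶠ v in 𝓝[Set.univ] (wE7 u₀), ∀ j, (v j).im < η.im := by
      refine eventually_im_lt fun j => ?_
      rw [hwu₀]
      fin_cases j <;> simpa
    rw [nhdsWithin_univ] at h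
    exact eventually_nhdsWithin_of_eventually_nhds (hc.continuousAt.tendsto.eventually h)
  have e3 : ∀ᶠ u in 𝓝[hypParamSpace ω₁ ω₂] u₀, BetaAdmissible ω₁ ω₂ (b u) :=
    eventually_nhdsWithin_of_eventually_nhds (hbc.continuousAt.eventually_mem
      ((isOpen_setOf_betaAdmissible ω₁ ω₂).mem_nhds (by rw [hbu₀]; exact hadm)))
  have e4 : ∀ᶠ u in 𝓝[hypParamSpace ω₁ ω₂] u₀, BetaAdmissible ω₁ ω₂ (b' u) :=
    eventually_nhdsWithin_of_eventually_nhds (hbc'.continuousAt.eventually_mem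
      ((isOpen_setOf_betaAdmissible ω₁ ω₂).mem_nhds (by rw [hbu₀']; exact hadm)))
  have e5 : ∀ᶠ u in 𝓝[hypParamSpace ω₁ ω₂] u₀, ∀ j k,
      |(η + b' u j + b' u k).im| < (ω₁.re + ω₂.re) / 2 := by
    rw [eventually_all]; intro j
    rw [eventually_all]; intro k
    refine eventually_nhdsWithin_of_eventually_nhds ?_
    have hc : Continuous fun u => |(η + b' u j + b' u k).im| :=
      (Complex.continuous_im.comp ((continuous_const.add ((continuous_apply j).comp hbc')).add
        ((continuous_apply k).comp hbc'))).abs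
    refine hc.continuousAt.eventually_lt_const ?_
    have h : (η + b' u₀ j + b' u₀ k).im = (θ / 2 - 1) * η.im := by
      rw [hbu₀', Complex.add_im, Complex.add_im, Complex.im_ofReal_mul]; ring
    show |(η + b' u₀ j + b' u₀ k).im| < _
    rw [h, hηi, abs_lt]
    constructor <;> nlinarith
  refine denseEq_of_eventually hS.meromorphic.isLocalQuotient
    (g := fun u => S (wE7 u)
      * (∏ p : Fin 8 × Fin 8 with p.1 < p.2 ∧ p.2 < 4,
          hypGamma ω₁ ω₂ (I * ((ω₁ + ω₂) / 2) - u p.1 - u p.2))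
      * ∏ p : Fin 8 × Fin 8 with 4 ≤ p.1 ∧ p.1 < p.2,
          hypGamma ω₁ ω₂ (I * ((ω₁ + ω₂) / 2) - u p.1 - u p.2))
    (((isParamIsometry_wE7.isLocalQuotient_comp hS.meromorphic.isLocalQuotient).mul
      (IsLocalQuotient.prod _ fun p _ => isLocalQuotient_hypGamma_sub hω₁ hω₂ p.1 p.2)).mul
      (IsLocalQuotient.prod _ fun p _ => isLocalQuotient_hypGamma_sub hω₁ hω₂ p.1 p.2)) hu₀H ?_
  filter_upwards [self_mem_nhdsWithin, e1, e2, e3, e4, e5] with u hu h1 h2 h3 h4 h5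
  have hwu := wE7_apply hu (s := s u) rfl
  have hwuH : wE7 u ∈ hypParamSpace ω₁ ω₂ := by
    rw [hypParamSpace_eq] at hu ⊢
    exact (isParamIsometry_wE7.sum_map u).trans hu
  have hsum : u 0 + u 1 + u 2 + u 3 + u 4 + u 5 + u 6 + u 7 = 4 * η := by
    rw [hypParamSpace_eq] at hu
    rw [← Fin.sum_univ_eight]; exact hu
  rw [hS.eq_hypInt hω₁ hω₂ hu h1, hS.eq_hypInt hω₁ hω₂ hwuH h2, prod_hypGamma_lt_four,
    prod_hypGamma_four_le]
  have key := hypInt_eight_mul_eq hω₁ hω₂ h4 h3 (a := -η - s u)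
    (by simp only [hb', hs, Matrix.cons_val]; linear_combination (-1 : ℂ) * hsum)
    (by simp only [hb, hs, Matrix.cons_val]; ring)
  have v1 : ![b u 0, b u 1, b u 2, b u 3, b' u 0 + η + (-η - s u), b' u 1 + η + (-η - s u),
      b' u 2 + η + (-η - s u), b' u 3 + η + (-η - s u)] = -u := by
    ext j
    fin_cases j <;> simp [hb, hb'] <;> ring
  have v2 : ![b u 0 + η + (-η - s u), b u 1 + η + (-η - s u), b u 2 + η + (-η - s u),
      b u 3 + η + (-η - s u), b' u 0, b' u 1, b' u 2, b' u 3] = -wE7 u := by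
    rw [hwu]
    ext j
    fin_cases j <;> simp [hb, hb'] <;> ring
  rw [← hη, v1, v2] at key
  have hone := hypPairProd_mul_eq_one hω₁ hω₂ (b := b' u) (c := ![-u 4, -u 5, -u 6, -u 7])
    (by simp only [hb', hs, Matrix.cons_val]; linear_combination (-1 : ℂ) * hsum)
    (by simp only [hb', hs, Matrix.cons_val]; linear_combination (-1 : ℂ) * hsum)
    (by simp only [hb', hs, Matrix.cons_val]; linear_combination (-1 : ℂ) * hsum)
    (by simp only [hb', hs, Matrix.cons_val]; linear_combination (-1 : ℂ) * hsum)
    (by simp only [hb', hs, Matrix.cons_val]; linear_combination (-1 : ℂ) * hsum)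
    (by simp only [hb', hs, Matrix.cons_val]; linear_combination (-1 : ℂ) * hsum) h5
  show _ = _ * hypPairProd ω₁ ω₂ (b u) * _
  linear_combination (hypPairProd ω₁ ω₂ ![-u 4, -u 5, -u 6, -u 7]) * key
    - hypInt ω₁ ω₂ (-u) * hone


/-! ### The weights `±λ_{jk}` -/

theorem lambdaE7_apply (j k i : Fin 8) : lambdaE7 j k i
    = (((if i = j then 1 else 0) + (if i = k then 1 else 0) : ℕ) : ℂ) - 1 / 4 := by
  simp [lambdaE7, Pi.single_apply]

theorem lambdaE7_comm (j k : Fin 8) : lambdaE7 j k = lambdaE7 k j := by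
  simp only [lambdaE7, add_comm]

theorem dot_lambdaE7 (u : Fin 8 → ℂ) (j k : Fin 8) :
    dot u (lambdaE7 j k) = u j + u k - (∑ i, u i) / 4 := by
  simp only [dot, lambdaE7, Pi.sub_apply, Pi.add_apply, mul_sub, mul_add, Finset.sum_sub_distrib,
    Finset.sum_add_distrib, Pi.single_apply, mul_ite, mul_one, mul_zero, Finset.sum_ite_eq',
    Finset.mem_univ, if_true, ← Finset.sum_mul]
  ring

/-- The pairs `j < k`. -/
abbrev IndexPair : Type := {p : Fin 8 × Fin 8 // p.1 < p.2}

/-- The vector `λ_{jk}` of a pair. -/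
def lam (p : IndexPair) : Fin 8 → ℂ := lambdaE7 p.1.1 p.1.2

theorem exists_lam_eq {j k : Fin 8} (h : j ≠ k) : ∃ p, lambdaE7 j k = lam p := by
  rcases lt_or_gt_of_ne h with h | h
  · exact ⟨⟨(j, k), h⟩, rfl⟩
  · exact ⟨⟨(k, j), h⟩, lambdaE7_comm j k⟩

theorem lam_ne_neg (p q : IndexPair) : lam p ≠ -lam q := by
  intro h
  have h1 := congrFun h p.1.1
  simp only [lam, Pi.neg_apply, lambdaE7_apply] at h1
  have h2 : (((1 + (if p.1.1 = p.1.2 then 1 else 0)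
      + ((if p.1.1 = q.1.1 then 1 else 0) + (if p.1.1 = q.1.2 then 1 else 0)) : ℕ) * 2 : ℕ) : ℂ)
      = ((1 : ℕ) : ℂ) := by
    push_cast at h1 ⊢
    linear_combination 2 * h1
  have := Nat.cast_injective h2
  omega

theorem lam_injective : Function.Injective lam := by
  intro p q h
  have key : ∀ i, ((if i = p.1.1 then 1 else 0) + (if i = p.1.2 then 1 else 0) : ℕ)
      = (if i = q.1.1 then 1 else 0) + (if i = q.1.2 then 1 else 0) := by
    intro i
    have h1 := congrFun h i
    simp only [lam, lambdaE7_apply] at h1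
    exact Nat.cast_injective (R := ℂ) (by linear_combination h1)
  obtain ⟨⟨j, k⟩, hp⟩ := p
  obtain ⟨⟨l, m⟩, hq⟩ := q
  simp only at key hp hq
  have h1 := key j
  have h2 := key k
  rw [if_pos rfl] at h1
  rw [if_pos rfl] at h2
  have h3 : j = l ∨ j = m := by
    by_contra! hc
    rw [if_neg hc.1, if_neg hc.2] at h1; omega
  have h4 : k = l ∨ k = m := by
    by_contra! hc
    rw [if_neg hc.1, if_neg hc.2] at h2; omega
  have h5 : j = l ∧ k = m := by omega
  rw [Subtype.mk.injEq, Prod.mk.injEq]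
  exact h5

/-- The maps that permute the 56 weights `±λ_{jk}`. -/
def PermutesWeights (σ : Module.End ℂ (Fin 8 → ℂ)) : Prop :=
  ∀ p, ∃ q, σ (lam p) = lam q ∨ σ (lam p) = -lam q

theorem PermutesWeights.mul {σ τ : Module.End ℂ (Fin 8 → ℂ)} (hσ : PermutesWeights σ)
    (hτ : PermutesWeights τ) : PermutesWeights (σ * τ) := by
  intro p
  obtain ⟨q, hq⟩ := hτ p
  obtain ⟨r, hr⟩ := hσ q
  refine ⟨r, ?_⟩
  rw [Module.End.mul_apply]
  rcases hq with hq | hq <;> rcases hr with hr | hr <;> simp [hq, hr]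

/-! ### The cocycle relation -/

open scoped Classical in
theorem twistE7_eq (σ : Module.End ℂ (Fin 8 → ℂ)) {u : Fin 8 → ℂ}
    (hu : u ∈ hypParamSpace ω₁ ω₂) : twistE7 ω₁ ω₂ σ u
      = ∏ p : IndexPair, if ∃ q, σ (lam p) = -lam q then hypGamma ω₁ ω₂ (-dot u (lam p)) else 1 := by
  rw [hypParamSpace_eq] at hu
  have hu' : ∑ j, u j = 4 * hypEta ω₁ ω₂ := hu
  have h : ∀ p : Fin 8 × Fin 8, p.1 < p.2 →
      ((p.1 < p.2 ∧ ∃ l m : Fin 8, l < m ∧ σ (lambdaE7 p.1 p.2) = -lambdaE7 l m)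
        ↔ ∃ q, σ (lambdaE7 p.1 p.2) = -lam q) := fun p hp =>
    ⟨fun ⟨_, l, m, hlm, h⟩ => ⟨⟨(l, m), hlm⟩, h⟩, fun ⟨q, h⟩ => ⟨hp, q.1.1, q.1.2, q.2, h⟩⟩
  rw [twistE7, ← Finset.prod_filter_mul_prod_filter_not _ fun p : Fin 8 × Fin 8 => p.1 < p.2,
    Finset.prod_eq_one (s := Finset.univ.filter fun p : Fin 8 × Fin 8 => ¬p.1 < p.2)
      (fun p hp => if_neg fun hc => (Finset.mem_filter.1 hp).2 hc.1), mul_one,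
    Finset.prod_subtype _ (p := fun p : Fin 8 × Fin 8 => p.1 < p.2) (by simp)]
  refine Finset.prod_congr rfl fun p _ => ?_
  rw [show -dot u (lam p) = I * ((ω₁ + ω₂) / 2) - u p.1.1 - u p.1.2 by
    rw [lam, dot_lambdaE7, hu', hypEta]; ring]
  exact if_congr (h p.1 p.2) rfl rfl

theorem hypGamma_dot_mul_neg (hω₁ : 0 < ω₁.re) (hω₂ : 0 < ω₂.re) (p : IndexPair) :
    DenseEq (fun x => hypGamma ω₁ ω₂ (dot (hypParam ω₁ ω₂ x) (lam p))
      * hypGamma ω₁ ω₂ (-dot (hypParam ω₁ ω₂ x) (lam p))) fun _ => 1 := by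
  refine (DenseEq.of_eq fun x => ?_).trans (denseEq_hypGamma_mul_neg hω₁ hω₂ p.1.1 p.1.2)
  have hu := hypParam_mem (ω₁ := ω₁) (ω₂ := ω₂) x
  rw [hypParamSpace_eq] at hu
  have hu' : ∑ j, hypParam ω₁ ω₂ x j = 4 * hypEta ω₁ ω₂ := hu
  rw [lam, dot_lambdaE7, hu', mul_comm, hypEta]
  congr 2 <;> ring

/-- The twist is a cocycle. A weight whose sign is changed twice contributes the factor
`G(z) G(-z) = 1`. -/
theorem twistE7_mul (hω₁ : 0 < ω₁.re) (hω₂ : 0 < ω₂.re) {σ τ : Module.End ℂ (Fin 8 → ℂ)}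
    (hσ : PermutesWeights σ) (hτ : PermutesWeights τ) (hτi : IsParamIsometry τ) :
    DenseEq (fun x => twistE7 ω₁ ω₂ (σ * τ) (hypParam ω₁ ω₂ x)) fun x =>
      twistE7 ω₁ ω₂ σ (τ (hypParam ω₁ ω₂ x)) * twistE7 ω₁ ω₂ τ (hypParam ω₁ ω₂ x) := by
  classical
  choose π hπ using hτ
  have hτinj : Function.Injective τ := by
    obtain ⟨τ', -, h⟩ := isUnit_iff_exists.1 hτi.isUnit
    intro x y hxy
    have := congrArg τ' hxy
    rwa [← Module.End.mul_apply, ← Module.End.mul_apply, h] at this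
  have hπinj : Function.Injective π := by
    intro p q hpq
    have h1 := hπ p
    have h2 := hπ q
    rw [hpq] at h1
    have h3 : τ (lam p) = τ (lam q) ∨ τ (lam p) = τ (-lam q) := by
      rw [map_neg]
      rcases h1 with h1 | h1 <;> rcases h2 with h2 | h2 <;> simp [h1, h2]
    rcases h3 with h3 | h3
    · exact lam_injective (hτinj h3)
    · exact absurd (hτinj h3) (lam_ne_neg p q)
  have hmem : ∀ x, τ (hypParam ω₁ ω₂ x) ∈ hypParamSpace ω₁ ω₂ := fun x => by
    have := hypParam_mem (ω₁ := ω₁) (ω₂ := ω₂) x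
    rw [hypParamSpace_eq] at this ⊢
    exact (hτi.sum_map _).trans this
  -- the twist of `σ` is reindexed by `π`, so that both sides can be compared weight by weight
  have hre : ∀ x, twistE7 ω₁ ω₂ σ (τ (hypParam ω₁ ω₂ x)) = ∏ p : IndexPair,
      if ∃ q, σ (lam (π p)) = -lam q then
        hypGamma ω₁ ω₂ (-dot (τ (hypParam ω₁ ω₂ x)) (lam (π p))) else 1 := fun x => by
    rw [twistE7_eq σ (hmem x)]
    exact ((Equiv.ofBijective π (Finite.injective_iff_bijective.1 hπinj)).prod_comp fun p =>
      if ∃ q, σ (lam p) = -lam q then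
        hypGamma ω₁ ω₂ (-dot (τ (hypParam ω₁ ω₂ x)) (lam p)) else 1).symm
  simp only [hre, twistE7_eq _ (hypParam_mem _), ← Finset.prod_mul_distrib]
  refine DenseEq.prod _ fun p _ => ?_
  rcases hπ p with h | h
  · have h1 : ¬∃ q, τ (lam p) = -lam q := fun ⟨q, hq⟩ => lam_ne_neg (π p) q (h.symm.trans hq)
    refine DenseEq.of_eq fun x => ?_
    rw [if_neg h1, mul_one, Module.End.mul_apply, h, ← h, hτi.dot_map]
  · have h1 : ∃ q, τ (lam p) = -lam q := ⟨_, h⟩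
    have h2 : ∀ x, -dot (τ (hypParam ω₁ ω₂ x)) (lam (π p)) = dot (hypParam ω₁ ω₂ x) (lam p) := by
      intro x
      rw [← dot_neg_right, ← h, hτi.dot_map]
    simp only [h2, if_pos h1]
    simp only [Module.End.mul_apply, h, map_neg, neg_inj]
    by_cases h3 : ∃ q, σ (lam (π p)) = -lam q
    · have h4 : ¬∃ q, σ (lam (π p)) = lam q := fun ⟨q, hq⟩ => by
        obtain ⟨q', hq'⟩ := h3
        exact lam_ne_neg q q' (hq.symm.trans hq')
      simp only [if_pos h3, if_neg h4]
      exact (hypGamma_dot_mul_neg hω₁ hω₂ p).symm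
    · have h4 : ∃ q, σ (lam (π p)) = lam q := by
        obtain ⟨q, hq⟩ := hσ (π p)
        exact ⟨q, hq.resolve_right fun hq' => h3 ⟨q, hq'⟩⟩
      simp only [if_neg h3, if_pos h4]
      exact DenseEq.of_eq fun x => (one_mul _).symm

/-! ### Generators of the Weyl group -/

theorem rootReflection_single_sub (j k : Fin 8) :
    rootReflection (Pi.single j 1 - Pi.single k 1) = permEnd (Equiv.swap j k) := by
  refine LinearMap.ext fun u => ?_
  have h : dot u (Pi.single j 1 - Pi.single k 1) = u j - u k := by
    simp [dot, mul_sub, Finset.sum_sub_distrib, Pi.single_apply]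
  rw [rootReflection_apply, h, permEnd_apply]
  ext i
  simp only [Pi.sub_apply, Pi.smul_apply, smul_eq_mul, Function.comp, Pi.single_apply,
    Equiv.swap_apply_def]
  split_ifs with h1 h2 h2 <;> simp_all

theorem betaRoot_comp (π : Equiv.Perm (Fin 8)) (T : Finset (Fin 8)) :
    betaRoot T ∘ π = betaRoot (T.map π.symm.toEmbedding) := by
  ext j
  simp [betaRoot, Finset.mem_map_equiv]

theorem permEnd_mul_rootReflection (π : Equiv.Perm (Fin 8)) (γ : Fin 8 → ℂ) :
    permEnd π * rootReflection γ = rootReflection (γ ∘ π) * permEnd π := by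
  refine LinearMap.ext fun u => ?_
  show rootReflection γ u ∘ π = rootReflection (γ ∘ π) (u ∘ π)
  have h : dot (u ∘ π) (γ ∘ π) = dot u γ := (isParamIsometry_permEnd π).dot_map u γ
  rw [rootReflection_apply, rootReflection_apply, h]
  rfl

theorem exists_perm_map_eq {T : Finset (Fin 8)} (hT : T.card = 4) :
    ∃ π : Equiv.Perm (Fin 8), T.map π.toEmbedding = {0, 1, 2, 3} := by
  have h : Fintype.card {x // x ∈ T} = Fintype.card {x // x ∈ ({0, 1, 2, 3} : Finset (Fin 8))} := by
    rw [Fintype.card_coe, Fintype.card_coe, hT]; rfl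
  let e := Fintype.equivOfCardEq h
  refine ⟨e.extendSubtype, Finset.eq_of_subset_of_card_le (fun i hi => ?_) ?_⟩
  · obtain ⟨j, hj, rfl⟩ := Finset.mem_map.1 hi
    exact e.extendSubtype_mem j hj
  · rw [Finset.card_map, hT]; rfl

/-- The Weyl group is generated by `w` and permutations. -/
theorem weylE7_le : weylE7 ≤ Submonoid.closure (Set.range permEnd ∪ {wE7}) := by
  have hperm : ∀ π, permEnd π ∈ Submonoid.closure (Set.range permEnd ∪ {wE7}) := fun π =>
    Submonoid.subset_closure (Or.inl ⟨π, rfl⟩)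
  refine Submonoid.closure_le.2 ?_
  rintro _ ⟨γ, ⟨j, k, _, rfl⟩ | ⟨T, hT, rfl⟩, rfl⟩
  · rw [rootReflection_single_sub j k]; exact hperm _
  · obtain ⟨π, hπ⟩ := exists_perm_map_eq hT
    have h1 : betaRoot {0, 1, 2, 3} ∘ π = betaRoot T := by
      rw [betaRoot_comp, ← hπ, Finset.map_map]
      congr 1
      ext i; simp
    have h2 : rootReflection (betaRoot T) = permEnd π * wE7 * permEnd π⁻¹ := by
      rw [wE7, permEnd_mul_rootReflection, h1, mul_assoc, permEnd_mul, inv_mul_cancel]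
      exact (mul_one _).symm
    rw [h2]
    exact mul_mem (mul_mem (hperm _) (Submonoid.subset_closure (Or.inr rfl))) (hperm _)

theorem permEnd_lam (π : Equiv.Perm (Fin 8)) (p : IndexPair) : ∃ q, permEnd π (lam p) = lam q := by
  have h : permEnd π (lam p) = lambdaE7 (π.symm p.1.1) (π.symm p.1.2) := by
    ext i
    simp only [permEnd_apply, Function.comp, lam, lambdaE7_apply, Equiv.eq_symm_apply]
  rw [h]
  exact exists_lam_eq (π.symm.injective.ne p.2.ne)

/-- The complementary pair in a block of four indices. -/
theorem exists_complementary_pair : ∀ j k : Fin 8, j < k → ((k < 4 → ∃ l m : Fin 8, l < m ∧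
      ∀ i, ((if i = j then 1 else 0) + (if i = k then 1 else 0)
        + ((if i = l then 1 else 0) + (if i = m then 1 else 0)) : ℕ) = if i < 4 then 1 else 0) ∧
    (4 ≤ j → ∃ l m : Fin 8, l < m ∧
      ∀ i, ((if i = j then 1 else 0) + (if i = k then 1 else 0)
        + ((if i = l then 1 else 0) + (if i = m then 1 else 0)) : ℕ)
          = if i < 4 then 0 else 1)) := by
  decide

theorem betaRoot_standard_apply (i : Fin 8) :
    betaRoot {0, 1, 2, 3} i = (if i < 4 then 1 else 0) - 1 / 2 := by
  have : i ∈ ({0, 1, 2, 3} : Finset (Fin 8)) ↔ i < 4 := by revert i; decide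
  rw [betaRoot]
  simp only [this]
  split_ifs <;> norm_num

theorem dot_lam_betaRoot (p : IndexPair) : dot (lam p) (betaRoot {0, 1, 2, 3})
    = (if p.1.1 < 4 then 1 else 0) + (if p.1.2 < 4 then 1 else 0) - 1 := by
  have h : ∑ i, betaRoot {0, 1, 2, 3} i = 0 := by
    rw [betaRoot_standard, Fin.sum_univ_eight]
    simp only [Matrix.cons_val]; norm_num
  rw [dot_comm, lam, dot_lambdaE7, h, betaRoot_standard_apply, betaRoot_standard_apply]
  ring

theorem wE7_lam_of_neg {p : IndexPair} (hp : p.1.2 < 4 ∨ 4 ≤ p.1.1) :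
    ∃ q, wE7 (lam p) = -lam q := by
  have hc := exists_complementary_pair p.1.1 p.1.2 p.2
  rcases hp with hp | hp
  · obtain ⟨l, m, hlm, h⟩ := hc.1 hp
    refine ⟨⟨(l, m), hlm⟩, ?_⟩
    rw [wE7, rootReflection_apply, dot_lam_betaRoot, if_pos hp, if_pos (p.2.trans hp)]
    ext i
    have h1 := congrArg (Nat.cast : ℕ → ℂ) (h i)
    simp only [lam, Pi.sub_apply, Pi.smul_apply, Pi.neg_apply, smul_eq_mul, lambdaE7_apply,
      betaRoot_standard_apply]
    push_cast at h1 ⊢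
    linear_combination h1
  · obtain ⟨l, m, hlm, h⟩ := hc.2 hp
    refine ⟨⟨(l, m), hlm⟩, ?_⟩
    rw [wE7, rootReflection_apply, dot_lam_betaRoot, if_neg (not_lt.2 hp),
      if_neg (not_lt.2 (hp.trans p.2.le))]
    ext i
    have h1 := congrArg (Nat.cast : ℕ → ℂ) (h i)
    have h2 : ((if i < 4 then 0 else 1 : ℕ) : ℂ) = 1 - if i < 4 then 1 else 0 := by
      split_ifs <;> simp
    rw [h2] at h1
    simp only [lam, Pi.sub_apply, Pi.smul_apply, Pi.neg_apply, smul_eq_mul, lambdaE7_apply,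
      betaRoot_standard_apply]
    push_cast at h1 ⊢
    linear_combination h1

theorem wE7_lam_of_not {p : IndexPair} (hp : ¬(p.1.2 < 4 ∨ 4 ≤ p.1.1)) :
    wE7 (lam p) = lam p := by
  push Not at hp
  rw [wE7, rootReflection_apply, dot_lam_betaRoot, if_pos hp.2, if_neg (not_lt.2 hp.1)]
  simp

theorem permutesWeights_wE7 : PermutesWeights wE7 := by
  intro p
  by_cases hp : p.1.2 < 4 ∨ 4 ≤ p.1.1
  · obtain ⟨q, hq⟩ := wE7_lam_of_neg hp
    exact ⟨q, Or.inr hq⟩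
  · exact ⟨p, Or.inl (wE7_lam_of_not hp)⟩

theorem twistE7_permEnd (π : Equiv.Perm (Fin 8)) {u : Fin 8 → ℂ}
    (hu : u ∈ hypParamSpace ω₁ ω₂) : twistE7 ω₁ ω₂ (permEnd π) u = 1 := by
  rw [twistE7_eq _ hu]
  refine Finset.prod_eq_one fun p _ => if_neg ?_
  rintro ⟨q, hq⟩
  obtain ⟨q', hq'⟩ := permEnd_lam π p
  exact lam_ne_neg q' q (hq'.symm.trans hq)

open scoped Classical in
theorem twistE7_wE7 (u : Fin 8 → ℂ) : twistE7 ω₁ ω₂ wE7 u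
    = (∏ p : Fin 8 × Fin 8 with p.1 < p.2 ∧ p.2 < 4,
        hypGamma ω₁ ω₂ (I * ((ω₁ + ω₂) / 2) - u p.1 - u p.2))
      * ∏ p : Fin 8 × Fin 8 with 4 ≤ p.1 ∧ p.1 < p.2,
        hypGamma ω₁ ω₂ (I * ((ω₁ + ω₂) / 2) - u p.1 - u p.2) := by
  have h : ∀ p : Fin 8 × Fin 8,
      ((p.1 < p.2 ∧ ∃ l m : Fin 8, l < m ∧ wE7 (lambdaE7 p.1 p.2) = -lambdaE7 l m)
        ↔ (p.1 < p.2 ∧ p.2 < 4) ∨ (4 ≤ p.1 ∧ p.1 < p.2)) := by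
    intro p
    constructor
    · rintro ⟨hp, l, m, hlm, h⟩
      by_contra hc
      have h1 := wE7_lam_of_not (p := ⟨p, hp⟩) (by tauto)
      exact lam_ne_neg ⟨p, hp⟩ ⟨(l, m), hlm⟩ (h1.symm.trans h)
    · intro hc
      have hp : p.1 < p.2 := by tauto
      obtain ⟨q, hq⟩ := wE7_lam_of_neg (p := ⟨p, hp⟩) (by tauto)
      exact ⟨hp, q.1.1, q.1.2, q.2, hq⟩
  simp only [twistE7, h]
  rw [← Finset.prod_filter, Finset.filter_or, Finset.prod_union]
  refine Finset.disjoint_filter.2 fun p _ h1 h2 => ?_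
  exact absurd (h1.1.trans h1.2) (not_lt.2 h2.1)

/-- The twisted invariance. -/
theorem IsHyperbolicHypergeometric.denseEq_weylE7 {S : (Fin 8 → ℂ) → ℂ}
    (hS : IsHyperbolicHypergeometric ω₁ ω₂ S) (hω₁ : 0 < ω₁.re) (hω₂ : 0 < ω₂.re)
    {σ : Module.End ℂ (Fin 8 → ℂ)} (hσ : σ ∈ weylE7) :
    DenseEq (fun x => S (hypParam ω₁ ω₂ x)) fun x =>
      S (σ (hypParam ω₁ ω₂ x)) * twistE7 ω₁ ω₂ σ (hypParam ω₁ ω₂ x) := by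
  suffices h : IsParamIsometry σ ∧ PermutesWeights σ ∧ DenseEq (fun x => S (hypParam ω₁ ω₂ x))
      fun x => S (σ (hypParam ω₁ ω₂ x)) * twistE7 ω₁ ω₂ σ (hypParam ω₁ ω₂ x) from h.2.2
  have hperm : ∀ π, IsParamIsometry (permEnd π) ∧ PermutesWeights (permEnd π) ∧
      DenseEq (fun x => S (hypParam ω₁ ω₂ x)) fun x => S (permEnd π (hypParam ω₁ ω₂ x))
        * twistE7 ω₁ ω₂ (permEnd π) (hypParam ω₁ ω₂ x) := fun π =>
    ⟨isParamIsometry_permEnd π, fun p => (permEnd_lam π p).imp fun _ h => Or.inl h, by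
      simp only [twistE7_permEnd π (hypParam_mem _), mul_one]
      exact (hS.denseEq_perm hω₁ hω₂ π).symm⟩
  refine Submonoid.closure_induction (fun τ hτ => ?_) ?_ (fun σ τ _ _ hσ hτ => ?_) (weylE7_le hσ)
  · rcases hτ with ⟨π, rfl⟩ | rfl
    · exact hperm π
    · refine ⟨isParamIsometry_wE7, permutesWeights_wE7, ?_⟩
      simp only [twistE7_wE7, ← mul_assoc]
      exact hS.denseEq_wE7 hω₁ hω₂
  · exact hperm 1
  · refine ⟨hσ.1.mul hτ.1, hσ.2.1.mul hτ.2.1, ?_⟩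
    have h1 := hτ.1.denseEq_comp (f := S)
      (g := fun u => S (σ u) * twistE7 ω₁ ω₂ σ u) hσ.2.2
    have h2 := (hτ.2.2.trans (h1.mul (DenseEq.of_eq fun x => rfl))).trans
      (DenseEq.of_eq fun x => mul_assoc _ _ _)
    exact h2.trans (DenseEq.mul (DenseEq.of_eq fun x => rfl)
      (twistE7_mul hω₁ hω₂ hσ.2.1 hτ.2.1 hτ.1).symm)

end

theorem theorem4p2 (ω₁ ω₂ : ℂ) (hω₁ : 0 < ω₁.re) (hω₂ : 0 < ω₂.re) :
    ∃ S : (Fin 8 → ℂ) → ℂ,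
      IsHyperbolicHypergeometric ω₁ ω₂ S ∧
      (∀ S' : (Fin 8 → ℂ) → ℂ, IsHyperbolicHypergeometric ω₁ ω₂ S' →
        MeromorphicEqOn S' S (hypParamSpace ω₁ ω₂)) ∧
      (∀ σ : Equiv.Perm (Fin 8),
        MeromorphicEqOn (fun u => S (u ∘ σ)) S (hypParamSpace ω₁ ω₂)) ∧
      MeromorphicEqOn S
        (fun u => S (wE7 u)
          * (∏ p : Fin 8 × Fin 8 with p.1 < p.2 ∧ p.2 < 4,
              hypGamma ω₁ ω₂ (I * ((ω₁ + ω₂) / 2) - u p.1 - u p.2))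
          * ∏ p : Fin 8 × Fin 8 with 4 ≤ p.1 ∧ p.1 < p.2,
              hypGamma ω₁ ω₂ (I * ((ω₁ + ω₂) / 2) - u p.1 - u p.2))
        (hypParamSpace ω₁ ω₂) ∧
      ∀ σ ∈ weylE7,
        MeromorphicEqOn S (fun u => S (σ u) * twistE7 ω₁ ω₂ σ u) (hypParamSpace ω₁ ω₂) := by
  obtain ⟨S, hS⟩ := exists_isHyperbolicHypergeometric hω₁ hω₂
  exact ⟨S, hS, fun S' hS' => meromorphicEqOn_of_denseEq (hS'.denseEq hS hω₁ hω₂),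
    fun σ => meromorphicEqOn_of_denseEq (f := fun u => S (u ∘ σ)) (hS.denseEq_perm hω₁ hω₂ σ),
    meromorphicEqOn_of_denseEq (hS.denseEq_wE7 hω₁ hω₂),
    fun σ hσ => meromorphicEqOn_of_denseEq (g := fun u => S (σ u) * twistE7 ω₁ ω₂ σ u)
      (hS.denseEq_weylE7 hω₁ hω₂ hσ)⟩
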